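/- Let $D\ge 4$ and let $dS_D=\{X\in\mathbb R^{D,1} : X\cdot X=1\}$ be de Sitter space of unit radius, with its induced Lorentzian metric $g_{\mu\nu}$ of signature $(-,+,\dots,+)$, Levi-Civita connection $\nabla$, volume element $\sqrt{-g}\,d^Dx$, d'Alembertian $\Box=\nabla^\mu\nabla_\mu$, and $Z(x,\bar x)=X\cdot\bar X$. Bars denote operations at the point $\bar x$. Let $O\subseteq dS_D$ be an open subset (for instance all of $dS_D$, or the domain of the Poincaré or of the static chart). Let $\mathscr T_{TT}$ be the space of smooth, complex, symmetric tensor fields $f^{\mu\nu}$ with compact support in $O$ such that $\nabla_\mu f^{\mu\nu}=0$ and $g_{\mu\nu}f^{\mu\nu}=0$. Set $$t^{(2)\,\bar\mu\bar\nu}_{\mu\nu}=(\nabla_{(\mu}\nabla^{(\bar\mu}Z)(\nabla_{\nu)}\nabla^{\bar\nu)}Z),\qquad \mathrm P_{\mu\nu}{}^{\alpha\beta}h_{\alpha\beta}=\nabla^\gamma\nabla^\delta C_{\gamma\mu\delta\nu}(h),$$ $$C^{\alpha\beta}{}_{\gamma\delta}(h)=\Upsilon^{[\alpha\beta][\rho\sigma]}_{[\gamma\delta][\mu\nu]}\left(\nabla_\rho\nabla^\mu+\delta^\mu_\rho\right)h^\nu{}_\sigma,$$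 $$\Upsilon^{\alpha\beta\,\rho\sigma}_{\gamma\delta\,\mu\nu}=-2\left(\delta^\alpha_\mu\delta^\beta_\nu\delta^\rho_\gamma\delta^\sigma_\delta+\tfrac{4}{D-2}\delta^\alpha_\mu\delta^\beta_\gamma\delta^\rho_\delta\delta^\sigma_\nu+\tfrac{2}{(D-2)(D-1)}\delta^\alpha_\gamma\delta^\beta_\delta\delta^\rho_\mu\delta^\sigma_\nu\right)$$ (so $C(h)$ is the linearized Weyl tensor). All equations for $U$ and $\delta^{TT}$ are in the sense of distributions on $O\times O$. (1) Let $a,b\in\mathbb C$ and let the bidistribution $U(x,\bar x)$ on $O\times O$ be any solution of $$\frac{(D-3)^2}{4(D-2)^2}\,\Box(\Box-(D-2))\,\bar\Box(\bar\Box-(D-2))\,U(x,\bar x)=a+bZ+i\,\frac{\delta^D(x,\bar x)}{\sqrt{-g}} .$$ Then the bitensor distribution $\delta^{TT}$ given by $$ i\,\delta^{TT\,\bar\mu\bar\nu}_{\mu\nu}(x,\bar x)=\mathrm P_{\mu\nu}{}^{\alpha\beta}\,\mathrm P^{\bar\mu\bar\nu}{}_{\bar\alpha\bar\beta}\left[U(x,\bar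 x)\,t^{(2)\,\bar\alpha\bar\beta}_{\alpha\beta}\right]$$ is an identity operator on the TT test functions: for all $f,p\in\mathscr T_{TT}$ $$\int_x\int_{\bar x}f^{\mu\nu}(x)\,p_{\bar\mu\bar\nu}(\bar x)\,\delta^{TT\,\bar\mu\bar\nu}_{\mu\nu}(x,\bar x)=\int_x f^{\mu\nu}(x)p_{\mu\nu}(x),$$ and for every smooth tensor field $q$ of rank two with compact support in $O$ the tensor distribution $\int_{\bar x}\delta^{TT\,\bar\mu\bar\nu}_{\mu\nu}(x,\bar x)\,q_{\bar\mu\bar\nu}(\bar x)$ is symmetric, transverse and traceless. (2) Let, for $z\in\mathbb C\setminus[1,\infty)$, $$\Delta_\omega(z)=\frac{1}{(4\pi)^{D/2}}\frac{\Gamma(-\omega)\Gamma(\omega+D-1)}{\Gamma(D/2)}\;{}_2F_1\!\left[-\omega,\omega+D-1;\tfrac D2;\tfrac{1+z}{2}\right],$$ $$U(z)=-\frac{4(D-2)^2}{(D-3)^2}\int_{\mathrm{Re}\,\omega=s}\frac{d\omega}{2\pi i}\,\frac{2\omega+D-1}{\omega^2(\omega+D-1)^2(\omega+1)^2(\omega+D-2)^2}\,\Delta_\omega(z),\qquad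 0<s<1,$$ the line being traversed upwards, so that the pole at $\omega=0$ lies to its left and the pole at $\omega=1$ to its right. For every $s\in(0,1)$ the integral converges absolutely, and the limit $U(Z-i\epsilon)$, $\epsilon\to0^+$, exists as a bidistribution on $O\times O$, which does not depend on $s$, is maximally symmetric (invariant under the isometries $O(D,1)$ acting on both points), and solves the equation in (1) with $a=1/\mathrm{vol}(S^D)$ and $b=0$, where $\mathrm{vol}(S^D)=2\pi^{(D+1)/2}/\Gamma(\tfrac{D+1}{2})$. -/

import Mathlib

open MeasureTheory Filter Topology

noncomputable section

namespace DeSitter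

/-! ### de Sitter space as the unit hyperboloid of Minkowski space -/

/-- The embedding space `ℝ^{D,1}`; the coordinate `0` is the time coordinate. -/
abbrev Amb (D : ℕ) : Type := Fin (D + 1) → ℝ

/-- The diagonal entries of the Minkowski metric `diag(-1, 1, …, 1)`. -/
def eta {D : ℕ} (A : Fin (D + 1)) : ℝ := if A = 0 then -1 else 1

/-- The Minkowski product `X · Y`. -/
def mink {D : ℕ} (X Y : Amb D) : ℝ := ∑ A, eta A * X A * Y A

theorem mink_smul_smul {D : ℕ} (c : ℝ) (X : Amb D) :
    mink (c • X) (c • X) = c ^ 2 * mink X X := by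
  simp only [mink, Pi.smul_apply, smul_eq_mul, Finset.mul_sum]
  exact Finset.sum_congr rfl fun A _ => by ring

/-- `D`-dimensional de Sitter space of radius `1`. -/
abbrev dS (D : ℕ) : Type := {X : Amb D // mink X X = 1}

theorem mink_normalize {D : ℕ} {X : Amb D} (h : 0 < mink X X) :
    mink ((√(mink X X))⁻¹ • X) ((√(mink X X))⁻¹ • X) = 1 := by
  rw [mink_smul_smul, inv_pow, Real.sq_sqrt h.le, inv_mul_cancel₀ h.ne']

/-- The radial projection of a spacelike vector to de Sitter space. -/
def normalize {D : ℕ} (X : Amb D) (h : 0 < mink X X) : dS D :=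
  ⟨(√(mink X X))⁻¹ • X, mink_normalize h⟩

/-- The open cone of spacelike vectors, which is the union of the rays through de Sitter space. -/
def cone (D : ℕ) : Set (Amb D) := {X | 0 < mink X X}

/-- The extension of a function on de Sitter space to the cone, constant along the rays
(and `0` outside of the cone). A function on de Sitter space is smooth if and only if this extension
is smooth on the cone. -/
def ext {D : ℕ} {E : Type*} [Zero E] (T : dS D → E) (X : Amb D) : E :=
  open scoped Classical in if h : 0 < mink X X then T (normalize X h) else 0

/-- The same extension for functions of two points. -/
def biExt {D : ℕ} {E : Type*} [Zero E] (T : dS D → dS D → E) (P : Amb D × Amb D) : E :=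
  ext (fun x => ext (T x) P.2) P.1

/-- The volume measure `√(-g) d^D x` of de Sitter space. Since the Lebesgue measure of the embedding
space is `r^D dr` times the volume element in the coordinates `X = r x`, the volume of a subset `S`
is `D + 1` times the Lebesgue measure of `{r x | 0 < r < 1, x ∈ S}`. -/
def vol (D : ℕ) : Measure (dS D) :=
  ((D : ENNReal) + 1) • Measure.map
    (fun X : {X : Amb D // 0 < mink X X ∧ mink X X < 1} => normalize X.1 X.2.1)
    (volume.comap Subtype.val)

/-- The embedding distance `Z(x, x̄) = X · X̄`. -/
def embZ {D : ℕ} (x y : dS D) : ℝ := mink x.1 y.1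

/-! ### Tensor fields and the Levi-Civita connection

A covariant tensor of rank `k` at `x` is represented by its components `T_{A B …}` with respect to
the embedding space; it is tangential: contracted with the position vector `x^A` in any slot it
gives `0`. Indices are raised with the Minkowski metric. -/

/-- Component fields of rank `k`. -/
abbrev TField (D k : ℕ) : Type := dS D → (Fin k → Fin (D + 1)) → ℂ

/-- Component fields of rank `k` at the first point `x` and rank `l` at the second point `x̄`. -/
abbrev BField (D k l : ℕ) : Type :=
  dS D → dS D → (Fin k → Fin (D + 1)) → (Fin l → Fin (D + 1)) → ℂ

/-- The tangential projector `Π_A^B = δ_A^B - x_A x^B`. -/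
def proj {D : ℕ} (x : dS D) (A B : Fin (D + 1)) : ℝ :=
  (if A = B then 1 else 0) - eta A * x.1 A * x.1 B

/-- The de Sitter metric `g_{AB} = η_{AB} - x_A x_B`. -/
def metric {D : ℕ} (x : dS D) (A B : Fin (D + 1)) : ℝ := proj x A B * eta B

/-- The derivative `∂_A` at a point of de Sitter space, of the extension constant along rays. -/
def partialD {D : ℕ} (f : dS D → ℂ) (x : dS D) (A : Fin (D + 1)) : ℂ :=
  fderiv ℝ (ext f) x.1 (Pi.single A 1)

/-- The covariant derivative `(∇T)_{A B …} = ∇_A T_{B …}` of the Levi-Civita connection of the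
induced metric: the tangential projection, in all indices, of the flat derivative. -/
def cov {D k : ℕ} (T : TField D k) : TField D (k + 1) := fun x I =>
  ∑ J : Fin (k + 1) → Fin (D + 1),
    (∏ i, (proj x (I i) (J i) : ℂ)) * partialD (fun z => T z (Fin.tail J)) x (J 0)

/-- The divergence `∇^A T_{A B …}`. -/
def divergence {D k : ℕ} (T : TField D (k + 1)) : TField D k := fun x I =>
  ∑ A : Fin (D + 1), (eta A : ℂ) * cov T x (Fin.cons A (Fin.cons A I))

/-- The covariant derivative of a bitensor field at the first point. -/
def covL {D k l : ℕ} (T : BField D k l) : BField D (k + 1) l := fun x y I J =>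
  cov (fun z I' => T z y I' J) x I

/-- The covariant derivative of a bitensor field at the second point. -/
def covR {D k l : ℕ} (T : BField D k l) : BField D k (l + 1) := fun x y I J =>
  cov (fun z J' => T x z I J') y J

/-- The divergence of a bitensor field at the first point. -/
def divL {D k l : ℕ} (T : BField D (k + 1) l) : BField D k l := fun x y I J =>
  divergence (fun z I' => T z y I' J) x I

/-- Exchange of the two points. -/
def swapField {D k l : ℕ} (T : BField D k l) : BField D l k := fun x y I J => T y x J I

/-- The exterior product `f(x) p(x̄)`. -/
def outer {D k l : ℕ} (f : TField D k) (p : TField D l) : BField D k l := fun x y I J =>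
  f x I * p y J

/-- The embedding distance as a biscalar field. -/
def ZField (D : ℕ) : BField D 0 0 := fun x y _ _ => (embZ x y : ℂ)

/-- The bitensor `∇_A ∇_Ā Z`. -/
def ddZ {D : ℕ} (x y : dS D) (A B : Fin (D + 1)) : ℂ := covL (covR (ZField D)) x y ![A] ![B]

/-- The maximally symmetric bitensor
`t⁽²⁾ = (∇_(μ ∇_(μ̄ Z) (∇_ν) ∇_ν̄) Z)`, symmetrized with weight one. -/
def tTwo {D : ℕ} : BField D 2 2 := fun x y I J =>
  (ddZ x y (I 0) (J 0) * ddZ x y (I 1) (J 1) + ddZ x y (I 0) (J 1) * ddZ x y (I 1) (J 0)) / 2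

/-! ### Test fields -/

/-- Smooth tensor fields of rank `k` with compact support in `O`. -/
structure IsTest {D k : ℕ} (O : Set (dS D)) (f : TField D k) : Prop where
  smooth : ContDiffOn ℝ ((⊤ : ℕ∞) : WithTop ℕ∞) (ext f) (cone D)
  compact : ∃ K : Set (dS D), IsCompact K ∧ K ⊆ O ∧ ∀ x, x ∉ K → f x = 0
  tangent : ∀ (x : dS D) (I : Fin k → Fin (D + 1)) (i : Fin k),
    ∑ A, (x.1 A : ℂ) * f x (Function.update I i A) = 0

/-- Smooth bitensor fields of rank `(k, l)` with support in the compact set `K`. -/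
structure IsBiTestOn {D k l : ℕ} (K : Set (dS D × dS D)) (φ : BField D k l) : Prop where
  smooth : ContDiffOn ℝ ((⊤ : ℕ∞) : WithTop ℕ∞) (biExt φ) (cone D ×ˢ cone D)
  support : ∀ x y, (x, y) ∉ K → φ x y = 0
  tangentL : ∀ (x y : dS D) (I : Fin k → Fin (D + 1)) (J : Fin l → Fin (D + 1)) (i : Fin k),
    ∑ A, (x.1 A : ℂ) * φ x y (Function.update I i A) J = 0
  tangentR : ∀ (x y : dS D) (I : Fin k → Fin (D + 1)) (J : Fin l → Fin (D + 1)) (j : Fin l),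
    ∑ A, (y.1 A : ℂ) * φ x y I (Function.update J j A) = 0

/-- Smooth bitensor fields of rank `(k, l)` with compact support in `O × O`. -/
def IsBiTest {D k l : ℕ} (O : Set (dS D)) (φ : BField D k l) : Prop :=
  ∃ K : Set (dS D × dS D), IsCompact K ∧ K ⊆ O ×ˢ O ∧ IsBiTestOn K φ

/-- The transverse traceless test tensors: symmetric, `∇^A f_{AB} = 0`, `g^{AB} f_{AB} = 0`. -/
structure IsTT {D : ℕ} (O : Set (dS D)) (f : TField D 2) : Prop where
  test : IsTest O f
  symm : ∀ x A B, f x ![A, B] = f x ![B, A]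
  transverse : ∀ x, divergence f x = 0
  traceless : ∀ x, ∑ A, (eta A : ℂ) * f x ![A, A] = 0

/-! ### Bitensor distributions

A bitensor distribution `W` is given by its values `W(Ψ) = ∫∫ W^{…} Ψ_{…}` on test fields;
its values on other fields are immaterial. Derivatives and multiplication by smooth tensors are
defined by transposition. -/

/-- Functionals on bitensor fields of rank `(k, l)`. -/
abbrev BDist (D k l : ℕ) : Type := BField D k l → ℂ

/-- `U` is a scalar bidistribution on `O × O`: it is linear on test functions, and on the test
functions supported in a compact set it is bounded by finitely many derivatives. -/
structure IsDistribution {D : ℕ} (O : Set (dS D)) (U : BDist D 0 0) : Prop where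
  map_add : ∀ φ ψ, IsBiTest O φ → IsBiTest O ψ → U (φ + ψ) = U φ + U ψ
  map_smul : ∀ (c : ℂ) (φ), IsBiTest O φ → U (c • φ) = c * U φ
  bound : ∀ K : Set (dS D × dS D), IsCompact K → K ⊆ O ×ˢ O → ∃ (C : ℝ) (N : ℕ),
    ∀ φ, IsBiTestOn K φ → ∀ B : ℝ,
      (∀ n ≤ N, ∀ P ∈ K, ‖iteratedFDeriv ℝ n (biExt φ) (P.1.1, P.2.1)‖ ≤ B) → ‖U φ‖ ≤ C * B

/-- Exchange of the two points. -/
def swapDist {D k l : ℕ} (W : BDist D k l) : BDist D l k := fun Ψ => W (swapField Ψ)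

/-- The covariant derivative `∇_A W_{B …}` at the first point. -/
def nablaL {D k l : ℕ} (W : BDist D k l) : BDist D (k + 1) l := fun Ψ => -W (divL Ψ)

/-- Multiplication by a tensor field at the first point and contraction: `M_{I'}{}^I W_I`. -/
def applyL {D k k' l : ℕ} (M : dS D → (Fin k' → Fin (D + 1)) → (Fin k → Fin (D + 1)) → ℝ)
    (W : BDist D k l) : BDist D k' l := fun Ψ =>
  W fun x y I J => ∑ I' : Fin k' → Fin (D + 1),
    (M x I' I : ℂ) * (∏ i, (eta (I' i) : ℂ)) * Ψ x y I' J

/-- The d'Alembertian `□ U = g^{AB} ∇_A ∇_B U` of a scalar bidistribution at the first point. -/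
def boxL {D : ℕ} (U : BDist D 0 0) : BDist D 0 0 :=
  applyL (fun x _ I => metric x (I 0) (I 1)) (nablaL (nablaL U))

/-- The d'Alembertian at the second point. -/
def boxR {D : ℕ} (U : BDist D 0 0) : BDist D 0 0 := swapDist (boxL (swapDist U))

/-- Antisymmetrization in two indices, with weight one. -/
def alt {ι : Type*} (f : ι → ι → ℝ) (a b : ι) : ℝ := (f a b - f b a) / 2

/-- The tensor `Υ^{αβ ρσ}_{γδ μν}` with all indices lowered. -/
def upsilon {D : ℕ} (x : dS D) (α β γ δ ρ σ μ ν : Fin (D + 1)) : ℝ :=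
  let g := metric x;
  (-2) * (g α μ * g β ν * g ρ γ * g σ δ
    + 4 / ((D : ℝ) - 2) * (g α μ * g β γ * g ρ δ * g σ ν)
    + 2 / (((D : ℝ) - 2) * ((D : ℝ) - 1)) * (g α γ * g β δ * g ρ μ * g σ ν))

/-- The tensor `Υ^{[αβ] [ρσ]}_{[γδ] [μν]}` with all indices lowered. -/
def upsilonAlt {D : ℕ} (x : dS D) (α β γ δ ρ σ μ ν : Fin (D + 1)) : ℝ :=
  alt (fun α β => alt (fun γ δ => alt (fun ρ σ => alt (fun μ ν =>
    upsilon x α β γ δ ρ σ μ ν) μ ν) ρ σ) γ δ) α β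

/-- The linearized Weyl tensor at the first point,
`C_{αβγδ}(h) = Υ_{[αβ][γδ]}{}^{[ρσ][μν]} (∇_ρ ∇_μ + g_{ρμ}) h_{νσ}`,
of a bitensor distribution of rank two at the first point. -/
def weylL {D l : ℕ} (h : BDist D 2 l) : BDist D 4 l :=
  applyL (fun x I' I =>
      upsilonAlt x (I' 0) (I' 1) (I' 2) (I' 3) (I 0) (I 3) (I 1) (I 2))
    (nablaL (nablaL h) +
      applyL (fun x (I' : Fin 4 → Fin (D + 1)) (I : Fin 2 → Fin (D + 1)) =>
        metric x (I' 0) (I' 1) * metric x (I' 2) (I 0) * metric x (I' 3) (I 1)) h)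

/-- The transverse traceless projection operator at the first point,
`P_{μν}{}^{αβ} h_{αβ} = ∇^γ ∇^δ C_{γμδν}(h)`. -/
def projL {D l : ℕ} (h : BDist D 2 l) : BDist D 2 l :=
  applyL (fun x I' I =>
      metric x (I 0) (I 2) * metric x (I 1) (I 4) * metric x (I' 0) (I 3) * metric x (I' 1) (I 5))
    (nablaL (nablaL (weylL h)))

/-- The transverse traceless projection operator at the second point. -/
def projR {D k : ℕ} (h : BDist D k 2) : BDist D k 2 := swapDist (projL (swapDist h))

/-- The bitensor distribution `U(x, x̄) t⁽²⁾`. -/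
def mulTTwo {D : ℕ} (U : BDist D 0 0) : BDist D 2 2 := fun Ψ =>
  U fun x y _ _ => ∑ I, ∑ J,
    (∏ i, (eta (I i) : ℂ)) * (∏ j, (eta (J j) : ℂ)) * tTwo x y I J * Ψ x y I J

/-- `K` is an identity operator on the transverse traceless test tensors: its values on pairs of
such tensors are their inner products, and smeared at the second point with an arbitrary test tensor
`q` it gives a symmetric, traceless and transverse tensor distribution. -/
structure IsTTIdentity {D : ℕ} (O : Set (dS D)) (K : BDist D 2 2) : Prop where
  identity : ∀ f p : TField D 2, IsTT O f → IsTT O p →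
    K (outer f p) = ∫ x, ∑ A, ∑ B, (eta A : ℂ) * (eta B : ℂ) * f x ![A, B] * p x ![A, B] ∂(vol D)
  symm : ∀ ψ q : TField D 2, IsTest O ψ → IsTest O q →
    K (outer (fun x I => ψ x ![I 1, I 0]) q) = K (outer ψ q)
  traceless : ∀ (φ : TField D 0) (q : TField D 2), IsTest O φ → IsTest O q →
    K (outer (fun x I => (metric x (I 0) (I 1) : ℂ) * φ x ![]) q) = 0
  transverse : ∀ (ξ : TField D 1) (q : TField D 2), IsTest O ξ → IsTest O q →
    K (outer (cov ξ) q) = 0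

/-- `U` solves, in the sense of distributions on `O × O`,
`(D-3)²/(4(D-2)²) □(□-(D-2)) □̄(□̄-(D-2)) U = a + b Z + i δ(x, x̄)/√(-g)`. -/
def SolvesU {D : ℕ} (O : Set (dS D)) (a b : ℂ) (U : BDist D 0 0) : Prop :=
  let massL : BDist D 0 0 → BDist D 0 0 := fun W => boxL W - ((D : ℂ) - 2) • W
  let massR : BDist D 0 0 → BDist D 0 0 := fun W => boxR W - ((D : ℂ) - 2) • W
  ∀ φ : BField D 0 0, IsBiTest O φ →
    ((D : ℂ) - 3) ^ 2 / (4 * ((D : ℂ) - 2) ^ 2) * boxL (massL (boxR (massR U))) φ =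
      ∫ x, (∫ y, (a + b * (embZ x y : ℂ)) * φ x y ![] ![] ∂(vol D)) ∂(vol D)
        + Complex.I * ∫ x, φ x x ![] ![] ∂(vol D)

/-! ### The explicit maximally symmetric solution -/

/-- The complex plane cut along `[1, ∞)`. -/
def cutPlane : Set ℂ := {z | ¬ (z.im = 0 ∧ 1 ≤ z.re)}

open scoped Classical in
/-- The Gauss hypergeometric function on the plane cut along `[1, ∞)`: the analytic continuation of
the hypergeometric series from the unit disc (unique, and existing for all parameters `c` outside
of `{0, -1, -2, …}`). -/
def gauss2F1 (a b c z : ℂ) : ℂ :=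
  if h : ∃ F : ℂ → ℂ, DifferentiableOn ℂ F cutPlane ∧
      ∀ w : ℂ, ‖w‖ < 1 → F w = ordinaryHypergeometric a b c w
  then h.choose z else 0

/-- The Klein-Gordon Green's function `Δ_ω(z)`, for `z` in the cut plane. -/
def greenDelta (D : ℕ) (ω z : ℂ) : ℂ :=
  1 / (4 * (Real.pi : ℂ)) ^ ((D : ℂ) / 2)
    * (Complex.Gamma (-ω) * Complex.Gamma (ω + D - 1) / Complex.Gamma ((D : ℂ) / 2))
    * gauss2F1 (-ω) (ω + D - 1) ((D : ℂ) / 2) ((1 + z) / 2)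

/-- The integrand of the contour integral for `U`. -/
def uIntegrand (D : ℕ) (z ω : ℂ) : ℂ :=
  (2 * ω + D - 1) / (ω ^ 2 * (ω + D - 1) ^ 2 * (ω + 1) ^ 2 * (ω + D - 2) ^ 2) * greenDelta D ω z

/-- `U(z) = -4(D-2)²/(D-3)² ∫ dω/(2πi) (2ω+D-1)/(ω²(ω+D-1)²(ω+1)²(ω+D-2)²) Δ_ω(z)`,
the contour being the line `Re ω = s`, traversed upwards. For `0 < s < 1` the poles at
`ω = 0, -1, …` are to the left of the contour and those at `ω = 1, 2, …` to its right. -/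
def uFun (D : ℕ) (s : ℝ) (z : ℂ) : ℂ :=
  -(4 * ((D : ℂ) - 2) ^ 2 / ((D : ℂ) - 3) ^ 2) *
    ((2 * (Real.pi : ℂ) * Complex.I)⁻¹ *
      ∫ t : ℝ, uIntegrand D z (s + t * Complex.I) * Complex.I)

/-- `U` is the distributional boundary value `F(Z(x, x̄) - iε)`, `ε → 0⁺`. -/
def IsBoundaryValue {D : ℕ} (O : Set (dS D)) (F : ℂ → ℂ) (U : BDist D 0 0) : Prop :=
  ∀ φ : BField D 0 0, IsBiTest O φ →
    Tendsto (fun ε : ℝ => ∫ x, (∫ y, F ((embZ x y : ℂ) - ε * Complex.I) * φ x y ![] ![]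
      ∂(vol D)) ∂(vol D)) (𝓝[>] 0) (𝓝 (U φ))

/-- The action on de Sitter space of a linear map that preserves the Minkowski product. -/
def act {D : ℕ} (Λ : Amb D →ₗ[ℝ] Amb D) (hΛ : ∀ X Y, mink (Λ X) (Λ Y) = mink X Y) (x : dS D) :
    dS D :=
  ⟨Λ x.1, (hΛ _ _).trans x.2⟩

/-- Maximal symmetry: invariance under the de Sitter isometries `O(D, 1)`, acting on both points. -/
def IsMaximallySymmetric {D : ℕ} (O : Set (dS D)) (U : BDist D 0 0) : Prop :=
  ∀ (Λ : Amb D →ₗ[ℝ] Amb D) (hΛ : ∀ X Y, mink (Λ X) (Λ Y) = mink X Y) (φ : BField D 0 0),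
    IsBiTest O φ → IsBiTest O (fun x y => φ (act Λ hΛ x) (act Λ hΛ y)) →
      U (fun x y => φ (act Λ hΛ x) (act Λ hΛ y)) = U φ

/-- The volume `2 π^{(D+1)/2} / Γ((D+1)/2)` of the unit sphere `S^D`. -/
def volSphere (D : ℕ) : ℝ :=
  2 * Real.pi ^ (((D : ℝ) + 1) / 2) / Real.Gamma (((D : ℝ) + 1) / 2)

end DeSitter

end

noncomputable section

namespace DeSitter

open Complex (Gamma Gamma_add_nat_div_Gamma_eq Gamma_add_one Gamma_ne_zero Gamma_ne_zero_of_re_pos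
  Gamma_ofReal Gamma_one I I_mul_I I_ne_zero I_sq arg_neg_I betaIntegral
  betaIntegral_eq_Gamma_mul_div continuous_cosh continuous_exp continuous_im continuous_ofReal
  continuous_re cosh cpow_add cpow_def_of_ne_zero cpow_natCast cpow_one exp exp_add exp_im exp_log
  exp_ne_zero exp_neg exp_re hasDerivAt_cosh im_ofReal_mul inv_re log_exp mul_im neg_im neg_re
  normSq_apply norm_I norm_cpow_eq_rpow_re_of_pos norm_exp norm_exp_ofReal_mul_I norm_ofNat
  norm_real ofRealCLM ofRealCLM_apply ofReal_cosh ofReal_cpow ofReal_im ofReal_inv ofReal_log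
  ofReal_mul ofReal_ne_zero ofReal_neg ofReal_ofNat ofReal_one ofReal_pow ofReal_re ofReal_sub
  ofReal_sum ofReal_zero re_le_norm re_ofReal_mul real_smul sinh slitPlane slitPlane_ne_zero
  sq_norm sub_re)
open Real (Gamma_pos_of_pos continuous_sqrt cosh_eq cosh_pos div_rpow exp_le_exp exp_le_one_iff
  exp_pos fourierInv_eq' hasDerivAt_rpow_const inv_rpow mul_rpow mul_self_sqrt norm_eq_abs
  norm_of_nonneg one_le_cosh pi_gt_three pi_ne_zero pi_pos rpow_add rpow_add_one rpow_le_rpow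
  rpow_le_rpow_of_nonpos rpow_mul rpow_natCast rpow_neg rpow_one rpow_sub_one rpow_zero sinh_eq
  sinh_pos_iff sqrt_eq_rpow sqrt_lt' sqrt_mul sqrt_nonneg sqrt_pos sqrt_sq
  tendsto_pow_mul_exp_neg_atTop_nhds_zero)
open Finset (mul_sum prod_mul_distrib single_le_sum smul_sum sum_add_distrib sum_comm sum_congr
  sum_div sum_eq_single sum_eq_zero sum_insert sum_le_sum sum_mul sum_neg_distrib sum_nonneg
  sum_singleton sum_sub_distrib univ_unique)
open Set (EqOn Icc Ici Ioi Ioo Ioo_subset_Icc_self iUnion_subset indicator_of_mem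
  indicator_of_notMem mem_iUnion singleton_subset_iff subset_univ)
open scoped Real

section
open scoped ContDiff
variable {D : ℕ}
variable {n : WithTop ℕ∞} {c : ℝ} {X : Amb D} {f g : dS D → ℂ}

/-- The indices of the embedding space. -/
notation "Ix" D:max => Fin (D + 1)

/-! ### Smooth functions on de Sitter space and tangential derivatives -/

lemma mink_comm (X Y : Amb D) : mink X Y = mink Y X :=
  sum_congr rfl fun A _ => by ring

lemma mink_smul_left (c : ℝ) (X Y : Amb D) : mink (c • X) Y = c * mink X Y := by
  simp only [mink, Pi.smul_apply, smul_eq_mul, mul_sum]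
  congr 1 with A; ring

lemma contDiff_mink : ContDiff ℝ n fun P : Amb D × Amb D => mink P.1 P.2 := by
  unfold mink; fun_prop

lemma contDiff_minkSelf : ContDiff ℝ n fun X : Amb D => mink X X := by
  unfold mink; fun_prop

lemma continuous_minkSelf : Continuous fun X : Amb D => mink X X :=
  (contDiff_minkSelf (n := 0)).continuous

lemma isOpen_cone : IsOpen (cone D) := isOpen_lt continuous_const continuous_minkSelf

lemma mink_coe_pos (x : dS D) : 0 < mink x.1 x.1 := by rw [x.2]; exact one_pos

lemma coe_mem_cone (x : dS D) : x.1 ∈ cone D := mink_coe_pos x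

lemma eta_mul_self (A : Ix D) : eta A * eta A = 1 := by unfold eta; split_ifs <;> norm_num

lemma eta_sq_complex (A : Ix D) : (eta A : ℂ) * (eta A : ℂ) = 1 := by
  rw [← ofReal_mul, eta_mul_self, ofReal_one]

lemma normalize_coe (x : dS D) (h : 0 < mink x.1 x.1) : normalize x.1 h = x := by
  apply Subtype.ext; simp [normalize, x.2]

lemma normalize_smul (hc : 0 < c) (X : Amb D) (h : 0 < mink X X)
    (h' : 0 < mink (c • X) (c • X)) : normalize (c • X) h' = normalize X h := by
  apply Subtype.ext
  simp only [normalize, mink_smul_smul, smul_smul]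
  congr 1
  rw [sqrt_mul (sq_nonneg c), sqrt_sq hc.le]
  field_simp

lemma smul_mem_cone (hc : 0 < c) : c • X ∈ cone D ↔ X ∈ cone D := by
  simp only [cone, Set.mem_ofPred_eq, mink_smul_smul]
  exact ⟨fun h => by by_contra hh; nlinarith [sq_nonneg c], fun h => by positivity⟩

section ext
variable {E : Type*} [Zero E]

lemma ext_of_mem (T : dS D → E) (h : 0 < mink X X) : ext T X = T (normalize X h) := by
  simp [ext, h]

lemma ext_coe (T : dS D → E) (x : dS D) : ext T x.1 = T x := by
  rw [ext_of_mem T (mink_coe_pos x), normalize_coe]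

lemma ext_smul (T : dS D → E) (hc : 0 < c) (X : Amb D) : ext T (c • X) = ext T X := by
  by_cases h : 0 < mink X X
  · have h' : 0 < mink (c • X) (c • X) := (smul_mem_cone hc).2 h
    rw [ext_of_mem T h, ext_of_mem T h', normalize_smul hc X h h']
  · have h' : ¬ 0 < mink (c • X) (c • X) := fun h' => h ((smul_mem_cone hc).1 h')
    simp [ext, h, h']
end ext

/-- Smoothness of a function on de Sitter space. -/
def Sm (f : dS D → ℂ) : Prop := ContDiffOn ℝ ∞ (ext f) (cone D)

lemma Sm.contDiffAt (hf : Sm f) (hX : X ∈ cone D) : ContDiffAt ℝ ∞ (ext f) X :=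
  ContDiffOn.contDiffAt (s := cone D) hf (isOpen_cone.mem_nhds hX)

lemma Sm.differentiableAt (hf : Sm f) (hX : X ∈ cone D) :
    DifferentiableAt ℝ (ext f) X := (hf.contDiffAt hX).differentiableAt (by simp)

/-- A function on de Sitter space is smooth if it is the restriction of a smooth function
composed with the radial projection. -/
lemma Sm.of_normalized {F : Amb D → ℂ} (hF : ContDiffOn ℝ ∞ F (cone D))
    (h : ∀ x : dS D, f x = F x.1) : Sm f := by
  have : ContDiffOn ℝ ∞ (fun X : Amb D => F ((√(mink X X))⁻¹ • X)) (cone D) := by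
    apply hF.comp
    · intro X hX
      have hX' : mink X X ≠ 0 := (show 0 < mink X X from hX).ne'
      refine ContDiffAt.contDiffWithinAt (ContDiffAt.fun_smul (ContDiffAt.inv ?_ ?_) contDiffAt_id)
      · exact (contDiff_minkSelf.contDiffAt).sqrt hX'
      · exact (sqrt_pos.2 hX).ne'
    · exact fun X hX => (smul_mem_cone (inv_pos.2 (sqrt_pos.2 hX))).2 hX
  refine this.congr fun X hX => ?_
  rw [ext_of_mem f hX, h]; rfl

lemma Sm.const (c : ℂ) : Sm (fun _ : dS D => c) :=
  Sm.of_normalized (F := fun _ => c) contDiffOn_const fun _ => rfl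

lemma ext_ofReal_contDiff (A : Ix D) : Sm (fun x : dS D => (x.1 A : ℂ)) :=
  Sm.of_normalized (F := fun X => (X A : ℂ))
    (ofRealCLM.contDiff.comp (contDiff_apply ℝ ℝ A)).contDiffOn fun _ => rfl

lemma Sm.add (hf : Sm f) (hg : Sm g) : Sm (f + g) :=
  (ContDiffOn.add hf hg).congr fun X hX => by simp [ext_of_mem _ hX]

lemma Sm.mul (hf : Sm f) (hg : Sm g) : Sm (f * g) :=
  (ContDiffOn.mul hf hg).congr fun X hX => by simp [ext_of_mem _ hX]

lemma ext_partialD (f : dS D → ℂ) (A : Ix D) (hX : X ∈ cone D) : ext (fun x => partialD f x A) X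
      = (√(mink X X) : ℂ) * fderiv ℝ (ext f) X (Pi.single A 1) := by
  have hr : 0 < √(mink X X) := sqrt_pos.2 hX
  have h := fderiv_comp_smul (𝕜 := ℝ) (f := ext f) (x := X) (√(mink X X))⁻¹
  have h2 : (ext f <| (√(mink X X))⁻¹ • ·) = ext f := funext fun Y => ext_smul f (inv_pos.2 hr) Y
  rw [h2] at h
  rw [ext_of_mem _ hX, h]
  simp only [partialD, normalize]
  have : (√(mink X X) : ℂ) ≠ 0 := ofReal_ne_zero.2 hr.ne'
  simp [this]

lemma Sm.partialD (hf : Sm f) (A : Ix D) : Sm (fun x => partialD f x A) := by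
  have h : ContDiffOn ℝ ∞ (fun X : Amb D => fderiv ℝ (ext f) X (Pi.single A 1)) (cone D) :=
    (hf.fderiv_of_isOpen isOpen_cone (m := ∞) (by simp)).clm_apply contDiffOn_const
  exact Sm.of_normalized h fun _ => rfl

lemma partialD_add (hf : Sm f) (hg : Sm g) (x : dS D) (A : Ix D) :
    partialD (f + g) x A = partialD f x A + partialD g x A := by
  have h : ext (f + g) =ᶠ[𝓝 x.1] ext f + ext g := by
    filter_upwards [isOpen_cone.mem_nhds (coe_mem_cone x)] with X hX
    simp [ext_of_mem _ hX]
  simp only [partialD]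
  rw [h.fderiv_eq, fderiv_add (hf.differentiableAt (coe_mem_cone x))
    (hg.differentiableAt (coe_mem_cone x))]
  rfl

lemma partialD_mul (hf : Sm f) (hg : Sm g) (x : dS D) (A : Ix D) :
    partialD (f * g) x A = f x * partialD g x A + g x * partialD f x A := by
  have h : ext (f * g) =ᶠ[𝓝 x.1] ext f * ext g := by
    filter_upwards [isOpen_cone.mem_nhds (coe_mem_cone x)] with X hX
    simp [ext_of_mem _ hX]
  simp only [partialD]
  rw [h.fderiv_eq, fderiv_mul (hf.differentiableAt (coe_mem_cone x))
    (hg.differentiableAt (coe_mem_cone x))]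
  simp [ext_coe]

lemma partialD_const (c : ℂ) (x : dS D) (A : Ix D) : partialD (fun _ => c) x A = 0 := by
  have h : ext (fun _ : dS D => c) =ᶠ[𝓝 x.1] fun _ => c := by
    filter_upwards [isOpen_cone.mem_nhds (coe_mem_cone x)] with X hX
    simp [ext_of_mem _ hX]
  simp only [partialD]
  rw [h.fderiv_eq]; simp

lemma partialD_const_mul (c : ℂ) (f : dS D → ℂ) (x : dS D) (A : Ix D) :
    partialD (fun z => c * f z) x A = c * partialD f x A := by
  have h : ext (fun z => c * f z) = c • ext f := by
    funext X; by_cases hX : 0 < mink X X <;> simp [ext, hX]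
  simp only [partialD]
  rw [h, fderiv_const_smul_field]; simp

/-- Smooth functions as an algebra. -/
def smoothFn (D : ℕ) : Subalgebra ℂ (dS D → ℂ) where
  carrier := {f | Sm f}
  mul_mem' := Sm.mul
  add_mem' := Sm.add
  algebraMap_mem' c := Sm.const c

/-- The tangential derivative `∂_A` as a derivation of the algebra of smooth functions. -/
def dd (A : Ix D) : Derivation ℂ (smoothFn D) (smoothFn D) where
  toFun f := ⟨fun x => partialD f.1 x A, Sm.partialD f.2 A⟩
  map_add' f g := Subtype.ext (funext fun x => partialD_add f.2 g.2 x A)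
  map_smul' c f := Subtype.ext (funext fun x => partialD_const_mul c f.1 x A)
  map_one_eq_zero' := Subtype.ext (funext fun x => partialD_const 1 x A)
  leibniz' f g := Subtype.ext (funext fun x => partialD_mul f.2 g.2 x A)

/-- The lowered coordinate `x_A = η_{AA} x^A` as a smooth function. -/
def xl (A : Ix D) : smoothFn D :=
  (eta A : ℂ) • ⟨fun x => (x.1 A : ℂ), ext_ofReal_contDiff A⟩

lemma xl_apply (A : Ix D) (x : dS D) : (xl A).1 x = (eta A : ℂ) * (x.1 A : ℂ) := rfl

lemma dd_apply (A : Ix D) (f : smoothFn D) (x : dS D) : (dd A f).1 x = partialD f.1 x A := rfl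

lemma sum_mul_partialD (hf : Sm f) (x : dS D) : ∑ A, (x.1 A : ℂ) * partialD f x A = 0 := by
  have h1 : ∑ A, (x.1 A : ℂ) * partialD f x A = fderiv ℝ (ext f) x.1 x.1 := by
    have h0 := congrArg (fderiv ℝ (ext f) x.1) (Finset.univ_sum_single x.1)
    rw [← h0, map_sum]
    congr 1 with A
    have : Pi.single A (x.1 A) = (x.1 A) • (Pi.single A (1 : ℝ) : Amb D) := by
      rw [← Pi.single_smul]; simp
    rw [this, map_smul]; simp [partialD]
  have h2 : HasDerivAt (fun t : ℝ => ext f ((1 + t) • x.1)) (fderiv ℝ (ext f) x.1 x.1) 0 := by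
    have hd := (hf.differentiableAt (coe_mem_cone x)).hasFDerivAt
    have hl : HasDerivAt (fun t : ℝ => (1 + t) • x.1) x.1 0 := by
      simpa using ((hasDerivAt_id (0 : ℝ)).const_add 1).smul_const x.1
    have hd' : HasFDerivAt (ext f) (fderiv ℝ (ext f) x.1) ((1 + (0 : ℝ)) • x.1) := by simpa using hd
    exact hd'.comp_hasDerivAt 0 hl
  have h3 : HasDerivAt (fun t : ℝ => ext f ((1 + t) • x.1)) 0 0 := by
    refine (hasDerivAt_const (0 : ℝ) (f x)).congr_of_eventuallyEq ?_
    filter_upwards [Ioi_mem_nhds (show (-1 : ℝ) < 0 by norm_num)] with t ht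
    rw [ext_smul f (by simp at ht; linarith) x.1, ext_coe]
  rw [h1, h2.unique h3]

lemma fderiv_sqrt_mink (x : dS D) : HasFDerivAt (fun X : Amb D => √(mink X X))
      (∑ B, (eta B * x.1 B) • ContinuousLinearMap.proj (R := ℝ) (φ := fun _ => ℝ) B) x.1 := by
  have h : HasFDerivAt (fun X : Amb D => mink X X)
      (∑ B, (2 * eta B * x.1 B) • ContinuousLinearMap.proj (R := ℝ) (φ := fun _ => ℝ) B) x.1 := by
    unfold mink
    refine HasFDerivAt.fun_sum fun B _ => ?_
    have hp : HasFDerivAt (fun X : Amb D => X B)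
      (ContinuousLinearMap.proj (R := ℝ) (φ := fun _ => ℝ) B) x.1 := hasFDerivAt_apply B x.1
    refine ((hp.const_mul (eta B)).fun_mul hp).congr_fderiv ?_
    ext v; simp; ring
  refine (h.sqrt (by rw [x.2]; exact one_ne_zero)).congr_fderiv ?_
  rw [x.2, smul_sum]
  congr 1 with B
  rw [smul_smul]; congr 1; simp; ring

lemma fderiv_sqrt_mink_apply (x : dS D) (A : Ix D) :
    fderiv ℝ (fun X : Amb D => √(mink X X)) x.1 (Pi.single A 1) = eta A * x.1 A := by
  rw [(fderiv_sqrt_mink x).fderiv]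
  simp [Pi.single_apply]

lemma partialD_coord (x : dS D) (A B : Ix D) :
    partialD (fun z => (z.1 B : ℂ)) x A = (if A = B then 1 else 0) - (eta A * x.1 A * x.1 B : ℂ) := by
  have hs := ((fderiv_sqrt_mink x).differentiableAt).hasFDerivAt
  have hi := (hasDerivAt_inv (x := √(mink x.1 x.1)) (by rw [x.2]; simp)).comp_hasFDerivAt x.1 hs
  have hp : HasFDerivAt (fun X : Amb D => X B)
      (ContinuousLinearMap.proj (R := ℝ) (φ := fun _ => ℝ) B) x.1 := hasFDerivAt_apply B x.1
  have hm := ofRealCLM.hasFDerivAt.comp x.1 (hi.mul hp)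
  have he : ext (fun z : dS D => (z.1 B : ℂ)) =ᶠ[𝓝 x.1]
      (ofRealCLM ∘ ((Inv.inv ∘ fun X : Amb D => √(mink X X)) * fun X : Amb D => X B)) := by
    filter_upwards [isOpen_cone.mem_nhds (coe_mem_cone x)] with X hX
    simp [ext_of_mem _ hX, normalize]
  simp only [partialD]
  rw [he.fderiv_eq, hm.fderiv]
  have h1 := fderiv_sqrt_mink_apply x A
  simp only [Function.comp_apply, ContinuousLinearMap.comp_apply, add_apply,
    smul_apply, ContinuousLinearMap.proj_apply, h1, x.2, Real.sqrt_one,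
    ofRealCLM_apply, smul_eq_mul, Pi.single_apply, eq_comm (a := B)]
  split_ifs <;> simp <;> ring

lemma partialD_partialD (hf : Sm f) (x : dS D) (A B : Ix D) :
    partialD (fun z => partialD f z B) x A = (eta A * x.1 A : ℂ) * partialD f x B
      + fderiv ℝ (fderiv ℝ (ext f)) x.1 (Pi.single A 1) (Pi.single B 1) := by
  have he : ext (fun z => partialD f z B) =ᶠ[𝓝 x.1]
      fun X => (√(mink X X)) • fderiv ℝ (ext f) X (Pi.single B 1) := by
    filter_upwards [isOpen_cone.mem_nhds (coe_mem_cone x)] with X hX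
    rw [ext_partialD f B hX]; simp
  have hs := ((fderiv_sqrt_mink x).differentiableAt).hasFDerivAt
  have hd : DifferentiableAt ℝ (fderiv ℝ (ext f)) x.1 :=
    ((hf.contDiffAt (coe_mem_cone x)).fderiv_right (m := ∞) (by simp)).differentiableAt (by simp)
  have hd2 := hd.hasFDerivAt.clm_apply (hasFDerivAt_const (Pi.single B 1 : Amb D) x.1)
  conv_lhs => rw [DeSitter.partialD]
  rw [he.fderiv_eq, (hs.fun_smul hd2).fderiv]
  have h1 := fderiv_sqrt_mink_apply x A
  simp [x.2, h1, DeSitter.partialD]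
  ring

lemma partialD_comm (hf : Sm f) (x : dS D) (A B : Ix D) :
    partialD (fun z => partialD f z B) x A - partialD (fun z => partialD f z A) x B
      = (eta A * x.1 A : ℂ) * partialD f x B - (eta B * x.1 B : ℂ) * partialD f x A := by
  have hsymm : fderiv ℝ (fderiv ℝ (ext f)) x.1 (Pi.single A 1) (Pi.single B 1)
      = fderiv ℝ (fderiv ℝ (ext f)) x.1 (Pi.single B 1) (Pi.single A 1) :=
    ((hf.contDiffAt (coe_mem_cone x)).isSymmSndFDerivAt
      (by rw [minSmoothness_of_isRCLikeNormedField]; exact WithTop.coe_le_coe.2 (le_top : (2 : ℕ∞) ≤ ⊤))) _ _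
  rw [partialD_partialD hf, partialD_partialD hf, hsymm]; ring

end

section


/-! ### Tangential tensor calculus over a ring of functions -/

/-- The algebraic rules of tangential differentiation on the unit hyperboloid: `x A` are the lowered
embedding coordinates, `d A` the tangential derivatives, `e A` the diagonal entries of the ambient
metric (constants), and `D` the dimension of the hyperboloid. -/
structure Calc (R ι : Type*) [CommRing R] [Algebra ℂ R] [Fintype ι] [DecidableEq ι] where
  e : ι → R
  x : ι → R
  d : ι → Derivation ℂ R R
  D : R
  e_sq : ∀ A, e A * e A = 1
  d_e : ∀ A B, d A (e B) = 0
  xx : ∑ A, e A * (x A * x A) = 1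
  dx : ∀ A B, d A (x B) = (if A = B then e A else 0) - x A * x B
  xd : ∀ f, ∑ A, e A * (x A * d A f) = 0
  comm : ∀ A B f, d A (d B f) = d B (d A f) + (x A * d B f - x B * d A f)
  card : (Fintype.card ι : R) = D + 1

namespace Calc
variable {R ι : Type*} [CommRing R] [Algebra ℂ R] [Fintype ι] [DecidableEq ι] (C : Calc R ι)

/-- Contraction of an index (occurring in two lower slots) with the ambient metric. -/
def ctr (F : ι → R) : R := ∑ A, C.e A * F A

/-- The induced metric. -/
def g (A B : ι) : R := (if A = B then C.e A else 0) - C.x A * C.x B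

lemma d_x (A B : ι) : C.d A (C.x B) = C.g A B := C.dx A B

lemma g_symm (A B : ι) : C.g A B = C.g B A := by
  unfold g; rcases eq_or_ne A B with h | h
  · rw [h]
  · simp [h, h.symm]; ring

lemma ctr_add (F G : ι → R) : C.ctr (fun A => F A + G A) = C.ctr F + C.ctr G := by
  simp [ctr, mul_add, sum_add_distrib]

lemma ctr_sub (F G : ι → R) : C.ctr (fun A => F A - G A) = C.ctr F - C.ctr G := by
  simp [ctr, mul_sub, sum_sub_distrib]

lemma ctr_neg (F : ι → R) : C.ctr (fun A => -F A) = -C.ctr F := by simp [ctr]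

lemma ctr_zero : C.ctr (fun _ => 0) = 0 := by simp [ctr]

lemma ctr_const_mul (a : R) (F : ι → R) : C.ctr (fun A => a * F A) = a * C.ctr F := by
  simp only [ctr, mul_sum]; congr 1 with _; ring

lemma ctr_mul_const (a : R) (F : ι → R) : C.ctr (fun A => F A * a) = C.ctr F * a := by
  simp only [ctr, sum_mul]; congr 1 with _; ring

lemma d_ctr (B : ι) (F : ι → R) : C.d B (C.ctr F) = C.ctr fun A => C.d B (F A) := by
  simp [ctr, C.d_e]

lemma ctr_comm (F : ι → ι → R) :
    (C.ctr fun A => C.ctr fun B => F A B) = C.ctr fun B => C.ctr fun A => F A B := by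
  simp only [ctr, mul_sum]
  rw [sum_comm]
  exact sum_congr rfl fun _ _ => sum_congr rfl fun _ _ => by ring

lemma ctr_xx : (C.ctr fun A => C.x A * C.x A) = 1 := C.xx

lemma ctr_xd (f : R) : (C.ctr fun A => C.x A * C.d A f) = 0 := C.xd f

/-- Contraction with the induced metric. -/
lemma ctr_g (T : ι → R) (B : ι) :
    (C.ctr fun A => C.g A B * T A) = T B - C.x B * C.ctr fun A => C.x A * T A := by
  have h : (∑ A, C.e A * ((if A = B then C.e A else 0) * T A)) = T B := by
    rw [sum_eq_single B]
    · simp [← mul_assoc, C.e_sq]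
    · intro A _ h; simp [h]
    · simp
  rw [← C.ctr_const_mul]
  simp only [ctr]
  rw [eq_sub_iff_add_eq, ← sum_add_distrib]
  refine Eq.trans (sum_congr rfl fun A _ => ?_) h
  unfold g; ring

lemma ctr_g_tan {T : ι → R} (hT : (C.ctr fun A => C.x A * T A) = 0) (B : ι) :
    (C.ctr fun A => C.g A B * T A) = T B := by rw [ctr_g, hT]; ring

lemma ctr_g_tan' {T : ι → R} (hT : (C.ctr fun A => C.x A * T A) = 0) (B : ι) :
    (C.ctr fun A => C.g B A * T A) = T B := by
  rw [← C.ctr_g_tan hT B]; simp only [C.g_symm]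

lemma ctr_xg (B : ι) : (C.ctr fun A => C.x A * C.g A B) = 0 := by
  have h := C.ctr_g C.x B
  rw [ctr_xx, mul_one, sub_self] at h
  simpa only [mul_comm] using h

lemma ctr_xg' (B : ι) : (C.ctr fun A => C.x A * C.g B A) = 0 := by
  rw [← C.ctr_xg B]; simp only [C.g_symm]

lemma ctr_gg : (C.ctr fun A => C.g A A) = C.D := by
  have h : (C.ctr fun A => C.g A A) = (C.ctr C.e) - C.ctr fun A => C.x A * C.x A := by
    rw [← C.ctr_sub]; simp [g]
  rw [h, C.ctr_xx]
  simp [ctr, e_sq, C.card]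

lemma d_g (A B E : ι) : C.d E (C.g A B) = -(C.g E A * C.x B + C.x A * C.g E B) := by
  have h : C.d E (if A = B then C.e A else 0) = 0 := by split_ifs <;> simp [C.d_e]
  conv_lhs => unfold g
  rw [map_sub, h, Derivation.leibniz, d_x, C.d_x]; simp only [smul_eq_mul]; ring

lemma d_mul (A : ι) (a b : R) : C.d A (a * b) = a * C.d A b + b * C.d A a := by
  rw [Derivation.leibniz]; rfl

/-- The divergence contracted in the first slot of a family. -/
def dv (T : ι → R) : R := C.ctr fun A => C.d A (T A)

lemma dv_add (F G : ι → R) : C.dv (fun A => F A + G A) = C.dv F + C.dv G := by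
  simp [dv, ctr_add]

lemma dv_sub (F G : ι → R) : C.dv (fun A => F A - G A) = C.dv F - C.dv G := by
  simp [dv, ctr_sub]

lemma dv_neg (F : ι → R) : C.dv (fun A => -F A) = -C.dv F := by simp [dv, ctr_neg]

lemma dv_zero : C.dv (fun _ => 0) = 0 := by simp [dv, ctr_zero]

/-- A one-index family is tangential if its contraction with `x` vanishes. -/
def Tan (T : ι → R) : Prop := (C.ctr fun A => C.x A * T A) = 0

variable {C} {T F G : ι → R}

lemma Tan.add (hF : C.Tan F) (hG : C.Tan G) : C.Tan fun A => F A + G A := by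
  unfold Tan at *; simp only [mul_add, ctr_add, hF, hG, add_zero]

lemma Tan.sub (hF : C.Tan F) (hG : C.Tan G) : C.Tan fun A => F A - G A := by
  unfold Tan at *; simp only [mul_sub, ctr_sub, hF, hG, sub_zero]

lemma Tan.neg (hF : C.Tan F) : C.Tan fun A => -F A := by
  unfold Tan at *; simp only [mul_neg, ctr_neg, hF, neg_zero]

lemma Tan.mul (hF : C.Tan F) (a : R) : C.Tan fun A => F A * a := by
  unfold Tan at *; simp only [← mul_assoc, ctr_mul_const, hF, zero_mul]

lemma Tan.const_mul (hF : C.Tan F) (a : R) : C.Tan fun A => a * F A := by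
  simpa only [mul_comm] using hF.mul a

lemma Tan.smul (hT : C.Tan T) (c : ℂ) : C.Tan fun A => c • T A := by
  simpa only [Algebra.smul_def] using hT.const_mul (algebraMap ℂ _ c)

lemma Tan.ctr {F : ι → ι → R} (hF : ∀ B, C.Tan fun A => F A B) :
    C.Tan fun A => C.ctr fun B => F A B := by
  have : (C.ctr fun A => C.x A * C.ctr fun B => F A B)
      = C.ctr fun B => C.ctr fun A => C.x A * F A B := by
    rw [← ctr_comm]; simp only [C.ctr_const_mul]
  unfold Tan at *; rw [this]; simp only [hF, ctr_zero]

variable (C)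

lemma tan_g (B : ι) : C.Tan fun A => C.g A B := C.ctr_xg B
lemma tan_g' (B : ι) : C.Tan fun A => C.g B A := C.ctr_xg' B
lemma tan_d (f : R) : C.Tan fun A => C.d A f := C.ctr_xd f

lemma ctr_x_d_tan (hT : C.Tan T) (B : ι) :
    (C.ctr fun A => C.x A * C.d B (T A)) = -T B := by
  have h := congrArg (C.d B) (show (C.ctr fun A => C.x A * T A) = 0 from hT)
  rw [d_ctr, map_zero] at h
  simp only [d_mul, C.d_x] at h
  rw [C.ctr_add] at h
  have h2 : (C.ctr fun A => T A * C.g B A) = T B := by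
    simpa only [mul_comm] using C.ctr_g_tan' hT B
  rw [h2] at h; linear_combination h

lemma dv_x_mul (hT : C.Tan T) (B : ι) :
    C.dv (fun A => C.x B * T A) = T B + C.x B * C.dv T := by
  simp only [dv, d_mul, d_x, ctr_add, C.ctr_const_mul]
  have h2 : (C.ctr fun A => T A * C.g A B) = T B := by
    simpa only [mul_comm] using C.ctr_g_tan hT B
  rw [h2]; ring

lemma dv_xself_mul (f : R) : C.dv (fun A => C.x A * f) = C.D * f := by
  simp only [dv, d_mul, d_x, ctr_add, ctr_const_mul, ctr_xd, C.ctr_gg]; ring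

lemma dv_const_mul (a : R) (T : ι → R) :
    C.dv (fun A => a * T A) = a * C.dv T + C.ctr fun A => T A * C.d A a := by
  simp only [dv, d_mul, ctr_add, C.ctr_const_mul]

lemma dv_g_mul (f : R) (B : ι) : C.dv (fun A => C.g A B * f) = C.d B f - C.D * C.x B * f := by
  have h1 : (C.ctr fun A => C.g A B * C.d A f) = C.d B f := C.ctr_g_tan (C.tan_d f) B
  have h2 : (C.ctr fun A => f * -(C.g A A * C.x B + C.x A * C.g A B)) = -(C.D * C.x B * f) := by
    rw [ctr_const_mul, ctr_neg, ctr_add, ctr_mul_const, ctr_gg, C.ctr_xg]; ring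
  simp only [dv, d_mul, d_g, C.ctr_add]
  rw [h1, h2]; ring

lemma dv_d (hT : C.Tan T) (B : ι) :
    C.dv (fun A => C.d B (T A)) = C.d B (C.dv T) - T B - C.x B * C.dv T := by
  simp only [dv, C.comm _ B, ctr_add, ctr_sub, ctr_const_mul, C.ctr_x_d_tan hT, C.d_ctr]
  ring

/-- The d'Alembertian on scalars. -/
def box (f : R) : R := C.dv fun A => C.d A f

lemma dv_smul (c : ℂ) (T : ι → R) : C.dv (fun A => c • T A) = c • C.dv T := by
  simp only [dv, ctr, Derivation.map_smul, smul_sum, mul_smul_comm]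

lemma box_add (f h : R) : C.box (f + h) = C.box f + C.box h := by simp [box, dv_add]
lemma box_sub (f h : R) : C.box (f - h) = C.box f - C.box h := by simp [box, dv_sub]

lemma box_smul (c : ℂ) (f : R) : C.box (c • f) = c • C.box f := by
  simp only [box, Derivation.map_smul, dv_smul]

lemma box_ctr (F : ι → R) : C.box (C.ctr F) = C.ctr fun A => C.box (F A) := by
  simp only [box, dv, C.d_ctr]
  rw [C.ctr_comm]

lemma box_mul (a b : R) :
    C.box (a * b) = a * C.box b + b * C.box a + 2 * C.ctr fun A => C.d A a * C.d A b := by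
  simp only [box, dv, d_mul, map_add, ctr_add, C.ctr_const_mul]
  have : (C.ctr fun A => C.d A b * C.d A a) = C.ctr fun A => C.d A a * C.d A b := by
    simp only [mul_comm]
  rw [this]; ring

lemma box_x (B : ι) : C.box (C.x B) = -(C.D * C.x B) := by
  have := C.dv_g_mul 1 B
  simpa [box, C.d_x] using this

/-- The commutator of a divergence with the d'Alembertian. -/
lemma d_box (B : ι) (f : R) :
    C.d B (C.box f) = C.box (C.d B f) + 2 * C.x B * C.box f + (2 - C.D) * C.d B f := by
  have h1 : (C.ctr fun A => C.x A * C.d B (C.d A f)) = -C.d B f := C.ctr_x_d_tan (C.tan_d f) B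
  have h2 : C.dv (fun A => C.x A * C.d B f) = C.D * C.d B f := C.dv_xself_mul _
  have h3 : C.dv (fun A => C.x B * C.d A f) = C.d B f + C.x B * C.box f :=
    C.dv_x_mul (C.tan_d f) B
  have h4 : C.d B (C.box f) = C.ctr fun A => C.d A (C.d B (C.d A f))
      + (C.x B * C.d A (C.d A f) - C.x A * C.d B (C.d A f)) := by
    simp only [box, dv, C.d_ctr]
    congr 1 with A; exact C.comm B A _
  have h5 : ∀ A, C.d A (C.d B (C.d A f)) = C.d A (C.d A (C.d B f))
      + (C.d A (C.x B * C.d A f) - C.d A (C.x A * C.d B f)) := by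
    intro A; rw [C.comm B A f, map_add, map_sub]
  rw [h4]
  simp only [h5, ctr_add, ctr_sub, ctr_const_mul, h1]
  simp only [dv] at h2 h3
  rw [h2, h3]
  simp only [box, dv]; ring

lemma ctr_x_box (hT : C.Tan T) :
    (C.ctr fun A => C.x A * C.box (T A)) = -(2 * C.dv T) := by
  have h := congrArg C.box (show (C.ctr fun A => C.x A * T A) = 0 from hT)
  rw [C.box_ctr] at h
  simp only [box_mul, box_x, d_x, C.ctr_add] at h
  have h1 : (C.ctr fun A => T A * -(C.D * C.x A)) = -(C.D * C.ctr fun A => C.x A * T A) := by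
    rw [← ctr_const_mul, ← C.ctr_neg]; congr 1 with A; ring
  have h2 : (C.ctr fun A => 2 * C.ctr fun B => C.g B A * C.d B (T A)) = 2 * C.dv T := by
    rw [ctr_const_mul, dv]; congr 1
    congr 1 with A; exact C.ctr_g_tan (C.tan_d _) A
  rw [h1, h2, show (C.ctr fun A => C.x A * T A) = 0 from hT] at h
  have h0 : C.box 0 = 0 := by simp [box, dv, ctr]
  rw [h0] at h; linear_combination h

lemma dv_box (hT : C.Tan T) :
    C.dv (fun A => C.box (T A)) = C.box (C.dv T) - (C.D + 2) * C.dv T := by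
  have h : C.dv (fun A => C.box (T A)) = C.box (C.dv T)
      + 2 * (C.ctr fun A => C.x A * C.box (T A)) + (2 - C.D) * C.dv T := by
    conv_rhs => rw [dv, C.box_ctr]
    rw [dv, ← ctr_const_mul, ← ctr_const_mul, ← ctr_add, ← C.ctr_add]
    congr 1 with A; rw [C.d_box]; ring
  rw [h, C.ctr_x_box hT]; ring

end Calc

end

section


lemma eq_zero_of_eq_neg (R : Type*) [CommRing R] [Algebra ℂ R] {a : R} (h : a = -a) : a = 0 := by
  have h2 : (2 : ℂ) • a = 0 := by rw [two_smul]; nth_rewrite 1 [h]; ring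
  have h3 := congrArg ((2 : ℂ)⁻¹ • ·) h2
  simp only [smul_smul, smul_zero] at h3
  norm_num at h3
  exact h3

namespace Calc
variable {R ι : Type*} [CommRing R] [Algebra ℂ R] [Fintype ι] [DecidableEq ι] (C : Calc R ι)

/-! ### The linearized Weyl projection -/

/-- The covariant derivative `∇_a f_{bc}` of a tangential tensor of rank two. -/
def nab2 (f : ι → ι → R) (a b c : ι) : R := C.d a (f b c) + C.x b * f a c + C.x c * f b a

/-- The covariant derivative `∇_g t_{abc}` of a tangential tensor of rank three. -/
def nab3 (t : ι → ι → ι → R) (g a b c : ι) : R :=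
  C.d g (t a b c) + C.x a * t g b c + C.x b * t a g c + C.x c * t a b g

/-- Four times the antisymmetrization of `∇_g ∇_a f_{bd}` in `ab` and in `gd`. -/
def curl (f : ι → ι → R) (a b g d : ι) : R :=
  C.nab3 (C.nab2 f) g a b d - C.nab3 (C.nab2 f) g b a d
    - C.nab3 (C.nab2 f) d a b g + C.nab3 (C.nab2 f) d b a g

/-- The contraction `y_m{}^b{}_{br}`. -/
def ric (y : ι → ι → ι → ι → R) (m r : ι) : R := C.ctr fun b => y m b b r

/-- The contraction `y^{ab}{}_{ab}`. -/
def scal (y : ι → ι → ι → ι → R) : R := C.ctr fun a => C.ctr fun b => y a b a b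

/-- The traceless projection of a tensor that is antisymmetric in its first and in its last pair of
indices, with the pairs interchanged. The constants stand for `k₁ = 1/(D-2)` and
`k₂ = 1/((D-1)(D-2))`. -/
def wp (k₁ k₂ : R) (y : ι → ι → ι → ι → R) (r s m n : ι) : R :=
  y m n r s + k₁ * (C.ric y m r * C.g s n - C.ric y n r * C.g s m - C.ric y m s * C.g r n
    + C.ric y n s * C.g r m) + k₂ * C.scal y * (C.g r m * C.g s n - C.g s m * C.g r n)

/-- Antisymmetry in both pairs and tangentiality. -/
structure Bi (y : ι → ι → ι → ι → R) : Prop where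
  anti₁ : ∀ a b g d, y b a g d = -y a b g d
  anti₂ : ∀ a b g d, y a b d g = -y a b g d
  tan₁ : ∀ b g d, C.Tan fun a => y a b g d
  tan₃ : ∀ a b d, C.Tan fun g => y a b g d

variable {C} {k₁ k₂ : R} {y z : ι → ι → ι → ι → R} {t : ι → ι → ι → R} {f : ι → ι → R} {T : ι → R}

lemma Bi.tan₂ (h : C.Bi y) (a g d : ι) : C.Tan fun b => y a b g d := by
  simpa only [h.anti₁ a, neg_neg] using (h.tan₁ a g d).neg

lemma Bi.tan₄ (h : C.Bi y) (a b g : ι) : C.Tan fun d => y a b g d := by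
  simpa only [h.anti₂ _ _ g, neg_neg] using (h.tan₃ a b g).neg

lemma Bi.tan_ric₁ (h : C.Bi y) (r : ι) : C.Tan fun m => C.ric y m r :=
  Tan.ctr fun b => h.tan₁ b b r

lemma Bi.tan_ric₂ (h : C.Bi y) (m : ι) : C.Tan fun r => C.ric y m r :=
  Tan.ctr fun b => h.tan₄ m b b

lemma Bi.scal_eq (h : C.Bi y) : C.scal y = -C.ctr fun a => C.ric y a a := by
  unfold scal ric
  rw [← C.ctr_neg]; congr 1 with a
  rw [← C.ctr_neg]; congr 1 with b
  rw [h.anti₂]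

lemma Bi.wp (h : C.Bi y) : C.Bi (C.wp k₁ k₂ y) where
  anti₁ r s m n := by unfold Calc.wp; rw [h.anti₂ m n r s]; ring
  anti₂ r s m n := by
    unfold Calc.wp
    rw [h.anti₁ m n r s]; ring
  tan₁ s m n := by
    unfold Calc.wp
    refine (((h.tan₃ _ _ _).add (Tan.const_mul (((((h.tan_ric₂ _).mul _).sub
      ((h.tan_ric₂ _).mul _)).sub ((C.tan_g _).const_mul _)).add
      ((C.tan_g _).const_mul _)) _)).add ?_)
    exact Tan.const_mul (((C.tan_g _).mul _).sub ((C.tan_g _).const_mul _)) _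
  tan₃ r s n := by
    unfold Calc.wp
    refine (((h.tan₁ _ _ _).add (Tan.const_mul (((((h.tan_ric₁ _).mul _).sub
      ((C.tan_g' _).const_mul _)).sub ((h.tan_ric₁ _).mul _)).add
      ((C.tan_g' _).const_mul _)) _)).add ?_)
    exact Tan.const_mul (((C.tan_g' _).mul _).sub ((C.tan_g' _).mul _)) _

lemma Bi.wp_trace (h₁ : k₁ * (C.D - 2) = 1) (h₂ : k₂ * (C.D - 1) = k₁)
    (h : C.Bi y) (s n : ι) :
    (C.ctr fun r => C.wp k₁ k₂ y r s r n) = 0 := by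
  have e0 : (C.ctr fun r => y r n r s) = -C.ric y n s := by
    rw [ric, ← C.ctr_neg]; congr 1 with r; rw [h.anti₁]
  have e1 : (C.ctr fun r => C.ric y n r * C.g s r) = C.ric y n s := by
    simpa only [mul_comm] using C.ctr_g_tan' (h.tan_ric₂ n) s
  have e2 : (C.ctr fun r => C.ric y r s * C.g r n) = C.ric y n s := by
    simpa only [mul_comm] using C.ctr_g_tan (h.tan_ric₁ s) n
  have e3 : (C.ctr fun r => C.g s r * C.g r n) = C.g s n := by
    simpa only [mul_comm] using C.ctr_g_tan (C.tan_g' s) n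
  have e4 := h.scal_eq
  unfold Calc.wp
  simp only [ctr_add, ctr_sub, ctr_const_mul, ctr_mul_const, e0, e1, e2, e3, C.ctr_gg]
  linear_combination (C.ric y n s) * h₁ + C.scal y * C.g s n * h₂ + k₁ * C.g s n * e4

variable (C)

lemma wp_congr_neg (c : R)
    (h : ∀ a b g d, y a b g d = c * z a b g d) (r s m n : ι) :
    C.wp k₁ k₂ y r s m n = c * C.wp k₁ k₂ z r s m n := by
  have : y = fun a b g d => c * z a b g d := by funext a b g d; exact h a b g d
  subst this
  simp only [wp, ric, scal, C.ctr_const_mul]; ring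

/-- Four times the antisymmetrization of `g_{bd} M_{ga}`. -/
def pureTrace (M : ι → ι → R) (a b g d : ι) : R :=
  C.g b d * M g a - C.g a d * M g b - C.g b g * M d a + C.g a g * M d b

/-- The traceless projection annihilates `g_{bd} M_{ga}`. -/
lemma wp_pureTrace (h₁ : k₁ * (C.D - 2) = 1) (h₂ : k₂ * (C.D - 1) = k₁)
    {M : ι → ι → R} (hM₁ : ∀ b, C.Tan fun a => M a b) (hM₂ : ∀ a, C.Tan fun b => M a b)
    (r s m n : ι) : C.wp k₁ k₂ (C.pureTrace M) r s m n = 0 := by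
  have hr : ∀ m r, C.ric (C.pureTrace M) m r
      = (2 - C.D) * M r m - C.g m r * C.ctr fun b => M b b := fun m r => by
    unfold ric pureTrace
    simp only [ctr_add, ctr_sub, ctr_const_mul, ctr_mul_const, C.ctr_gg]
    rw [C.ctr_g_tan (hM₁ m) r, C.ctr_g_tan' (hM₂ r) m]; ring
  have hs : C.scal (C.pureTrace M) = (2 * C.D - 2) * C.ctr fun b => M b b := by
    have h1 : ∀ a, (C.ctr fun b => C.pureTrace M a b a b)
        = (C.D - 2) * M a a + C.g a a * C.ctr fun b => M b b := fun a => by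
      unfold pureTrace
      simp only [ctr_add, ctr_sub, ctr_const_mul, ctr_mul_const, C.ctr_gg]
      rw [C.ctr_g_tan' (hM₂ a) a, C.ctr_g_tan (hM₁ a) a]; ring
    unfold scal
    simp only [h1, ctr_add, ctr_const_mul, ctr_mul_const, C.ctr_gg]; ring
  unfold wp
  rw [hr, hr, hr, hr, hs]
  unfold pureTrace
  rw [C.g_symm m s, C.g_symm n r, C.g_symm n s, C.g_symm m r]
  linear_combination (-(C.g s n * M r m) + C.g s m * M r n + C.g r n * M s m - C.g r m * M s n) * h₁
    + 2 * (C.ctr fun b => M b b) * (C.g r m * C.g s n - C.g s m * C.g r n) * h₂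

lemma wp_swap (hy : C.Bi y)
    (h : ∀ a b g d, z a b g d = y g d a b) (r s m n : ι) :
    C.wp k₁ k₂ z r s m n = C.wp k₁ k₂ y m n r s := by
  have h1 : ∀ m r, C.ric z m r = C.ric y r m := by
    intro m r; unfold ric; congr 1 with b
    rw [h, hy.anti₁, hy.anti₂, neg_neg]
  have h2 : C.scal z = C.scal y := by
    unfold scal; congr 1 with a; congr 1 with b; rw [h]
  unfold wp
  rw [h1, h1, h1, h1, h2, h, C.g_symm n s, C.g_symm n r, C.g_symm m s, C.g_symm m r]; ring

/-! ### The transposed projection operator -/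

/-- A tensor of rank two that is tangential in both indices. -/
def Tan2 (f : ι → ι → R) : Prop := (∀ b, C.Tan fun a => f a b) ∧ ∀ a, C.Tan fun b => f a b

lemma tan_nab (hT : C.Tan T) (B : ι) : C.Tan fun A => C.d B (T A) + C.x A * T B := by
  unfold Tan
  simp only [mul_add, ← mul_assoc, ctr_add, ctr_mul_const, ctr_xx, C.ctr_x_d_tan hT]; ring

lemma tan_grad (hT : C.Tan T) (B : ι) : C.Tan fun A => C.d A (T B) + C.x B * T A :=
  (C.tan_d _).add (hT.const_mul _)

lemma nab2_tan₁ (hf : C.Tan2 f) (b c : ι) : C.Tan fun a => C.nab2 f a b c :=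
  ((C.tan_d _).add ((hf.1 c).const_mul _)).add ((hf.2 b).const_mul _)

lemma nab2_tan₂ (hf : C.Tan2 f) (a c : ι) : C.Tan fun b => C.nab2 f a b c :=
  (C.tan_nab (hf.1 c) a).add ((hf.1 a).const_mul _)

lemma nab2_tan₃ (hf : C.Tan2 f) (a b : ι) : C.Tan fun c => C.nab2 f a b c := by
  simpa only [nab2, add_right_comm] using (C.tan_nab (hf.2 b) a).add ((hf.2 a).const_mul (C.x b))

lemma nab3_tan₁ (h₁ : ∀ b c, C.Tan fun a => t a b c)
    (h₂ : ∀ a c, C.Tan fun b => t a b c) (h₃ : ∀ a b, C.Tan fun c => t a b c) (a b c : ι) :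
    C.Tan fun g => C.nab3 t g a b c :=
  (((C.tan_d _).add ((h₁ b c).const_mul _)).add ((h₂ a c).const_mul _)).add
    ((h₃ a b).const_mul _)

lemma nab3_tan₂ (h₁ : ∀ b c, C.Tan fun a => t a b c) (g b c : ι) :
    C.Tan fun a => C.nab3 t g a b c :=
  ((C.tan_nab (h₁ b c) g).add ((h₁ g c).const_mul _)).add ((h₁ b g).const_mul _)

lemma nab3_tan₃ (h₂ : ∀ a c, C.Tan fun b => t a b c) (g a c : ι) :
    C.Tan fun b => C.nab3 t g a b c := by
  have := ((C.tan_nab (h₂ a c) g).add ((h₂ g c).const_mul (C.x a))).add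
    ((h₂ a g).const_mul (C.x c))
  refine (congrArg C.Tan (funext fun b => ?_)).mp this
  unfold nab3; ring

lemma nab3_tan₄ (h₃ : ∀ a b, C.Tan fun c => t a b c) (g a b : ι) :
    C.Tan fun c => C.nab3 t g a b c := by
  have := ((C.tan_nab (h₃ a b) g).add ((h₃ g b).const_mul (C.x a))).add
    ((h₃ a g).const_mul (C.x b))
  refine (congrArg C.Tan (funext fun c => ?_)).mp this
  unfold nab3; ring

lemma bi_curl (hf : C.Tan2 f) : C.Bi (C.curl f) := by
  have h₁ := C.nab2_tan₁ hf
  have h₂ := C.nab2_tan₂ hf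
  have h₃ := C.nab2_tan₃ hf
  refine ⟨fun a b g d => by unfold curl; ring, fun a b g d => by unfold curl; ring,
    fun b g d => ?_, fun a b d => ?_⟩
  · exact (((C.nab3_tan₂ h₁ _ _ _).sub (C.nab3_tan₃ h₂ _ _ _)).sub
      (C.nab3_tan₂ h₁ _ _ _)).add (C.nab3_tan₃ h₂ _ _ _)
  · exact (((C.nab3_tan₁ h₁ h₂ h₃ _ _ _).sub (C.nab3_tan₁ h₁ h₂ h₃ _ _ _)).sub
      (C.nab3_tan₄ h₃ _ _ _)).add (C.nab3_tan₄ h₃ _ _ _)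

/-- `-2` times the transpose of the operator `h ↦ ∇^γ ∇^δ C_{γμδν}(h)`. -/
def pt (k₁ k₂ : R) (f : ι → ι → R) (n s : ι) : R :=
  C.dv fun m => C.dv fun r => C.wp k₁ k₂ (C.curl f) r s m n

lemma curl_metric_mul (φ : R) (a b g d : ι) : C.curl (fun b d => C.g b d * φ) a b g d
      = C.pureTrace (fun g a => C.d g (C.d a φ) + C.x a * C.d g φ) a b g d := by
  simp only [curl, nab3, nab2, d_mul, d_g, map_add, map_neg, d_x, pureTrace]
  rw [C.g_symm b a, C.g_symm g a, C.g_symm g b, C.g_symm d a, C.g_symm d b, C.g_symm d g]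
  ring

lemma curl_grad (ξ : ι → R) (a b g d : ι) : C.curl (fun b d => C.d b (ξ d) + C.x d * ξ b) a b g d
      = -1 * C.pureTrace (fun g a => C.d g (ξ a) + C.x a * ξ g) a b g d := by
  have key : ∀ a b d, C.nab2 (fun b d => C.d b (ξ d) + C.x d * ξ b) a b d
      = C.nab2 (fun b d => C.d b (ξ d) + C.x d * ξ b) b a d + (C.g a d * ξ b - C.g b d * ξ a) := fun a b d => by
    simp only [nab2, d_mul, map_add, C.d_x]
    rw [C.comm a b (ξ d)]; ring
  have key2 : ∀ g a b d, C.nab3 (C.nab2 (fun b d => C.d b (ξ d) + C.x d * ξ b)) g a b d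
      - C.nab3 (C.nab2 (fun b d => C.d b (ξ d) + C.x d * ξ b)) g b a d
      = C.g a d * (C.d g (ξ b) + C.x b * ξ g) - C.g b d * (C.d g (ξ a) + C.x a * ξ g) := fun g a b d => by
    unfold nab3
    rw [key a b d, key g b d, key a g d, key a b g]
    simp only [map_add, map_sub, d_mul, C.d_g]
    rw [C.g_symm g a, C.g_symm b g]
    ring
  have h1 := key2 g a b d
  have h2 := key2 d a b g
  unfold curl pureTrace
  linear_combination h1 - h2

lemma curl_transpose (f : ι → ι → R) (a b g d : ι) :
    C.curl (fun a b => f b a) a b g d = C.curl f g d a b := by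
  have key : ∀ a b g d, C.nab3 (C.nab2 fun a b => f b a) g a b d = C.nab3 (C.nab2 f) a g d b
      + (C.g g d * f a b - C.g a d * f g b + C.g g b * f d a - C.g a b * f d g) := fun a b g d => by
    simp only [nab3, nab2, d_mul, map_add, C.d_x]
    rw [C.comm g a (f d b)]; ring
  unfold curl
  rw [key a b g d, key b a g d, key a b d g, key b a d g]
  rw [C.g_symm g d, C.g_symm b a, C.g_symm g a, C.g_symm g b, C.g_symm d a, C.g_symm d b]
  ring

lemma dv_dv_comm {T : ι → ι → R} (h₁ : ∀ r, C.Tan fun m => T m r) (h₂ : ∀ m, C.Tan fun r => T m r) :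
    (C.dv fun m => C.dv fun r => T m r) = C.dv fun r => C.dv fun m => T m r := by
  have h : (C.dv fun m => C.dv fun r => T m r)
      = C.ctr fun m => C.ctr fun r => C.d m (C.d r (T m r)) := by simp only [dv, C.d_ctr]
  have h' : (C.dv fun r => C.dv fun m => T m r)
      = C.ctr fun r => C.ctr fun m => C.d r (C.d m (T m r)) := by simp only [dv, C.d_ctr]
  have e1 : (C.ctr fun m => C.ctr fun r => C.x m * C.d r (T m r)) = -C.ctr fun r => T r r := by
    rw [ctr_comm, ← C.ctr_neg]; congr 1 with r; exact C.ctr_x_d_tan (h₁ r) r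
  have e2 : (C.ctr fun m => C.ctr fun r => C.x r * C.d m (T m r)) = -C.ctr fun r => T r r := by
    rw [← C.ctr_neg]; congr 1 with m; exact C.ctr_x_d_tan (h₂ m) m
  have e3 : (C.ctr fun m => C.ctr fun r => C.d m (C.d r (T m r)))
      = C.ctr fun m => C.ctr fun r => C.d r (C.d m (T m r))
        + (C.x m * C.d r (T m r) - C.x r * C.d m (T m r)) := by
    congr 1 with m; congr 1 with r; exact C.comm m r _
  rw [h, h', C.ctr_comm (fun r m => C.d r (C.d m (T m r))), e3]
  simp only [ctr_add, ctr_sub, e1, e2]; ring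


lemma pt_eq_zero (h : ∀ r s m n, C.wp k₁ k₂ (C.curl f) r s m n = 0) (n s : ι) :
    C.pt k₁ k₂ f n s = 0 := by
  unfold pt; simp only [h, C.dv_zero]

lemma pt_transpose (hf : C.Tan2 f) (n s : ι) :
    C.pt k₁ k₂ (fun a b => f b a) n s = C.pt k₁ k₂ f s n := by
  have hb := (C.bi_curl hf).wp (k₁ := k₁) (k₂ := k₂)
  have h : ∀ r s m n, C.wp k₁ k₂ (C.curl fun a b => f b a) r s m n = C.wp k₁ k₂ (C.curl f) m n r s :=
    fun r s m n => C.wp_swap (C.bi_curl hf) (C.curl_transpose f) r s m n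
  unfold pt
  simp only [h]
  exact C.dv_dv_comm (fun r => hb.tan₁ _ _ _) (fun m => hb.tan₃ _ _ _)

lemma d_D (A : ι) : C.d A C.D = 0 := by
  have : C.D = (Fintype.card ι : R) - 1 := by rw [C.card]; ring
  rw [this]; simp [map_sub]

lemma dv_mul_g (hT : C.Tan T) (h0 : C.dv T = 0) (s n : ι) :
    (C.dv fun r => T r * C.g s n) = -(C.x n * T s + C.x s * T n) := by
  have h : (C.dv fun r => T r * C.g s n) = C.dv fun r => C.g s n * T r := by simp only [mul_comm]
  have h1 : (C.ctr fun r => T r * -(C.g r s * C.x n + C.x s * C.g r n))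
      = -((C.ctr fun r => C.g r s * T r) * C.x n + C.x s * C.ctr fun r => C.g r n * T r) := by
    rw [← ctr_mul_const, ← ctr_const_mul, ← ctr_add, ← C.ctr_neg]
    congr 1 with r; ring
  rw [h, dv_const_mul, h0]
  simp only [C.d_g]
  rw [h1, C.ctr_g_tan hT, C.ctr_g_tan hT]; ring

lemma ctr_x_dv {T : ι → ι → R} (hT : ∀ r, C.Tan fun s => T r s) :
    (C.ctr fun s => C.x s * C.dv fun r => T r s) = -C.ctr fun r => T r r := by
  simp only [dv, ← C.ctr_const_mul]
  rw [ctr_comm, ← C.ctr_neg]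
  congr 1 with r; exact C.ctr_x_d_tan (hT r) r

/-- The divergence of a traceless tensor with the symmetries of `Bi` is tangential. -/
lemma dv_tan (hy : C.Bi y) (htr : ∀ s n, (C.ctr fun r => y r s r n) = 0) :
    (∀ m n, C.Tan fun s => C.dv fun r => y r s m n) ∧
      (∀ s n, C.Tan fun m => C.dv fun r => y r s m n) ∧
      ∀ s m, C.Tan fun n => C.dv fun r => y r s m n := by
  have h2 : ∀ s n, C.Tan fun m => C.dv fun r => y r s m n := fun s n => by
    unfold Tan; rw [C.ctr_x_dv fun r => hy.tan₃ r s n, htr, neg_zero]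
  refine ⟨fun m n => ?_, h2, fun s m => ?_⟩
  · unfold Tan; rw [C.ctr_x_dv fun r => hy.tan₂ r m n]
    rw [eq_zero_of_eq_neg R (a := C.ctr fun r => y r r m n), neg_zero]
    rw [← C.ctr_neg]; congr 1 with r; exact hy.anti₁ r r m n
  · have := (h2 s m).neg
    simpa only [← dv_neg, hy.anti₂ _ s m, neg_neg] using this

lemma ctr_dv (T : ι → ι → R) :
    (C.ctr fun m => C.dv fun r => T r m) = C.dv fun r => C.ctr fun m => T r m := by
  simp only [dv, C.d_ctr]; rw [C.ctr_comm]

/-- The transpose of the projection operator takes tangential values. -/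
lemma pt_tan (h₁ : k₁ * (C.D - 2) = 1) (h₂ : k₂ * (C.D - 1) = k₁)
    (hf : C.Tan2 f) : C.Tan2 (C.pt k₁ k₂ f) := by
  have hb := (C.bi_curl hf).wp (k₁ := k₁) (k₂ := k₂)
  have htr := (C.bi_curl hf).wp_trace h₁ h₂
  obtain ⟨ht1, ht2, ht3⟩ := C.dv_tan hb htr
  refine ⟨fun s => ?_, fun n => ?_⟩
  · unfold Tan pt
    rw [C.ctr_x_dv fun m => ht3 s m, eq_zero_of_eq_neg R (a := C.ctr _), neg_zero]
    rw [← C.ctr_neg]; congr 1 with m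
    rw [← C.dv_neg]; congr 1 with r; exact hb.anti₂ _ _ _ _
  · unfold Tan pt
    rw [C.ctr_x_dv (T := fun m s => C.dv fun r => C.wp k₁ k₂ (C.curl f) r s m n)
      fun m => ht1 m n, C.ctr_dv]
    have : ∀ r, (C.ctr fun m => C.wp k₁ k₂ (C.curl f) r m m n) = 0 := fun r => by
      rw [← neg_eq_zero, ← ctr_neg, ← htr r n]
      congr 1 with m; rw [hb.anti₁, neg_neg]
    simp only [this, dv_zero, neg_zero]

/-- The transpose of the projection operator annihilates the metric multiples. -/
lemma pt_metric (h₁ : k₁ * (C.D - 2) = 1) (h₂ : k₂ * (C.D - 1) = k₁) (φ : R)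
    (n s : ι) : C.pt k₁ k₂ (fun b d => C.g b d * φ) n s = 0 := by
  refine C.pt_eq_zero (fun r s m n => ?_) n s
  have h : C.curl (fun b d => C.g b d * φ)
      = C.pureTrace (fun g a => C.d g (C.d a φ) + C.x a * C.d g φ) := by
    funext a b g d; exact C.curl_metric_mul φ a b g d
  rw [h]
  exact C.wp_pureTrace h₁ h₂ (fun b => (C.tan_d _).add ((C.tan_d φ).const_mul _))
    (fun a => C.tan_nab (C.tan_d φ) a) r s m n

/-- The transpose of the projection operator annihilates the gradients. -/
lemma pt_grad (h₁ : k₁ * (C.D - 2) = 1) (h₂ : k₂ * (C.D - 1) = k₁) {ξ : ι → R}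
    (hξ : C.Tan ξ) (n s : ι) : C.pt k₁ k₂ (fun b d => C.d b (ξ d) + C.x d * ξ b) n s = 0 := by
  refine C.pt_eq_zero (fun r s m n => ?_) n s
  rw [C.wp_congr_neg (-1) (C.curl_grad ξ),
    C.wp_pureTrace h₁ h₂ (fun b => (C.tan_d _).add (hξ.const_mul _))
    (fun a => C.tan_nab hξ a) r s m n, mul_zero]

/-! ### Transverse traceless tensors -/

/-- Symmetric, tangential, traceless and divergence-free component families. -/
structure TT (f : ι → ι → R) : Prop where
  symm : ∀ a b, f a b = f b a
  tan : ∀ b, C.Tan fun a => f a b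
  trace : (C.ctr fun a => f a a) = 0
  div : ∀ b, (C.dv fun a => f a b) = 0

variable {C}

lemma TT.tan' (h : C.TT f) (a : ι) : C.Tan fun b => f a b := by
  simpa only [h.symm a] using h.tan a

lemma TT.div' (h : C.TT f) (a : ι) : (C.dv fun b => f a b) = 0 := by
  simpa only [h.symm a] using h.div a

lemma TT.tan2 (h : C.TT f) : C.Tan2 f := ⟨h.tan, h.tan'⟩

lemma TT.box (h : C.TT f) : C.TT fun a b => C.box (f a b) where
  symm a b := by rw [h.symm]
  tan b := by unfold Tan; rw [C.ctr_x_box (h.tan b), h.div]; ring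
  trace := by rw [← box_ctr, h.trace]; simp [Calc.box, C.dv_zero]
  div b := by rw [C.dv_box (h.tan b), h.div]; simp [Calc.box, C.dv_zero]

/-- The antisymmetrized covariant derivative of a symmetric tensor. -/
def cc (C : Calc R ι) (f : ι → ι → R) (m n s : ι) : R :=
  C.d m (f n s) - C.d n (f m s) + C.x n * f m s - C.x m * f n s

lemma TT.dv_cc₃ (h : C.TT f) (m n : ι) : (C.dv fun s => C.cc f m n s) = 0 := by
  unfold cc
  rw [dv_sub, dv_add, dv_sub, C.dv_d (h.tan' n), C.dv_d (h.tan' m), C.dv_x_mul (h.tan' m),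
    C.dv_x_mul (h.tan' n), h.div', h.div', h.symm m n]
  simp

/-- The operator `□ - (D - 2)` on components. -/
def ee (C : Calc R ι) (f : ι → ι → R) (n s : ι) : R := C.box (f n s) - (C.D - 2) * f n s

lemma TT.dv_cc₁ (h : C.TT f) (n s : ι) : (C.dv fun m => C.cc f m n s) = C.ee f n s := by
  unfold cc ee
  rw [dv_sub, dv_add, dv_sub, C.dv_d (h.tan s), C.dv_x_mul (h.tan s), dv_xself_mul, h.div]
  simp only [map_zero, Calc.box]; ring

lemma TT.ctr_cc (h : C.TT f) (m : ι) : (C.ctr fun n => C.cc f m n n) = 0 := by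
  unfold cc
  have h1 := h.div m
  have h2 : (C.ctr fun n => C.x n * f m n) = 0 := h.tan' m
  simp only [dv, h.symm _ m] at h1
  rw [ctr_sub, ctr_add, ctr_sub, ← d_ctr, h.trace, h1, ctr_const_mul, h.trace, h2]
  simp

lemma TT.cc_tan₁ (h : C.TT f) (n s : ι) : C.Tan fun m => C.cc f m n s := by
  have := ((C.tan_d (f n s)).add ((h.tan s).const_mul (C.x n))).sub (C.tan_nab (h.tan s) n)
  refine (congrArg C.Tan (funext fun c => ?_)).mp this
  unfold cc; ring

lemma TT.cc_tan₃ (h : C.TT f) (m n : ι) : C.Tan fun s => C.cc f m n s := by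
  have := ((C.tan_nab (h.tan' n) m).sub (C.tan_nab (h.tan' m) n)).add
    (((h.tan' m).const_mul (C.x n)).sub ((h.tan' n).const_mul (C.x m)))
  refine (congrArg C.Tan (funext fun s => ?_)).mp this
  unfold cc; rw [h.symm m n]; ring

lemma cc_anti (m n s : ι) : C.cc f m n s = -C.cc f n m s := by unfold cc; ring

lemma TT.cc_tan₂ (h : C.TT f) (m s : ι) : C.Tan fun n => C.cc f m n s := by
  simpa only [← cc_anti] using (h.cc_tan₁ m s).neg

lemma TT.cc_cyclic (h : C.TT f) (m n s : ι) : C.cc f s n m + C.cc f m s n = C.cc f m n s := by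
  unfold cc; rw [h.symm n m, h.symm s m, h.symm s n]; ring

lemma TT.curl_eq (h : C.TT f) (m n r s : ι) : C.curl f m n r s =
    C.d r (C.cc f m n s) - C.d s (C.cc f m n r) + C.x m * C.cc f r n s - C.x m * C.cc f s n r
      + C.x n * C.cc f m r s - C.x n * C.cc f m s r + C.x s * C.cc f m n r
      - C.x r * C.cc f m n s := by
  have h1 : ∀ m n s, C.cc f m n s = C.nab2 f m n s - C.nab2 f n m s := by
    intro m n s; unfold cc nab2; rw [h.symm n m]; ring
  simp only [h1, map_sub]
  unfold curl nab3; ring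

lemma TT.ee (h : C.TT f) : C.TT (C.ee f) where
  symm a b := by unfold Calc.ee; rw [h.symm]
  tan b := (h.box.tan b).sub ((h.tan b).const_mul _)
  trace := by
    unfold Calc.ee
    rw [ctr_sub, ctr_const_mul, h.trace, h.box.trace]; ring
  div b := by
    have h0 : C.ee f = fun n s => C.dv fun m => C.cc f m n s := by
      funext n s; exact (h.dv_cc₁ n s).symm
    rw [h0]
    rw [C.dv_dv_comm (fun r => h.cc_tan₂ r b) (fun m => h.cc_tan₁ m b)]
    have : C.dv (fun m => C.dv fun r => C.cc f r m b)
        = -C.dv fun m => C.dv fun r => C.cc f m r b := by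
      rw [← C.dv_neg]; congr 1 with m; rw [← C.dv_neg]; congr 1 with r; exact cc_anti _ _ _
    apply eq_zero_of_eq_neg R
    conv_lhs => rw [← C.dv_dv_comm (fun r => h.cc_tan₂ r b) (fun m => h.cc_tan₁ m b), this]

lemma TT.ric_curl (h : C.TT f) (m s : ι) : C.ric (C.curl f) m s = -C.ee f m s := by
  have e1 : (C.ctr fun b => C.d b (C.cc f m b s)) = -C.ee f m s := by
    rw [← h.dv_cc₁, dv, ← C.ctr_neg]; congr 1 with b; rw [cc_anti, map_neg]
  have e2 : (C.ctr fun b => C.x b * C.cc f m s b) = 0 := h.cc_tan₃ m s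
  have e3 : (C.ctr fun b => C.x b * C.cc f m b s) = 0 := h.cc_tan₂ m s
  have e4 : (C.ctr fun b => C.cc f s b b) = 0 := h.ctr_cc s
  have e5 : (C.ctr fun b => C.cc f b b s) = 0 := by
    apply eq_zero_of_eq_neg R
    rw [← C.ctr_neg]; congr 1 with b; exact cc_anti _ _ _
  have e6 := h.ctr_cc m
  unfold ric
  simp only [h.curl_eq, ctr_add, ctr_sub, ctr_const_mul, ← d_ctr, e1, e2, e3, e4, e5, e6]
  simp

lemma TT.scal_curl (h : C.TT f) : C.scal (C.curl f) = 0 := by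
  rw [(C.bi_curl h.tan2).scal_eq]
  simp only [h.ric_curl, ctr_neg, h.ee.trace, neg_zero]

lemma TT.dv_curl (h : C.TT f) (m n s : ι) : (C.dv fun r => C.curl f m n r s) =
    C.box (C.cc f m n s) + (3 - C.D) * C.cc f m n s + C.x m * C.ee f n s - C.x n * C.ee f m s := by
  have e0 : (C.dv fun r => C.d r (C.cc f m n s)) = C.box (C.cc f m n s) := rfl
  have e1 := C.dv_d (h.cc_tan₃ m n) s
  have e2 := C.dv_x_mul (h.cc_tan₁ n s) m
  have e3 := C.dv_x_mul (h.cc_tan₃ s n) m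
  have e4 := C.dv_x_mul (h.cc_tan₂ m s) n
  have e5 := C.dv_x_mul (h.cc_tan₃ m s) n
  have e6 := C.dv_x_mul (h.cc_tan₃ m n) s
  have e7 := C.dv_xself_mul (C.cc f m n s)
  have e8 : (C.dv fun r => C.cc f m r s) = -C.ee f m s := by
    rw [← h.dv_cc₁, ← C.dv_neg]; congr 1 with r; exact cc_anti _ _ _
  have e9 := h.cc_cyclic m n s
  simp only [h.curl_eq, dv_add, C.dv_sub]
  rw [e0, e1, e2, e3, e4, e5, e6, e7, e8, h.dv_cc₃, h.dv_cc₁, h.dv_cc₃, h.dv_cc₃, map_zero]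
  linear_combination -e9

lemma TT.dv_dv_curl (h : C.TT f) (n s : ι) :
    (C.dv fun m => C.dv fun r => C.curl f m n r s) = C.box (C.ee f n s) - C.D * C.ee f n s := by
  have e1 := C.dv_box (h.cc_tan₁ n s)
  have e2 : (C.dv fun m => (3 - C.D) * C.cc f m n s) = (3 - C.D) * C.ee f n s := by
    have hD : ∀ m, C.d m (3 - C.D) = 0 := fun m => by
      have : (3 : R) = ((3 : ℕ) : R) := by norm_num
      rw [map_sub, d_D, this, Derivation.map_natCast, sub_zero]
    rw [dv_const_mul, h.dv_cc₁]; simp [hD, C.ctr_zero]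
  have e3 := C.dv_xself_mul (C.ee f n s)
  have e4 := C.dv_x_mul (h.ee.tan s) n
  simp only [h.dv_curl, dv_add, C.dv_sub]
  rw [e1, e2, e3, e4, h.dv_cc₁, h.ee.div]; ring

/-- On transverse traceless tensors the transposed projection operator acts on the components
with respect to the embedding space as `□ (□ - (D - 2))`, up to a factor. -/
lemma TT.pt_eq (h₁ : k₁ * (C.D - 2) = 1) (hk : ∀ A, C.d A k₁ = 0) (h : C.TT f)
    (n s : ι) : C.pt k₁ k₂ f n s = k₁ * (C.D - 3) * C.box (C.ee f n s) := by
  have he := h.ee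
  have hD : ∀ (T : ι → R), (C.dv fun m => C.D * T m) = C.D * C.dv T := by
    intro T; rw [C.dv_const_mul]; simp [d_D, C.ctr_zero]
  have t1 : (C.dv fun m => C.dv fun r => C.ee f m r * C.g s n) = -(2 * C.ee f n s) := by
    simp only [C.dv_mul_g (he.tan' _) (he.div' _), dv_neg, C.dv_add]
    rw [C.dv_x_mul (he.tan s), C.dv_x_mul (he.tan n), he.div, he.div, he.symm s n]; ring
  have t2 : (C.dv fun m => C.dv fun r => C.ee f n r * C.g s m) = -((C.D + 1) * C.ee f n s) := by
    simp only [C.dv_mul_g (he.tan' _) (he.div' _), dv_neg, C.dv_add]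
    rw [dv_xself_mul, C.dv_x_mul (he.tan' n), he.div', he.symm n s]; ring
  have t3 : (C.dv fun m => C.dv fun r => C.ee f m s * C.g r n) = -((C.D + 1) * C.ee f n s) := by
    simp only [mul_comm _ (C.g _ n), dv_g_mul, dv_sub, mul_assoc]
    rw [C.dv_d (he.tan s), hD, C.dv_x_mul (he.tan s), he.div, map_zero]; ring
  have t4 : (C.dv fun m => C.dv fun r => C.ee f n s * C.g r m)
      = C.box (C.ee f n s) - C.D * C.D * C.ee f n s := by
    simp only [mul_comm _ (C.g _ _), dv_g_mul, dv_sub, mul_assoc]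
    rw [hD, C.dv_xself_mul]; rfl
  unfold pt wp
  simp only [h.scal_curl, h.ric_curl]
  have hc : ∀ T : ι → ι → R, (C.dv fun m => C.dv fun r => k₁ * T m r)
      = k₁ * C.dv fun m => C.dv fun r => T m r := fun T => by
    simp only [dv_const_mul, hk, mul_zero, ctr_zero, add_zero]
  simp only [mul_zero, zero_mul, add_zero, dv_add, hc, neg_mul, dv_sub, dv_neg, t1, t2, t3,
    t4, h.dv_dv_curl]
  linear_combination (-C.box (C.ee f n s) + C.D * C.ee f n s) * h₁

end Calc

end

section
variable {D : ℕ}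
variable {k : ℕ}

/-! ### From component fields to the tangential calculus -/

lemma smoothFn_sum_apply {α : Type*} (s : Finset α) (f : α → smoothFn D) (x : dS D) :
    (∑ i ∈ s, f i).1 x = ∑ i ∈ s, (f i).1 x := by
  simp

/-- Families of smooth functions with two indices. -/
abbrev Fam (D : ℕ) := Ix D → Ix D → smoothFn D

/-- The tangential calculus of de Sitter space. -/
def ds (D : ℕ) : Calc (smoothFn D) (Ix D) where
  e A := algebraMap ℂ _ (eta A : ℂ)
  x := xl
  d := dd
  D := (D : smoothFn D)
  e_sq A := by rw [← map_mul, eta_sq_complex, map_one]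
  d_e A B := Derivation.map_algebraMap _ _
  xx := by
    refine Subtype.ext (funext fun x => ?_)
    rw [smoothFn_sum_apply]
    have h := congrArg (fun r : ℝ => (r : ℂ)) x.2
    simp only [mink, ofReal_sum, ofReal_mul, ofReal_one] at h
    refine Eq.trans (sum_congr rfl fun A _ => ?_) h
    change (eta A : ℂ) * (((eta A : ℂ) * x.1 A) * ((eta A : ℂ) * x.1 A)) = _
    linear_combination (eta A : ℂ) * x.1 A * x.1 A * eta_sq_complex A
  dx A B := by
    refine Subtype.ext (funext fun x => ?_)
    have h1 : (dd A (xl B)).1 x = (eta B : ℂ) * partialD (fun z => (z.1 B : ℂ)) x A :=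
      partialD_const_mul _ _ _ _
    rw [h1, partialD_coord]
    rcases eq_or_ne A B with h | h
    · subst h
      simp only [if_true]
      change _ = (eta A : ℂ) - ((eta A : ℂ) * x.1 A) * ((eta A : ℂ) * x.1 A)
      ring
    · simp only [h, if_false]
      change _ = 0 - ((eta A : ℂ) * x.1 A) * ((eta B : ℂ) * x.1 B)
      ring
  xd f := by
    refine Subtype.ext (funext fun x => ?_)
    rw [smoothFn_sum_apply]
    refine Eq.trans (sum_congr rfl fun A _ => ?_) (sum_mul_partialD f.2 x)
    change (eta A : ℂ) * (((eta A : ℂ) * x.1 A) * partialD f.1 x A) = _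
    linear_combination x.1 A * partialD f.1 x A * eta_sq_complex A
  comm A B f := by
    refine Subtype.ext (funext fun x => ?_)
    have := partialD_comm f.2 x A B
    change partialD (fun z => partialD f.1 z B) x A = partialD (fun z => partialD f.1 z A) x B
      + (((eta A : ℂ) * x.1 A) * partialD f.1 x B - ((eta B : ℂ) * x.1 B) * partialD f.1 x A)
    rw [← this]; ring
  card := by simp

lemma g_apply (x : dS D) (A B : Ix D) : ((ds D).g A B).1 x = (metric x A B : ℂ) := by
  have h : ((ds D).g A B).1 x
      = (if A = B then (eta A : ℂ) else 0) - ((eta A : ℂ) * x.1 A) * ((eta B : ℂ) * x.1 B) := by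
    rcases eq_or_ne A B with h | h
    · simp only [Calc.g, h, if_true]; rfl
    · simp only [Calc.g, h, if_false]; rfl
  rw [h, metric, proj]
  rcases eq_or_ne A B with h | h
  · subst h; simp; ring
  · simp [h]; ring

lemma ctr_apply (F : Ix D → smoothFn D) (x : dS D) :
    ((ds D).ctr F).1 x = ∑ A, (eta A : ℂ) * (F A).1 x := by
  rw [Calc.ctr, smoothFn_sum_apply]; rfl

lemma dv_apply (F : Ix D → smoothFn D) (x : dS D) :
    ((ds D).dv F).1 x = ∑ A, (eta A : ℂ) * partialD (F A).1 x A := ctr_apply _ _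

lemma tan_iff (T : Ix D → smoothFn D) :
    (ds D).Tan T ↔ ∀ x : dS D, ∑ A, (x.1 A : ℂ) * (T A).1 x = 0 := by
  have h : ∀ x, ((ds D).ctr fun A => (ds D).x A * T A).1 x = ∑ A, (x.1 A : ℂ) * (T A).1 x := fun x => by
    rw [ctr_apply]
    congr 1 with A
    change (eta A : ℂ) * (((eta A : ℂ) * x.1 A) * (T A).1 x) = _
    linear_combination x.1 A * (T A).1 x * eta_sq_complex A
  refine ⟨fun hT x => ?_, fun hT => Subtype.ext (funext fun x => ?_)⟩
  · rw [← h, show ((ds D).ctr fun A => (ds D).x A * T A) = 0 from hT]; rfl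
  · rw [h, hT]; rfl

lemma sum_cons {ι E : Type*} [Fintype ι] [AddCommMonoid E]
    (F : (Fin (k + 1) → ι) → E) : ∑ J, F J = ∑ A, ∑ J' : Fin k → ι, F (Fin.cons A J') := by
  rw [← (Fin.consEquiv fun _ => ι).sum_comp, Fintype.sum_prod_type]; rfl

/-- The tangential projection, in all indices, of an array of components. -/
def projSum (x : dS D) (S : (Fin k → Ix D) → ℂ) (I : Fin k → Ix D) : ℂ :=
  ∑ J : Fin k → Ix D, (∏ i, (proj x (I i) (J i) : ℂ)) * S J

lemma sum_proj_mul (x : dS D) (A : Ix D) (T : Ix D → ℂ) :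
    ∑ B, (proj x A B : ℂ) * T B = T A - eta A * x.1 A * ∑ B, (x.1 B : ℂ) * T B := by
  simp only [proj, ofReal_sub, ofReal_mul, sub_mul, sum_sub_distrib, mul_sum]
  congr 1
  · rw [sum_eq_single A] <;> simp +contextual [eq_comm]
  · congr 1 with _; ring

lemma projSum_succ (x : dS D) (S : (Fin (k + 1) → Ix D) → ℂ) (I : Fin (k + 1) → Ix D) :
    projSum x S I = ∑ A, (proj x (I 0) A : ℂ) * projSum x (fun J => S (Fin.cons A J)) (Fin.tail I) := by
  simp only [projSum, sum_cons, Fin.prod_univ_succ, Fin.cons_zero, Fin.cons_succ, mul_sum,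
    mul_assoc, Fin.tail]

lemma projSum_add (x : dS D) (S T : (Fin k → Ix D) → ℂ) (I) :
    projSum x (fun J => S J + T J) I = projSum x S I + projSum x T I := by
  simp only [projSum, mul_add, sum_add_distrib]

lemma projSum_of_tan (x : dS D) (S : (Fin k → Ix D) → ℂ)
    (hS : ∀ I i, ∑ A, (x.1 A : ℂ) * S (Function.update I i A) = 0) (I) : projSum x S I = S I := by
  induction k with
  | zero => simp [projSum, Subsingleton.elim _ I]
  | succ k ih =>
    rw [projSum_succ]
    have h1 : ∀ A, projSum x (fun J => S (Fin.cons A J)) (Fin.tail I)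
        = S (Fin.cons A (Fin.tail I)) := fun A => by
      refine ih _ (fun I' i => ?_) _
      have := hS (Fin.cons A I') i.succ
      simpa only [← Fin.cons_update] using this
    simp only [h1]
    rw [sum_proj_mul, Fin.cons_self_tail]
    have := hS I 0
    rw [← Fin.cons_self_tail I] at this
    simp only [Fin.update_cons_zero] at this
    rw [this]; ring

lemma projSum_normal (x : dS D) (i : Fin k) (N : (Fin k → Ix D) → ℂ)
    (hN : ∀ J a, N (Function.update J i a) = N J) (I) :
    projSum x (fun J => (eta (J i) * x.1 (J i) : ℂ) * N J) I = 0 := by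
  have hx : ∀ A, ∑ B, (proj x A B : ℂ) * (eta B * x.1 B) = 0 := fun A => by
    have h := congrArg (fun r : ℝ => (r : ℂ)) x.2
    simp only [mink, ofReal_sum, ofReal_mul, ofReal_one] at h
    rw [sum_proj_mul]
    have : ∑ B, (x.1 B : ℂ) * (eta B * x.1 B) = 1 := by
      rw [← h]; congr 1 with _; ring
    rw [this]; ring
  induction k with
  | zero => exact i.elim0
  | succ k ih =>
    rw [projSum_succ]
    induction i using Fin.cases with
    | zero =>
      have h1 : ∀ A J', N (Fin.cons A J') = N (Fin.cons 0 J') := fun A J' => by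
        have := hN (Fin.cons 0 J') A
        rwa [Fin.update_cons_zero] at this
      simp only [Fin.cons_zero, h1]
      have h2 : ∀ A, projSum x (fun J' => (eta A * x.1 A : ℂ) * N (Fin.cons 0 J')) (Fin.tail I)
          = (eta A * x.1 A : ℂ) * projSum x (fun J' => N (Fin.cons 0 J')) (Fin.tail I) := fun A => by
        simp only [projSum, mul_sum]
        congr 1 with _; ring
      simp only [h2, ← mul_assoc, ← sum_mul]
      simp only [mul_assoc, hx]
      exact zero_mul _
    | succ j =>
      refine sum_eq_zero fun A _ => ?_
      simp only [Fin.cons_succ]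
      rw [ih j (fun J' => N (Fin.cons A J')) (fun J a => ?_), mul_zero]
      have := hN (Fin.cons A J) a
      rwa [← Fin.cons_update] at this

/-- The component field of an array of smooth functions. -/
def ev (t : (Fin k → Ix D) → smoothFn D) : TField D k := fun x J => (t J).1 x

lemma sum_eta_proj_proj (x : dS D) (B E : Ix D) :
    ∑ A, (eta A : ℂ) * ((proj x A B : ℂ) * (proj x A E : ℂ))
      = (if B = E then (eta B : ℂ) else 0) - x.1 B * x.1 E := by
  have h := congrArg (fun r : ℝ => (r : ℂ)) x.2
  simp only [mink, ofReal_sum, ofReal_mul, ofReal_one] at h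
  have e : ∀ A, (eta A : ℂ) * ((proj x A B : ℂ) * (proj x A E : ℂ))
      = (if A = B then 1 else 0) * ((if A = E then 1 else 0) * eta A - (x.1 A : ℂ) * x.1 E)
        - (if A = E then 1 else 0) * ((x.1 A : ℂ) * x.1 B)
        + (eta A * x.1 A * x.1 A) * (x.1 B * x.1 E) := fun A => by
    have h2 := eta_sq_complex A
    have h3 : ∀ B, (proj x A B : ℂ) = (if A = B then 1 else 0) - eta A * x.1 A * x.1 B := by
      intro B; rw [proj]; split_ifs <;> push_cast <;> rfl
    rw [h3, h3]
    linear_combination (eta A * x.1 A * x.1 A * x.1 B * x.1 E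
      - (if A = B then 1 else 0) * ((x.1 A : ℂ) * x.1 E)
      - (if A = E then 1 else 0) * ((x.1 A : ℂ) * x.1 B)) * h2
  simp only [e, sum_add_distrib, sum_sub_distrib, ← sum_mul, h]
  simp
  ring

lemma divergence_eq (T : TField D (k + 1)) (hT : ∀ J, Sm fun x => T x J) (x : dS D)
    (I : Fin k → Ix D) : divergence T x I
      = projSum x (fun J => ∑ B, (eta B : ℂ) * partialD (fun z => T z (Fin.cons B J)) x B) I := by
  have h1 : ∀ (J : Fin k → Ix D),
      ∑ B, ∑ E, (∑ A, (eta A : ℂ) * ((proj x A B : ℂ) * (proj x A E : ℂ)))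
        * partialD (fun z => T z (Fin.cons E J)) x B
      = ∑ B, (eta B : ℂ) * partialD (fun z => T z (Fin.cons B J)) x B := fun J => by
    simp only [sum_eta_proj_proj, sub_mul, sum_sub_distrib, ite_mul, zero_mul,
      Finset.sum_ite_eq, Finset.mem_univ, if_true]
    rw [sub_eq_self, sum_comm]
    refine sum_eq_zero fun E _ => ?_
    rw [← mul_zero (x.1 E : ℂ), ← sum_mul_partialD (hT (Fin.cons E J)) x, mul_sum]
    congr 1 with _; ring
  simp only [projSum, ← h1]
  simp only [divergence, cov, sum_cons, Fin.prod_univ_succ, Fin.cons_zero, Fin.cons_succ,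
    Fin.tail_cons, mul_sum, sum_mul]
  rw [sum_comm]
  conv_lhs => enter [2, B]; rw [sum_comm]
  conv_lhs => enter [2, B, 2, E]; rw [sum_comm]
  conv_rhs => rw [sum_comm]
  congr 1 with B
  rw [sum_comm]
  refine sum_congr rfl fun J _ => sum_congr rfl fun E _ =>
    sum_congr rfl fun A _ => ?_
  ring

end

section
variable {D : ℕ}
variable {k k' l : ℕ}

/-! ### The transpose of the projection operator on product test fields -/

/-- The transpose of `applyL`, on fields at the first point. -/
def applyField (M : dS D → (Fin k' → Ix D) → (Fin k → Ix D) → ℝ)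
    (f : TField D k') : TField D k := fun x I =>
  ∑ I' : Fin k' → Ix D, (M x I' I : ℂ) * (∏ i, (eta (I' i) : ℂ)) * f x I'

lemma applyL_outer (M : dS D → (Fin k' → Ix D) → (Fin k → Ix D) → ℝ)
    (W : BDist D k l) (f : TField D k') (p : TField D l) :
    applyL M W (outer f p) = W (outer (applyField M f) p) := by
  unfold applyL
  congr 1; funext x y I J
  simp only [outer, applyField, sum_mul, mul_assoc]

lemma divergence_mul_const (f : TField D (k + 1)) (c : ℂ) :
    divergence (fun z I => f z I * c) = fun z I => divergence f z I * c := by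
  funext x I
  have h : ∀ (J : Fin (k + 1) → Ix D) A, partialD (fun z => f z J * c) x A
      = c * partialD (fun z => f z J) x A := fun J A => by
    rw [← partialD_const_mul]; congr 1 with z; ring
  simp only [divergence, cov, h, sum_mul, mul_sum]
  exact sum_congr rfl fun _ _ => sum_congr rfl fun _ _ => by ring

lemma divL_outer (f : TField D (k + 1)) (p : TField D l) :
    divL (outer f p) = outer (divergence f) p := by
  funext x y I J
  simp only [divL, outer, divergence_mul_const]

lemma nablaL_outer (W : BDist D k l) (f : TField D (k + 1)) (p : TField D l) :
    nablaL W (outer f p) = -W (outer (divergence f) p) := by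
  rw [nablaL, divL_outer]

lemma outer_zero (f : TField D k) : outer f (0 : TField D l) = 0 := by
  funext x y I J; simp [outer]

lemma zero_outer (p : TField D l) : outer (0 : TField D k) p = 0 := by
  funext x y I J; simp [outer]

/-- Arrays of functions whose tangential projection vanishes. -/
def Negl (S : (Fin k → Ix D) → smoothFn D) : Prop :=
  ∀ x I, projSum x (fun J => (S J).1 x) I = 0

lemma Negl.add {S T : (Fin k → Ix D) → smoothFn D} (hS : Negl S) (hT : Negl T) :
    Negl fun J => S J + T J := fun x I => by
  have := projSum_add x (fun J => (S J).1 x) (fun J => (T J).1 x) I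
  rw [hS, hT, add_zero] at this
  exact this

lemma Negl.of_slot (i : Fin k) (N : (Fin k → Ix D) → smoothFn D)
    (hN : ∀ J a, N (Function.update J i a) = N J) :
    Negl fun J => (ds D).x (J i) * N J := fun x I =>
  projSum_normal x i (fun J => (N J).1 x) (fun J a => by rw [hN]) I

/-- The covariant divergence, computed from the flat divergence up to normal components. -/
lemma divergence_ev (t : (Fin (k + 1) → Ix D) → smoothFn D) (u S : (Fin k → Ix D) → smoothFn D)
    (h : ∀ J, ((ds D).dv fun B => t (Fin.cons B J)) = u J + S J) (hS : Negl S)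
    (hu : ∀ I i, (ds D).Tan fun A => u (Function.update I i A)) :
    divergence (ev t) = ev u := by
  funext x I
  rw [divergence_eq (ev t) (fun J => (t J).2)]
  have e : ∀ J, ∑ B, (eta B : ℂ) * partialD (fun z => ev t z (Fin.cons B J)) x B
      = (u J).1 x + (S J).1 x := fun J => by
    rw [show (u J).1 x + (S J).1 x = (u J + S J).1 x from rfl, ← h, dv_apply]; rfl
  simp only [e]
  rw [projSum_add, hS x I, add_zero]
  exact projSum_of_tan x _ (fun I i => (tan_iff _).1 (hu I i) x) I

lemma divergence_ev_of_tan (t : (Fin (k + 1) → Ix D) → smoothFn D) (u : (Fin k → Ix D) → smoothFn D)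
    (h : ∀ J, ((ds D).dv fun B => t (Fin.cons B J)) = u J)
    (hu : ∀ I i, (ds D).Tan fun A => u (Function.update I i A)) :
    divergence (ev t) = ev u := by
  refine divergence_ev t u (fun _ => 0) (fun J => by rw [h, add_zero]) (fun x I => ?_) hu
  simp [projSum]

/-- The constant `1/(D-2)`. -/
def k1 (D : ℕ) : smoothFn D := algebraMap ℂ _ (1 / ((D : ℂ) - 2))

/-- The constant `1/((D-1)(D-2))`. -/
def k2 (D : ℕ) : smoothFn D := algebraMap ℂ _ (1 / (((D : ℂ) - 2) * ((D : ℂ) - 1)))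

lemma ds_D : (ds D).D = algebraMap ℂ (smoothFn D) (D : ℂ) := by
  rw [map_natCast]; rfl

lemma k1_mul (hD : 4 ≤ D) : k1 D * ((ds D).D - 2) = 1 := by
  have h : (D : ℂ) - 2 ≠ 0 := by
    rw [sub_ne_zero]; norm_cast; omega
  rw [ds_D, k1, ← map_ofNat (algebraMap ℂ (smoothFn D)) 2, ← map_sub, ← map_mul,
    one_div_mul_cancel h, map_one]

lemma k2_mul (hD : 4 ≤ D) : k2 D * ((ds D).D - 1) = k1 D := by
  have h : (D : ℂ) - 1 ≠ 0 := by
    rw [sub_ne_zero]; norm_cast; omega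
  rw [ds_D, k2, ← map_one (algebraMap ℂ (smoothFn D)), ← map_sub, ← map_mul, k1]
  congr 1; field_simp

/-- The tensor `Υ` as an array of smooth functions. -/
def ups (a b c d r s m n : Ix D) : smoothFn D :=
  let g := (ds D).g
  (-2) * (g a m * g b n * g r c * g s d + 4 * k1 D * (g a m * g b c * g r d * g s n)
    + 2 * k2 D * (g a c * g b d * g r m * g s n))

/-- `Υ`, antisymmetrized in the last two pairs of indices, up to a factor. -/
def upsR (a b c d r s m n : Ix D) : smoothFn D :=
  ups a b c d r s m n - ups a b c d r s n m - ups a b c d s r m n + ups a b c d s r n m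

lemma ups_apply (x : dS D) (a b c d r s m n : Ix D) :
    (ups a b c d r s m n).1 x = (upsilon x a b c d r s m n : ℂ) := by
  have h : (ups a b c d r s m n).1 x = (-2) * (((ds D).g a m).1 x * ((ds D).g b n).1 x
      * ((ds D).g r c).1 x * ((ds D).g s d).1 x
      + 4 * (1 / ((D : ℂ) - 2)) * (((ds D).g a m).1 x * ((ds D).g b c).1 x
      * ((ds D).g r d).1 x * ((ds D).g s n).1 x)
      + 2 * (1 / (((D : ℂ) - 2) * ((D : ℂ) - 1))) * (((ds D).g a c).1 x * ((ds D).g b d).1 x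
      * ((ds D).g r m).1 x * ((ds D).g s n).1 x)) := rfl
  rw [h]
  simp only [g_apply, upsilon]
  push_cast
  ring

lemma upsilonAlt_eq (x : dS D) (a b c d r s m n : Ix D) :
    (upsilonAlt x a b c d r s m n : ℂ) = (1 / 16) * (upsR a b c d r s m n
      - upsR a b d c r s m n - upsR b a c d r s m n + upsR b a d c r s m n).1 x := by
  have h : ∀ a b c d, (upsR a b c d r s m n).1 x = (ups a b c d r s m n).1 x
      - (ups a b c d r s n m).1 x - (ups a b c d s r m n).1 x + (ups a b c d s r n m).1 x :=
    fun _ _ _ _ => rfl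
  have h2 : (upsR a b c d r s m n - upsR a b d c r s m n - upsR b a c d r s m n
      + upsR b a d c r s m n).1 x = (upsR a b c d r s m n).1 x - (upsR a b d c r s m n).1 x
      - (upsR b a c d r s m n).1 x + (upsR b a d c r s m n).1 x := rfl
  rw [h2]
  simp only [h, ups_apply, upsilonAlt, alt]
  push_cast
  ring

/-- Tangentiality in all four indices. -/
def Tan4 (Y : Ix D → Ix D → Fam D) : Prop :=
  (∀ b c d, (ds D).Tan fun a => Y a b c d) ∧ (∀ a c d, (ds D).Tan fun b => Y a b c d) ∧
  (∀ a b d, (ds D).Tan fun c => Y a b c d) ∧ ∀ a b c, (ds D).Tan fun d => Y a b c d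

/-- The fourfold contraction. -/
def ctr4 (Y : Ix D → Ix D → Fam D) : smoothFn D :=
  (ds D).ctr fun a => (ds D).ctr fun b => (ds D).ctr fun c => (ds D).ctr fun d =>
    Y a b c d

lemma ctr4_ups {Y : Ix D → Ix D → Fam D} (hY : Tan4 Y) (r s m n : Ix D) :
    ctr4 (fun a b c d => ups a b c d r s m n * Y a b c d)
      = (-2) * (Y m n r s + 4 * k1 D * ((ds D).ric Y m r * (ds D).g s n)
        + 2 * k2 D * ((ds D).scal Y * ((ds D).g r m * (ds D).g s n))) := by
  obtain ⟨h1, h2, h3, h4⟩ := hY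
  set C := ds D with hC
  have t4 : ∀ a b c s, (C.ctr fun d => C.g s d * Y a b c d) = Y a b c s :=
    fun a b c s => C.ctr_g_tan' (h4 a b c) s
  have t3 : ∀ a b d r, (C.ctr fun c => C.g r c * Y a b c d) = Y a b r d :=
    fun a b d r => C.ctr_g_tan' (h3 a b d) r
  have t2 : ∀ a c d n, (C.ctr fun b => C.g b n * Y a b c d) = Y a n c d :=
    fun a c d n => C.ctr_g_tan (h2 a c d) n
  have t1 : ∀ b c d m, (C.ctr fun a => C.g a m * Y a b c d) = Y m b c d :=
    fun b c d m => C.ctr_g_tan (h1 b c d) m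
  have t5 : ∀ m r, (C.ctr fun a => C.g a m * C.ctr fun b => Y a b b r) = C.ctr fun b => Y m b b r :=
    fun m r => C.ctr_g_tan (T := fun a => C.ctr fun b => Y a b b r)
      (Calc.Tan.ctr fun b => h1 b b r) m
  have e : ∀ a b c d, ups a b c d r s m n * Y a b c d
      = (-2) * (C.g a m * (C.g b n * (C.g r c * (C.g s d * Y a b c d)))
        + (4 * k1 D * C.g s n) * (C.g a m * (C.g b c * (C.g r d * Y a b c d)))
        + (2 * k2 D * C.g r m * C.g s n) * (C.g a c * (C.g b d * Y a b c d))) := by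
    intro a b c d; simp only [ups, ← hC]; ring
  unfold ctr4 Calc.ric Calc.scal
  simp only [e, C.ctr_add, C.ctr_const_mul, t4, t3, t2, t1, t5, ← hC]
  ring

lemma ctr4_add (Y Z : Ix D → Ix D → Fam D) :
    ctr4 (fun a b c d => Y a b c d + Z a b c d) = ctr4 Y + ctr4 Z := by
  simp only [ctr4, Calc.ctr_add]

lemma ctr4_sub (Y Z : Ix D → Ix D → Fam D) :
    ctr4 (fun a b c d => Y a b c d - Z a b c d) = ctr4 Y - ctr4 Z := by
  simp only [ctr4, Calc.ctr_sub]

lemma ctr4_swap₁ (Y : Ix D → Ix D → Fam D) :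
    ctr4 (fun a b c d => Y b a c d) = ctr4 Y := by
  unfold ctr4; rw [Calc.ctr_comm]

lemma ctr4_swap₃ (Y : Ix D → Ix D → Fam D) :
    ctr4 (fun a b c d => Y a b d c) = ctr4 Y := by
  unfold ctr4
  congr 1; funext a; congr 1 with b
  rw [Calc.ctr_comm]

lemma ctr4_upsilonAlt {y : Ix D → Ix D → Fam D}
    (hy : Tan4 fun a b c d => y a b c d - y b a c d - y a b d c + y b a d c)
    (r s m n : Ix D) :
    ctr4 (fun a b c d => (upsR a b c d r s m n - upsR a b d c r s m n - upsR b a c d r s m n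
      + upsR b a d c r s m n) * y a b c d)
      = (-8) * (ds D).wp (k1 D) (k2 D)
        (fun a b c d => y a b c d - y b a c d - y a b d c + y b a d c) r s m n := by
  set Y := fun a b c d => y a b c d - y b a c d - y a b d c + y b a d c with hYd
  have e1 : ctr4 (fun a b c d => (upsR a b c d r s m n - upsR a b d c r s m n
      - upsR b a c d r s m n + upsR b a d c r s m n) * y a b c d)
      = ctr4 (fun a b c d => upsR a b c d r s m n * Y a b c d) := by
    have f1 := ctr4_swap₁ (fun a b c d => upsR a b c d r s m n * y b a c d)
    have f2 := ctr4_swap₃ (fun a b c d => upsR a b c d r s m n * y a b d c)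
    have f3 := ctr4_swap₃ (fun a b c d => upsR b a c d r s m n * y a b d c)
    have f4 := ctr4_swap₁ (fun a b c d => upsR a b c d r s m n * y b a d c)
    simp only [hYd, sub_mul, add_mul, mul_sub, mul_add, ctr4_add, ctr4_sub] at f1 f2 f3 f4 ⊢
    rw [f1, f2, f3, f4]; ring
  rw [e1]
  have e2 : ∀ a b c d, upsR a b c d r s m n * Y a b c d = ups a b c d r s m n * Y a b c d
      - ups a b c d r s n m * Y a b c d - ups a b c d s r m n * Y a b c d
      + ups a b c d s r n m * Y a b c d := by
    intro a b c d; rw [upsR]; ring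
  simp only [e2, ctr4_add, ctr4_sub, ctr4_ups hy]
  have a1 : Y m n s r = -Y m n r s := by simp only [hYd]; ring
  have a2 : Y n m r s = -Y m n r s := by simp only [hYd]; ring
  have a3 : Y n m s r = Y m n r s := by simp only [hYd]; ring
  rw [a1, a2, a3, Calc.wp, Calc.g_symm _ r n, Calc.g_symm _ n r]
  ring

end

section
variable {D : ℕ}
variable {l : ℕ}

lemma mul_val (u v : smoothFn D) (x : dS D) : (u * v).1 x = u.1 x * v.1 x := rfl

lemma ctr2_apply (F : Fam D) (x : dS D) :
    ((ds D).ctr fun a => (ds D).ctr fun b => F a b).1 x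
      = ∑ a, (eta a : ℂ) * ∑ b, (eta b : ℂ) * (F a b).1 x := by
  simp only [ctr_apply]

lemma ctr4_apply (F : Ix D → Ix D → Fam D)
    (x : dS D) : (ctr4 F).1 x = ∑ a, (eta a : ℂ) * ∑ b, (eta b : ℂ) * ∑ c, (eta c : ℂ)
      * ∑ d, (eta d : ℂ) * (F a b c d).1 x := by
  simp only [ctr4, ctr_apply]

lemma sum_fin_two (F : (Fin 2 → Ix D) → ℂ) : ∑ I, F I = ∑ a, ∑ b, F ![a, b] := by
  simp only [sum_cons, univ_unique, sum_singleton]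
  refine sum_congr rfl fun a _ => sum_congr rfl fun b _ => ?_
  congr 1

lemma sum_fin_four (F : (Fin 4 → Ix D) → ℂ) : ∑ I, F I = ∑ a, ∑ b, ∑ c, ∑ d, F ![a, b, c, d] := by
  simp only [sum_cons, univ_unique, sum_singleton]
  refine sum_congr rfl fun a _ => sum_congr rfl fun b _ =>
    sum_congr rfl fun c _ => sum_congr rfl fun d _ => ?_
  congr 1

section
variable (F : Fam D)

/-- The field of components of a matrix of smooth functions. -/
def ev2 : TField D 2 := ev fun J => F (J 0) (J 1)

lemma apply_phi (hF : (ds D).Tan2 F) : applyField (fun x I' (I : Fin 6 → Ix D) =>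
      metric x (I 0) (I 2) * metric x (I 1) (I 4) * metric x (I' 0) (I 3) * metric x (I' 1) (I 5))
      (ev2 F) = ev fun J => (ds D).g (J 0) (J 2) * ((ds D).g (J 1) (J 4) * F (J 3) (J 5)) := by
  funext x I
  have h1 : ((ds D).ctr fun a => (ds D).ctr fun b =>
      (ds D).g a (I 3) * ((ds D).g b (I 5) * F a b)) = F (I 3) (I 5) := by
    simp only [Calc.ctr_const_mul, Calc.ctr_g_tan _ (hF.2 _)]
    exact Calc.ctr_g_tan _ (hF.1 _) _
  have h2 : (ev fun J => (ds D).g (J 0) (J 2) * ((ds D).g (J 1) (J 4) * F (J 3) (J 5))) x I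
    = ((ds D).g (I 0) (I 2)).1 x * (((ds D).g (I 1) (I 4)).1 x * (F (I 3) (I 5)).1 x) := rfl
  rw [h2, ← h1, ctr2_apply, applyField, sum_fin_two]
  simp only [Fin.prod_univ_two, g_apply, mul_sum]
  refine sum_congr rfl fun a _ => sum_congr rfl fun b _ => ?_
  have : ((ds D).g a (I 3) * ((ds D).g b (I 5) * F a b)).1 x
    = ((ds D).g a (I 3)).1 x * (((ds D).g b (I 5)).1 x * (F a b).1 x) := rfl
  rw [this, g_apply, g_apply]
  simp only [Matrix.cons_val_zero, Matrix.cons_val_one, ev2, ev]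
  push_cast; ring

lemma div_phi (hF : (ds D).Tan2 F) : divergence (ev fun J : Fin 6 → Ix D =>
      (ds D).g (J 0) (J 2) * ((ds D).g (J 1) (J 4) * F (J 3) (J 5)))
    = ev fun J : Fin 5 → Ix D =>
      (ds D).g (J 0) (J 3) * (ds D).nab2 F (J 1) (J 2) (J 4) := by
  set C := ds D with hC
  refine divergence_ev _ _ (fun J =>
    C.x (J 3) * (-(C.g (J 1) (J 0) * F (J 2) (J 4))) +
    C.x (J 0) * (-(C.g (J 1) (J 3) * F (J 2) (J 4))) +
    C.x (J 2) * (-(C.g (J 0) (J 3) * F (J 1) (J 4))) +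
    C.x (J 4) * (-(C.g (J 0) (J 3) * F (J 2) (J 1))) +
    C.x (J 1) * (-(C.D * (C.g (J 0) (J 3) * F (J 2) (J 4))))) (fun J => ?_) ?_ (fun I i => ?_)
  · have := C.dv_g_mul (C.g (J 0) (J 3) * F (J 2) (J 4)) (J 1)
    exact this.trans (by rw [C.d_mul, C.d_g, Calc.nab2]; ring)
  · refine ((((Negl.of_slot 3 _ ?_).add (Negl.of_slot 0 _ ?_)).add (Negl.of_slot 2 _ ?_)).add
      (Negl.of_slot 4 _ ?_)).add (Negl.of_slot 1 _ ?_) <;> intro J a <;> simp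
  · fin_cases i <;> simp
    · exact (C.tan_g _).mul _
    · exact (C.nab2_tan₁ hF _ _).const_mul _
    · exact (C.nab2_tan₂ hF _ _).const_mul _
    · exact (C.tan_g' _).mul _
    · exact (C.nab2_tan₃ hF _ _).const_mul _

lemma div_div_phi (hF : (ds D).Tan2 F) : divergence (ev fun J : Fin 5 → Ix D =>
      (ds D).g (J 0) (J 3) * (ds D).nab2 F (J 1) (J 2) (J 4))
    = ev fun J : Fin 4 → Ix D => (ds D).nab3 ((ds D).nab2 F) (J 2) (J 0) (J 1) (J 3) := by
  set C := ds D with hC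
  have n1 := C.nab2_tan₁ hF
  have n2 := C.nab2_tan₂ hF
  have n3 := C.nab2_tan₃ hF
  refine divergence_ev _ _ (fun J =>
    C.x (J 0) * (-(C.nab2 F (J 2) (J 1) (J 3))) +
    C.x (J 1) * (-(C.nab2 F (J 0) (J 2) (J 3))) +
    C.x (J 3) * (-(C.nab2 F (J 0) (J 1) (J 2))) +
    C.x (J 2) * (-(C.D * (C.nab2 F (J 0) (J 1) (J 3))))) (fun J => ?_) ?_ (fun I i => ?_)
  · have := C.dv_g_mul (C.nab2 F (J 0) (J 1) (J 3)) (J 2)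
    exact this.trans (by rw [Calc.nab3]; ring)
  · refine (((Negl.of_slot 0 _ ?_).add (Negl.of_slot 1 _ ?_)).add (Negl.of_slot 3 _ ?_)).add
      (Negl.of_slot 2 _ ?_) <;> intro J a <;> simp
  · fin_cases i <;> simp
    · exact C.nab3_tan₂ n1 _ _ _
    · exact C.nab3_tan₃ n2 _ _ _
    · exact C.nab3_tan₁ n1 n2 n3 _ _ _
    · exact C.nab3_tan₄ n3 _ _ _

lemma apply_upsilon (hF : (ds D).Tan2 F) : applyField (fun x I' (I : Fin 4 → Ix D) =>
      upsilonAlt x (I' 0) (I' 1) (I' 2) (I' 3) (I 0) (I 3) (I 1) (I 2))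
      (ev fun J : Fin 4 → Ix D =>
        (ds D).nab3 ((ds D).nab2 F) (J 2) (J 0) (J 1) (J 3))
    = ev fun J : Fin 4 → Ix D => (-(1 / 2) : ℂ) •
      (ds D).wp (k1 D) (k2 D) ((ds D).curl F) (J 0) (J 3) (J 1) (J 2) := by
  funext x I
  set C := ds D with hC
  have hb := C.bi_curl hF
  have hc : C.curl F = fun a b c d => C.nab3 (C.nab2 F) c a b d - C.nab3 (C.nab2 F) c b a d
      - C.nab3 (C.nab2 F) d a b c + C.nab3 (C.nab2 F) d b a c := rfl
  have h := ctr4_upsilonAlt (y := fun a b c d => C.nab3 (C.nab2 F) c a b d)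
    ⟨hb.tan₁, hb.tan₂, hb.tan₃, hb.tan₄⟩ (I 0) (I 3) (I 1) (I 2)
  rw [← hC, ← hc] at h
  have h' := congrArg (fun f : smoothFn D => f.1 x) h
  simp only [ctr4_apply] at h'
  have e : (ev (fun J => (-(1 / 2) : ℂ) • C.wp (k1 D) (k2 D) (C.curl F) (J 0) (J 3) (J 1) (J 2))) x I
      = (1 / 16) * ((-8 : smoothFn D) * C.wp (k1 D) (k2 D) (C.curl F) (I 0) (I 3) (I 1) (I 2)).1 x := by
    change -(1 / 2) * (C.wp (k1 D) (k2 D) (C.curl F) (I 0) (I 3) (I 1) (I 2)).1 x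
      = (1 / 16) * ((-8) * (C.wp (k1 D) (k2 D) (C.curl F) (I 0) (I 3) (I 1) (I 2)).1 x)
    ring
  rw [e, ← h', applyField, sum_fin_four]
  simp only [Fin.prod_univ_four, mul_sum]
  refine sum_congr rfl fun a _ => sum_congr rfl fun b _ =>
    sum_congr rfl fun c _ => sum_congr rfl fun d _ => ?_
  simp only [Matrix.cons_val_zero, Matrix.cons_val_one, Matrix.cons_val, upsilonAlt_eq, ev]
  rw [mul_val]
  ring

variable {F}

lemma div_upsilon (hD : 4 ≤ D) (hF : (ds D).Tan2 F) :
    divergence (ev fun J : Fin 4 → Ix D => (-(1 / 2) : ℂ) •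
      (ds D).wp (k1 D) (k2 D) ((ds D).curl F) (J 0) (J 3) (J 1) (J 2))
    = ev fun J : Fin 3 → Ix D => (-(1 / 2) : ℂ) • (ds D).dv fun r =>
      (ds D).wp (k1 D) (k2 D) ((ds D).curl F) r (J 2) (J 0) (J 1) := by
  have hb := ((ds D).bi_curl hF).wp (k₁ := k1 D) (k₂ := k2 D)
  have htr := ((ds D).bi_curl hF).wp_trace (k1_mul hD) (k2_mul hD)
  obtain ⟨t1, t2, t3⟩ := (ds D).dv_tan hb htr
  generalize (ds D).wp (k1 D) (k2 D) ((ds D).curl F) = W at t1 t2 t3 ⊢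
  refine divergence_ev_of_tan _ _ (fun J => (ds D).dv_smul _ _) fun I i => ?_
  fin_cases i
  exacts [(t2 _ _).smul _, (t3 _ _).smul _, (t1 _ _).smul _]

lemma div_div_upsilon (hD : 4 ≤ D) (hF : (ds D).Tan2 F) :
    divergence (ev fun J : Fin 3 → Ix D => (-(1 / 2) : ℂ) • (ds D).dv fun r =>
      (ds D).wp (k1 D) (k2 D) ((ds D).curl F) r (J 2) (J 0) (J 1))
    = ev2 fun n s => (-(1 / 2) : ℂ) • (ds D).pt (k1 D) (k2 D) F n s := by
  obtain ⟨t1, t2⟩ := (ds D).pt_tan (k1_mul hD) (k2_mul hD) hF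
  refine divergence_ev_of_tan _ _ (fun J => (ds D).dv_smul _ _) fun I i => ?_
  fin_cases i
  exacts [(t1 _).smul _, (t2 _).smul _]

lemma apply_trace (hD : 4 ≤ D) (hF : (ds D).Tan2 F) :
    applyField (fun x (I' : Fin 4 → Ix D) (I : Fin 2 → Ix D) =>
        metric x (I' 0) (I' 1) * metric x (I' 2) (I 0) * metric x (I' 3) (I 1))
      (ev fun J : Fin 4 → Ix D => (-(1 / 2) : ℂ) •
      (ds D).wp (k1 D) (k2 D) ((ds D).curl F) (J 0) (J 3) (J 1) (J 2)) = 0 := by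
  funext x I
  set C := ds D with hC
  have hb := (C.bi_curl hF).wp (k₁ := k1 D) (k₂ := k2 D)
  have htr : ∀ s n, (C.ctr fun r => C.wp (k1 D) (k2 D) (C.curl F) r s r n) = 0 :=
    (C.bi_curl hF).wp_trace (k1_mul hD) (k2_mul hD)
  have h : ctr4 (fun a b c d => C.g a b * (C.g c (I 0) * (C.g d (I 1) *
      C.wp (k1 D) (k2 D) (C.curl F) a d b c))) = 0 := by
    rw [ctr4, ← hC]
    simp only [C.ctr_const_mul, C.ctr_g_tan (hb.tan₂ _ _ _)]
    simp only [C.ctr_g_tan (hb.tan₄ _ _ _)]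
    simp only [C.ctr_g_tan' (hb.tan₃ _ _ _), htr]
  have h' := congrArg (fun f : smoothFn D => -(1 / 2) * f.1 x) h
  simp only [ctr4_apply] at h'
  rw [show (0 : TField D 2) x I = -(1 / 2) * (0 : smoothFn D).1 x by simp, ← h', applyField,
    sum_fin_four]
  simp only [Fin.prod_univ_four, mul_sum]
  refine sum_congr rfl fun a _ => sum_congr rfl fun b _ =>
    sum_congr rfl fun c _ => sum_congr rfl fun d _ => ?_
  simp only [Matrix.cons_val_zero, Matrix.cons_val_one, Matrix.cons_val, ev]
  rw [mul_val, mul_val, mul_val, show ∀ (z : ℂ) (u : smoothFn D), (z • u).1 x = z * u.1 x from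
    fun _ _ => rfl, g_apply, g_apply, g_apply]
  push_cast; ring

/-- The transpose of the projection operator on components. -/
def ptr (F : Fam D) : Fam D :=
  fun n s => (-(1 / 2) : ℂ) • (ds D).pt (k1 D) (k2 D) F n s

lemma projL_outer (hD : 4 ≤ D) (h : BDist D 2 l) (h0 : h 0 = 0)
    (hF : (ds D).Tan2 F) (p : TField D l) :
    projL h (outer (ev2 F) p) = h (outer (ev2 (ptr F)) p) := by
  rw [projL, applyL_outer, apply_phi F hF, nablaL_outer, nablaL_outer, div_phi F hF,
    div_div_phi F hF, neg_neg, weylL, applyL_outer, apply_upsilon F hF]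
  simp only [Pi.add_apply]
  rw [nablaL_outer, nablaL_outer, applyL_outer, div_upsilon hD hF, div_div_upsilon hD hF,
    apply_trace hD hF, zero_outer, h0, neg_neg, add_zero]
  rfl

lemma swapField_outer {k l : ℕ} (f : TField D k) (p : TField D l) :
    swapField (outer f p) = outer p f := by
  funext x y I J; simp only [swapField, outer, mul_comm]

lemma projL_zero (hD : 4 ≤ D) (h : BDist D 2 l) (h0 : h 0 = 0) : projL h 0 = 0 := by
  have h1 : (ds D).Tan2 (0 : Fam D) := by
    constructor <;> intro b <;> simp [Calc.Tan, Calc.ctr]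
  have := projL_outer hD h h0 h1 0
  rwa [outer_zero, outer_zero, h0] at this

lemma ptr_tan (hD : 4 ≤ D) (hF : (ds D).Tan2 F) : (ds D).Tan2 (ptr F) := by
  obtain ⟨t1, t2⟩ := (ds D).pt_tan (k1_mul hD) (k2_mul hD) hF
  exact ⟨fun b => (t1 b).smul _, fun b => (t2 b).smul _⟩

lemma projL_projR_outer (hD : 4 ≤ D) (h : BDist D 2 2) (h0 : h 0 = 0)
    {P : Fam D} (hF : (ds D).Tan2 F)
    (hP : (ds D).Tan2 P) :
    projL (projR h) (outer (ev2 F) (ev2 P)) = h (outer (ev2 (ptr F)) (ev2 (ptr P))) := by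
  have h1 : swapDist h 0 = 0 := h0
  rw [projL_outer hD (projR h) (projL_zero hD _ h1) hF, projR, swapDist, swapField_outer,
    projL_outer hD _ h1 hP, swapDist, swapField_outer]

end

attribute [irreducible] ptr

/-! ### The bitensor `t⁽²⁾` -/

lemma cov_one (T : TField D 0) (x : dS D) (I : Fin 1 → Ix D) :
    cov T x I = ∑ A, (proj x (I 0) A : ℂ) * partialD (fun z => T z ![]) x A := by
  simp only [cov, sum_cons, univ_unique, sum_singleton, Fin.prod_univ_succ,
    Fin.prod_univ_zero, mul_one, Fin.cons_zero, Fin.tail_cons]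
  simp only [Matrix.empty_eq]

/-- The coordinate `x^A` as a smooth function. -/
def xu (A : Ix D) : smoothFn D := ⟨fun x => (x.1 A : ℂ), ext_ofReal_contDiff A⟩

lemma partialD_linear (c : Ix D → ℂ) (x : dS D) (A : Ix D) :
    partialD (fun z => ∑ B, c B * (z.1 B : ℂ)) x A = ∑ B, (proj x A B : ℂ) * c B := by
  have h1 : (∑ B, c B • (xu B : smoothFn D)).1 = fun z : dS D => ∑ B, c B * (z.1 B : ℂ) := by
    funext z; rw [smoothFn_sum_apply]; rfl
  rw [← h1, ← dd_apply, map_sum, smoothFn_sum_apply]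
  congr 1 with B
  rw [(dd A).map_smul]
  change c B * partialD (fun z => (z.1 B : ℂ)) x A = _
  rw [partialD_coord, proj]
  split_ifs <;> push_cast <;> ring

lemma proj_proj (x : dS D) (A B : Ix D) :
    ∑ E, (proj x A E : ℂ) * (proj x E B : ℂ) = proj x A B := by
  have h := congrArg Complex.ofReal x.2
  simp only [mink, ofReal_sum, ofReal_mul, ofReal_one] at h
  rw [sum_proj_mul]
  have : ∑ E, (x.1 E : ℂ) * (proj x E B : ℂ) = 0 := by
    have e : ∀ E, (x.1 E : ℂ) * (proj x E B : ℂ)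
        = (if E = B then (x.1 E : ℂ) else 0) - (eta E * x.1 E * x.1 E) * x.1 B := by
      intro E; rw [proj]; split_ifs <;> push_cast <;> ring
    simp only [e, sum_sub_distrib, ← sum_mul, h]
    simp
  rw [this]; ring

lemma embZ_eq (x y : dS D) : (embZ x y : ℂ) = ∑ B, (eta B * x.1 B : ℂ) * (y.1 B : ℂ) := by
  simp [embZ, mink]

lemma ddZ_eq (x y : dS D) (A B : Ix D) :
    ddZ x y A B = ∑ E, (eta E : ℂ) * ((proj x A E : ℂ) * (proj y B E : ℂ)) := by
  have h1 : ∀ (x y : dS D) (J : Fin 1 → Ix D), covR (ZField D) x y ![] J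
      = ∑ E, ((proj y (J 0) E : ℂ) * eta E) * x.1 E := fun x y J => by
    rw [covR, cov_one]
    simp only [ZField, embZ_eq, partialD_linear, mul_sum]
    rw [sum_comm]
    congr 1 with E
    rw [← proj_proj, sum_mul, sum_mul]
    congr 1 with _; ring
  rw [ddZ, covL, cov_one]
  simp only [h1, partialD_linear, mul_sum]
  rw [sum_comm]
  congr 1 with E
  simp only [Matrix.cons_val_zero]
  rw [← proj_proj x, sum_mul, mul_sum]
  congr 1 with _; ring

lemma sum_ddZ (x y : dS D) {p : Ix D → ℂ} (hp : ∑ B, (y.1 B : ℂ) * p B = 0) (A : Ix D) :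
    ∑ B, (eta B : ℂ) * (ddZ x y A B * p B) = ∑ B, (eta B : ℂ) * (metric x A B : ℂ) * p B := by
  have h : ∀ E, ∑ B, (eta B : ℂ) * ((proj y B E : ℂ) * p B) = (eta E : ℂ) * p E := fun E => by
    have e : ∀ B, (eta B : ℂ) * ((proj y B E : ℂ) * p B)
        = (if B = E then (eta B : ℂ) * p B else 0) - x.1 0 * 0 - (y.1 B : ℂ) * p B * y.1 E := fun B => by
      rw [proj]
      split_ifs <;> push_cast <;> linear_combination -(y.1 B : ℂ) * y.1 E * p B * eta_sq_complex B
    simp only [e, sum_sub_distrib, ← sum_mul, hp]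
    simp
  simp only [ddZ_eq, sum_mul, mul_sum]
  rw [sum_comm]
  congr 1 with E
  calc _ = (eta E * proj x A E : ℂ) * ∑ B, (eta B : ℂ) * ((proj y B E : ℂ) * p B) := by
        rw [mul_sum]; congr 1 with _; ring
    _ = _ := by rw [h, metric]; push_cast; ring

end

section
open scoped ContDiff
variable {D : ℕ}
variable {X Y : Amb D} {u v : dS D → dS D → ℂ} {f : dS D → ℂ} {K : Set (dS D × dS D)} {O : Set (dS

  D)}

/-! ### Smooth functions of two points -/

/-- Smoothness of a function of two points of de Sitter space. -/
def Sm2 (u : dS D → dS D → ℂ) : Prop := ContDiffOn ℝ ∞ (biExt u) (cone D ×ˢ cone D)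

lemma biExt_of_mem {E : Type*} [Zero E] (u : dS D → dS D → E) (hX : 0 < mink X X)
    (hY : 0 < mink Y Y) : biExt u (X, Y) = u (normalize X hX) (normalize Y hY) := by
  simp only [biExt]
  rw [ext_of_mem _ hX, ext_of_mem _ hY]

lemma biExt_coe {E : Type*} [Zero E] (u : dS D → dS D → E) (x y : dS D) :
    biExt u (x.1, y.1) = u x y := by
  simp only [biExt, ext_coe]

lemma biExt_coe_right (u : dS D → dS D → ℂ) (X : Amb D) (y : dS D) :
    biExt u (X, y.1) = ext (fun x => u x y) X := by
  simp only [biExt, ext_coe]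

lemma isOpen_cone_prod : IsOpen (cone D ×ˢ cone D) := isOpen_cone.prod isOpen_cone

lemma Sm2.contDiffAt (hu : Sm2 u) {P : Amb D × Amb D}
    (hP : P ∈ cone D ×ˢ cone D) : ContDiffAt ℝ ∞ (biExt u) P :=
  ContDiffOn.contDiffAt (s := cone D ×ˢ cone D) hu (isOpen_cone_prod.mem_nhds hP)

lemma Sm2.of_normalized {F : Amb D × Amb D → ℂ}
    (hF : ContDiffOn ℝ ∞ F (cone D ×ˢ cone D)) (h : ∀ x y, u x y = F (x.1, y.1)) : Sm2 u := by
  have hn : ContDiffOn ℝ ∞ (fun X : Amb D => (√(mink X X))⁻¹ • X) (cone D) := by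
    intro X hX
    have hX' : mink X X ≠ 0 := (show 0 < mink X X from hX).ne'
    refine ContDiffAt.contDiffWithinAt (ContDiffAt.fun_smul (ContDiffAt.inv ?_ ?_) contDiffAt_id)
    · exact (contDiff_minkSelf.contDiffAt).sqrt hX'
    · exact (sqrt_pos.2 hX).ne'
  have hm : ∀ X ∈ cone D, (√(mink X X))⁻¹ • X ∈ cone D := fun X hX =>
    (smul_mem_cone (inv_pos.2 (sqrt_pos.2 hX))).2 hX
  have : ContDiffOn ℝ ∞ (fun P : Amb D × Amb D =>
      F ((√(mink P.1 P.1))⁻¹ • P.1, (√(mink P.2 P.2))⁻¹ • P.2)) (cone D ×ˢ cone D) := by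
    refine hF.comp (ContDiffOn.prodMk (hn.comp contDiffOn_fst fun P hP => hP.1)
      (hn.comp contDiffOn_snd fun P hP => hP.2)) fun P hP => ⟨hm _ hP.1, hm _ hP.2⟩
  refine this.congr fun P hP => ?_
  rw [← Prod.mk.eta (p := P), biExt_of_mem u hP.1 hP.2, h]; rfl

lemma Sm2.slice (hu : Sm2 u) (y : dS D) : Sm fun x => u x y := by
  have h : ContDiffOn ℝ ∞ (fun X : Amb D => biExt u (X, y.1)) (cone D) :=
    ContDiffOn.comp (t := cone D ×ˢ cone D) hu
      (contDiffOn_id.prodMk contDiffOn_const) fun X hX => ⟨hX, coe_mem_cone y⟩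
  exact h.congr fun X _ => (biExt_coe_right u X y).symm

lemma Sm2.swap (hu : Sm2 u) : Sm2 fun x y => u y x := by
  have h : ContDiffOn ℝ ∞ (fun P : Amb D × Amb D => biExt u (P.2, P.1)) (cone D ×ˢ cone D) :=
    ContDiffOn.comp (t := cone D ×ˢ cone D) hu
      (contDiffOn_snd.prodMk contDiffOn_fst) fun X hX => ⟨hX.2, hX.1⟩
  exact Sm2.of_normalized h fun x y => (biExt_coe u y x).symm

lemma Sm2.add (hu : Sm2 u) (hv : Sm2 v) :
    Sm2 fun x y => u x y + v x y :=
  Sm2.of_normalized (ContDiffOn.add hu hv) fun x y => by simp [biExt_coe]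

lemma Sm2.mul (hu : Sm2 u) (hv : Sm2 v) :
    Sm2 fun x y => u x y * v x y :=
  Sm2.of_normalized (ContDiffOn.mul hu hv) fun x y => by simp [biExt_coe]

lemma Sm2.const (c : ℂ) : Sm2 fun _ _ : dS D => c :=
  Sm2.of_normalized (F := fun _ => c) contDiffOn_const fun _ _ => rfl

lemma Sm2.left (hf : Sm f) : Sm2 fun x _ => f x :=
  Sm2.of_normalized (F := fun P => ext f P.1)
    (ContDiffOn.comp (t := cone D) hf contDiffOn_fst fun _ hP => hP.1)
    fun x _ => (ext_coe f x).symm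

lemma Sm2.right (hf : Sm f) : Sm2 fun _ y => f y := (Sm2.left hf).swap

lemma Sm2.sum {α : Type*} (s : Finset α) {u : α → dS D → dS D → ℂ} (h : ∀ i, Sm2 (u i)) :
    Sm2 fun x y => ∑ i ∈ s, u i x y := by
  classical
  induction s using Finset.induction_on with
  | empty => simpa using Sm2.const 0
  | insert a s ha ih => simpa only [sum_insert ha] using (h a).add ih

lemma biExt_partialD (u : dS D → dS D → ℂ) (A : Ix D) (hX : X ∈ cone D)
    (hY : Y ∈ cone D) : biExt (fun x y => partialD (fun z => u z y) x A) (X, Y)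
      = (√(mink X X) : ℂ) * fderiv ℝ (fun X' => biExt u (X', Y)) X (Pi.single A 1) := by
  rw [biExt_of_mem _ hX hY, ← ext_of_mem (fun x => partialD (fun z => u z (normalize Y hY)) x A) hX,
    ext_partialD _ _ hX]
  congr 3
  funext X'
  simp only [biExt]
  congr 1 with x; rw [ext_of_mem _ hY]

lemma Sm2.partialD (hu : Sm2 u) (A : Ix D) :
    Sm2 fun x y => partialD (fun z => u z y) x A := by
  have h : ContDiffOn ℝ ∞ (fun P : Amb D × Amb D =>
      fderiv ℝ (biExt u) P (Pi.single A 1, 0)) (cone D ×ˢ cone D) :=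
    (hu.fderiv_of_isOpen isOpen_cone_prod (m := ∞) (by simp)).clm_apply contDiffOn_const
  refine Sm2.of_normalized h fun x y => ?_
  have h1 : HasFDerivAt (fun X' => biExt u (X', y.1)) ((fderiv ℝ (biExt u) (x.1, y.1)).comp
      (ContinuousLinearMap.inl ℝ (Amb D) (Amb D))) x.1 :=
    (((hu.contDiffAt ⟨coe_mem_cone x, coe_mem_cone y⟩).differentiableAt
      (by simp)).hasFDerivAt).comp x.1 (hasFDerivAt_prodMk_left x.1 y.1)
  rw [← biExt_coe (fun x y => DeSitter.partialD (fun z => u z y) x A) x y,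
    biExt_partialD u A (coe_mem_cone x) (coe_mem_cone y), h1.fderiv, x.2]
  simp

/-- The d'Alembertian of a scalar function. -/
def boxFn (f : dS D → ℂ) (x : dS D) : ℂ :=
  ∑ A, (eta A : ℂ) * partialD (fun z => partialD f z A) x A

lemma box_val (f : smoothFn D) : ((ds D).box f).1 = boxFn f.1 := by
  funext x; exact dv_apply _ _

/-- The value of a biscalar field. -/
def fn (φ : BField D 0 0) (x y : dS D) : ℂ := φ x y ![] ![]

/-- A function of two points as a biscalar field. -/
def bi (u : dS D → dS D → ℂ) : BField D 0 0 := fun x y _ _ => u x y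

lemma bi_fn (φ : BField D 0 0) : bi (fn φ) = φ := by
  funext x y I J; simp only [bi, fn, Matrix.empty_eq]

lemma biExt_bi (u : dS D → dS D → ℂ) (P : Amb D × Amb D) (I J) :
    biExt (bi u) P I J = biExt u P := by
  obtain ⟨X, Y⟩ := P
  by_cases hX : 0 < mink X X
  · by_cases hY : 0 < mink Y Y
    · rw [biExt_of_mem _ hX hY, biExt_of_mem _ hX hY]; rfl
    · simp [biExt, ext, hX, hY]
  · simp [biExt, ext, hX]

/-- Smooth biscalar functions supported in `K`. -/
def TestOn (K : Set (dS D × dS D)) (u : dS D → dS D → ℂ) : Prop :=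
  Sm2 u ∧ ∀ x y, (x, y) ∉ K → u x y = 0

lemma isBiTestOn_bi :
    IsBiTestOn K (bi u) ↔ TestOn K u := by
  constructor
  · rintro ⟨h1, h2, -, -⟩
    refine ⟨?_, fun x y h => congrFun (congrFun (h2 x y h) ![]) ![]⟩
    have := contDiffOn_pi.1 (contDiffOn_pi.1 h1 ![]) ![]
    exact this.congr fun P _ => (biExt_bi u P _ _).symm
  · rintro ⟨h1, h2⟩
    refine ⟨contDiffOn_pi.2 fun I => contDiffOn_pi.2 fun J => ?_, fun x y h => ?_,
      fun _ _ _ _ i => i.elim0, fun _ _ _ _ i => i.elim0⟩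
    · exact ContDiffOn.congr h1 fun P _ => biExt_bi u P _ _
    · funext I J; exact h2 x y h

/-- Smooth biscalar functions with compact support in `O × O`. -/
def Test (O : Set (dS D)) (u : dS D → dS D → ℂ) : Prop :=
  ∃ K : Set (dS D × dS D), IsCompact K ∧ K ⊆ O ×ˢ O ∧ TestOn K u

lemma isBiTest_bi : IsBiTest O (bi u) ↔ Test O u := by
  simp only [IsBiTest, Test, isBiTestOn_bi]

lemma isBiTest_iff {φ : BField D 0 0} : IsBiTest O φ ↔ Test O (fn φ) := by
  rw [← isBiTest_bi, bi_fn]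

lemma partialD_eq_zero {S : Set (dS D)} (hS : IsOpen S) (h : ∀ z ∈ S, f z = 0)
    {x : dS D} (hx : x ∈ S) (A : Ix D) : partialD f x A = 0 := by
  obtain ⟨V, hV, hVe⟩ := isOpen_induced_iff.1 hS
  have hn : ext f =ᶠ[𝓝 x.1] fun _ => (0 : ℂ) := by
    have hc : ContinuousAt (fun X : Amb D => (√(mink X X))⁻¹ • X) x.1 := by
      have : ContinuousAt (fun X : Amb D => (√(mink X X))⁻¹) x.1 :=
        (continuous_sqrt.comp continuous_minkSelf).continuousAt.inv₀
          (by simp [x.2])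
      exact this.smul continuousAt_id
    have hx' : (√(mink x.1 x.1))⁻¹ • x.1 ∈ V := by
      have : x ∈ Subtype.val ⁻¹' V := by rw [hVe]; exact hx
      simpa [x.2] using this
    filter_upwards [hc.preimage_mem_nhds (hV.mem_nhds hx'), isOpen_cone.mem_nhds (coe_mem_cone x)]
      with X hX hX'
    rw [ext_of_mem _ hX']
    have : normalize X hX' ∈ Subtype.val ⁻¹' V := hX
    rw [hVe] at this
    exact h _ this
  rw [partialD, hn.fderiv_eq]; simp

lemma TestOn.partialD (hK : IsCompact K)
    (hu : TestOn K u) (A : Ix D) : TestOn K fun x y => partialD (fun z => u z y) x A :=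
  ⟨hu.1.partialD A, fun x y h => partialD_eq_zero
    (hK.isClosed.isOpen_compl.preimage (Continuous.prodMk_left y)) (fun z hz => hu.2 z y hz) h A⟩

lemma TestOn.add (hu : TestOn K u)
    (hv : TestOn K v) : TestOn K fun x y => u x y + v x y :=
  ⟨hu.1.add hv.1, fun x y h => by simp [hu.2 x y h, hv.2 x y h]⟩

lemma TestOn.mul (hv : Sm2 v)
    (hu : TestOn K u) : TestOn K fun x y => v x y * u x y :=
  ⟨hv.mul hu.1, fun x y h => by simp [hu.2 x y h]⟩

lemma TestOn.const_mul (c : ℂ)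
    (hu : TestOn K u) : TestOn K fun x y => c * u x y := hu.mul (Sm2.const c)

lemma TestOn.sum {α : Type*} (s : Finset α) {u : α → dS D → dS D → ℂ}
    (h : ∀ i, TestOn K (u i)) : TestOn K fun x y => ∑ i ∈ s, u i x y :=
  ⟨Sm2.sum s fun i => (h i).1, fun x y hK => sum_eq_zero fun i _ => (h i).2 x y hK⟩

/-- The d'Alembertian at the first point. -/
def box1 (u : dS D → dS D → ℂ) : dS D → dS D → ℂ := fun x y => boxFn (fun z => u z y) x

/-- The d'Alembertian at the second point. -/
def box2 (u : dS D → dS D → ℂ) : dS D → dS D → ℂ := fun x y => boxFn (u x) y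

lemma TestOn.box1 (hK : IsCompact K)
    (hu : TestOn K u) : TestOn K (box1 u) :=
  TestOn.sum Finset.univ fun A => TestOn.const_mul (eta A : ℂ) ((hu.partialD hK A).partialD hK A)

lemma TestOn.swap (hu : TestOn K u) :
    TestOn (Prod.swap ⁻¹' K) fun x y => u y x :=
  ⟨hu.1.swap, fun x y h => hu.2 y x h⟩

lemma isCompact_swap (hK : IsCompact K) : IsCompact (Prod.swap ⁻¹' K) := by
  rw [← Set.image_swap_eq_preimage_swap]; exact hK.image continuous_swap

lemma TestOn.box2 (hK : IsCompact K)
    (hu : TestOn K u) : TestOn K (box2 u) :=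
  (hu.swap.box1 (isCompact_swap hK)).swap

lemma Test.box1 : Test O u → Test O (box1 u) :=
  fun ⟨K, h1, h2, h3⟩ => ⟨K, h1, h2, h3.box1 h1⟩

lemma Test.box2 : Test O u → Test O (box2 u) :=
  fun ⟨K, h1, h2, h3⟩ => ⟨K, h1, h2, h3.box2 h1⟩

lemma Test.const_mul (c : ℂ) :
    Test O u → Test O fun x y => c * u x y :=
  fun ⟨K, h1, h2, h3⟩ => ⟨K, h1, h2, h3.const_mul c⟩

lemma TestOn.mono {K L : Set (dS D × dS D)} (h : K ⊆ L)
    (hu : TestOn K u) : TestOn L u := ⟨hu.1, fun x y hL => hu.2 x y fun hK => hL (h hK)⟩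

lemma Test.add :
    Test O u → Test O v → Test O fun x y => u x y + v x y :=
  fun ⟨K, h1, h2, h3⟩ ⟨L, k1, k2, k3⟩ => ⟨K ∪ L, h1.union k1, Set.union_subset h2 k2,
    (h3.mono Set.subset_union_left).add (k3.mono Set.subset_union_right)⟩

/-! ### The d'Alembertian of a bidistribution -/

lemma divergence_divergence_metric (hf : Sm f) :
    divergence (divergence fun x (I : Fin 2 → Ix D) => (metric x (I 0) (I 1) : ℂ) * f x)
      = fun x _ => boxFn f x := by
  set C := ds D with hC
  set F : smoothFn D := ⟨f, hf⟩
  have h1 : (fun x (I : Fin 2 → Ix D) => (metric x (I 0) (I 1) : ℂ) * f x)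
      = ev fun J : Fin 2 → Ix D => C.g (J 0) (J 1) * F := by
    funext x I
    rw [← g_apply]; rfl
  have h2 : divergence (ev fun J : Fin 2 → Ix D => C.g (J 0) (J 1) * F)
      = ev fun J : Fin 1 → Ix D => C.d (J 0) F := by
    refine divergence_ev _ _ (fun J => C.x (J 0) * (-(C.D * F))) (fun J => ?_)
      (Negl.of_slot 0 _ fun J a => rfl) (fun I i => ?_)
    · exact (C.dv_g_mul F (J 0)).trans (by ring)
    · fin_cases i; simpa using C.tan_d F
  have h3 : divergence (ev fun J : Fin 1 → Ix D => C.d (J 0) F)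
      = ev fun _ : Fin 0 → Ix D => C.box F :=
    divergence_ev_of_tan _ _ (fun J => rfl) fun I i => i.elim0
  rw [h1, h2, h3]
  funext x I
  exact congrFun (box_val F) x

lemma boxL_bi (U : BDist D 0 0) (hu : ∀ y, Sm fun x => u x y) :
    boxL U (bi u) = U (bi (box1 u)) := by
  simp only [boxL, applyL, nablaL, neg_neg]
  congr 1
  funext x y I J
  have h := congrFun (congrFun (divergence_divergence_metric (hu y)) x) I
  refine Eq.trans ?_ h
  simp only [divL]
  congr 1
  funext z I'
  congr 1
  funext z I'
  simp [bi]

lemma swapField_bi (u : dS D → dS D → ℂ) : swapField (bi u) = bi fun x y => u y x := rfl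

lemma boxR_bi (U : BDist D 0 0) (hu : ∀ x, Sm (u x)) :
    boxR U (bi u) = U (bi (box2 u)) := by
  rw [boxR, swapDist, swapField_bi, boxL_bi _ fun x => hu x, swapDist, swapField_bi]; rfl

end

section
open scoped ContDiff
variable {D : ℕ}
variable {k : ℕ} {O : Set (dS D)} {f : TField D 2} {F P : Fam D}

  {u : dS D → dS D → ℂ}

/-! ### The projected kernel on pairs of test tensors -/

lemma IsTest.sm {f : TField D k} (hf : IsTest O f)
    (I : Fin k → Ix D) : Sm fun x => f x I :=
  (contDiffOn_pi.1 hf.smooth I).congr fun X hX => by rw [ext_of_mem _ hX, ext_of_mem _ hX]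

/-- The components of a test tensor of rank two as smooth functions. -/
def IsTest.comp (hf : IsTest O f) (a b : Ix D) :
    smoothFn D := ⟨fun x => f x ![a, b], hf.sm ![a, b]⟩

lemma IsTest.ev_comp (hf : IsTest O f) : ev2 hf.comp = f := by
  funext x J
  exact congrArg (f x) (List.ofFn_inj.1 rfl)

lemma IsTest.comp_tan (hf : IsTest O f) :
    (ds D).Tan2 hf.comp := by
  refine ⟨fun b => (tan_iff _).2 fun x => Eq.trans ?_ (hf.tangent x ![0, b] 0),
    fun a => (tan_iff _).2 fun x => Eq.trans ?_ (hf.tangent x ![a, 0] 1)⟩ <;>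
  · refine sum_congr rfl fun A _ => congrArg _ (congrArg (f x) ?_)
    funext i; fin_cases i <;> rfl

/-- Vanishing outside of a compact subset of `O`. -/
def Supp (O : Set (dS D)) (f : dS D → ℂ) : Prop :=
  ∃ K : Set (dS D), IsCompact K ∧ K ⊆ O ∧ ∀ x, x ∉ K → f x = 0

lemma IsTest.comp_supp (hf : IsTest O f) (a b : Ix D) :
    Supp O (hf.comp a b).1 := by
  obtain ⟨K, h1, h2, h3⟩ := hf.compact
  exact ⟨K, h1, h2, fun x hx => congrFun (h3 x hx) _⟩

/-- The contracted exterior product `F^{AB}(x) P_{AB}(y)` of two component families. -/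
def pairing (F P : Fam D) (x y : dS D) : ℂ :=
  ∑ A, (eta A : ℂ) * ∑ B, (eta B : ℂ) * ((F A B).1 x * (P A B).1 y)

lemma pairing_swap (F P : Fam D) (x y : dS D) :
    pairing F P x y = pairing P F y x := by
  simp only [pairing, mul_comm]

lemma sum_sum_ddZ {x y : dS D} {f p : Ix D → ℂ} (hf : ∑ A, (x.1 A : ℂ) * f A = 0)
    (hp : ∑ B, (y.1 B : ℂ) * p B = 0) :
    ∑ A, ∑ B, (eta A : ℂ) * (eta B : ℂ) * ddZ x y A B * (f A * p B)
      = ∑ A, (eta A : ℂ) * (f A * p A) := by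
  have h1 : ∀ A, ∑ B, (eta A : ℂ) * (eta B : ℂ) * ddZ x y A B * (f A * p B)
      = (eta A : ℂ) * f A * ∑ B, (eta B : ℂ) * (metric x A B : ℂ) * p B := by
    intro A
    rw [← sum_ddZ x y hp, mul_sum]
    congr 1 with _; ring
  have h2 : ∀ B, ∑ A, (eta A : ℂ) * f A * (metric x A B : ℂ) = f B := by
    intro B
    have e : ∀ A, (eta A : ℂ) * f A * (metric x A B : ℂ)
        = (if A = B then f A else 0) - (x.1 A : ℂ) * f A * (x.1 B * eta B) := by
      intro A
      rw [metric, proj]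
      split_ifs with h
      · subst h; push_cast
        linear_combination f A * (1 - x.1 A * x.1 A * eta A) * eta_sq_complex A
      · push_cast
        linear_combination -f A * x.1 A * x.1 B * eta B * eta_sq_complex A
    simp only [e, sum_sub_distrib, ← sum_mul, hf]
    simp
  simp only [h1, mul_sum]
  rw [sum_comm]
  congr 1 with B
  rw [← h2 B, sum_mul, mul_sum]
  congr 1 with _; ring

lemma sum_comm₃ {ι : Type*} [Fintype ι] (G : ι → ι → ι → ℂ) :
    ∑ a, ∑ b, ∑ c, G a b c = ∑ c, ∑ a, ∑ b, G a b c := by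
  refine Eq.trans (sum_congr rfl fun a _ => sum_comm) sum_comm

lemma sum_comm₄ {ι : Type*} [Fintype ι] (G : ι → ι → ι → ι → ℂ) :
    ∑ a, ∑ b, ∑ c, ∑ d, G a b c d = ∑ b, ∑ d, ∑ a, ∑ c, G a b c d := by
  rw [sum_comm]
  exact sum_congr rfl fun b _ => sum_comm₃ fun a c d => G a b c d

lemma mulTTwo_ev2 (U : BDist D 0 0)
    (hF : (ds D).Tan2 F) (hP : (ds D).Tan2 P) :
    mulTTwo U (outer (ev2 F) (ev2 P))
      = U (bi fun x y => (pairing F P x y + pairing F (fun a b => P b a) x y) / 2) := by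
  have key : ∀ P : Fam D, (ds D).Tan2 P → ∀ x y : dS D,
      ∑ a, ∑ b, ∑ a', ∑ b', ((eta a : ℂ) * eta b * (eta a' * eta b')) *
        (ddZ x y a a' * ddZ x y b b') * ((F a b).1 x * (P a' b').1 y) = pairing F P x y := by
    intro P hP x y
    have g1 : ∀ b b', ∑ a, ∑ a', (eta a : ℂ) * eta a' * ddZ x y a a' * ((F a b).1 x * (P a' b').1 y)
        = ∑ a, (eta a : ℂ) * ((F a b).1 x * (P a b').1 y) := fun b b' =>
      sum_sum_ddZ (f := fun a => (F a b).1 x) (p := fun a => (P a b').1 y)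
        ((tan_iff _).1 (hF.1 b) x) ((tan_iff _).1 (hP.1 b') y)
    have g2 : ∀ a, ∑ b, ∑ b', (eta b : ℂ) * eta b' * ddZ x y b b' * ((F a b).1 x * (P a b').1 y)
        = ∑ b, (eta b : ℂ) * ((F a b).1 x * (P a b).1 y) := fun a =>
      sum_sum_ddZ (f := fun b => (F a b).1 x) (p := fun b => (P a b).1 y)
        ((tan_iff _).1 (hF.2 a) x) ((tan_iff _).1 (hP.2 a) y)
    calc _ = ∑ b, ∑ b', ((eta b : ℂ) * eta b' * ddZ x y b b') *
          ∑ a, ∑ a', (eta a : ℂ) * eta a' * ddZ x y a a' * ((F a b).1 x * (P a' b').1 y) := by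
          rw [sum_comm₄]
          refine sum_congr rfl fun b _ => sum_congr rfl fun b' _ => ?_
          simp only [mul_sum]
          exact sum_congr rfl fun _ _ => sum_congr rfl fun _ _ => by ring
      _ = ∑ a, (eta a : ℂ) * ∑ b, ∑ b', (eta b : ℂ) * eta b' * ddZ x y b b' *
            ((F a b).1 x * (P a b').1 y) := by
          simp only [g1, mul_sum]
          rw [sum_comm₃]
          exact sum_congr rfl fun _ _ => sum_congr rfl fun _ _ =>
            sum_congr rfl fun _ _ => by ring
      _ = _ := by simp only [g2, pairing]
  unfold mulTTwo
  congr 1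
  funext x y I J
  change _ = (pairing F P x y + pairing F (fun a b => P b a) x y) / 2
  rw [← key P hP, ← key (fun a b => P b a) ⟨hP.2, hP.1⟩, ← sum_add_distrib, sum_div,
    sum_fin_two]
  congr 1 with a
  rw [← sum_add_distrib, sum_div]
  congr 1 with b
  rw [sum_fin_two]
  have hc : ∑ a', ∑ b', ((eta a : ℂ) * eta b * (eta a' * eta b')) *
        (ddZ x y a a' * ddZ x y b b') * ((F a b).1 x * (P b' a').1 y)
      = ∑ a', ∑ b', ((eta a : ℂ) * eta b * (eta b' * eta a')) *
        (ddZ x y a b' * ddZ x y b a') * ((F a b).1 x * (P a' b').1 y) := sum_comm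
  rw [hc, ← sum_add_distrib, sum_div]
  refine sum_congr rfl fun a' _ => ?_
  rw [← sum_add_distrib, sum_div]
  refine sum_congr rfl fun b' _ => ?_
  simp only [Fin.prod_univ_two, Matrix.cons_val_zero, Matrix.cons_val_one, tTwo, outer, ev2, ev]
  ring

lemma mulTTwo_zero (U : BDist D 0 0) (hU : U 0 = 0) : mulTTwo U 0 = 0 := by
  rw [← hU]; unfold mulTTwo; congr 1
  funext x y I J; simp

lemma IsDistribution.map_zero {U : BDist D 0 0} (hU : IsDistribution O U) :
    U 0 = 0 := by
  have h : IsBiTest O (bi fun _ _ : dS D => (0 : ℂ)) :=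
    isBiTest_bi.2 ⟨∅, isCompact_empty, Set.empty_subset _, Sm2.const 0, fun _ _ _ => rfl⟩
  have := hU.map_smul 0 _ h
  simpa using this

/-- The projected kernel on a pair of tangential fields. -/
lemma kernel_ev2 (hD : 4 ≤ D) (U : BDist D 0 0) (hU : U 0 = 0)
    (hF : (ds D).Tan2 F) (hP : (ds D).Tan2 P) :
    projL (projR (mulTTwo U)) (outer (ev2 F) (ev2 P))
      = U (bi fun x y => (pairing (ptr F) (ptr P) x y
        + pairing (ptr F) (fun a b => ptr P b a) x y) / 2) := by
  rw [projL_projR_outer hD _ (mulTTwo_zero U hU) hF hP,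
    mulTTwo_ev2 U (ptr_tan hD hF) (ptr_tan hD hP)]

lemma ptr_transpose (hF : (ds D).Tan2 F) :
    ptr (fun a b => F b a) = fun a b => ptr F b a := by
  funext n s
  simp only [ptr, (ds D).pt_transpose hF n s]

lemma pairing_transpose (F P : Fam D) (x y : dS D) :
    pairing (fun a b => F b a) P x y = pairing F (fun a b => P b a) x y := by
  simp only [pairing, mul_sum]
  rw [sum_comm]
  exact sum_congr rfl fun _ _ => sum_congr rfl fun _ _ => by ring

lemma ev2_transpose (F : Fam D) :
    (fun x I => ev2 F x ![I 1, I 0]) = ev2 fun a b => F b a := rfl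

lemma pairing_zero (P : Fam D) (x y : dS D) :
    pairing 0 P x y = 0 := by simp [pairing]

lemma kernel_of_ptr_eq_zero (hD : 4 ≤ D) (U : BDist D 0 0) (hU : U 0 = 0)
    (hF : (ds D).Tan2 F) (hP : (ds D).Tan2 P) (h : ptr F = 0) :
    projL (projR (mulTTwo U)) (outer (ev2 F) (ev2 P)) = 0 := by
  rw [kernel_ev2 hD U hU hF hP, h]
  simp only [pairing_zero]
  refine Eq.trans (congrArg U ?_) hU
  funext x y I J; simp [bi]

lemma kernel_symm (hD : 4 ≤ D) (U : BDist D 0 0) (hU : U 0 = 0)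
    (hF : (ds D).Tan2 F) (hP : (ds D).Tan2 P) :
    projL (projR (mulTTwo U)) (outer (fun x I => ev2 F x ![I 1, I 0]) (ev2 P))
      = projL (projR (mulTTwo U)) (outer (ev2 F) (ev2 P)) := by
  rw [ev2_transpose, kernel_ev2 hD U hU ⟨hF.2, hF.1⟩ hP, kernel_ev2 hD U hU hF hP,
    ptr_transpose hF]
  congr 2
  funext x y
  rw [pairing_transpose (ptr F) (ptr P), pairing_transpose (ptr F) fun a b => ptr P b a, add_comm]

lemma cov_ev_of_tan (t : (Fin k → Ix D) → smoothFn D)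
    (u S : (Fin (k + 1) → Ix D) → smoothFn D)
    (h : ∀ J, (ds D).d (J 0) (t (Fin.tail J)) = u J + S J) (hS : Negl S)
    (hu : ∀ I i, (ds D).Tan fun A => u (Function.update I i A)) :
    cov (ev t) = ev u := by
  funext x I
  have e : ∀ J : Fin (k + 1) → Ix D, partialD (fun z => ev t z (Fin.tail J)) x (J 0)
      = (u J).1 x + (S J).1 x := fun J => congrArg (fun f : smoothFn D => f.1 x) (h J)
  have h1 : cov (ev t) x I = projSum x (fun J => (u J).1 x + (S J).1 x) I := by
    simp only [cov, projSum, e]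
  rw [h1, projSum_add, hS x I, add_zero]
  exact projSum_of_tan x _ (fun I i => (tan_iff _).1 (hu I i) x) I

lemma cov_ev (ξ : Ix D → smoothFn D) (hξ : (ds D).Tan ξ) :
    cov (ev fun J : Fin 1 → Ix D => ξ (J 0))
      = ev2 fun a b => (ds D).d a (ξ b) + (ds D).x b * ξ a := by
  refine cov_ev_of_tan _ _ (fun J => (ds D).x (J 1) * (-ξ (J 0))) (fun J => ?_)
    (Negl.of_slot 1 _ fun J a => by simp) (fun I i => ?_)
  · change (ds D).d (J 0) (ξ (J 1)) = ((ds D).d (J 0) (ξ (J 1))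
      + (ds D).x (J 1) * ξ (J 0)) + (ds D).x (J 1) * -ξ (J 0)
    ring
  · fin_cases i
    · exact (ds D).tan_grad hξ (I 1)
    · exact (ds D).tan_nab hξ (I 0)

lemma IsTT.tt (hf : IsTT O f) : (ds D).TT hf.test.comp := by
  have ht := hf.test.comp_tan
  have htr : ((ds D).ctr fun a => hf.test.comp a a) = 0 :=
    Subtype.ext (funext fun x => (ctr_apply _ _).trans (hf.traceless x))
  have hd : (ds D).Tan fun b => (ds D).dv fun a => hf.test.comp a b := by
    unfold Calc.Tan
    rw [Calc.ctr_x_dv _ fun r => ht.2 r, htr, neg_zero]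
  refine ⟨fun a b => Subtype.ext (funext fun x => hf.symm x a b), ht.1, htr, fun b => ?_⟩
  have h := divergence_ev_of_tan (fun J : Fin 2 → Ix D => hf.test.comp (J 0) (J 1))
    (fun J : Fin 1 → Ix D => (ds D).dv fun a => hf.test.comp a (J 0)) (fun J => rfl)
    (fun I i => by fin_cases i; exact hd)
  refine Subtype.ext (funext fun x => ?_)
  have h2 := congrFun (congrFun h x) ![b]
  rw [show (ev fun J : Fin 2 → Ix D => hf.test.comp (J 0) (J 1)) = f from hf.test.ev_comp,
    hf.transverse] at h2
  exact h2.symm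

lemma box1_pairing (F P : Fam D) :
    box1 (pairing F P) = pairing (fun a b => (ds D).box (F a b)) P := by
  funext x y
  have h : (fun z => pairing F P z y)
      = ((ds D).ctr fun a => (ds D).ctr fun b => (P a b).1 y • F a b).1 := by
    funext z
    rw [ctr2_apply]
    refine sum_congr rfl fun a _ => congrArg _ (sum_congr rfl fun b _ => congrArg _ ?_)
    exact mul_comm _ _
  rw [box1, h, ← box_val, Calc.box_ctr]
  simp only [Calc.box_ctr, Calc.box_smul]
  rw [ctr2_apply]
  refine sum_congr rfl fun a _ => congrArg _ (sum_congr rfl fun b _ => congrArg _ ?_)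
  exact mul_comm _ _

lemma box2_pairing (F P : Fam D) :
    box2 (pairing F P) = pairing F fun a b => (ds D).box (P a b) := by
  funext x y
  rw [pairing_swap, ← box1_pairing, box1, box2]
  congr 1 with z; exact pairing_swap _ _ _ _

lemma pairing_sub_mul (F G H P : Fam D) (c : ℂ)
    (h : ∀ a b, H a b = F a b - algebraMap ℂ (smoothFn D) c * G a b) (x y : dS D) :
    pairing H P x y = pairing F P x y - c * pairing G P x y := by
  simp only [pairing, mul_sum, ← sum_sub_distrib]
  refine sum_congr rfl fun a _ => sum_congr rfl fun b _ => ?_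
  rw [show (H a b).1 x = (F a b).1 x - c * (G a b).1 x by rw [h]; rfl]
  ring

lemma pairing_smul (F P : Fam D) (c : ℂ) (x y : dS D) :
    pairing (fun a b => c • F a b) P x y = c * pairing F P x y := by
  simp only [pairing, mul_sum]
  refine sum_congr rfl fun a _ => sum_congr rfl fun b _ => ?_
  change (eta a : ℂ) * (eta b * (c * (F a b).1 x * _)) = _
  ring

lemma ptr_eq (hD : 4 ≤ D) (hF : (ds D).TT F) :
    ptr F = fun a b => (-(((D : ℂ) - 3) / (2 * ((D : ℂ) - 2)))) • (ds D).box ((ds D).ee F a b) := by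
  funext a b
  have hk : ∀ A, (ds D).d A (k1 D) = 0 := fun A => Derivation.map_algebraMap _ _
  rw [ptr, hF.pt_eq (k1_mul hD) hk, k1, ds_D, ← map_ofNat (algebraMap ℂ (smoothFn D)) 3,
    ← map_sub, ← map_mul, ← Algebra.smul_def, smul_smul]
  congr 1
  have h : (D : ℂ) - 2 ≠ 0 := by rw [sub_ne_zero]; norm_cast; omega
  field_simp

lemma test_pairing
    (hF : ∀ a b, Supp O (F a b).1) (hP : ∀ a b, Supp O (P a b).1) : Test O (pairing F P) := by
  choose K hK1 hK2 hK3 using hF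
  choose L hL1 hL2 hL3 using hP
  refine ⟨(⋃ a, ⋃ b, K a b) ×ˢ (⋃ a, ⋃ b, L a b),
    (isCompact_iUnion fun a => isCompact_iUnion (hK1 a)).prod
      (isCompact_iUnion fun a => isCompact_iUnion (hL1 a)),
    Set.prod_mono (iUnion_subset fun a => iUnion_subset (hK2 a))
      (iUnion_subset fun a => iUnion_subset (hL2 a)), ?_, fun x y h => ?_⟩
  · refine Sm2.sum _ fun a => (Sm2.const _).mul (Sm2.sum _ fun b => (Sm2.const _).mul ?_)
    exact (Sm2.left (F a b).2).mul (Sm2.right (P a b).2)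
  · refine sum_eq_zero fun a _ => ?_
    rw [sum_eq_zero fun b _ => ?_, mul_zero]
    by_cases hx : x ∈ K a b
    · have hy : y ∉ L a b := fun hy => h ⟨mem_iUnion.2 ⟨a, mem_iUnion.2 ⟨b, hx⟩⟩,
        mem_iUnion.2 ⟨a, mem_iUnion.2 ⟨b, hy⟩⟩⟩
      rw [hL3 a b y hy]; ring
    · rw [hK3 a b x hx]; ring

lemma Test.sm_left (hu : Test O u) (y : dS D) :
    Sm fun x => u x y := by obtain ⟨K, -, -, h⟩ := hu; exact h.1.slice y

lemma Test.sm_right (hu : Test O u) (x : dS D) :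
    Sm (u x) := by obtain ⟨K, -, -, h⟩ := hu; exact h.1.swap.slice x

/-- The left hand side of the equation for `U`, transposed to the test function. -/
lemma boxL_mass_boxR_mass (U : BDist D 0 0) (m : ℂ)
    (hu : Test O u) :
    boxL (boxL (boxR (boxR U - m • U)) - m • boxR (boxR U - m • U)) (bi u)
      = U (bi (box2 (box2 (box1 (box1 u))))) - m * U (bi (box2 (box1 (box1 u))))
        - m * (U (bi (box2 (box2 (box1 u)))) - m * U (bi (box2 (box1 u)))) := by
  have h1 := hu.box1
  have h2 := h1.box1
  have key : ∀ w, Test O w → boxR (boxR U - m • U) (bi w)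
      = U (bi (box2 (box2 w))) - m * U (bi (box2 w)) := by
    intro w hw
    rw [boxR_bi _ hw.sm_right]
    simp only [Pi.sub_apply, Pi.smul_apply, smul_eq_mul]
    rw [boxR_bi _ hw.box2.sm_right]
  rw [boxL_bi _ hu.sm_left]
  simp only [Pi.sub_apply, Pi.smul_apply, smul_eq_mul]
  rw [boxL_bi _ h1.sm_left, key _ h2, key _ h1]

end

section
open scoped ContDiff Pointwise
variable {D : ℕ}
variable {R : ℝ} {f : dS D → ℂ}

/-! ### The volume measure in polar coordinates -/

/-- The part of the cone over `T` in which the radial coordinate is less than `R`. -/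
def sector (R : ℝ) (T : Set (dS D)) : Set (Amb D) :=
  {X | ∃ h : 0 < mink X X, mink X X < R ^ 2 ∧ normalize X h ∈ T}

lemma measurable_normalize {p : Amb D → Prop} (hp : ∀ X, p X → 0 < mink X X) :
    Measurable fun X : {X : Amb D // p X} => normalize X.1 (hp X.1 X.2) := by
  refine Measurable.subtype_mk ?_
  have h : Measurable fun X : Amb D => (√(mink X X))⁻¹ • X :=
    ((continuous_sqrt.comp continuous_minkSelf).measurable.inv).smul measurable_id
  exact h.comp measurable_subtype_coe

lemma measurableSet_cone : MeasurableSet (cone D) := isOpen_cone.measurableSet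

lemma vol_apply {T : Set (dS D)} (hT : MeasurableSet T) :
    vol D T = ((D : ENNReal) + 1) * volume (sector 1 T) := by
  have hm : MeasurableSet {X : Amb D | 0 < mink X X ∧ mink X X < 1} :=
    (isOpen_cone.inter (isOpen_lt continuous_minkSelf continuous_const)).measurableSet
  rw [vol, Measure.smul_apply, Measure.map_apply (measurable_normalize fun X h => h.1) hT,
    smul_eq_mul]
  congr 1
  refine (comap_subtype_coe_apply hm _ _).trans (congrArg _ ?_)
  ext X
  constructor
  · rintro ⟨Y, hY, rfl⟩
    exact ⟨Y.2.1, by simpa using Y.2.2, hY⟩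
  · rintro ⟨h, h1, h2⟩
    exact ⟨⟨X, h, by simpa using h1⟩, h2, rfl⟩

lemma sector_eq_smul (hR : 0 < R) (T : Set (dS D)) : sector R T = R • sector 1 T := by
  ext X
  rw [Set.mem_smul_set_iff_inv_smul_mem₀ hR.ne']
  have hR' := inv_pos.2 hR
  constructor
  · rintro ⟨h, h1, h2⟩
    have h' : 0 < mink (R⁻¹ • X) (R⁻¹ • X) := (smul_mem_cone hR').2 h
    refine ⟨h', ?_, ?_⟩
    · rw [mink_smul_smul, inv_pow, one_pow, inv_mul_lt_iff₀ (by positivity), mul_one]; exact h1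
    · rw [normalize_smul hR' X h h']; exact h2
  · rintro ⟨h', h1, h2⟩
    have h : 0 < mink X X := (smul_mem_cone hR').1 h'
    refine ⟨h, ?_, ?_⟩
    · rw [mink_smul_smul, inv_pow, one_pow, inv_mul_lt_iff₀ (by positivity), mul_one] at h1
      exact h1
    · rw [normalize_smul hR' X h h'] at h2; exact h2

lemma volume_sector (hR : 0 < R) (T : Set (dS D)) :
    volume (sector R T) = ENNReal.ofReal (R ^ (D + 1)) * volume (sector 1 T) := by
  rw [sector_eq_smul hR, Measure.addHaar_smul, Module.finrank_fin_fun, abs_of_pos (by positivity)]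

instance : IsLocallyFiniteMeasure (vol D) := by
  refine ⟨fun x => ?_⟩
  have ho : IsOpen {y : dS D | ‖y.1‖ < ‖x.1‖ + 1} :=
    isOpen_lt (continuous_norm.comp continuous_subtype_val) continuous_const
  refine ⟨_, ho.mem_nhds (by simp), ?_⟩
  rw [vol_apply ho.measurableSet]
  refine ENNReal.mul_lt_top (by simp [lt_top_iff_ne_top]) ?_
  refine lt_of_le_of_lt (measure_mono (t := Metric.ball 0 (‖x.1‖ + 1)) ?_) measure_ball_lt_top
  rintro X ⟨h, h1, h2⟩
  have hr : 0 < √(mink X X) := sqrt_pos.2 h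
  have hr1 : √(mink X X) < 1 := by rw [sqrt_lt' one_pos]; exact h1
  rw [mem_ball_zero_iff]
  have h3 : ‖(√(mink X X))⁻¹ • X‖ < ‖x.1‖ + 1 := h2
  rw [norm_smul, norm_inv, norm_of_nonneg hr.le, inv_mul_lt_iff₀ hr] at h3
  nlinarith [norm_nonneg x.1]

/-- The radial coordinate and the direction of a spacelike vector. -/
def toPolar (X : cone D) : dS D × Ioi (0 : ℝ) :=
  (normalize X.1 X.2, ⟨√(mink X.1 X.1), sqrt_pos.2 X.2⟩)

/-- The vector with given direction and radial coordinate. -/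
def ofPolar (p : dS D × Ioi (0 : ℝ)) : Amb D := p.2.1 • p.1.1

lemma measurable_toPolar : Measurable (toPolar : cone D → dS D × Ioi (0 : ℝ)) := by
  refine Measurable.prodMk (measurable_normalize fun X h => h) (Measurable.subtype_mk ?_)
  exact (continuous_sqrt.comp continuous_minkSelf).measurable.comp measurable_subtype_coe

lemma continuous_ofPolar : Continuous (ofPolar : dS D × Ioi (0 : ℝ) → Amb D) :=
  (continuous_subtype_val.comp continuous_snd).smul (continuous_subtype_val.comp continuous_fst)

lemma ofPolar_toPolar (X : cone D) : ofPolar (toPolar X) = X.1 := by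
  have : √(mink X.1 X.1) ≠ 0 := (sqrt_pos.2 X.2).ne'
  simp [ofPolar, toPolar, normalize, smul_smul, this]

lemma map_toPolar : Measure.map toPolar (volume.comap (Subtype.val : cone D → Amb D))
    = (vol D).prod (Measure.volumeIoiPow D) := by
  symm
  refine Measure.prod_eq_generateFrom MeasurableSpace.generateFrom_measurableSet
    ((borel_eq_generateFrom_Iio _).symm.trans BorelSpace.measurable_eq.symm)
    MeasurableSpace.isPiSystem_measurableSet isPiSystem_Iio
    (vol D).toFiniteSpanningSetsIn (Measure.finiteSpanningSetsIn_volumeIoiPow_range_Iio _)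
    fun T hT => Set.forall_mem_range.2 fun r => ?_
  have hr : 0 < r.1 := r.2
  rw [Measure.map_apply measurable_toPolar (MeasurableSet.prod hT measurableSet_Iio),
    comap_subtype_coe_apply measurableSet_cone, Measure.volumeIoiPow_apply_Iio, vol_apply hT]
  have h : Subtype.val '' (toPolar ⁻¹' (T ×ˢ Set.Iio r)) = sector r.1 T := by
    ext X
    constructor
    · rintro ⟨Y, ⟨h1, h2⟩, rfl⟩
      exact ⟨Y.2, (sqrt_lt' hr).1 h2, h1⟩
    · rintro ⟨h, h1, h2⟩
      exact ⟨⟨X, h⟩, ⟨h2, (sqrt_lt' hr).2 h1⟩, rfl⟩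
  have h0 : (0 : ℝ) < D + 1 := by positivity
  rw [h, volume_sector hr, ENNReal.ofReal_div_of_pos h0]
  have : ENNReal.ofReal ((D : ℝ) + 1) = (D : ENNReal) + 1 := by
    rw [ENNReal.ofReal_add (by positivity) zero_le_one]; simp
  rw [this, div_eq_mul_inv, mul_comm ((D : ENNReal) + 1), mul_assoc, mul_comm ((D : ENNReal) + 1),
    mul_assoc, ENNReal.inv_mul_cancel (by simp) (by simp), mul_one, mul_comm]

lemma map_ofPolar : Measure.map ofPolar ((vol D).prod (Measure.volumeIoiPow D))
    = volume.restrict (cone D) := by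
  rw [← map_toPolar, Measure.map_map continuous_ofPolar.measurable measurable_toPolar,
    show ofPolar ∘ toPolar = (Subtype.val : cone D → Amb D) from funext ofPolar_toPolar,
    map_comap_subtype_coe measurableSet_cone]

lemma integral_cone {F : Amb D → ℂ} (hF : AEStronglyMeasurable F (volume.restrict (cone D))) :
    ∫ X in cone D, F X = ∫ p, F (ofPolar p) ∂((vol D).prod (Measure.volumeIoiPow D)) := by
  rw [← map_ofPolar] at hF ⊢
  exact integral_map continuous_ofPolar.aemeasurable hF

lemma integral_volumeIoiPow (n : ℕ) (g : ℝ → ℂ) :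
    ∫ r : Ioi (0 : ℝ), g r.1 ∂(Measure.volumeIoiPow n) = ∫ r in Ioi (0 : ℝ), (r : ℂ) ^ n * g r := by
  rw [Measure.volumeIoiPow, integral_withDensity_eq_integral_toReal_smul (by fun_prop) (by simp)]
  rw [← integral_subtype_comap measurableSet_Ioi fun r : ℝ => (r : ℂ) ^ n * g r]
  congr 1 with r
  have : 0 ≤ r.1 ^ n := pow_nonneg (le_of_lt r.2) n
  simp [ENNReal.toReal_ofReal this]

/-! ### Integrals over de Sitter space -/

lemma Sm.continuous (hf : Sm f) : Continuous f := by
  have h : Continuous fun x : dS D => ext f x.1 :=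
    ContinuousOn.comp_continuous (s := cone D) (ContDiffOn.continuousOn hf)
      continuous_subtype_val coe_mem_cone
  simpa only [ext_coe] using h

lemma integrable_of_supp {O : Set (dS D)} (hf : Continuous f) (h : Supp O f) :
    Integrable f (vol D) := by
  obtain ⟨K, h1, -, h3⟩ := h
  exact hf.integrable_of_hasCompactSupport (HasCompactSupport.intro h1 h3)

lemma fderiv_sqrt_mink_of_mem {X : Amb D} (hX : 0 < mink X X) (A : Ix D) :
    HasFDerivAt (fun X : Amb D => √(mink X X)) (fderiv ℝ (fun X : Amb D => √(mink X X)) X) X ∧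
    fderiv ℝ (fun X : Amb D => √(mink X X)) X (Pi.single A 1) = eta A * X A / √(mink X X) := by
  have hd : DifferentiableAt ℝ (fun X : Amb D => mink X X) X :=
    contDiff_minkSelf.differentiable (by simp : (1 : WithTop ℕ∞) ≠ 0) X
  refine ⟨(hd.sqrt hX.ne').hasFDerivAt, ?_⟩
  rw [fderiv_sqrt hd hX.ne']
  have h : fderiv ℝ (fun X : Amb D => mink X X) X (Pi.single A 1) = 2 * (eta A * X A) := by
    have h1 : HasFDerivAt (fun X : Amb D => mink X X)
        (∑ B, eta B • ((X B) • ContinuousLinearMap.proj (R := ℝ) (φ := fun _ : Ix D => ℝ) B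
          + (X B) • ContinuousLinearMap.proj (R := ℝ) (φ := fun _ : Ix D => ℝ) B)) X := by
      have : (fun X : Amb D => mink X X) = fun X => ∑ B, eta B * (X B * X B) := by
        funext X; simp only [mink, mul_assoc]
      rw [this]
      refine HasFDerivAt.fun_sum fun B _ => ?_
      exact (((hasFDerivAt_apply B X).mul (hasFDerivAt_apply B X))).const_mul (eta B)
    rw [h1.fderiv]
    simp only [FunLike.coe_sum, Finset.sum_apply]
    rw [sum_eq_single A]
    · simp; ring
    · intro B _ hB; simp [hB]
    · simp
  change 1 / (2 * √(mink X X)) * fderiv ℝ (fun X : Amb D => mink X X) X (Pi.single A 1) = _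
  rw [h]
  ring

end

section
open scoped ContDiff Pointwise
variable {D : ℕ}
variable {r : ℝ} {O : Set (dS D)} {f : dS D → ℂ}

lemma integrable_volumeIoiPow (n : ℕ) (g : ℝ → ℂ) :
    Integrable (fun r : Ioi (0 : ℝ) => g r.1) (Measure.volumeIoiPow n)
      ↔ IntegrableOn (fun r : ℝ => (r : ℂ) ^ n * g r) (Ioi 0) := by
  rw [integrableOn_iff_comap_subtypeVal measurableSet_Ioi, Measure.volumeIoiPow,
    integrable_withDensity_iff_integrable_smul' (by fun_prop) (by simp)]
  refine integrable_congr (Eventually.of_forall fun r => ?_)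
  have : 0 ≤ r.1 ^ n := pow_nonneg (le_of_lt r.2) n
  simp [ENNReal.toReal_ofReal this]

/-- A smooth bump function of the radial coordinate, supported in `[1, 3]`. -/
def bump (r : ℝ) : ℝ := (⟨1 / 2, 1, by norm_num, by norm_num⟩ : ContDiffBump (2 : ℝ)) r

lemma contDiff_bump {n : ℕ∞} : ContDiff ℝ n bump := ContDiffBump.contDiff _

lemma bump_nonneg (r : ℝ) : 0 ≤ bump r := ContDiffBump.nonneg _

lemma bump_ne_zero : bump r ≠ 0 ↔ r ∈ Ioo (1 : ℝ) 3 := by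
  have h := Set.ext_iff.1
    (ContDiffBump.support_eq (⟨1 / 2, 1, by norm_num, by norm_num⟩ : ContDiffBump (2 : ℝ))) r
  rw [Real.ball_eq_Ioo] at h
  norm_num at h
  exact h

lemma bump_eq_zero (h : r ∉ Ioo (1 : ℝ) 3) : bump r = 0 :=
  not_not.1 fun h' => h (bump_ne_zero.1 h')

/-- The derivative of the bump function. -/
def dbump (r : ℝ) : ℝ := deriv bump r

lemma deriv_bump_eq_zero (h : r ∉ Icc (1 : ℝ) 3) : dbump r = 0 := by
  have : bump =ᶠ[𝓝 r] fun _ => 0 := by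
    filter_upwards [isClosed_Icc.isOpen_compl.mem_nhds h] with s hs
    exact bump_eq_zero fun h' => hs (Ioo_subset_Icc_self h')
  rw [dbump, this.deriv_eq]; simp

lemma hasDerivAt_bump (r : ℝ) : HasDerivAt bump (dbump r) r :=
  ((contDiff_bump (n := 1)).differentiable (by simp) r).hasDerivAt

lemma hasCompactSupport_bump_pow (g : ℝ → ℂ) : HasCompactSupport fun r => g r * (bump r : ℂ) :=
  HasCompactSupport.intro (K := Icc 1 3) isCompact_Icc fun r hr => by
    rw [bump_eq_zero fun h => hr (Ioo_subset_Icc_self h)]; simp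

lemma continuous_bump : Continuous bump := (contDiff_bump (n := 0)).continuous

lemma continuous_deriv_bump : Continuous dbump :=
  (contDiff_bump (n := 1)).continuous_deriv le_rfl

lemma integral_deriv_bump (n : ℕ) :
    ∫ r in Ioi (0 : ℝ), (r : ℂ) ^ (n + 1) * (dbump r : ℂ)
      = -((n : ℂ) + 1) * ∫ r in Ioi (0 : ℝ), (r : ℂ) ^ n * (bump r : ℂ) := by
  have z : ∀ r : ℝ, r ∉ Ioi (0 : ℝ) → bump r = 0 ∧ dbump r = 0 := by
    intro r hr
    have hr' : r ≤ 0 := not_lt.1 hr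
    exact ⟨bump_eq_zero fun h => by linarith [h.1], deriv_bump_eq_zero fun h => by linarith [h.1]⟩
  rw [setIntegral_eq_integral_of_forall_compl_eq_zero fun r hr => by rw [(z r hr).2]; simp,
    setIntegral_eq_integral_of_forall_compl_eq_zero fun r hr => by rw [(z r hr).1]; simp]
  have i1 : Integrable fun r : ℝ => (r : ℂ) ^ n * (bump r : ℂ) := by
    refine Continuous.integrable_of_hasCompactSupport ?_ (hasCompactSupport_bump_pow _)
    have := continuous_bump; fun_prop
  have i2 : Integrable fun r : ℝ => (r : ℂ) ^ (n + 1) * (bump r : ℂ) := by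
    refine Continuous.integrable_of_hasCompactSupport ?_ (hasCompactSupport_bump_pow _)
    have := continuous_bump; fun_prop
  have i3 : Integrable fun r : ℝ => (r : ℂ) ^ (n + 1) * (dbump r : ℂ) := by
    refine Continuous.integrable_of_hasCompactSupport ?_ ?_
    · have := continuous_deriv_bump; fun_prop
    · refine HasCompactSupport.intro (K := Icc 1 3) isCompact_Icc fun r hr => ?_
      rw [deriv_bump_eq_zero hr]; simp
  have hd : ∀ r : ℝ, HasDerivAt (fun r : ℝ => (r : ℂ) ^ (n + 1) * (bump r : ℂ))
      ((n + 1 : ℂ) * ((r : ℂ) ^ n * (bump r : ℂ)) + (r : ℂ) ^ (n + 1) * (dbump r : ℂ)) r := by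
    intro r
    have h1 : HasDerivAt (fun r : ℝ => (r : ℂ) ^ (n + 1)) ((n + 1 : ℂ) * (r : ℂ) ^ n) r := by
      have := (hasDerivAt_id r).ofReal_comp.fun_pow (n + 1)
      simpa using this
    exact (h1.mul (hasDerivAt_bump r).ofReal_comp).congr_deriv (by ring)
  have := integral_eq_zero_of_hasDerivAt_of_integrable hd ((i1.const_mul _).add i3) i2
  rw [integral_add (i1.const_mul _) i3, integral_const_mul] at this
  linear_combination this

lemma integral_bump_pow_ne_zero (n : ℕ) :
    ∫ r in Ioi (0 : ℝ), (r : ℂ) ^ n * (bump r : ℂ) ≠ 0 := by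
  have h1 : ∫ r in Ioi (0 : ℝ), (r : ℂ) ^ n * (bump r : ℂ)
      = ((∫ r in Ioi (0 : ℝ), r ^ n * bump r : ℝ) : ℂ) := by
    rw [← integral_complex_ofReal]; simp
  rw [h1, ofReal_ne_zero]
  have hc : Continuous fun r : ℝ => r ^ n * bump r := by have := continuous_bump; fun_prop
  have hi : Integrable fun r : ℝ => r ^ n * bump r := by
    refine hc.integrable_of_hasCompactSupport
      (HasCompactSupport.intro (K := Icc 1 3) isCompact_Icc fun r hr => ?_)
    rw [bump_eq_zero fun h => hr (Ioo_subset_Icc_self h)]; simp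
  refine ne_of_gt ?_
  rw [setIntegral_pos_iff_support_of_nonneg_ae ?_ hi.integrableOn]
  · refine lt_of_lt_of_le ?_ (measure_mono (s := Ioo (3 / 2 : ℝ) (5 / 2)) fun r hr => ?_)
    · rw [Real.volume_Ioo]; norm_num
    · have hr0 : 0 < r := by linarith [hr.1]
      refine ⟨?_, hr0⟩
      have : bump r ≠ 0 := bump_ne_zero.2 ⟨by linarith [hr.1], by linarith [hr.2]⟩
      exact mul_ne_zero (pow_ne_zero _ hr0.ne') this
  · filter_upwards [ae_restrict_mem measurableSet_Ioi] with r hr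
    exact mul_nonneg (pow_nonneg (le_of_lt hr) _) (bump_nonneg _)

lemma Supp.partialD (h : Supp O f) (A : Ix D) :
    Supp O fun x => partialD f x A := by
  obtain ⟨K, h1, h2, h3⟩ := h
  exact ⟨K, h1, h2, fun x hx => partialD_eq_zero h1.isClosed.isOpen_compl h3 hx A⟩

/-- The product of a function on de Sitter space with a bump function of the radial coordinate. -/
def cut (f : dS D → ℂ) (X : Amb D) : ℂ := (bump (√(mink X X)) : ℂ) * ext f X

lemma cut_eventually_zero (f : dS D → ℂ) {X : Amb D} (hX : X ∉ cone D) :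
    cut f =ᶠ[𝓝 X] fun _ => 0 := by
  have hX' : mink X X < 1 := lt_of_le_of_lt (not_lt.1 hX) one_pos
  filter_upwards [(isOpen_lt continuous_minkSelf continuous_const).mem_nhds hX'] with Y hY
  have : √(mink Y Y) ≤ 1 := Real.sqrt_le_one.2 (le_of_lt hY)
  rw [cut, bump_eq_zero fun h => by linarith [h.1]]; simp

lemma cut_contDiff (hf : Sm f) : ContDiff ℝ ∞ (cut f) := by
  rw [contDiff_iff_contDiffAt]
  intro X
  by_cases hX : X ∈ cone D
  · have h1 : ContDiffAt ℝ ∞ (fun X : Amb D => √(mink X X)) X :=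
      (contDiff_minkSelf.contDiffAt).sqrt (show 0 < mink X X from hX).ne'
    have h2 : ContDiffAt ℝ ∞ (fun X : Amb D => bump (√(mink X X))) X :=
      ContDiffAt.comp X contDiff_bump.contDiffAt h1
    exact (ofRealCLM.contDiff.contDiffAt.comp X h2).mul (hf.contDiffAt hX)
  · exact (contDiffAt_const (c := (0 : ℂ))).congr_of_eventuallyEq (cut_eventually_zero f hX)

lemma cut_hasCompactSupport (h : Supp O f) :
    HasCompactSupport (cut f) := by
  obtain ⟨K, h1, -, h3⟩ := h
  refine HasCompactSupport.intro (K := (fun p : ℝ × dS D => p.1 • p.2.1) '' (Icc 1 3 ×ˢ K))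
    ((isCompact_Icc.prod h1).image (by fun_prop)) fun X hX => ?_
  by_contra h0
  obtain ⟨ha, hb⟩ := mul_ne_zero_iff.1 h0
  have hc : 0 < mink X X := by
    by_contra hc; exact hb (by simp [ext, hc])
  rw [ext_of_mem _ hc] at hb
  refine hX ⟨(√(mink X X), normalize X hc), ⟨?_, ?_⟩, ?_⟩
  · by_contra h'
    exact ha (by rw [bump_eq_zero fun h => h' (Ioo_subset_Icc_self h)]; simp)
  · by_contra h'; exact hb (h3 _ h')
  · have : √(mink X X) ≠ 0 := (sqrt_pos.2 hc).ne'
    simp [normalize, smul_smul, this]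

lemma sqrt_mink_smul (hr : 0 < r) (x : dS D) : √(mink (r • x.1) (r • x.1)) = r := by
  rw [mink_smul_smul, x.2, mul_one, sqrt_sq hr.le]

lemma fderiv_cut (hf : Sm f) (A : Ix D) (p : dS D × Ioi (0 : ℝ)) :
    fderiv ℝ (cut f) (ofPolar p) (Pi.single A 1)
      = ((eta A * p.1.1 A : ℂ) * f p.1) * (dbump p.2.1 : ℂ)
        + partialD f p.1 A * ((p.2.1 : ℂ)⁻¹ * (bump p.2.1 : ℂ)) := by
  obtain ⟨x, r, hr⟩ := p
  have hr : 0 < r := hr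
  have hX : r • x.1 ∈ cone D := (smul_mem_cone hr).2 (coe_mem_cone x)
  have hs := sqrt_mink_smul hr x
  obtain ⟨h1, h2⟩ := fderiv_sqrt_mink_of_mem hX A
  have h3 : HasFDerivAt (fun X : Amb D => bump (√(mink X X)))
      (dbump (√(mink (r • x.1) (r • x.1))) • fderiv ℝ (fun X : Amb D => √(mink X X)) (r • x.1))
      (r • x.1) := HasDerivAt.comp_hasFDerivAt (f := fun X : Amb D => √(mink X X)) (r • x.1)
        (hasDerivAt_bump _) h1
  have h4 : HasFDerivAt (fun X : Amb D => (bump (√(mink X X)) : ℂ)) (ofRealCLM.comp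
      (dbump (√(mink (r • x.1) (r • x.1))) • fderiv ℝ (fun X : Amb D => √(mink X X)) (r • x.1)))
      (r • x.1) := ofRealCLM.hasFDerivAt.comp _ h3
  have h5 : HasFDerivAt (cut f) _ (r • x.1) := h4.mul (hf.differentiableAt hX).hasFDerivAt
  have h6 : ext (fun x => partialD f x A) (r • x.1) = partialD f x A := by
    rw [ext_smul _ hr, ext_coe]
  rw [ext_partialD f A hX, hs] at h6
  rw [show ofPolar (x, (⟨r, hr⟩ : Ioi (0 : ℝ))) = r • x.1 from rfl]
  rw [h5.fderiv]
  have hr0 : (r : ℂ) ≠ 0 := ofReal_ne_zero.2 hr.ne'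
  have e1 : ext f (r • x.1) = f x := by rw [ext_smul _ hr, ext_coe]
  rw [← h6]
  simp only [add_apply, smul_apply, ContinuousLinearMap.comp_apply, h2, e1, hs,
    smul_eq_mul, ofRealCLM_apply, Pi.smul_apply]
  push_cast
  field_simp
  ring

/-- The divergence theorem for the tangential derivatives. -/
lemma integral_partialD (hD : 1 ≤ D) (hf : Sm f) (h : Supp O f)
    (A : Ix D) :
    ∫ x, partialD f x A ∂(vol D) = D * ∫ x, (eta A * x.1 A : ℂ) * f x ∂(vol D) := by
  have hc := cut_contDiff hf
  have hs := cut_hasCompactSupport h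
  have hc1 : Continuous fun X => fderiv ℝ (cut f) X (Pi.single A 1) :=
    (hc.continuous_fderiv (by simp)).clm_apply continuous_const
  have hs1 : HasCompactSupport fun X => fderiv ℝ (cut f) X (Pi.single A 1) :=
    (hs.fderiv (𝕜 := ℝ)).comp_left (g := fun L : Amb D →L[ℝ] ℂ => L (Pi.single A 1)) rfl
  have hi1 := hc1.integrable_of_hasCompactSupport (μ := volume) hs1
  have h0 : ∫ X, fderiv ℝ (cut f) X (Pi.single A 1) = 0 := by
    have := integral_mul_fderiv_eq_neg_fderiv_mul_of_integrable (μ := (volume : Measure (Amb D)))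
      (f := fun _ => (1 : ℂ)) (g := cut f) (v := Pi.single A 1) (by simp) (by simpa using hi1)
      (by simpa using hc.continuous.integrable_of_hasCompactSupport hs) (by simp)
      (fun X _ => hc.differentiable (by simp) X)
    simpa using this
  have h1 : ∫ X in cone D, fderiv ℝ (cut f) X (Pi.single A 1) = 0 := by
    rw [← h0]
    refine setIntegral_eq_integral_of_forall_compl_eq_zero fun X hX => ?_
    rw [(cut_eventually_zero f hX).fderiv_eq]; simp
  rw [integral_cone hc1.aestronglyMeasurable] at h1
  simp only [fderiv_cut hf] at h1
  obtain ⟨n, rfl⟩ : ∃ n, D = n + 1 := ⟨D - 1, by omega⟩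
  have j1 : Integrable (fun x : dS (n + 1) => (eta A * x.1 A : ℂ) * f x) (vol (n + 1)) := by
    obtain ⟨K, k1, k2, k3⟩ := h
    refine integrable_of_supp (O := O) ?_ ⟨K, k1, k2, fun x hx => by simp [k3 x hx]⟩
    exact Sm.continuous (show Sm fun x => (eta A * x.1 A : ℂ) * f x from
      (xl A * (⟨f, hf⟩ : smoothFn (n + 1))).2)
  have j2 : Integrable (fun x : dS (n + 1) => partialD f x A) (vol (n + 1)) := by
    exact integrable_of_supp (hf.partialD A).continuous (h.partialD A)
  have e0 : ∀ r ∈ Ioi (0 : ℝ), (r : ℂ) ^ (n + 1) * ((r : ℂ)⁻¹ * (bump r : ℂ))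
      = (r : ℂ) ^ n * (bump r : ℂ) := by
    intro r hr
    have : (r : ℂ) ≠ 0 := ofReal_ne_zero.2 (ne_of_gt hr)
    field_simp
    ring
  have j3 : Integrable (fun r : Ioi (0 : ℝ) => (dbump r.1 : ℂ))
      (Measure.volumeIoiPow (n + 1)) := by
    rw [integrable_volumeIoiPow (n + 1) fun r => (dbump r : ℂ)]
    refine (Continuous.integrable_of_hasCompactSupport ?_ ?_).integrableOn
    · have := continuous_deriv_bump; fun_prop
    · refine HasCompactSupport.intro (K := Icc 1 3) isCompact_Icc fun r hr => ?_
      rw [deriv_bump_eq_zero hr]; simp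
  have j4 : Integrable (fun r : Ioi (0 : ℝ) => (r.1 : ℂ)⁻¹ * (bump r.1 : ℂ))
      (Measure.volumeIoiPow (n + 1)) := by
    rw [integrable_volumeIoiPow (n + 1) fun r => (r : ℂ)⁻¹ * (bump r : ℂ),
      integrableOn_congr_fun e0 measurableSet_Ioi]
    refine (Continuous.integrable_of_hasCompactSupport ?_ (hasCompactSupport_bump_pow _)).integrableOn
    have := continuous_bump; fun_prop
  have p1 := integral_prod_mul (μ := vol (n + 1)) (ν := Measure.volumeIoiPow (n + 1))
    (fun x : dS (n + 1) => (eta A * x.1 A : ℂ) * f x) (fun r => (dbump r.1 : ℂ))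
  have p2 := integral_prod_mul (μ := vol (n + 1)) (ν := Measure.volumeIoiPow (n + 1))
    (fun x : dS (n + 1) => partialD f x A) (fun r => (r.1 : ℂ)⁻¹ * (bump r.1 : ℂ))
  rw [integral_add (j1.mul_prod j3) (j2.mul_prod j4), p1, p2,
    integral_volumeIoiPow (n + 1) fun r => (dbump r : ℂ),
    integral_volumeIoiPow (n + 1) fun r => (r : ℂ)⁻¹ * (bump r : ℂ),
    setIntegral_congr_fun measurableSet_Ioi e0, integral_deriv_bump] at h1
  have hne := integral_bump_pow_ne_zero n
  rw [← sub_eq_zero] at h1 ⊢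
  have := (mul_eq_zero.1 (show (∫ r in Ioi (0 : ℝ), (r : ℂ) ^ n * (bump r : ℂ)) *
    (∫ x, partialD f x A ∂(vol (n + 1)) - ((n + 1 : ℕ) : ℂ) *
      ∫ x, (eta A * x.1 A : ℂ) * f x ∂(vol (n + 1))) = 0 by
        push_cast; linear_combination h1)).resolve_left hne
  exact this

end

section
open scoped ContDiff Pointwise
variable {D : ℕ}
variable {O : Set (dS D)} {P : Fam D} {U : BDist D 0 0} {u : dS D → dS D → ℂ}

  {f p : TField D 2}

/-! ### Transverse traceless test tensors: the identity -/

lemma Supp.mul_left {f : dS D → ℂ} (h : Supp O f) (g : dS D → ℂ) :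
    Supp O fun x => g x * f x := by
  obtain ⟨K, h1, h2, h3⟩ := h
  exact ⟨K, h1, h2, fun x hx => by simp [h3 x hx]⟩

lemma integrable_smoothFn (f : smoothFn D) (h : Supp O f.1) :
    Integrable f.1 (vol D) := integrable_of_supp (Sm.continuous f.2) h

/-- The integral of the divergence of a tangential field vanishes. -/
lemma integral_dv (hD : 1 ≤ D) {T : Ix D → smoothFn D}
    (hT : (ds D).Tan T) (hs : ∀ A, Supp O (T A).1) :
    ∫ x, ((ds D).dv T).1 x ∂(vol D) = 0 := by
  simp only [dv_apply]
  rw [integral_finsetSum _ fun A _ => ((integrable_of_supp ((T A).2.partialD A).continuous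
    ((hs A).partialD A))).const_mul _]
  have hi : ∀ A, Integrable (fun x : dS D => (eta A * x.1 A : ℂ) * (T A).1 x) (vol D) := fun A =>
    integrable_smoothFn (xl A * T A) ((hs A).mul_left _)
  have h1 : ∀ A, ∫ x, (eta A : ℂ) * partialD (T A).1 x A ∂(vol D)
      = D * ∫ x, (eta A : ℂ) * ((eta A * x.1 A : ℂ) * (T A).1 x) ∂(vol D) := by
    intro A
    rw [integral_const_mul, integral_partialD hD (T A).2 (hs A), integral_const_mul]; ring
  simp only [h1]
  rw [← mul_sum, ← integral_finsetSum _ fun A _ => (hi A).const_mul _]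
  have h2 : ∀ x : dS D, ∑ A, (eta A : ℂ) * ((eta A * x.1 A : ℂ) * (T A).1 x) = 0 := by
    intro x
    rw [← (tan_iff T).1 hT x]
    congr 1 with A
    linear_combination x.1 A * (T A).1 x * eta_sq_complex A
  simp [h2]

lemma tt_integrals (hD : 1 ≤ D)
    (hP : (ds D).TT P) (hs : ∀ a b, Supp O (P a b).1) (a b c : Ix D) :
    ∫ x, (P a b).1 x ∂(vol D) = 0 ∧ ∫ x, (xl c).1 x * (P a b).1 x ∂(vol D) = 0 := by
  have hm : ∀ a, (ds D).Tan fun e => (ds D).x a * P e b := fun a => (hP.tan b).const_mul _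
  constructor
  · rw [← integral_dv hD (hm a) fun e => (hs e b).mul_left _, Calc.dv_x_mul _ (hP.tan b), hP.div,
      mul_zero, add_zero]
  · have key : ∀ a b c, ∫ x, (xl c).1 x * (P a b).1 x ∂(vol D)
        = -∫ x, (xl a).1 x * (P c b).1 x ∂(vol D) := by
      intro a b c
      have h1 := integral_dv hD (T := fun e => (ds D).x a * ((ds D).x c * P e b)) (O := O)
        (((hP.tan b).const_mul _).const_mul _)
        fun e => ((hs e b).mul_left (xl c).1).mul_left (xl a).1
      rw [Calc.dv_x_mul _ ((hP.tan b).const_mul _), Calc.dv_x_mul _ (hP.tan b), hP.div, mul_zero,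
        add_zero] at h1
      have h2 : ∫ x, (xl c).1 x * (P a b).1 x + (xl a).1 x * (P c b).1 x ∂(vol D) = 0 := h1
      have i1 : ∀ a b c, Integrable (fun x => (xl c).1 x * (P a b).1 x) (vol D) := fun a b c =>
        integrable_smoothFn (xl c * P a b) ((hs a b).mul_left _)
      rw [integral_add (i1 a b c) (i1 c b a)] at h2
      exact eq_neg_of_add_eq_zero_left h2
    -- a tensor of rank three, symmetric in one pair of slots and antisymmetric in another, vanishes
    refine eq_zero_of_eq_neg ℂ ?_
    nth_rw 1 [key a b c, hP.symm c b, key b c a, neg_neg, hP.symm a c, key c a b, hP.symm b a]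

/-- Transverse traceless tensors are orthogonal to the kernel `a + b Z`. -/
lemma integral_affine_pairing (hD : 1 ≤ D)
    (F : Fam D)
    (hP : (ds D).TT P) (hs : ∀ a b, Supp O (P a b).1) (a b : ℂ) (x : dS D) :
    ∫ y, (a + b * (embZ x y : ℂ)) * pairing F P x y ∂(vol D) = 0 := by
  have h1 : ∀ A B, Integrable (fun y => (a + b * (embZ x y : ℂ)) * (P A B).1 y) (vol D) ∧
      ∫ y, (a + b * (embZ x y : ℂ)) * (P A B).1 y ∂(vol D) = 0 := by
    intro A B
    have e : ∀ y, (a + b * (embZ x y : ℂ)) * (P A B).1 y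
        = a * (P A B).1 y + ∑ E, (b * x.1 E) * ((xl E).1 y * (P A B).1 y) := by
      intro y
      rw [embZ_eq, add_mul, mul_sum, sum_mul]
      congr 1
      congr 1 with E
      rw [xl_apply]; ring
    have i1 := integrable_smoothFn (P A B) (hs A B)
    have i2 : ∀ E, Integrable (fun y => (xl E).1 y * (P A B).1 y) (vol D) := fun E =>
      integrable_smoothFn (xl E * P A B) ((hs A B).mul_left _)
    have i3 : Integrable (fun y => ∑ E, (b * x.1 E) * ((xl E).1 y * (P A B).1 y)) (vol D) :=
      integrable_finsetSum _ fun E _ => (i2 E).const_mul _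
    simp only [e]
    refine ⟨(i1.const_mul a).add i3, ?_⟩
    rw [integral_add (i1.const_mul a) i3, integral_const_mul,
      integral_finsetSum _ fun E _ => (i2 E).const_mul _]
    simp only [integral_const_mul, (tt_integrals hD hP hs A B _).2, (tt_integrals hD hP hs A B 0).1]
    simp
  have e : ∀ y, (a + b * (embZ x y : ℂ)) * pairing F P x y
      = ∑ A, ∑ B, ((eta A : ℂ) * eta B * (F A B).1 x) * ((a + b * (embZ x y : ℂ)) * (P A B).1 y) := by
    intro y
    simp only [pairing, mul_sum]
    exact sum_congr rfl fun _ _ => sum_congr rfl fun _ _ => by ring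
  simp only [e]
  rw [integral_finsetSum _ fun A _ => integrable_finsetSum _ fun B _ => (h1 A B).1.const_mul _]
  refine sum_eq_zero fun A _ => ?_
  rw [integral_finsetSum _ fun B _ => (h1 A B).1.const_mul _]
  refine sum_eq_zero fun B _ => ?_
  rw [integral_const_mul, (h1 A B).2, mul_zero]

lemma IsDistribution.add_bi (hU : IsDistribution O U)
    {u v : dS D → dS D → ℂ} (hu : Test O u) (hv : Test O v) :
    U (bi fun x y => u x y + v x y) = U (bi u) + U (bi v) :=
  hU.map_add _ _ (isBiTest_bi.2 hu) (isBiTest_bi.2 hv)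

lemma IsDistribution.const_mul_bi (hU : IsDistribution O U)
    (hu : Test O u) (c : ℂ) :
    U (bi fun x y => c * u x y) = c * U (bi u) :=
  hU.map_smul c _ (isBiTest_bi.2 hu)

lemma box_ee (F : Fam D) (a b : Ix D) :
    (ds D).box ((ds D).ee F a b) = (ds D).box ((ds D).box (F a b))
      - algebraMap ℂ (smoothFn D) ((D : ℂ) - 2) * (ds D).box (F a b) := by
  rw [Calc.ee, ds_D, ← map_ofNat (algebraMap ℂ (smoothFn D)) 2, ← map_sub, ← Algebra.smul_def,
    ← Algebra.smul_def, Calc.box_sub, Calc.box_smul]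

lemma pairing_box_ee (F P : Fam D) (x y : dS D) :
    pairing (fun a b => (ds D).box ((ds D).ee F a b))
        (fun a b => (ds D).box ((ds D).ee P a b)) x y
      = (box2 (box2 (box1 (box1 (pairing F P)))) x y
          + (-((D : ℂ) - 2)) * box2 (box1 (box1 (pairing F P))) x y)
        + (-((D : ℂ) - 2)) * (box2 (box2 (box1 (pairing F P))) x y
          + (-((D : ℂ) - 2)) * box2 (box1 (pairing F P)) x y) := by
  simp only [box1_pairing, box2_pairing]
  rw [pairing_sub_mul _ _ _ _ _ (box_ee F), pairing_swap, pairing_sub_mul _ _ _ _ _ (box_ee P),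
    pairing_swap _ _ _ y, pairing_sub_mul (H := fun a b => (ds D).box ((ds D).ee P a b))
      _ _ _ _ (box_ee P)]
  simp only [fun F P : Fam D => pairing_swap F P y x]
  ring

lemma pairing_comp (hf : IsTest O f) (hp : IsTest O p)
    (x : dS D) : pairing hf.comp hp.comp x x
      = ∑ A, ∑ B, (eta A : ℂ) * (eta B : ℂ) * f x ![A, B] * p x ![A, B] := by
  simp only [pairing, mul_sum, mul_assoc]
  rfl

lemma kernel_symm' (hD : 4 ≤ D) (U : BDist D 0 0) (hU : U 0 = 0)
    {F P : Fam D} (hF : (ds D).Tan2 F)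
    (hP : (ds D).Tan2 P) (hf : ev2 F = f) (hp : ev2 P = p) :
    projL (projR (mulTTwo U)) (outer (fun x I => f x ![I 1, I 0]) p)
      = projL (projR (mulTTwo U)) (outer f p) := by
  subst hf hp
  exact kernel_symm hD U hU hF hP

lemma kernel_metric (hD : 4 ≤ D) (U : BDist D 0 0) (hU : U 0 = 0) (Φ : smoothFn D)
    (hP : (ds D).Tan2 P)
    (hp : ev2 P = p) {φ : dS D → ℂ} (hφ : ∀ x, Φ.1 x = φ x) :
    projL (projR (mulTTwo U))
      (outer (fun x (I : Fin 2 → Ix D) => (metric x (I 0) (I 1) : ℂ) * φ x) p) = 0 := by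
  subst hp
  have e : (fun x (I : Fin 2 → Ix D) => (metric x (I 0) (I 1) : ℂ) * φ x)
      = ev2 fun a b => (ds D).g a b * Φ := by
    funext x I; rw [← g_apply, ← hφ]; rfl
  have h0 : ptr (fun a b => (ds D).g a b * Φ) = 0 := by
    funext n s
    rw [ptr, (ds D).pt_metric (k1_mul hD) (k2_mul hD), smul_zero]; rfl
  rw [e]
  exact kernel_of_ptr_eq_zero hD U hU
    ⟨fun b => ((ds D).tan_g b).mul _, fun a => ((ds D).tan_g' a).mul _⟩ hP h0

lemma kernel_grad (hD : 4 ≤ D) (U : BDist D 0 0) (hU : U 0 = 0) {X : Ix D → smoothFn D}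
    (hX : (ds D).Tan X) (hP : (ds D).Tan2 P)
    (hp : ev2 P = p) {ξ : TField D 1} (hξ : ∀ x J, ξ x J = (X (J 0)).1 x) :
    projL (projR (mulTTwo U)) (outer (cov ξ) p) = 0 := by
  subst hp
  have e : ξ = ev fun J : Fin 1 → Ix D => X (J 0) := by
    funext x J; exact hξ x J
  have h0 : ptr (fun a b => (ds D).d a (X b) + (ds D).x b * X a) = 0 := by
    funext n s
    rw [ptr, (ds D).pt_grad (k1_mul hD) (k2_mul hD) hX, smul_zero]; rfl
  rw [e, cov_ev X hX]
  exact kernel_of_ptr_eq_zero hD U hU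
    ⟨fun b => (ds D).tan_grad hX b, fun a => (ds D).tan_nab hX a⟩ hP h0

lemma isTTIdentity (hD : 4 ≤ D) (hU : IsDistribution O U)
    {a b : ℂ} (hS : SolvesU O a b U) :
    IsTTIdentity O (-Complex.I • projL (projR (mulTTwo U))) where
  identity f p hf hp := by
    have hF := hf.tt
    have hP := hp.tt
    have hsF := hf.test.comp_supp
    have hsP := hp.test.comp_supp
    have ef := hf.test.ev_comp
    have ep := hp.test.ev_comp
    set F := hf.test.comp with hFd
    set P := hp.test.comp with hPd
    have hu : Test O (pairing F P) := test_pairing hsF hsP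
    have hsym : (fun a b => ptr P b a) = ptr P := by
      rw [← ptr_transpose hP.tan2]
      congr 1; funext a b; exact hP.symm b a
    set G := pairing (fun a b => (ds D).box ((ds D).ee F a b))
      (fun a b => (ds D).box ((ds D).ee P a b)) with hG
    have e : G = _ := funext fun x => funext fun y => pairing_box_ee F P x y
    have t1 := hu.box1.box1.box2.box2
    have t2 := hu.box1.box1.box2
    have t3 := hu.box1.box2.box2
    have t4 := hu.box1.box2
    have h1 : projL (projR (mulTTwo U)) (outer f p)
        = (((D : ℂ) - 3) ^ 2 / (4 * ((D : ℂ) - 2) ^ 2)) * U (bi G) := by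
      rw [← ef, ← ep, kernel_ev2 hD U hU.map_zero hF.tan2 hP.tan2, hsym, ptr_eq hD hF, ptr_eq hD hP,
        ← hU.const_mul_bi (by
          rw [e]; exact (t1.add (t2.const_mul _)).add ((t3.add (t4.const_mul _)).const_mul _))]
      congr 2; funext x y
      rw [pairing_smul, pairing_swap, pairing_smul, pairing_swap, ← hG]
      have h2 : (D : ℂ) - 2 ≠ 0 := by rw [sub_ne_zero]; norm_cast; omega
      field_simp
      ring
    have h2 := hS (bi (pairing F P)) (isBiTest_bi.2 hu)
    simp only [] at h2
    rw [boxL_mass_boxR_mass U _ hu] at h2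
    have h3 : U (bi G) = U (bi (box2 (box2 (box1 (box1 (pairing F P))))))
          - ((D : ℂ) - 2) * U (bi (box2 (box1 (box1 (pairing F P)))))
        - ((D : ℂ) - 2) * (U (bi (box2 (box2 (box1 (pairing F P)))))
          - ((D : ℂ) - 2) * U (bi (box2 (box1 (pairing F P))))) := by
      rw [e, hU.add_bi (t1.add (t2.const_mul _)) ((t3.add (t4.const_mul _)).const_mul _),
        hU.add_bi t1 (t2.const_mul _), hU.const_mul_bi t2,
        hU.const_mul_bi (t3.add (t4.const_mul _)), hU.add_bi t3 (t4.const_mul _),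
        hU.const_mul_bi t4]
      ring
    have h4 : ∀ x, ∫ y, (a + b * (embZ x y : ℂ)) * bi (pairing F P) x y ![] ![] ∂(vol D) = 0 :=
      integral_affine_pairing (by omega) F hP hsP a b
    rw [← h3, ← h1] at h2
    simp only [h4, integral_zero, zero_add] at h2
    rw [Pi.smul_apply, smul_eq_mul, h2, ← mul_assoc, neg_mul, I_mul_I, neg_neg, one_mul]
    exact integral_congr_ae (Eventually.of_forall fun x => pairing_comp hf.test hp.test x)
  symm ψ q hψ hq := by
    rw [Pi.smul_apply, Pi.smul_apply,
      kernel_symm' hD U hU.map_zero hψ.comp_tan hq.comp_tan hψ.ev_comp hq.ev_comp]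
  traceless φ q hφ hq := by
    rw [Pi.smul_apply, kernel_metric hD U hU.map_zero ⟨_, hφ.sm ![]⟩ hq.comp_tan hq.ev_comp
      (fun _ => rfl), smul_zero]
  transverse ξ q hξ hq := by
    have hT : (ds D).Tan fun a => (⟨_, hξ.sm ![a]⟩ : smoothFn D) := by
      refine (tan_iff _).2 fun x => ?_
      rw [← hξ.tangent x ![0] 0]
      refine sum_congr rfl fun A _ => congrArg _ (congrArg (ξ x) ?_)
      funext i; fin_cases i; rfl
    rw [Pi.smul_apply, kernel_grad hD U hU.map_zero hT hq.comp_tan hq.ev_comp, smul_zero]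
    intro x J
    refine congrArg (ξ x) ?_
    funext i; fin_cases i; rfl

/-! ### Invariance of the volume measure -/

lemma mink_single (Y : Amb D) (A : Ix D) : mink (Pi.single A 1) Y = eta A * Y A := by
  rw [mink, sum_eq_single A] <;> simp +contextual

lemma det_sq (Λ : Amb D →ₗ[ℝ] Amb D) (hΛ : ∀ X Y, mink (Λ X) (Λ Y) = mink X Y) :
    LinearMap.det Λ ^ 2 = 1 := by
  have h : (LinearMap.toMatrix' Λ).transpose * Matrix.diagonal (eta : Ix D → ℝ)
      * LinearMap.toMatrix' Λ = Matrix.diagonal eta := by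
    ext A B
    have h1 := hΛ (Pi.single A 1) (Pi.single B 1)
    rw [mink_single] at h1
    rw [Matrix.mul_apply, Matrix.diagonal_apply]
    simp only [Matrix.mul_diagonal, Matrix.transpose_apply]
    have h2 : ∀ C B, LinearMap.toMatrix' Λ C B = Λ (Pi.single B 1) C := fun C B => by
      simp [LinearMap.toMatrix'_apply]
    simp only [h2]
    rw [mink] at h1
    refine Eq.trans (sum_congr rfl fun C _ => by ring) (h1.trans ?_)
    rcases eq_or_ne A B with rfl | h <;> simp [*]
  have hd := congrArg Matrix.det h
  rw [Matrix.det_mul, Matrix.det_mul, Matrix.det_transpose, LinearMap.det_toMatrix'] at hd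
  have hne : (Matrix.diagonal (eta : Ix D → ℝ)).det ≠ 0 := by
    rw [Matrix.det_diagonal, Finset.prod_ne_zero_iff]
    exact fun A _ h0 => by simpa [h0] using eta_mul_self A
  have : (LinearMap.det Λ ^ 2 - 1) * (Matrix.diagonal (eta : Ix D → ℝ)).det = 0 := by
    linear_combination hd
  exact sub_eq_zero.1 ((mul_eq_zero.1 this).resolve_right hne)

lemma continuous_act (Λ : Amb D →ₗ[ℝ] Amb D) (hΛ : ∀ X Y, mink (Λ X) (Λ Y) = mink X Y) :
    Continuous (act Λ hΛ) :=
  (Λ.continuous_of_finiteDimensional.comp continuous_subtype_val).subtype_mk _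

/-- The de Sitter isometries preserve the volume. -/
lemma map_act_vol (Λ : Amb D →ₗ[ℝ] Amb D) (hΛ : ∀ X Y, mink (Λ X) (Λ Y) = mink X Y) :
    Measure.map (act Λ hΛ) (vol D) = vol D := by
  have hdet : |LinearMap.det Λ| = 1 := by
    rw [← sq_eq_sq₀ (abs_nonneg _) zero_le_one, sq_abs, det_sq Λ hΛ, one_pow]
  ext T hT
  rw [Measure.map_apply (continuous_act Λ hΛ).measurable hT, vol_apply hT,
    vol_apply ((continuous_act Λ hΛ).measurable hT)]
  congr 1
  have h1 : sector 1 (act Λ hΛ ⁻¹' T) = Λ ⁻¹' sector 1 T := by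
    ext X
    have hn : ∀ (h : 0 < mink X X) (h' : 0 < mink (Λ X) (Λ X)),
        normalize (Λ X) h' = act Λ hΛ (normalize X h) := fun h h' =>
      Subtype.ext (by simp only [normalize, act, map_smul, hΛ])
    constructor
    · rintro ⟨h, h1, h2⟩
      exact ⟨by rw [hΛ]; exact h, by rw [hΛ]; exact h1, by rw [hn h]; exact h2⟩
    · rintro ⟨h', h1, h2⟩
      have h : 0 < mink X X := by rwa [hΛ] at h'
      exact ⟨h, by rwa [hΛ] at h1, by rwa [hn h] at h2⟩
  have hne : LinearMap.det Λ ≠ 0 := fun h0 => by simp [h0] at hdet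
  rw [h1, Measure.addHaar_preimage_linearMap _ hne, abs_inv, hdet]
  simp

end

section
open scoped ContDiff
variable {Ω : Type*} [MeasurableSpace Ω] {D : ℕ} {μ : Measure Ω} {Z : Ω → ℝ} {s B σ R : ℝ}
variable {f : ℕ → Ω → ℂ} {g : Ω → ℂ}

/-! ### Oscillatory integrals and their asymptotics -/

/-- A sequence `f` of integrable functions and a bounded function `Z` on a measure space such that,
weakly on functions of `Z`, `f (i + 1)` is the d'Alembertian of `f i`: the operator
`(1 - Z²) ∂_Z² - D Z ∂_Z` is the d'Alembertian on functions of the embedding distance. -/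
structure WaveChain (D : ℕ) (μ : Measure Ω) (Z : Ω → ℝ) (R : ℝ) (f : ℕ → Ω → ℂ) : Prop where
  meas : Measurable Z
  bound : ∀ᵐ x ∂μ, |Z x| ≤ R
  int : ∀ i, Integrable (f i) μ
  green : ∀ i (F : ℝ → ℂ), ContDiff ℝ ∞ F → ∫ x, F (Z x) * f (i + 1) x ∂μ
    = ∫ x, ((1 - (Z x : ℂ) ^ 2) * deriv (deriv F) (Z x) - D * (Z x : ℂ) * deriv F (Z x)) * f i x ∂μ

/-- The oscillatory integral `∫ exp(-i s Z) f`. -/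
def osc (μ : Measure Ω) (Z : Ω → ℝ) (f : Ω → ℂ) (s : ℝ) : ℂ :=
  ∫ x, exp (-(I * s * Z x)) * f x ∂μ

lemma norm_exp_osc (s t : ℝ) : ‖exp (-(I * s * t))‖ = 1 := by
  simp [norm_exp]

lemma aesm_exp_osc (hZ : Measurable Z) (s : ℝ) :
    AEStronglyMeasurable (fun x => exp (-(I * s * Z x))) μ := by
  exact Measurable.aestronglyMeasurable (by fun_prop)

lemma integrable_osc (hZ : Measurable Z)
    (hf : Integrable g μ) (s : ℝ) :
    Integrable (fun x => exp (-(I * s * Z x)) * g x) μ :=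
  hf.bdd_mul (c := 1) (aesm_exp_osc hZ s) (.of_forall fun x => (norm_exp_osc s (Z x)).le)

lemma norm_osc_le (g : Ω → ℂ) (s : ℝ) :
    ‖osc μ Z g s‖ ≤ ∫ x, ‖g x‖ ∂μ := by
  simpa [osc, norm_exp_osc] using norm_integral_le_integral_norm (μ := μ) fun x => exp (-(I * s * Z x)) * g x

/-- The product with `-i Z`. -/
def mulZ (Z : Ω → ℝ) (f : Ω → ℂ) (x : Ω) : ℂ := -(I * Z x) * f x

lemma integrable_mulZ (hZ : Measurable Z)
    (hR : ∀ᵐ x ∂μ, |Z x| ≤ R) (hf : Integrable g μ) : Integrable (mulZ Z g) μ := by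
  refine hf.bdd_mul (c := R) (Measurable.aestronglyMeasurable (by fun_prop)) ?_
  filter_upwards [hR] with x h
  simpa using h

lemma integral_norm_mulZ_le (hZ : Measurable Z)
    (hR : ∀ᵐ x ∂μ, |Z x| ≤ R) (hf : Integrable g μ) :
    ∫ x, ‖mulZ Z g x‖ ∂μ ≤ R * ∫ x, ‖g x‖ ∂μ := by
  rw [← integral_const_mul]
  refine integral_mono_ae (integrable_mulZ hZ hR hf).norm (hf.norm.const_mul R) ?_
  filter_upwards [hR] with x h
  simp only [mulZ, norm_mul, norm_neg, norm_I, one_mul, norm_real, norm_eq_abs]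
  gcongr

lemma hasDerivAt_osc (hZ : Measurable Z)
    (hR : ∀ᵐ x ∂μ, |Z x| ≤ R) (hf : Integrable g μ) (s : ℝ) :
    HasDerivAt (osc μ Z g) (osc μ Z (mulZ Z g) s) s := by
  refine (hasDerivAt_integral_of_dominated_loc_of_deriv_le (s := Set.univ)
    (bound := fun x => ‖mulZ Z g x‖)
    (F' := fun s x => exp (-(I * (s : ℝ) * Z x)) * mulZ Z g x)
    univ_mem (.of_forall fun s => (integrable_osc hZ hf s).aestronglyMeasurable)
    (integrable_osc hZ hf s) (integrable_osc hZ (integrable_mulZ hZ hR hf) s).aestronglyMeasurable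
    (.of_forall fun x s _ => ?_) (integrable_mulZ hZ hR hf).norm
    (.of_forall fun x s _ => ?_)).2
  · rw [norm_mul, norm_exp_osc, one_mul]
  · have h1 : HasDerivAt (fun s : ℝ => -(I * (s : ℂ) * Z x)) (-(I * 1 * Z x)) s :=
      (((ofRealCLM.hasDerivAt (x := s)).const_mul I).mul_const _).neg
    have h2 := (h1.cexp).mul_const (g x)
    refine h2.congr_deriv ?_
    rw [mulZ]; ring

namespace WaveChain

lemma osc_ode (h : WaveChain D μ Z R f) (i : ℕ) (s : ℝ) :
    (s : ℂ) ^ 2 * osc μ Z (mulZ Z (mulZ Z (f i))) s + D * s * osc μ Z (mulZ Z (f i)) s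
      + (s : ℂ) ^ 2 * osc μ Z (f i) s = -osc μ Z (f (i + 1)) s := by
  set F : ℝ → ℂ := fun t => exp (-(I * s * t)) with hF
  have hd : ∀ t, HasDerivAt F (-(I * s) * F t) t := fun t => by
    have h1 : HasDerivAt (fun t : ℝ => -(I * s * (t : ℂ))) (-(I * s * 1)) t :=
      ((ofRealCLM.hasDerivAt (x := t)).const_mul (I * s)).neg
    exact h1.cexp.congr_deriv (by simp only [hF]; ring)
  have e1 : deriv F = fun t => -(I * s) * F t := funext fun t => (hd t).deriv
  have e2 : deriv (deriv F) = fun t => -(I * s) * (-(I * s) * F t) := by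
    rw [e1]; exact funext fun t => ((hd t).const_mul _).deriv
  have hg := h.green i F (by
    have : ContDiff ℝ ∞ fun t : ℝ => (t : ℂ) := ofRealCLM.contDiff
    simp only [hF]; fun_prop)
  have i0 := integrable_osc h.meas (h.int i) s
  have i1 := integrable_osc h.meas (integrable_mulZ h.meas h.bound (h.int i)) s
  have i2 := integrable_osc h.meas (integrable_mulZ h.meas h.bound
    (integrable_mulZ h.meas h.bound (h.int i))) s
  rw [e2, e1] at hg
  rw [osc, osc, osc, osc, hg, ← integral_const_mul, ← integral_const_mul, ← integral_const_mul,
    ← integral_neg, ← integral_add (i2.const_mul _) (i1.const_mul _)]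
  have i12 := (i2.const_mul ((s : ℂ) ^ 2)).add (i1.const_mul (D * (s : ℂ)))
  refine (integral_add i12 (i0.const_mul ((s : ℂ) ^ 2))).symm.trans ?_
  congr 1 with x
  simp only [hF, mulZ, Pi.add_apply]
  linear_combination (s : ℂ) ^ 2 * exp (-(I * s * Z x)) * f i x * I_sq

end WaveChain

/-- The oscillatory integral, normalized by the power `s^{D/2}` of its decay. -/
def psi (D : ℕ) (μ : Measure Ω) (Z : Ω → ℝ) (f : Ω → ℂ) (s : ℝ) : ℂ :=
  ((s ^ ((D : ℝ) / 2) : ℝ) : ℂ) * osc μ Z f s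

/-- The derivative of `psi`. -/
def dpsi (D : ℕ) (μ : Measure Ω) (Z : Ω → ℝ) (f : Ω → ℂ) (s : ℝ) : ℂ :=
  ((s ^ ((D : ℝ) / 2) : ℝ) : ℂ) * (osc μ Z (mulZ Z f) s + (D : ℂ) / 2 * (s : ℂ)⁻¹ * osc μ Z f s)

lemma hasDerivAt_rpow_half (D : ℕ) (hs : 0 < s) :
    HasDerivAt (fun s : ℝ => ((s ^ ((D : ℝ) / 2) : ℝ) : ℂ))
      ((D : ℂ) / 2 * (s : ℂ)⁻¹ * ((s ^ ((D : ℝ) / 2) : ℝ) : ℂ)) s := by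
  have := (hasDerivAt_rpow_const (x := s) (p := (D : ℝ) / 2) (Or.inl hs.ne')).ofReal_comp
  refine this.congr_deriv ?_
  rw [rpow_sub_one hs.ne']
  push_cast
  field_simp

/-- The sum of the `L¹` norms of the first functions of a sequence. -/
def l1Sum (μ : Measure Ω) (f : ℕ → Ω → ℂ) (i : ℕ) : ℝ :=
  ∑ j ∈ Finset.range (i + 1), ∫ x, ‖f j x‖ ∂μ

lemma l1Sum_mono (μ : Measure Ω) (f : ℕ → Ω → ℂ) : Monotone (l1Sum μ f) := fun i j h =>
  Finset.sum_le_sum_of_subset_of_nonneg (by simpa using h)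
    fun _ _ _ => integral_nonneg fun _ => norm_nonneg _

lemma le_l1Sum (μ : Measure Ω) (f : ℕ → Ω → ℂ) {i j : ℕ} (h : i ≤ j) :
    ∫ x, ‖f i x‖ ∂μ ≤ l1Sum μ f j :=
  single_le_sum (f := fun j => ∫ x, ‖f j x‖ ∂μ)
    (fun _ _ => integral_nonneg fun _ => norm_nonneg _) (by simpa using by omega)

lemma l1Sum_nonneg (μ : Measure Ω) (f : ℕ → Ω → ℂ) (i : ℕ) : 0 ≤ l1Sum μ f i :=
  sum_nonneg fun _ _ => integral_nonneg fun _ => norm_nonneg _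

/-- A function with derivative of order `s^{β - 1}`. -/
lemma norm_le_of_deriv_le_rpow {E E' : ℝ → ℂ} {C β : ℝ} (hβ : β ≠ 0)
    (hE : ∀ s, 1 ≤ s → HasDerivAt E (E' s) s) (h : ∀ s, 1 ≤ s → ‖E' s‖ ≤ C * s ^ (β - 1))
    (hs : 1 ≤ s) : ‖E s‖ ≤ ‖E 1‖ + C * (s ^ β - 1) / β := by
  refine image_norm_le_of_norm_deriv_right_le_deriv_boundary' (a := 1) (b := s) (f := E) (f' := E')
    (B := fun s => ‖E 1‖ + C * (s ^ β - 1) / β) (B' := fun s => C * s ^ (β - 1))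
    (fun x hx => (hE x hx.1).continuousAt.continuousWithinAt)
    (fun x hx => (hE x hx.1).hasDerivWithinAt) (by simp) ?_ ?_ (fun x hx => h x hx.1) ⟨hs, le_rfl⟩
  · intro x hx
    have : x ≠ 0 := (one_pos.trans_le hx.1).ne'
    exact ContinuousAt.continuousWithinAt (by fun_prop (disch := simp [this]))
  · intro x hx
    have hx0 : x ≠ 0 := (one_pos.trans_le hx.1).ne'
    have := (((hasDerivAt_rpow_const (x := x) (p := β) (Or.inl hx0)).sub_const 1).const_mul
      C).div_const β
    refine (this.const_add ‖E 1‖).hasDerivWithinAt.congr_deriv ?_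
    field_simp

namespace WaveChain

lemma hasDerivAt_psi (h : WaveChain D μ Z R f) (i : ℕ) (hs : 0 < s) :
    HasDerivAt (psi D μ Z (f i)) (dpsi D μ Z (f i) s) s := by
  refine ((hasDerivAt_rpow_half D hs).mul (hasDerivAt_osc h.meas h.bound (h.int i) s)).congr_deriv ?_
  rw [dpsi]; ring

lemma hasDerivAt_dpsi (h : WaveChain D μ Z R f) (i : ℕ) (hs : 0 < s) :
    HasDerivAt (dpsi D μ Z (f i)) (-psi D μ Z (f i) s + (s : ℂ)⁻¹ ^ 2 *
      ((D : ℂ) / 2 * ((D : ℂ) / 2 - 1) * psi D μ Z (f i) s - psi D μ Z (f (i + 1)) s)) s := by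
  have h1 := hasDerivAt_osc h.meas h.bound (h.int i) s
  have h2 := hasDerivAt_osc h.meas h.bound (integrable_mulZ h.meas h.bound (h.int i)) s
  have hs' : (s : ℂ) ≠ 0 := by exact_mod_cast hs.ne'
  have h3 : HasDerivAt (fun s : ℝ => (D : ℂ) / 2 * (s : ℂ)⁻¹) ((D : ℂ) / 2 * (-1 / (s : ℂ) ^ 2)) s :=
    ((ofRealCLM.hasDerivAt (x := s)).fun_inv hs').const_mul _
  refine ((hasDerivAt_rpow_half D hs).mul (h2.add (h3.mul h1))).congr_deriv ?_
  have ho := h.osc_ode i s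
  simp only [psi]
  have e : osc μ Z (f (i + 1)) s = -((s : ℂ) ^ 2 * osc μ Z (mulZ Z (mulZ Z (f i))) s
      + D * s * osc μ Z (mulZ Z (f i)) s + (s : ℂ) ^ 2 * osc μ Z (f i) s) := by rw [ho, neg_neg]
  rw [e]
  simp only [Pi.add_apply, Pi.mul_apply]
  field_simp
  ring

end WaveChain

/-- The amplitudes `e^{iσs} (ψ' - iσψ)`, for `σ = ±1`, which converge at infinity. -/
def amp (D : ℕ) (μ : Measure Ω) (Z : Ω → ℝ) (f : Ω → ℂ) (σ s : ℝ) : ℂ :=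
  exp (I * σ * s) * (dpsi D μ Z f s - I * σ * psi D μ Z f s)

lemma norm_exp_amp (s t : ℝ) : ‖exp (I * s * t)‖ = 1 := by
  simp [norm_exp]

lemma norm_psi_le_amp (D : ℕ) (μ : Measure Ω) (Z : Ω → ℝ) (f : Ω → ℂ) (s : ℝ)
    (h : ∀ σ : ℝ, σ ^ 2 = 1 → ‖amp D μ Z f σ s‖ ≤ B) : ‖psi D μ Z f s‖ ≤ B := by
  have h1 := h 1 (by norm_num)
  have h2 := h (-1) (by norm_num)
  rw [amp, norm_mul, norm_exp_amp, one_mul] at h1 h2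
  have e : psi D μ Z f s = ((dpsi D μ Z f s - I * ((-1 : ℝ) : ℂ) * psi D μ Z f s)
      - (dpsi D μ Z f s - I * ((1 : ℝ) : ℂ) * psi D μ Z f s)) / (2 * I) := by
    push_cast
    field_simp
    ring
  rw [e, norm_div, div_le_iff₀ (by simp)]
  refine (norm_sub_le _ _).trans ?_
  simp
  simp at h1 h2
  linarith

namespace WaveChain

lemma hasDerivAt_amp (h : WaveChain D μ Z R f) (i : ℕ) (hσ : σ ^ 2 = 1)
    (hs : 0 < s) : HasDerivAt (amp D μ Z (f i) σ) (exp (I * σ * s) * ((s : ℂ)⁻¹ ^ 2 *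
      ((D : ℂ) / 2 * ((D : ℂ) / 2 - 1) * psi D μ Z (f i) s - psi D μ Z (f (i + 1)) s))) s := by
  have h1 : HasDerivAt (fun t : ℝ => I * σ * (t : ℂ)) (I * σ * 1) s :=
    (ofRealCLM.hasDerivAt (x := s)).const_mul (I * σ)
  refine (h1.cexp.mul ((h.hasDerivAt_dpsi i hs).sub
    ((h.hasDerivAt_psi i hs).const_mul (I * σ)))).congr_deriv ?_
  have hσ' : (σ : ℂ) ^ 2 = 1 := by exact_mod_cast hσ
  simp only [Pi.sub_apply]
  linear_combination exp (I * σ * s) * psi D μ Z (f i) s *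
    (-(σ : ℂ) ^ 2 * I_sq + hσ')

lemma norm_amp_one_le (h : WaveChain D μ Z R f) (hR : 0 ≤ R) (i : ℕ) (hσ : σ ^ 2 = 1) :
    ‖amp D μ Z (f i) σ 1‖ ≤ (R + D / 2 + 1) * l1Sum μ f i := by
  have hσ' : |σ| = 1 := by rw [← sq_eq_sq₀ (abs_nonneg _) zero_le_one, sq_abs, hσ, one_pow]
  rw [amp, norm_mul, norm_exp_amp, one_mul, psi, dpsi]
  have e1 : ‖osc μ Z (f i) 1‖ ≤ l1Sum μ f i := (norm_osc_le _ _).trans (le_l1Sum μ f le_rfl)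
  have e2 : ‖osc μ Z (mulZ Z (f i)) 1‖ ≤ R * l1Sum μ f i :=
    (norm_osc_le _ _).trans ((integral_norm_mulZ_le h.meas h.bound (h.int i)).trans
      (mul_le_mul_of_nonneg_left (le_l1Sum μ f le_rfl) hR))
  simp only [Real.one_rpow, ofReal_one, one_mul, inv_one, mul_one]
  refine (norm_sub_le _ _).trans ?_
  have e3 : ‖I * σ * osc μ Z (f i) 1‖ = ‖osc μ Z (f i) 1‖ := by simp [hσ']
  have e4 : ‖(D : ℂ) / 2 * osc μ Z (f i) 1‖ = D / 2 * ‖osc μ Z (f i) 1‖ := by simp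
  have e5 : (D : ℝ) / 2 * ‖osc μ Z (f i) 1‖ ≤ D / 2 * l1Sum μ f i := by gcongr
  have e6 := norm_add_le (osc μ Z (mulZ Z (f i)) 1) ((D : ℂ) / 2 * osc μ Z (f i) 1)
  rw [e3]; rw [e4] at e6
  nlinarith

/-- Bounds `s^a` of the normalized integrals bound the derivatives of the amplitudes. -/
lemma norm_deriv_amp_le {k : ℕ} {a C : ℝ} (hC : 0 ≤ C)
    (h0 : ∀ i s, 1 ≤ s → ‖psi D μ Z (f i) s‖ ≤ C * l1Sum μ f (i + k) * s ^ a) (i : ℕ) (σ : ℝ)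
    (hs : 1 ≤ s) : ‖exp (I * σ * s) * ((s : ℂ)⁻¹ ^ 2 *
      ((D : ℂ) / 2 * ((D : ℂ) / 2 - 1) * psi D μ Z (f i) s - psi D μ Z (f (i + 1)) s))‖
      ≤ (|(D : ℝ) / 2 * (D / 2 - 1)| + 1) * (C * l1Sum μ f (i + (k + 1))) * s ^ (a - 1 - 1) := by
  have hs0 : 0 < s := one_pos.trans_le hs
  have h1 := h0 i s hs
  have h2 := h0 (i + 1) s hs
  rw [add_right_comm, add_assoc] at h2
  rw [norm_mul, norm_exp_amp, one_mul, norm_mul, norm_pow, norm_inv, norm_real,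
    norm_of_nonneg hs0.le, rpow_sub_one hs0.ne', rpow_sub_one hs0.ne']
  have e : ‖(D : ℂ) / 2 * ((D : ℂ) / 2 - 1)‖ = |(D : ℝ) / 2 * (D / 2 - 1)| := by
    rw [← norm_eq_abs, ← norm_real]; push_cast; rfl
  have h3 := l1Sum_mono μ f (show i + k ≤ i + (k + 1) by omega)
  have := l1Sum_nonneg μ f (i + k)
  calc _ ≤ s⁻¹ ^ 2 * (|(D : ℝ) / 2 * (D / 2 - 1)| * (C * l1Sum μ f (i + (k + 1)) * s ^ a)
        + C * l1Sum μ f (i + (k + 1)) * s ^ a) := by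
        refine mul_le_mul_of_nonneg_left ((norm_sub_le _ _).trans (add_le_add ?_ h2)) (by positivity)
        rw [norm_mul, e]
        gcongr
        exact h1.trans (by gcongr)
    _ = _ := by field_simp

lemma norm_amp_le (h : WaveChain D μ Z R f) (hR : 0 ≤ R) {k : ℕ} {a C : ℝ} (hC : 0 ≤ C)
    (h0 : ∀ i s, 1 ≤ s → ‖psi D μ Z (f i) s‖ ≤ C * l1Sum μ f (i + k) * s ^ a) (ha : a - 1 ≠ 0)
    (i : ℕ) (hσ : σ ^ 2 = 1) (hs : 1 ≤ s) : ‖amp D μ Z (f i) σ s‖ ≤ (R + D / 2 + 1 +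
      (|(D : ℝ) / 2 * (D / 2 - 1)| + 1) * C * ((s ^ (a - 1) - 1) / (a - 1)))
        * l1Sum μ f (i + (k + 1)) := by
  have h1 := norm_le_of_deriv_le_rpow ha (fun t ht => h.hasDerivAt_amp i hσ (one_pos.trans_le ht))
    (fun t ht => norm_deriv_amp_le hC h0 i σ ht) hs
  have h2 := (h.norm_amp_one_le hR i hσ).trans (mul_le_mul_of_nonneg_left
    (l1Sum_mono μ f (Nat.le_add_right i (k + 1))) (by positivity))
  exact h1.trans ((add_le_add_left h2 _).trans_eq (by ring))

end WaveChain

lemma exists_psi_le_rpow (Ω : Type*) [MeasurableSpace Ω] (D : ℕ) {R : ℝ} (hR : 0 ≤ R) (k : ℕ)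
    (hk : k ≤ D) :
    ∃ C, 0 ≤ C ∧ ∀ (μ : Measure Ω) (Z : Ω → ℝ) (f : ℕ → Ω → ℂ), WaveChain D μ Z R f → ∀ i s, 1 ≤ s →
      ‖psi D μ Z (f i) s‖ ≤ C * l1Sum μ f (i + k) * s ^ ((D : ℝ) + 1 / 2 - k) := by
  induction k with
  | zero =>
    refine ⟨1, zero_le_one, fun μ Z f h i s hs => ?_⟩
    have hs0 : 0 < s := one_pos.trans_le hs
    rw [psi, norm_mul, norm_real, norm_of_nonneg (by positivity), one_mul, mul_comm]
    have : (D : ℝ) / 2 ≤ D + 1 / 2 - (0 : ℕ) := by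
      have : (0 : ℝ) ≤ D := D.cast_nonneg
      push_cast; linarith
    exact mul_le_mul ((norm_osc_le _ _).trans (le_l1Sum μ f le_rfl))
      (Real.rpow_le_rpow_of_exponent_le hs this) (by positivity) (l1Sum_nonneg _ _ _)
  | succ k ih =>
    obtain ⟨C, hC, h0⟩ := ih (by omega)
    refine ⟨R + D / 2 + 1 + 2 * ((|(D : ℝ) / 2 * (D / 2 - 1)| + 1) * C), by positivity,
      fun μ Z f h i s hs => ?_⟩
    set a : ℝ := (D : ℝ) + 1 / 2 - k with ha
    have hk' : ((k + 1 : ℕ) : ℝ) ≤ D := by exact_mod_cast hk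
    push_cast at hk'
    rw [show (D : ℝ) + 1 / 2 - ((k + 1 : ℕ) : ℝ) = a - 1 by rw [ha]; push_cast; ring]
    refine norm_psi_le_amp D μ Z (f i) s fun σ hσ =>
      (h.norm_amp_le hR hC (h0 μ Z f h) (by linarith) i hσ hs).trans ?_
    refine (mul_le_mul_of_nonneg_right ?_ (l1Sum_nonneg μ f _)).trans_eq (mul_right_comm _ _ _)
    have h3 : 1 ≤ s ^ (a - 1) := Real.one_le_rpow hs (by linarith)
    have h4 : (s ^ (a - 1) - 1) / (a - 1) ≤ 2 * s ^ (a - 1) := by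
      rw [div_le_iff₀ (by linarith)]
      nlinarith
    have h5 : 0 ≤ (|(D : ℝ) / 2 * (D / 2 - 1)| + 1) * C := by positivity
    have h6 : 0 ≤ R + D / 2 + 1 := by positivity
    linarith [mul_le_mul_of_nonneg_left h4 h5, mul_le_mul_of_nonneg_left h3 h6]

/-- Integration by parts against the wave operator gains decay until the oscillatory integral
is of order `s^{-D/2}`. -/
lemma exists_amp_le (Ω : Type*) [MeasurableSpace Ω] (D : ℕ) {R : ℝ} (hR : 0 ≤ R) :
    ∃ C, 0 ≤ C ∧ ∀ (μ : Measure Ω) (Z : Ω → ℝ) (f : ℕ → Ω → ℂ), WaveChain D μ Z R f → ∀ i s, 1 ≤ s →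
      ∀ σ : ℝ, σ ^ 2 = 1 → ‖amp D μ Z (f i) σ s‖ ≤ C * l1Sum μ f (i + (D + 1)) := by
  obtain ⟨C, hC, h0⟩ := exists_psi_le_rpow Ω D hR D le_rfl
  refine ⟨R + D / 2 + 1 + (|(D : ℝ) / 2 * (D / 2 - 1)| + 1) * C * 2, by positivity,
    fun μ Z f h i s hs σ hσ => (h.norm_amp_le hR hC (h0 μ Z f h) (by norm_num) i hσ hs).trans ?_⟩
  refine mul_le_mul_of_nonneg_right ?_ (l1Sum_nonneg _ _ _)
  gcongr
  rw [div_le_iff_of_neg (by norm_num)]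
  have : 0 ≤ s ^ ((D : ℝ) + 1 / 2 - D - 1) := by positivity
  linarith

end

section
open scoped ContDiff
variable {D : ℕ}
variable {Y : Amb D} {F : ℝ → ℂ} {O : Set (dS D)}

section amplitude

variable {Ω : Type*} [MeasurableSpace Ω] {μ : Measure Ω} {Z : Ω → ℝ} {R : ℝ} {f : ℕ → Ω → ℂ}

/-- The limit of the amplitude at infinity. -/
def ampInf (D : ℕ) (μ : Measure Ω) (Z : Ω → ℝ) (f : Ω → ℂ) (σ : ℝ) : ℂ :=
  limUnder atTop (amp D μ Z f σ)

lemma exists_tendsto_of_deriv_le {E E' : ℝ → ℂ} {C : ℝ}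
    (hE : ∀ s, 1 ≤ s → HasDerivAt E (E' s) s) (h : ∀ s, 1 ≤ s → ‖E' s‖ ≤ C * (s ^ 2)⁻¹) :
    ∃ L, Tendsto E atTop (𝓝 L) ∧ ∀ s, 1 ≤ s → ‖L - E s‖ ≤ C * s⁻¹ := by
  have hC : 0 ≤ C := by simpa using (norm_nonneg _).trans (h 1 le_rfl)
  have key : ∀ s t, 1 ≤ s → s ≤ t → ‖E t - E s‖ ≤ C * s⁻¹ := by
    intro s t hs hst
    have hs0 : 0 < s := lt_of_lt_of_le one_pos hs
    have := image_norm_le_of_norm_deriv_right_le_deriv_boundary' (a := s) (b := t)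
      (f := fun t => E t - E s) (f' := E') (B := fun t => C * (s⁻¹ - t⁻¹))
      (B' := fun t => C * (t ^ 2)⁻¹)
      (fun x hx => ((hE x (hs.trans hx.1)).sub_const _).continuousAt.continuousWithinAt)
      (fun x hx => ((hE x (hs.trans hx.1)).sub_const _).hasDerivWithinAt) (by simp) ?_ ?_
      (fun x hx => h x (hs.trans hx.1)) ⟨hst, le_rfl⟩
    · refine this.trans (mul_le_mul_of_nonneg_left ?_ hC)
      have : 0 < t⁻¹ := inv_pos.2 (hs0.trans_le hst)
      linarith
    · intro x hx
      have : x ≠ 0 := (hs0.trans_le hx.1).ne'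
      exact ContinuousAt.continuousWithinAt (by fun_prop (disch := simp [this]))
    · intro x hx
      have hx0 : x ≠ 0 := (hs0.trans_le hx.1).ne'
      have := ((hasDerivAt_inv hx0).const_sub s⁻¹).const_mul C
      exact this.hasDerivWithinAt.congr_deriv (by ring)
  have hc : CauchySeq fun s => E (max 1 s) := by
    refine cauchySeq_of_le_tendsto_0' (fun s => C * (max 1 s)⁻¹) (fun s t hst => ?_) ?_
    · rw [dist_comm, dist_eq_norm]
      exact key _ _ (le_max_left _ _) (max_le_max le_rfl hst)
    · have h1 : Tendsto (fun s : ℝ => max 1 s) atTop atTop :=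
        tendsto_atTop_mono (le_max_right 1) tendsto_id
      simpa using (tendsto_inv_atTop_zero.comp h1).const_mul C
  obtain ⟨L, hL⟩ := cauchySeq_tendsto_of_complete hc
  have hL' : Tendsto E atTop (𝓝 L) := hL.congr' (by
    filter_upwards [eventually_ge_atTop 1] with s hs
    rw [max_eq_right hs])
  refine ⟨L, hL', fun s hs => le_of_tendsto ((hL'.sub_const (E s)).norm) ?_⟩
  filter_upwards [eventually_ge_atTop s] with t ht
  exact key s t hs ht

/-- The convergence of the amplitudes, with rate. -/
lemma exists_amp_sub_le (Ω : Type*) [MeasurableSpace Ω] (D : ℕ) {R : ℝ} (hR : 0 ≤ R) :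
    ∃ C, 0 ≤ C ∧ ∀ (μ : Measure Ω) (Z : Ω → ℝ) (f : ℕ → Ω → ℂ), WaveChain D μ Z R f → ∀ i,
      ∀ σ : ℝ, σ ^ 2 = 1 →
        Tendsto (amp D μ Z (f i) σ) atTop (𝓝 (ampInf D μ Z (f i) σ)) ∧ ∀ s, 1 ≤ s →
          ‖ampInf D μ Z (f i) σ - amp D μ Z (f i) σ s‖ ≤ C * l1Sum μ f (i + (D + 2)) * s⁻¹ := by
  obtain ⟨C, hC, h0⟩ := exists_amp_le Ω D hR
  refine ⟨(|(D : ℝ) / 2 * (D / 2 - 1)| + 1) * C, by positivity, fun μ Z f h i σ hσ => ?_⟩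
  have hb : ∀ j t, 1 ≤ t → ‖psi D μ Z (f j) t‖ ≤ C * l1Sum μ f (j + (D + 1)) * t ^ (0 : ℝ) :=
    fun j t ht => by
      rw [rpow_zero, mul_one]
      exact norm_psi_le_amp _ _ _ _ _ fun σ hσ => h0 μ Z f h j t ht σ hσ
  obtain ⟨L, h1, h2⟩ := exists_tendsto_of_deriv_le (fun s hs => h.hasDerivAt_amp i hσ
    (one_pos.trans_le hs)) fun s hs => by
      have := WaveChain.norm_deriv_amp_le hC hb i σ hs
      rwa [show (0 - 1 - 1 : ℝ) = -((2 : ℕ) : ℝ) by norm_num, rpow_neg (zero_le_one.trans hs),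
        rpow_natCast] at this
  have hL : ampInf D μ Z (f i) σ = L := h1.limUnder_eq
  rw [hL]
  exact ⟨h1, fun s hs => (h2 s hs).trans (le_of_eq (by ring))⟩

end amplitude

/-! ### Functions of the embedding distance -/

/-- The embedding distance to a fixed point as a smooth function. -/
def zFn (x : dS D) : smoothFn D := ∑ B, ((x.1 B : ℝ) : ℂ) • xl B

lemma zFn_apply (x y : dS D) : (zFn x).1 y = (embZ x y : ℂ) := by
  rw [zFn, smoothFn_sum_apply, embZ_eq]
  congr 1 with B
  change (x.1 B : ℂ) * ((eta B : ℂ) * (y.1 B : ℂ)) = _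
  ring

lemma dd_zFn (x y : dS D) (A : Ix D) :
    (dd A (zFn x)).1 y = (eta A : ℂ) * (x.1 A - y.1 A * embZ x y) := by
  have h : dd A (zFn x) = ∑ B, ((x.1 B : ℝ) : ℂ) • (ds D).g A B := by
    rw [zFn, map_sum]
    refine sum_congr rfl fun B _ => ?_
    rw [Derivation.map_smul]; congr 1; exact (ds D).d_x A B
  have h1 : (dd A (zFn x)).1 y = ∑ B, (x.1 B : ℂ) * (metric y A B : ℂ) := by
    rw [h, smoothFn_sum_apply]
    congr 1 with B
    rw [← g_apply]; rfl
  rw [h1, embZ_eq]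
  simp only [metric, proj, ofReal_sub, ofReal_mul, sub_mul, mul_sub,
    sum_sub_distrib, mul_sum]
  congr 1
  · rw [sum_eq_single A]
    · simp; ring
    · intro B _ hB; simp [hB.symm]
    · simp
  · congr 1 with B; ring

lemma box_zFn (x : dS D) : (ds D).box (zFn x) = -((ds D).D * zFn x) := by
  have : ∀ s : Finset (Ix D), (ds D).box (∑ B ∈ s, ((x.1 B : ℝ) : ℂ) • xl B)
      = -((ds D).D * ∑ B ∈ s, ((x.1 B : ℝ) : ℂ) • xl B) := fun s => by
    induction s using Finset.induction_on with
    | empty => simp [Calc.box, Calc.dv, Calc.ctr]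
    | insert a s ha ih =>
      rw [sum_insert ha, Calc.box_add, Calc.box_smul, ih,
        show (ds D).box (xl a) = _ from (ds D).box_x a, mul_add, neg_add, smul_neg,
        mul_smul_comm]
      rfl
  exact this _

lemma grad_zFn_sq (x y : dS D) :
    ((ds D).ctr fun A => dd A (zFn x) * dd A (zFn x)).1 y = 1 - (embZ x y : ℂ) ^ 2 := by
  rw [ctr_apply]
  have hx := congrArg Complex.ofReal x.2
  have hy := congrArg Complex.ofReal y.2
  simp only [mink, ofReal_sum, ofReal_mul, ofReal_one] at hx hy
  have e : ∀ A, (eta A : ℂ) * (dd A (zFn x) * dd A (zFn x)).1 y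
      = (eta A * x.1 A * x.1 A : ℂ) - 2 * embZ x y * ((eta A * x.1 A : ℂ) * y.1 A)
        + (embZ x y : ℂ) ^ 2 * (eta A * y.1 A * y.1 A) := by
    intro A
    rw [show (dd A (zFn x) * dd A (zFn x)).1 y = (dd A (zFn x)).1 y * (dd A (zFn x)).1 y from rfl,
      dd_zFn]
    linear_combination (eta A : ℂ) * (x.1 A - y.1 A * embZ x y) ^ 2 * eta_sq_complex A
  simp only [e, sum_add_distrib, sum_sub_distrib, ← mul_sum, hx, hy]
  rw [← embZ_eq]
  ring

/-- The embedding distance on the cone, constant along the rays in the second point. -/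
def zExt (x : dS D) (Y : Amb D) : ℝ := (√(mink Y Y))⁻¹ * mink x.1 Y

lemma zExt_contDiffAt (x : dS D) (hY : Y ∈ cone D) : ContDiffAt ℝ ∞ (zExt x) Y := by
  have h : mink Y Y ≠ 0 := (show 0 < mink Y Y from hY).ne'
  refine ContDiffAt.mul (ContDiffAt.inv ((contDiff_minkSelf.contDiffAt).sqrt h) ?_) ?_
  · exact (sqrt_pos.2 hY).ne'
  · exact ((contDiff_mink (D := D)).comp (contDiff_const.prodMk contDiff_id)).contDiffAt

lemma ext_embZ (x : dS D) {E : Type*} [Zero E] (F : ℝ → E) (hY : Y ∈ cone D) :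
    ext (fun y => F (embZ x y)) Y = F (zExt x Y) := by
  rw [ext_of_mem _ hY]
  congr 1
  change mink x.1 ((√(mink Y Y))⁻¹ • Y) = zExt x Y
  rw [zExt, mink_comm x.1, mink_smul_left, mink_comm Y x.1]

lemma sm_embZ (x : dS D) (hF : ContDiff ℝ ∞ F) : Sm fun y => F (embZ x y) := by
  intro Y hY
  have : ContDiffAt ℝ ∞ (fun Y => F (zExt x Y)) Y :=
    hF.contDiffAt.comp Y (zExt_contDiffAt x hY)
  exact (this.contDiffWithinAt).congr (fun Y hY => ext_embZ x F hY) (ext_embZ x F hY)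

lemma partialD_embZ (x y : dS D) {F' : ℂ} (hF : HasDerivAt F F' (embZ x y))
    (A : Ix D) :
    partialD (fun y => F (embZ x y)) y A = F' * partialD (fun y => (embZ x y : ℂ)) y A := by
  have hz := (zExt_contDiffAt x (coe_mem_cone y)).differentiableAt (by simp) |>.hasFDerivAt
  have hv : zExt x y.1 = embZ x y := by simp [zExt, y.2, embZ]
  have key : ∀ {G : ℝ → ℂ} {G' : ℂ}, HasDerivAt G G' (embZ x y) →
      partialD (fun y => G (embZ x y)) y A = ((fderiv ℝ (zExt x) y.1 (Pi.single A 1) : ℝ) : ℂ) * G' := by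
    intro G G' hG
    rw [← hv] at hG
    have h1 := hG.hasFDerivAt.comp y.1 hz
    have h2 : ext (fun y => G (embZ x y)) =ᶠ[𝓝 y.1] G ∘ zExt x := by
      filter_upwards [isOpen_cone.mem_nhds (coe_mem_cone y)] with Y hY
      exact ext_embZ x G hY
    rw [partialD, h2.fderiv_eq, h1.fderiv]
    simp
  rw [key hF, key (G := fun t => (t : ℂ)) (ofRealCLM.hasDerivAt (x := embZ x y))]
  simp
  ring

/-- The d'Alembertian of a function of the embedding distance. -/
lemma boxFn_embZ (x y : dS D) (hF : ContDiff ℝ ∞ F) :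
    boxFn (fun y => F (embZ x y)) y
      = (1 - (embZ x y : ℂ) ^ 2) * deriv (deriv F) (embZ x y) - D * (embZ x y : ℂ) * deriv F (embZ x y) := by
  have hF1 : ContDiff ℝ ∞ (deriv F) := (contDiff_infty_iff_deriv.1 hF).2
  set a : smoothFn D := ⟨_, sm_embZ x hF⟩
  set a1 : smoothFn D := ⟨_, sm_embZ x hF1⟩
  set a2 : smoothFn D := ⟨_, sm_embZ x (contDiff_infty_iff_deriv.1 hF1).2⟩
  have hd : ∀ (G : ℝ → ℂ) (hG : ContDiff ℝ ∞ G) (g g1 : smoothFn D), (∀ y, g.1 y = G (embZ x y)) →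
      (∀ y, g1.1 y = deriv G (embZ x y)) → ∀ A, dd A g = g1 * dd A (zFn x) := by
    intro G hG g g1 hg hg1 A
    refine Subtype.ext (funext fun y => ?_)
    change partialD g.1 y A = g1.1 y * partialD (zFn x).1 y A
    rw [show g.1 = fun y => G (embZ x y) from funext hg,
      show (zFn x).1 = fun y => (embZ x y : ℂ) from funext (zFn_apply x), hg1]
    exact partialD_embZ x y (hG.differentiable (by simp) _).hasDerivAt A
  have d1 := hd F hF a a1 (fun _ => rfl) fun _ => rfl
  have d2 := hd _ hF1 a1 a2 (fun _ => rfl) fun _ => rfl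
  have hb : (ds D).box a = a1 * (ds D).box (zFn x)
      + a2 * (ds D).ctr fun A => dd A (zFn x) * dd A (zFn x) := by
    rw [Calc.box, Calc.box, Calc.dv, Calc.dv, ← Calc.ctr_const_mul, ← Calc.ctr_const_mul,
      ← Calc.ctr_add]
    congr 1
    funext A
    change dd A (dd A a) = a1 * dd A (dd A (zFn x)) + a2 * (dd A (zFn x) * dd A (zFn x))
    rw [d1, Derivation.leibniz, d2]
    simp only [smul_eq_mul]
    ring
  have h := congrArg (fun g : smoothFn D => g.1 y) hb
  simp only [box_val, box_zFn] at h
  refine h.trans ?_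
  change deriv F (embZ x y) * -((D : smoothFn D).1 y * (zFn x).1 y)
    + deriv (deriv F) (embZ x y) * ((ds D).ctr fun A => dd A (zFn x) * dd A (zFn x)).1 y = _
  rw [grad_zFn_sq, zFn_apply]
  have : ((D : smoothFn D)).1 y = D := by simp
  rw [this]
  ring

lemma boxFn_eq_zero {b : dS D → ℂ} {K : Set (dS D)} (hK : IsCompact K) (h : ∀ y, y ∉ K → b y = 0)
    {y : dS D} (hy : y ∉ K) : boxFn b y = 0 :=
  sum_eq_zero fun A _ => by
    rw [partialD_eq_zero hK.isClosed.isOpen_compl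
      (fun z hz => partialD_eq_zero hK.isClosed.isOpen_compl h hz A) hy A, mul_zero]

/-- The d'Alembertian is symmetric. -/
lemma integral_mul_boxFn (hD : 1 ≤ D) (a b : smoothFn D) (hb : Supp O b.1) :
    ∫ y, a.1 y * boxFn b.1 y ∂(vol D) = ∫ y, boxFn a.1 y * b.1 y ∂(vol D) := by
  have hT : (ds D).Tan fun A => a * dd A b - b * dd A a :=
    (((ds D).tan_d b).const_mul a).sub (((ds D).tan_d a).const_mul b)
  have hs : ∀ A, Supp O (a * dd A b - b * dd A a).1 := by
    obtain ⟨K, h1, h2, h3⟩ := hb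
    refine fun A => ⟨K, h1, h2, fun y hy => ?_⟩
    change a.1 y * partialD b.1 y A - b.1 y * _ = 0
    rw [h3 y hy, partialD_eq_zero h1.isClosed.isOpen_compl h3 hy A]; simp
  have hdv : (ds D).dv (fun A => a * dd A b - b * dd A a)
      = a * (ds D).box b - (ds D).box a * b := by
    rw [Calc.box, Calc.box, Calc.dv, Calc.dv, Calc.dv, ← Calc.ctr_const_mul, ← Calc.ctr_mul_const,
      ← Calc.ctr_sub]
    congr 1
    funext A
    change dd A (a * dd A b - b * dd A a) = a * dd A (dd A b) - dd A (dd A a) * b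
    rw [map_sub, Derivation.leibniz, Derivation.leibniz]
    simp only [smul_eq_mul]
    ring
  have h0 := integral_dv hD hT hs
  rw [hdv] at h0
  have hbb : Supp O ((ds D).box b).1 := by
    obtain ⟨K, h1, h2, h3⟩ := hb
    exact ⟨K, h1, h2, fun y hy => by rw [box_val, boxFn_eq_zero h1 h3 hy]⟩
  have i1 := integrable_smoothFn (a * (ds D).box b) (hbb.mul_left a.1)
  have i2 := integrable_smoothFn ((ds D).box a * b) (hb.mul_left ((ds D).box a).1)
  have h1 : ∫ y, ((a * (ds D).box b).1 y - ((ds D).box a * b).1 y) ∂(vol D) = 0 := h0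
  rw [integral_sub i1 i2, sub_eq_zero] at h1
  rw [← box_val, ← box_val]
  exact h1

lemma integral_embZ_boxFn (hD : 1 ≤ D) (x : dS D)
    (hF : ContDiff ℝ ∞ F) {b : dS D → ℂ} (hb : Sm b) (hs : Supp O b) :
    ∫ y, F (embZ x y) * boxFn b y ∂(vol D) = ∫ y, ((1 - (embZ x y : ℂ) ^ 2) *
      deriv (deriv F) (embZ x y) - D * (embZ x y : ℂ) * deriv F (embZ x y)) * b y ∂(vol D) := by
  rw [integral_mul_boxFn hD ⟨_, sm_embZ x hF⟩ ⟨b, hb⟩ hs]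
  exact integral_congr_ae (Eventually.of_forall fun y => by
    simp only [boxFn_embZ x y hF])

end

section
open scoped ContDiff
variable {D : ℕ}
variable {b : dS D → ℂ} {K : Set (dS D × dS D)} {R : ℝ} {u : dS D → dS D → ℂ} {F : ℝ → ℂ}

/-! ### The wave chains on de Sitter space -/

/-- The volume measure of the pairs of points. -/
abbrev vol₂ (D : ℕ) : Measure (dS D × dS D) := (vol D).prod (vol D)

lemma continuous_embZ : Continuous fun P : dS D × dS D => embZ P.1 P.2 :=
  (contDiff_mink (n := 0)).continuous.comp
    ((continuous_subtype_val.comp continuous_fst).prodMk (continuous_subtype_val.comp continuous_snd))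

lemma sm_iterate_boxFn (hb : Sm b) (i : ℕ) : Sm (boxFn^[i] b) := by
  induction i with
  | zero => exact hb
  | succ i ih =>
    rw [Function.iterate_succ_apply', ← box_val ⟨_, ih⟩]
    exact ((ds D).box ⟨_, ih⟩).2

lemma iterate_boxFn_eq_zero {K : Set (dS D)} (hK : IsCompact K)
    (h : ∀ y, y ∉ K → b y = 0) (i : ℕ) : ∀ y, y ∉ K → boxFn^[i] b y = 0 := by
  induction i with
  | zero => exact h
  | succ i ih =>
    intro y hy
    rw [Function.iterate_succ_apply']
    exact boxFn_eq_zero hK ih hy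

lemma waveChain_point (hD : 1 ≤ D) (x : dS D) {K : Set (dS D)} (hK : IsCompact K)
    (hR : ∀ y ∈ K, |embZ x y| ≤ R) (hb : Sm b) (h0 : ∀ y, y ∉ K → b y = 0) :
    WaveChain D ((vol D).restrict K) (embZ x) R fun i => boxFn^[i] b where
  meas := (continuous_embZ.comp (Continuous.prodMk_right x)).measurable
  bound := by filter_upwards [ae_restrict_mem hK.measurableSet] with y hy using hR y hy
  int i := (integrable_of_supp (sm_iterate_boxFn hb i).continuous
    ⟨K, hK, subset_univ K, iterate_boxFn_eq_zero hK h0 i⟩).restrict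
  green i F hF := by
    have hi := iterate_boxFn_eq_zero hK h0 i
    have hi1 := iterate_boxFn_eq_zero hK h0 (i + 1)
    rw [setIntegral_eq_integral_of_forall_compl_eq_zero fun y hy => by grind,
      setIntegral_eq_integral_of_forall_compl_eq_zero fun y hy => by grind,
      Function.iterate_succ_apply', integral_embZ_boxFn hD x hF (sm_iterate_boxFn hb i)
        ⟨K, hK, subset_univ K, hi⟩]

lemma Sm2.continuous (hu : Sm2 u) : Continuous fun P : dS D × dS D => u P.1 P.2 := by
  have h : Continuous fun P : dS D × dS D => biExt u (P.1.1, P.2.1) :=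
    ContinuousOn.comp_continuous (s := cone D ×ˢ cone D) (ContDiffOn.continuousOn hu)
      ((continuous_subtype_val.comp continuous_fst).prodMk
        (continuous_subtype_val.comp continuous_snd))
      fun P => ⟨coe_mem_cone P.1, coe_mem_cone P.2⟩
  simpa only [biExt_coe] using h

lemma integrable_of_testOn (hK : IsCompact K)
    (hu : TestOn K u) {g : dS D × dS D → ℂ} (hg : Continuous g) :
    Integrable (fun P : dS D × dS D => g P * u P.1 P.2) (vol₂ D) :=
  (hg.mul hu.1.continuous).integrable_of_hasCompactSupport
    (HasCompactSupport.intro hK fun P hP => by rw [Pi.mul_apply, hu.2 P.1 P.2 hP, mul_zero])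

lemma TestOn.supp_right (hK : IsCompact K)
    (hu : TestOn K u) (x : dS D) : Supp Set.univ (u x) :=
  ⟨Prod.snd '' K, hK.image continuous_snd, subset_univ _, fun y hy =>
    hu.2 x y fun h => hy ⟨(x, y), h, rfl⟩⟩

lemma integral_embZ_box2 (hD : 1 ≤ D) (hK : IsCompact K)
    (hu : TestOn K u) (hF : ContDiff ℝ ∞ F) :
    ∫ P, F (embZ P.1 P.2) * box2 u P.1 P.2 ∂(vol₂ D)
      = ∫ P, ((1 - (embZ P.1 P.2 : ℂ) ^ 2) * deriv (deriv F) (embZ P.1 P.2)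
        - D * (embZ P.1 P.2 : ℂ) * deriv F (embZ P.1 P.2)) * u P.1 P.2 ∂(vol₂ D) := by
  have hF1 := (contDiff_infty_iff_deriv.1 hF).2
  have hF2 := (contDiff_infty_iff_deriv.1 hF1).2
  have hZ := continuous_embZ (D := D)
  have hZc : Continuous fun P : dS D × dS D => (embZ P.1 P.2 : ℂ) := continuous_ofReal.comp hZ
  rw [integral_prod _ (integrable_of_testOn hK (hu.box2 hK)
      (g := fun P => F (embZ P.1 P.2)) (hF.continuous.comp hZ)),
    integral_prod _ (integrable_of_testOn hK hu
      (g := fun P => (1 - (embZ P.1 P.2 : ℂ) ^ 2) * deriv (deriv F) (embZ P.1 P.2)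
        - D * (embZ P.1 P.2 : ℂ) * deriv F (embZ P.1 P.2)) ?_)]
  · congr 1 with x
    have h := integral_embZ_boxFn hD x hF (hu.1.swap.slice x) (hu.supp_right hK x)
    tauto
  fun_prop

lemma embZ_comm (x y : dS D) : embZ x y = embZ y x := mink_comm _ _

lemma integral_embZ_box1 (hD : 1 ≤ D) (hK : IsCompact K)
    (hu : TestOn K u) (hF : ContDiff ℝ ∞ F) :
    ∫ P, F (embZ P.1 P.2) * box1 u P.1 P.2 ∂(vol₂ D)
      = ∫ P, F (embZ P.1 P.2) * box2 u P.1 P.2 ∂(vol₂ D) := by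
  rw [integral_embZ_box2 hD hK hu hF]
  have h := integral_embZ_box2 hD (isCompact_swap hK) hu.swap hF
  refine (integral_prod_swap _).symm.trans (Eq.trans ?_ (h.trans ((integral_prod_swap _).symm.trans ?_)))
  · congr 1 with P
    change F (embZ P.2 P.1) * _ = F (embZ P.1 P.2) * _
    rw [embZ_comm]; rfl
  · congr 1 with P
    simp only [Prod.fst_swap, Prod.snd_swap, embZ_comm P.2 P.1]

/-- The iterated d'Alembertian, at the second point, of a test function. -/
def boxSeq (u : dS D → dS D → ℂ) (i : ℕ) (P : dS D × dS D) : ℂ := (box2^[i] u) P.1 P.2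

lemma TestOn.iterate_box2 (hK : IsCompact K)
    (hu : TestOn K u) (i : ℕ) : TestOn K (DeSitter.box2^[i] u) := by
  induction i with
  | zero => exact hu
  | succ i ih => rw [Function.iterate_succ_apply']; exact ih.box2 hK

lemma waveChain_pair (hD : 1 ≤ D) (hK : IsCompact K)
    (hR : ∀ P ∈ K, |embZ P.1 P.2| ≤ R) (hu : TestOn K u) :
    WaveChain D ((vol₂ D).restrict K) (fun P => embZ P.1 P.2) R (boxSeq u) where
  meas := continuous_embZ.measurable
  bound := by filter_upwards [ae_restrict_mem hK.measurableSet] with y hy using hR y hy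
  int i := by
    have := (integrable_of_testOn hK (hu.iterate_box2 hK i) (g := fun _ => 1) continuous_const).restrict
      (s := K)
    aesop
  green i F hF := by
    have hi := hu.iterate_box2 hK i
    have hi1 := hu.iterate_box2 hK (i + 1)
    rw [setIntegral_eq_integral_of_forall_compl_eq_zero fun P hP => by
        rw [boxSeq, hi1.2 P.1 P.2 hP, mul_zero],
      setIntegral_eq_integral_of_forall_compl_eq_zero fun P hP => by
        rw [boxSeq, hi.2 P.1 P.2 hP, mul_zero]]
    simp only [boxSeq, Function.iterate_succ_apply']
    exact integral_embZ_box2 hD hK hi hF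

lemma exists_embZ_bound (hK : IsCompact K) :
    ∃ R, 0 ≤ R ∧ ∀ P ∈ K, |embZ P.1 P.2| ≤ R := by
  obtain ⟨R, hR⟩ := hK.exists_bound_of_continuousOn (continuous_embZ (D := D)).continuousOn
  exact ⟨max R 0, le_max_right _ _, fun P hP => (hR P hP).trans (le_max_left _ _)⟩

/-- The oscillatory integral of a test function of two points. -/
def oscPair (u : dS D → dS D → ℂ) (s : ℝ) : ℂ :=
  osc (vol₂ D) (fun P => embZ P.1 P.2) (fun P => u P.1 P.2) s

lemma osc_restrict {Ω : Type*} [MeasurableSpace Ω] (μ : Measure Ω) (Z : Ω → ℝ) {f : Ω → ℂ}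
    {K : Set Ω} (h : ∀ P, P ∉ K → f P = 0) (s : ℝ) : osc (μ.restrict K) Z f s = osc μ Z f s :=
  setIntegral_eq_integral_of_forall_compl_eq_zero fun P hP => by grind

end

section
open scoped ContDiff

/-! ### Fresnel integrals -/

variable {ι : Type*} [Fintype ι]

lemma ofReal_mul_cpow {r : ℝ} (hr : 0 < r) {z : ℂ} (hz : z ≠ 0) (c : ℂ) :
    ((r : ℂ) * z) ^ c = (r : ℂ) ^ c * z ^ c := by
  have hr' : (r : ℂ) ≠ 0 := by exact_mod_cast hr.ne'
  rw [cpow_def_of_ne_zero (mul_ne_zero hr' hz), cpow_def_of_ne_zero hr',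
    cpow_def_of_ne_zero hz, Complex.log_ofReal_mul hr hz, ofReal_log hr.le, add_mul,
    exp_add]

open scoped FourierTransform in
lemma exists_fourier_rep {G : (ι → ℝ) → ℂ} (hG : ContDiff ℝ ∞ G) (hc : HasCompactSupport G) :
    ∃ h : (ι → ℝ) → ℂ, Integrable h ∧ ∀ v, G v = ∫ ξ, h ξ * exp (∑ i, 2 * π * I * ξ i * v i) := by
  set g : EuclideanSpace ℝ ι → ℂ := fun v => G (WithLp.ofLp v) with hg
  have hgc : HasCompactSupport g :=
    hc.comp_homeomorph (PiLp.continuousLinearEquiv 2 ℝ fun _ : ι => ℝ).toHomeomorph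
  have hgd : ContDiff ℝ ∞ g :=
    hG.comp (PiLp.continuousLinearEquiv 2 ℝ fun _ : ι => ℝ).contDiff
  set f := hgc.toSchwartzMap hgd with hf
  have hfg : (f : EuclideanSpace ℝ ι → ℂ) = g := rfl
  have hi : Integrable (𝓕 g) := by
    rw [← hfg, ← SchwartzMap.fourier_coe]; exact (𝓕 f).integrable
  have hmp := PiLp.volume_preserving_toLp ι
  refine ⟨fun ξ => 𝓕 g (WithLp.toLp 2 ξ), hmp.integrable_comp_of_integrable hi, fun v => ?_⟩
  have hinv := Continuous.fourierInv_fourier_eq hgd.continuous (hfg ▸ f.integrable) hi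
  have h1 : G v = 𝓕⁻ (𝓕 g) (WithLp.toLp 2 v) := by rw [hinv]
  rw [h1, fourierInv_eq', ← hmp.integral_comp (MeasurableEquiv.toLp 2 (ι → ℝ)).measurableEmbedding]
  congr 1 with ξ
  simp only [smul_eq_mul]
  rw [mul_comm]
  congr 2
  simp only [PiLp.inner_apply, ofReal_mul, ofReal_sum, mul_sum, sum_mul]
  congr 1 with i
  simp
  ring

/-- The Gaussian `exp (-∑ bᵢ vᵢ²)` with complex coefficients. -/
def gauss (b : ι → ℂ) (v : ι → ℝ) : ℂ := exp (-∑ i, b i * (v i : ℂ) ^ 2)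

lemma norm_gauss_le_one {b : ι → ℂ} (hb : ∀ i, 0 ≤ (b i).re) (v : ι → ℝ) : ‖gauss b v‖ ≤ 1 := by
  rw [gauss, norm_exp, exp_le_one_iff, neg_re, neg_nonpos, Complex.re_sum]
  refine sum_nonneg fun i _ => ?_
  rw [← ofReal_pow, Complex.re_mul_ofReal]
  exact mul_nonneg (hb i) (sq_nonneg _)

lemma continuous_gauss (b : ι → ℂ) : Continuous (gauss b) := by unfold gauss; fun_prop

/-- Integrals against Gaussians depend continuously on the coefficients, up to the boundary of the
half-plane of convergence. -/
lemma tendsto_integral_gauss {l : Filter ℝ} [l.IsCountablyGenerated] {b : ℝ → ι → ℂ} {b₀ : ι → ℂ}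
    (hb : ∀ i, Tendsto (b · i) l (𝓝 (b₀ i))) (hre : ∀ᶠ δ in l, ∀ i, 0 ≤ (b δ i).re)
    {h : (ι → ℝ) → ℂ} (hh : Integrable h) :
    Tendsto (fun δ => ∫ v, h v * gauss (b δ) v) l (𝓝 (∫ v, h v * gauss b₀ v)) := by
  refine tendsto_integral_filter_of_dominated_convergence (fun v => ‖h v‖)
    (.of_forall fun δ => hh.1.mul (continuous_gauss _).aestronglyMeasurable)
    (hre.mono fun δ hδ => .of_forall fun v => ?_) hh.norm (.of_forall fun v => ?_)
  · rw [norm_mul]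
    exact mul_le_of_le_one_right (norm_nonneg _) (norm_gauss_le_one hδ v)
  · exact ((continuous_exp.tendsto _).comp
      (tendsto_finsetSum _ fun i _ => (hb i).mul_const _).neg).const_mul _

lemma integral_gauss_mul {b : ι → ℂ} (hb : ∀ i, 0 < (b i).re) {G h : (ι → ℝ) → ℂ}
    (hh : Integrable h) (hG : ∀ v, G v = ∫ ξ, h ξ * exp (∑ i, 2 * π * I * ξ i * v i)) :
    ∫ v, G v * gauss b v
      = (∏ i, (π / b i) ^ (1 / 2 : ℂ)) * ∫ ξ, h ξ * gauss (fun i => π ^ 2 / b i) ξ := by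
  have hgi : Integrable (gauss b) := by
    unfold gauss
    simpa using GaussianFourier.integrable_cexp_neg_sum_mul_add hb 0
  have e1 : ∀ v, G v * gauss b v
      = ∫ ξ, (gauss b v * h ξ) * exp (∑ i, 2 * π * I * ξ i * v i) := fun v => by
    rw [hG v, mul_comm, ← integral_const_mul]
    simp only [mul_assoc]
  simp only [e1]
  rw [integral_integral_swap, ← integral_const_mul]
  · congr 1 with ξ
    have e2 : ∀ v, (gauss b v * h ξ) * exp (∑ i, 2 * π * I * ξ i * v i)
        = h ξ * exp (-∑ i, b i * (v i : ℂ) ^ 2 + ∑ i, 2 * π * I * ξ i * v i) := fun v => by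
      rw [gauss, exp_add]; ring
    simp only [e2]
    rw [integral_const_mul, GaussianFourier.integral_cexp_neg_sum_mul_add hb, prod_mul_distrib,
      ← Complex.exp_sum, gauss, ← sum_neg_distrib, mul_left_comm]
    congr 4 with i
    have : b i ≠ 0 := fun h => by have := hb i; simp [h] at this
    field_simp
    rw [I_sq]; ring
  · refine (hgi.mul_prod hh).mul_bdd (c := 1) ?_ (.of_forall fun P => by simp [norm_exp])
    exact Continuous.aestronglyMeasurable (by fun_prop)

lemma re_pi_sq_div_nonneg {z : ℂ} (hz : 0 ≤ z.re) : 0 ≤ (π ^ 2 / z : ℂ).re := by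
  rw [div_eq_mul_inv, ← ofReal_pow, re_ofReal_mul, inv_re]
  have := Complex.normSq_nonneg z
  positivity

lemma integral_fresnel {s : ℝ} (hs : 0 < s) {ε : ι → ℝ} (hε : ∀ i, ε i = 1 ∨ ε i = -1)
    {G h : (ι → ℝ) → ℂ} (hGi : Integrable G) (hh : Integrable h)
    (hG : ∀ v, G v = ∫ ξ, h ξ * exp (∑ i, 2 * π * I * ξ i * v i)) :
    ∫ v, G v * gauss (fun i => -(I * s * ε i) / 2) v
      = (∏ i, (π / (-(I * s * ε i) / 2)) ^ (1 / 2 : ℂ))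
        * ∫ ξ, h ξ * gauss (fun i => π ^ 2 / (-(I * s * ε i) / 2)) ξ := by
  set b : ℝ → ι → ℂ := fun δ i => δ + -(I * s * ε i) / 2 with hb
  have hre : ∀ δ i, (b δ i).re = δ := fun δ i => by simp [hb]
  have hre' : ∀ᶠ δ in 𝓝[>] 0, ∀ i, 0 ≤ (b δ i).re :=
    eventually_mem_nhdsWithin.mono fun δ hδ i => (hre δ i).symm ▸ le_of_lt hδ
  have hne : ∀ i, -(I * s * ε i) / 2 ≠ 0 := fun i => by
    rcases hε i with h | h <;> simp [h, hs.ne']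
  have hbt : ∀ i, Tendsto (b · i) (𝓝[>] 0) (𝓝 (-(I * s * ε i) / 2)) := fun i => by
    have : Continuous fun δ : ℝ => b δ i := by simp only [hb]; fun_prop
    simpa [hb] using (this.tendsto 0).mono_left nhdsWithin_le_nhds
  have hbt' := fun i => (tendsto_const_nhds (x := (π ^ 2 : ℂ))).div (hbt i) (hne i)
  have L : ∀ i, Tendsto (fun δ => (π / b δ i) ^ (1 / 2 : ℂ)) (𝓝[>] 0)
      (𝓝 ((π / (-(I * s * ε i) / 2)) ^ (1 / 2 : ℂ))) := fun i => by
    refine (tendsto_const_nhds.div (hbt i) (hne i)).cpow tendsto_const_nhds (Or.inr ?_)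
    rcases hε i with h | h <;> simp [h, Complex.div_im, pi_ne_zero, hs.ne']
  refine tendsto_nhds_unique (tendsto_integral_gauss hbt hre' hGi) (((tendsto_finsetProd _
    fun i _ => L i).mul (tendsto_integral_gauss hbt' (hre'.mono fun δ h i =>
      re_pi_sq_div_nonneg (h i)) hh)).congr' ?_)
  filter_upwards [self_mem_nhdsWithin] with δ hδ
  exact (integral_gauss_mul (fun i => (hre δ i).symm ▸ hδ) hh hG).symm

/-- The method of stationary phase for a diagonal quadratic form. -/
lemma tendsto_fresnel {ε : ι → ℝ} (hε : ∀ i, ε i = 1 ∨ ε i = -1)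
    {G : (ι → ℝ) → ℂ} (hG : ContDiff ℝ ∞ G) (hc : HasCompactSupport G) :
    Tendsto (fun s : ℝ => ((√s : ℝ) : ℂ) ^ Fintype.card ι *
      ∫ v : ι → ℝ, exp (I * s / 2 * ∑ i, (ε i : ℂ) * (v i : ℂ) ^ 2) * G v) atTop
      (𝓝 ((∏ i, (2 * π * I * ε i) ^ (1 / 2 : ℂ)) * G 0)) := by
  obtain ⟨h, hh, hrep⟩ := exists_fourier_rep hG hc
  have hGi : Integrable G := hG.continuous.integrable_of_hasCompactSupport hc
  have hb : ∀ i, Tendsto (fun s : ℝ => (π ^ 2 / (-(I * s * ε i) / 2) : ℂ)) atTop (𝓝 0) := fun i => by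
    have h1 : Tendsto (fun s : ℝ => ((s⁻¹ : ℝ) : ℂ)) atTop (𝓝 ((0 : ℝ) : ℂ)) :=
      (continuous_ofReal.tendsto 0).comp tendsto_inv_atTop_zero
    have h2 := h1.mul_const (π ^ 2 / (-(I * ε i) / 2))
    rw [ofReal_zero, zero_mul] at h2
    refine h2.congr fun s => ?_
    rw [ofReal_inv, show -(I * s * ε i) / 2 = s * (-(I * ε i) / 2) by ring, div_mul_eq_div_div,
      div_eq_inv_mul _ (s : ℂ)]
    ring
  have L := (tendsto_integral_gauss hb (.of_forall fun s i => re_pi_sq_div_nonneg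
    (by simp)) hh).const_mul (∏ i, (2 * π * I * ε i) ^ (1 / 2 : ℂ))
  have e0 : ∫ v, h v * gauss 0 v = G 0 := by simp [gauss, hrep 0]
  rw [show (fun _ : ι => (0 : ℂ)) = 0 from rfl, e0] at L
  refine L.congr' ?_
  filter_upwards [eventually_gt_atTop 0] with s hs
  have e1 : ∀ v, exp (I * s / 2 * ∑ i, (ε i : ℂ) * (v i : ℂ) ^ 2) * G v
      = G v * gauss (fun i => -(I * s * ε i) / 2) v := fun v => by
    rw [mul_comm, gauss, mul_sum, ← sum_neg_distrib]
    congr 3 with i; ring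
  simp only [e1]
  rw [integral_fresnel hs hε hGi hh hrep, ← mul_assoc, Fintype.card, ← Finset.prod_const,
    ← prod_mul_distrib]
  congr 1
  refine Finset.prod_congr rfl fun i _ => ?_
  have hne : (2 * π * I * ε i : ℂ) ≠ 0 := by rcases hε i with h | h <;> simp [h, pi_ne_zero]
  have e2 : (π : ℂ) / (-(I * s * ε i) / 2) = ((s⁻¹ : ℝ) : ℂ) * (2 * π * I * ε i) := by
    have hs' : (s : ℂ) ≠ 0 := by exact_mod_cast hs.ne'
    rcases hε i with h | h <;> rw [h, ofReal_inv] <;> push_cast <;> field_simp <;> simp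
  have e3 : ((s⁻¹ : ℝ) : ℂ) ^ (1 / 2 : ℂ) = ((√s)⁻¹ : ℝ) := by
    rw [← Real.sqrt_inv, sqrt_eq_rpow, ofReal_cpow (inv_pos.2 hs).le]; simp
  rw [e2, ofReal_mul_cpow (inv_pos.2 hs) hne, e3, ← mul_assoc, ← ofReal_mul,
    mul_inv_cancel₀ (sqrt_pos.2 hs).ne', ofReal_one, one_mul]

end

section
open scoped ContDiff
variable {D : ℕ}

/-! ### The amplitude of the critical point on the diagonal -/

lemma tendsto_fresnel_real {g : ℝ → ℂ} (hg : ContDiff ℝ ∞ g) (hc : HasCompactSupport g) :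
    Tendsto (fun s : ℝ => ((√s : ℝ) : ℂ) * ∫ t : ℝ, exp (I * s / 2 * (t : ℂ) ^ 2) * g t)
      atTop (𝓝 ((2 * π * I) ^ (1 / 2 : ℂ) * g 0)) := by
  have h := tendsto_fresnel (ι := Fin 1) (ε := fun _ => 1) (fun _ => Or.inl rfl)
    (G := fun v => g (v 0)) (hg.comp (contDiff_apply ℝ ℝ (0 : Fin 1)))
    (hc.comp_homeomorph (ContinuousLinearEquiv.funUnique (Fin 1) ℝ ℝ).toHomeomorph)
  simp only [Fintype.card_fin, pow_one, univ_unique, sum_singleton,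
    Finset.prod_singleton, ofReal_one, mul_one, one_mul, Fin.default_eq_zero,
    Pi.zero_apply] at h
  refine h.congr fun s => ?_
  congr 1
  exact (volume_preserving_funUnique (Fin 1) ℝ).integral_comp
    (MeasurableEquiv.funUnique (Fin 1) ℝ).measurableEmbedding
    fun t : ℝ => exp (I * s / 2 * (t : ℂ) ^ 2) * g t

/-- The radial profile of the test function, in the normalization of the oscillatory integral. -/
def profile (D : ℕ) (r : ℝ) : ℂ := ((r ^ ((D : ℝ) / 2) * bump (2 * r) : ℝ) : ℂ)

lemma profile_eq_zero {r : ℝ} (h : r ∉ Icc (1 / 2 : ℝ) (3 / 2)) : profile D r = 0 := by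
  rw [profile, bump_eq_zero fun h' => h ⟨by linarith [h'.1], by linarith [h'.2]⟩]; simp

lemma contDiff_profile : ContDiff ℝ ∞ (profile D) := by
  refine contDiff_iff_contDiffAt.2 fun r => ?_
  by_cases hr : r = 0
  · have : profile D =ᶠ[𝓝 r] fun _ => 0 := by
      filter_upwards [gt_mem_nhds (show r < 1 / 2 by simp [hr])] with t ht
      exact profile_eq_zero fun h => absurd h.1 (not_le.2 ht)
    exact contDiffAt_const.congr_of_eventuallyEq this
  · exact ofRealCLM.contDiff.contDiffAt.comp r ((Real.contDiffAt_rpow_const_of_ne hr).mul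
      ((contDiff_bump (n := ⊤)).comp (contDiff_const.mul contDiff_id)).contDiffAt)

lemma profile_hasCompactSupport (a : ℝ) : HasCompactSupport fun r => profile D (r + a) :=
  .intro (K := Icc (1 / 2 - a) (3 / 2 - a)) isCompact_Icc fun _ hr =>
    profile_eq_zero fun h => hr ⟨by linarith [h.1], by linarith [h.2]⟩

lemma integrable_profile_mul {c : ℝ → ℂ} (hc : Continuous c) (a : ℝ) :
    Integrable fun r => profile D (r + a) * c r :=
  ((contDiff_profile.continuous.comp (continuous_add_const a)).mul hc).integrable_of_hasCompactSupport
    (profile_hasCompactSupport a).mul_right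

/-- The radial integrals against the two asymptotic waves. -/
lemma tendsto_radial (A B : ℂ) :
    Tendsto (fun s : ℝ => ((√s : ℝ) : ℂ) * ∫ r : ℝ, profile D r *
      (exp (I * s / 2 * (1 + r ^ 2)) *
        (A * exp (-(I * s * r)) + B * exp (I * s * r)))) atTop
      (𝓝 ((2 * π * I) ^ (1 / 2 : ℂ) * (A * profile D 1))) := by
  have h0 : ∀ a : ℝ, ContDiff ℝ ∞ fun r => profile D (r + a) := fun a =>
    contDiff_profile.comp (contDiff_id.add contDiff_const)
  have h1 := tendsto_fresnel_real (h0 1) (profile_hasCompactSupport 1)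
  have h2 := tendsto_fresnel_real (h0 (-1)) (profile_hasCompactSupport (-1))
  have z : profile D (0 + -1) = 0 := profile_eq_zero (by norm_num)
  rw [z, mul_zero] at h2
  rw [zero_add] at h1
  have h3 := (h1.const_mul A).add (h2.const_mul B)
  rw [mul_zero, add_zero, mul_left_comm] at h3
  refine h3.congr fun s => ?_
  have i : ∀ b : ℝ, Integrable fun r : ℝ => exp (I * s / 2 * ((r + b : ℝ) : ℂ) ^ 2)
      * profile D r := fun b => by
    simpa [mul_comm] using integrable_profile_mul (D := D)
      (c := fun r => exp (I * s / 2 * ((r + b : ℝ) : ℂ) ^ 2)) (by fun_prop) 0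
  rw [← integral_add_right_eq_self (fun t : ℝ => exp (I * s / 2 * (t : ℂ) ^ 2)
      * profile D (t + 1)) (-1),
    ← integral_add_right_eq_self (fun t : ℝ => exp (I * s / 2 * (t : ℂ) ^ 2)
      * profile D (t + -1)) 1]
  simp only [neg_add_cancel_right, add_neg_cancel_right]
  rw [mul_left_comm A, mul_left_comm B, ← mul_add, ← integral_const_mul, ← integral_const_mul,
    ← integral_add ((i _).const_mul A) ((i _).const_mul B)]
  congr 2 with r
  have e1 : exp (I * s / 2 * (1 + (r : ℂ) ^ 2)) * exp (-(I * s * r))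
      = exp (I * s / 2 * ((r + -1 : ℝ) : ℂ) ^ 2) := by
    rw [← exp_add]; congr 1; push_cast; ring
  have e2 : exp (I * s / 2 * (1 + (r : ℂ) ^ 2)) * exp (I * s * r)
      = exp (I * s / 2 * ((r + 1 : ℝ) : ℂ) ^ 2) := by
    rw [← exp_add]; congr 1; push_cast; ring
  rw [← e1, ← e2]
  ring

variable {Ω : Type*} [MeasurableSpace Ω] {μ : Measure Ω} {Z : Ω → ℝ} {R : ℝ} {f : ℕ → Ω → ℂ}

/-- The two asymptotic waves of the oscillatory integral. -/
lemma psi_eq_waves (f : Ω → ℂ) (s : ℝ) :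
    psi D μ Z f s = I / 2 * amp D μ Z f 1 s * exp (-(I * s))
      + -(I / 2) * amp D μ Z f (-1) s * exp (I * s) := by
  have h1 : exp (I * s) * exp (-(I * s)) = 1 := by simp [← exp_add]
  simp only [amp]
  push_cast
  rw [show I * -1 * (s : ℂ) = -(I * s) by ring, mul_one]
  linear_combination (-(psi D μ Z f s) + (psi D μ Z f s) * (1 + I ^ 2)) * h1
   + psi D μ Z f s * I_sq

/-- The remainder of the oscillatory integral after its two asymptotic waves. -/
def psiRem (D : ℕ) (μ : Measure Ω) (Z : Ω → ℝ) (f : Ω → ℂ) (s : ℝ) : ℂ :=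
  psi D μ Z f s - I / 2 * ampInf D μ Z f 1 * exp (-(I * s))
    - -(I / 2) * ampInf D μ Z f (-1) * exp (I * s)

lemma norm_exp_I_ofReal (s : ℝ) : ‖exp (I * s)‖ = 1 ∧ ‖exp (-(I * s))‖ = 1 := by
  simp [norm_exp]

lemma exists_psiRem_le_inv (hR : 0 ≤ R) (h : WaveChain D μ Z R f) (i : ℕ) :
    ∃ C, 0 ≤ C ∧ ∀ s, 1 ≤ s → ‖psiRem D μ Z (f i) s‖ ≤ C * s⁻¹ := by
  obtain ⟨C, hC, h1⟩ := exists_amp_sub_le Ω D hR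
  have hL := l1Sum_nonneg μ f (i + (D + 2))
  refine ⟨C * l1Sum μ f (i + (D + 2)), by positivity, fun s hs => ?_⟩
  obtain ⟨n1, n2⟩ := norm_exp_I_ofReal s
  have e1 := (h1 μ Z f h i 1 (by norm_num)).2 s hs
  have e2 := (h1 μ Z f h i (-1) (by norm_num)).2 s hs
  have e : psiRem D μ Z (f i) s
      = -(I / 2) * (ampInf D μ Z (f i) 1 - amp D μ Z (f i) 1 s) * exp (-(I * s))
      + I / 2 * (ampInf D μ Z (f i) (-1) - amp D μ Z (f i) (-1) s) * exp (I * s) := by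
    rw [psiRem, psi_eq_waves]; ring
  rw [e]
  refine (norm_add_le _ _).trans ?_
  simp only [norm_mul, n1, n2, norm_neg, norm_div, norm_I, norm_ofNat]
  linarith

lemma continuous_osc (h : WaveChain D μ Z R f) (i : ℕ) : Continuous (osc μ Z (f i)) :=
  continuous_iff_continuousAt.2 fun s => (hasDerivAt_osc h.meas h.bound (h.int i) s).continuousAt

lemma continuous_psiRem (h : WaveChain D μ Z R f) (i : ℕ) :
    Continuous (psiRem D μ Z (f i)) := by
  have h1 : Continuous fun s : ℝ => s ^ ((D : ℝ) / 2) :=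
    continuous_id.rpow_const fun _ => Or.inr (by positivity)
  have h2 := continuous_osc h i
  unfold psiRem psi
  fun_prop

end

section
open scoped ContDiff
variable {D : ℕ}

lemma mink_sub_self (X Y : Amb D) :
    mink (Y - X) (Y - X) = mink Y Y - 2 * mink X Y + mink X X := by
  simp only [mink, Pi.sub_apply, mul_sum, ← sum_sub_distrib, ← sum_add_distrib]
  congr 1 with A; ring

lemma cut_smul_coe (f : dS D → ℂ) {r : ℝ} (hr : 0 < r) (y : dS D) :
    cut f (r • y.1) = bump r * f y := by
  rw [cut, sqrt_mink_smul hr, ext_smul f hr, ext_coe]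

lemma cut_of_notMem (f : dS D → ℂ) {X : Amb D} (hX : X ∉ cone D) : cut f X = 0 :=
  (cut_eventually_zero f hX).self_of_nhds

/-- A Fresnel integral in the embedding space, in polar coordinates. -/
lemma integral_fresnel_polar {f : dS D → ℂ} (hf : Sm f) {O : Set (dS D)} (h : Supp O f) (x : dS D)
    (s : ℝ) :
    ∫ W : Amb D, exp (I * s / 2 * ∑ i, (eta i : ℂ) * (W i : ℂ) ^ 2)
        * cut f ((2 : ℝ) • (W + x.1))
      = ∫ r in Ioi (0 : ℝ), (r : ℂ) ^ D * (exp (I * s / 2 * (1 + r ^ 2))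
        * (bump (2 * r) : ℂ) * osc (vol D) (embZ x) f (s * r)) := by
  set F : Amb D → ℂ := fun Y => exp (I * s / 2 * (mink (Y - x.1) (Y - x.1) : ℝ))
    * cut f ((2 : ℝ) • Y) with hF
  have hc2 : HasCompactSupport fun Y : Amb D => cut f ((2 : ℝ) • Y) :=
    (cut_hasCompactSupport h).comp_homeomorph (Homeomorph.smulOfNeZero (2 : ℝ) two_ne_zero)
  have hFc : Continuous F := by
    have h1 : Continuous fun Y : Amb D => mink (Y - x.1) (Y - x.1) :=
      continuous_minkSelf.comp (continuous_id.sub continuous_const)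
    have h2 := (cut_contDiff hf).continuous
    fun_prop
  have hFi : Integrable F := hFc.integrable_of_hasCompactSupport hc2.mul_left
  have e1 : ∫ W : Amb D, exp (I * s / 2 * ∑ i, (eta i : ℂ) * (W i : ℂ) ^ 2)
      * cut f ((2 : ℝ) • (W + x.1)) = ∫ Y, F Y := by
    rw [← integral_add_right_eq_self F x.1]
    congr 1 with W
    simp only [hF, add_sub_cancel_right, mink, ofReal_sum, ofReal_mul, pow_two, mul_assoc]
  have e2 : ∫ Y, F Y = ∫ Y in cone D, F Y :=
    (setIntegral_eq_integral_of_forall_compl_eq_zero fun Y hY => by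
      simp [hF, cut_of_notMem f fun h' => hY ((smul_mem_cone two_pos).1 h')]).symm
  have hFp : Integrable (fun p => F (ofPolar p)) ((vol D).prod (Measure.volumeIoiPow D)) := by
    have := hFi.integrableOn (s := cone D)
    rw [IntegrableOn, ← map_ofPolar] at this
    exact this.comp_measurable continuous_ofPolar.measurable
  rw [e1, e2, integral_cone hFc.aestronglyMeasurable, integral_prod_symm _ hFp,
    ← integral_volumeIoiPow]
  congr 1 with r
  obtain ⟨r, hr⟩ := r
  have hr : 0 < r := hr
  simp only [osc, ← integral_const_mul]
  congr 1 with y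
  simp only [hF, ofPolar, smul_smul]
  rw [cut_smul_coe f (by positivity), mink_sub_self, mink_smul_smul, y.2, x.2, mink_comm x.1,
    mink_smul_left, mink_comm]
  change _ = exp _ * _ * (exp (-(I * ((s * r : ℝ) : ℂ) * (mink x.1 y.1 : ℝ))) * f y)
  have e3 : exp (I * s / 2 * ((r ^ 2 * 1 - 2 * (r * mink x.1 y.1) + 1 : ℝ) : ℂ))
      = exp (I * s / 2 * (1 + r ^ 2))
        * exp (-(I * ((s * r : ℝ) : ℂ) * (mink x.1 y.1 : ℝ))) := by
    rw [← exp_add]; congr 1; push_cast; ring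
  rw [e3]
  ring

/-- The amplitude, at the critical point on the diagonal, of the oscillatory integral. -/
def ampConst (D : ℕ) : ℂ :=
  (2 * π * I * ((-1 : ℝ) : ℂ)) ^ (1 / 2 : ℂ)
    * ((2 * π * I) ^ (1 / 2 : ℂ)) ^ (D - 1)

lemma prod_eta_cpow (D : ℕ) :
    ∏ i : Ix D, (2 * π * I * eta i) ^ (1 / 2 : ℂ)
      = (2 * π * I * ((-1 : ℝ) : ℂ)) ^ (1 / 2 : ℂ)
        * ((2 * π * I) ^ (1 / 2 : ℂ)) ^ D := by
  rw [Fin.prod_univ_succ]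
  simp [eta, Fin.succ_ne_zero]

lemma sqrt_pow_eq (D : ℕ) {s : ℝ} (hs : 0 ≤ s) : √s ^ D = s ^ ((D : ℝ) / 2) := by
  rw [sqrt_eq_rpow, ← rpow_natCast, ← rpow_mul hs]; congr 1; ring

/-- Only the value on the diagonal enters the amplitude of the critical point `y = x` of the
embedding distance. -/
lemma ampInf_point (hD : 1 ≤ D) (x : dS D) {K : Set (dS D)} (hK : IsCompact K) {b : dS D → ℂ}
    (hb : Sm b) (h0 : ∀ y, y ∉ K → b y = 0) :
    I / 2 * ampInf D ((vol D).restrict K) (embZ x) b 1 = ampConst D * b x := by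
  have hs : Supp Set.univ b := ⟨K, hK, subset_univ K, h0⟩
  obtain ⟨R, hR⟩ := hK.exists_bound_of_continuousOn
    (continuous_embZ.comp (Continuous.prodMk_right x)).continuousOn
  have hR' : ∀ y ∈ K, |embZ x y| ≤ max R 0 := fun y hy => (hR y hy).trans (le_max_left _ _)
  have hch := waveChain_point hD x hK hR' hb h0
  set ν := (vol D).restrict K with hν
  obtain ⟨C, hC, hrem⟩ := exists_psiRem_le_inv (le_max_right R 0) hch 0
  have hcont := continuous_psiRem hch 0
  simp only [Function.iterate_zero, id_eq] at hrem hcont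
  set A := I / 2 * ampInf D ν (embZ x) b 1
  set B := -(I / 2) * ampInf D ν (embZ x) b (-1)
  -- both sides are the limit of the same Fresnel integral
  have L1 := tendsto_fresnel (ι := Ix D) (ε := eta)
    (fun i => by unfold eta; split_ifs <;> simp) (G := fun W => cut b ((2 : ℝ) • (W + x.1)))
    ((cut_contDiff hb).comp ((contDiff_id.add contDiff_const).const_smul (2 : ℝ)))
    ((cut_hasCompactSupport hs).comp_homeomorph
      ((Homeomorph.addRight x.1).trans (Homeomorph.smulOfNeZero (2 : ℝ) two_ne_zero)))
  simp only [Fintype.card_fin, zero_add, cut_smul_coe b two_pos] at L1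
  rw [prod_eta_cpow] at L1
  set N : ℝ → ℝ → ℂ := fun s r => exp (I * s / 2 * (1 + r ^ 2))
  have hint : ∀ c : ℝ → ℂ, Continuous c → Integrable fun r : ℝ => profile D r * c r := fun c hc => by
    simpa using integrable_profile_mul (D := D) hc 0
  have e1 : ∀ s : ℝ, 0 < s → ((√s : ℝ) : ℂ) * (∫ r : ℝ, profile D r * (N s r
        * (A * exp (-(I * s * r)) + B * exp (I * s * r))))
      + ((√s : ℝ) : ℂ) * (∫ r : ℝ, profile D r * (N s r * psiRem D ν (embZ x) b (s * r)))
      = ((√s : ℝ) : ℂ) ^ (D + 1) * ∫ W : Amb D,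
        exp (I * s / 2 * ∑ i, (eta i : ℂ) * (W i : ℂ) ^ 2) * cut b ((2 : ℝ) • (W + x.1)) := by
    intro s hs0
    rw [integral_fresnel_polar hb hs, pow_succ', mul_assoc, ← integral_const_mul (_ ^ D), ← mul_add,
      ← integral_add (hint _ (by fun_prop)) (hint _ (by fun_prop)),
      ← setIntegral_eq_integral_of_forall_compl_eq_zero (s := Ioi (0 : ℝ)) fun r hr => ?_]
    · congr 1
      refine setIntegral_congr_fun measurableSet_Ioi fun r hr => ?_
      have hr : 0 < r := hr
      have : (r : ℝ) ^ D = r ^ ((D : ℝ) / 2) * r ^ ((D : ℝ) / 2) := by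
        rw [← rpow_add hr, add_halves, rpow_natCast]
      simp only [profile, psiRem, psi, A, B, N]
      rw [show osc ν (embZ x) b (s * r) = _ from osc_restrict _ _ h0 _, ← ofReal_pow √s, sqrt_pow_eq D hs0.le, mul_rpow hs0.le hr.le,
        ← ofReal_pow r D, this]
      push_cast
      ring_nf
    · simp [profile_eq_zero fun h => hr (lt_of_lt_of_le one_half_pos h.1)]
  have L3 : Tendsto (fun s : ℝ => ((√s : ℝ) : ℂ) * ∫ r : ℝ, profile D r * (N s r
      * psiRem D ν (embZ x) b (s * r))) atTop (𝓝 0) := by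
    set M := ∫ r : ℝ, ‖profile D r‖
    refine squeeze_zero_norm' (a := fun s => 2 * C * M * (√s)⁻¹) ?_ (by
      simpa using (tendsto_inv_atTop_zero.comp Real.tendsto_sqrt_atTop).const_mul (2 * C * M))
    filter_upwards [eventually_ge_atTop 2] with s hs2
    have hs0 : 0 < s := by linarith
    have hle : ‖∫ r : ℝ, profile D r * (N s r * psiRem D ν (embZ x) b (s * r))‖
        ≤ ∫ r : ℝ, ‖profile D r‖ * (2 * C * s⁻¹) := by
      refine norm_integral_le_of_norm_le ((by simpa using hint _ continuous_one :
        Integrable (profile D)).norm.mul_const _) (.of_forall fun r => ?_)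
      by_cases hr : r ∈ Icc (1 / 2 : ℝ) (3 / 2)
      · have hr1 := hr.1
        rw [norm_mul, norm_mul, show ‖N s r‖ = 1 by simp [N, norm_exp, ← ofReal_pow], one_mul]
        gcongr
        calc _ ≤ C * (s * r)⁻¹ := hrem _ (by nlinarith)
          _ ≤ C * (s * (1 / 2))⁻¹ := by gcongr
          _ = _ := by field_simp
      · simp [profile_eq_zero hr]
    rw [integral_mul_const] at hle
    rw [norm_mul, norm_real, norm_of_nonneg (sqrt_nonneg _)]
    have := sqrt_pos.2 hs0
    calc √s * _ ≤ √s * (M * (2 * C * s⁻¹)) := by gcongr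
      _ = _ := by
        rw [show s⁻¹ = (√s)⁻¹ * (√s)⁻¹ by rw [← mul_inv, mul_self_sqrt hs0.le]]
        field_simp
  have key := tendsto_nhds_unique (((tendsto_radial A B).add L3).congr'
    ((eventually_gt_atTop 0).mono e1)) L1
  have hb2 : (bump 2 : ℂ) ≠ 0 := ofReal_ne_zero.2 (bump_ne_zero.2 (by norm_num))
  have hpi : ((2 * π * I) ^ (1 / 2 : ℂ) : ℂ) ≠ 0 := by simp [Complex.cpow_eq_zero_iff, pi_ne_zero]
  rw [show profile D 1 = bump 2 by simp [profile]] at key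
  obtain ⟨d, rfl⟩ : ∃ d, D = d + 1 := ⟨D - 1, by omega⟩
  rw [pow_succ] at key
  rw [ampConst, Nat.add_sub_cancel]
  refine mul_left_cancel₀ (mul_ne_zero hpi hb2) ?_
  linear_combination key

end

section
open scoped ContDiff
variable {D : ℕ}
variable {K : Set (dS D × dS D)} {u : dS D → dS D → ℂ}
variable {Ω : Type*} [MeasurableSpace Ω] (μ : Measure Ω) (Z : Ω → ℝ) {f : Ω → ℂ} {L : Set Ω}

lemma amp_restrict (h : ∀ P, P ∉ L → f P = 0) (σ s : ℝ) :
    amp D (μ.restrict L) Z f σ s = amp D μ Z f σ s := by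
  simp only [amp, psi, dpsi]
  rw [osc_restrict μ Z h, osc_restrict μ Z fun P hP => by rw [mulZ, h P hP, mul_zero]]

lemma ampInf_restrict (h : ∀ P, P ∉ L → f P = 0) (σ : ℝ) :
    ampInf D (μ.restrict L) Z f σ = ampInf D μ Z f σ := by
  rw [ampInf, funext (amp_restrict μ Z h σ), ← ampInf]

lemma iterate_box2_apply (u : dS D → dS D → ℂ) (i : ℕ) (x : dS D) :
    (box2^[i] u) x = boxFn^[i] (u x) := by
  induction i with
  | zero => rfl
  | succ i ih => rw [Function.iterate_succ_apply', Function.iterate_succ_apply', ← ih]; rfl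

lemma isCompact_slice (hK : IsCompact K) (x : dS D) :
    IsCompact {y | (x, y) ∈ K} :=
  (hK.image continuous_snd).of_isClosed_subset (hK.isClosed.preimage (Continuous.prodMk_right x))
    fun y hy => ⟨(x, y), hy, rfl⟩

lemma osc_prod (hK : IsCompact K) 
    (hu : TestOn K u) {g : dS D × dS D → ℂ} (hg : Continuous g) (s : ℝ) :
    Integrable (fun x => osc (vol D) (embZ x) (fun y => g (x, y) * u x y) s) (vol D) ∧
    osc (vol₂ D) (fun P => embZ P.1 P.2) (fun P => g P * u P.1 P.2) s
      = ∫ x, osc (vol D) (embZ x) (fun y => g (x, y) * u x y) s ∂(vol D) := by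
  have hi := integrable_osc continuous_embZ.measurable (integrable_of_testOn hK hu hg) s
  exact ⟨hi.integral_prod_left, integral_prod _ hi⟩

lemma amp_prod (hK : IsCompact K) 
    (hu : TestOn K u) (σ s : ℝ) :
    Integrable (fun x => amp D (vol D) (embZ x) (u x) σ s) (vol D) ∧
    amp D (vol₂ D) (fun P => embZ P.1 P.2) (fun P => u P.1 P.2) σ s
      = ∫ x, amp D (vol D) (embZ x) (u x) σ s ∂(vol D) := by
  have h1 := osc_prod hK hu (g := fun _ => 1) continuous_const s
  have h2 := osc_prod hK hu (g := fun P => -(I * (embZ P.1 P.2 : ℂ)))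
    (continuous_const.mul (continuous_ofReal.comp continuous_embZ)).neg s
  simp only [one_mul] at h1
  set a : dS D → ℂ := fun x => osc (vol D) (embZ x) (u x) s
  set b : dS D → ℂ := fun x => osc (vol D) (embZ x) (mulZ (embZ x) (u x)) s
  have h1a : Integrable a (vol D) := h1.1
  have h2b : Integrable b (vol D) := h2.1
  set c : ℂ := ((s ^ ((D : ℝ) / 2) : ℝ) : ℂ)
  set E := exp (I * σ * s)
  have e : ∀ x, amp D (vol D) (embZ x) (u x) σ s
      = E * c * b x + E * c * ((D : ℂ) / 2 * (s : ℂ)⁻¹ - I * σ) * a x := fun x => by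
    simp only [amp, psi, dpsi]
    ring
  have e' : amp D (vol₂ D) (fun P => embZ P.1 P.2) (fun P => u P.1 P.2) σ s
      = E * c * ∫ x, b x ∂(vol D) + E * c * ((D : ℂ) / 2 * (s : ℂ)⁻¹ - I * σ)
        * ∫ x, a x ∂(vol D) := by
    rw [← h1.2, show ∫ x, b x ∂(vol D) = _ from h2.2.symm]
    simp only [amp, psi, dpsi]
    change E * (c * (osc _ _ (mulZ _ _) s + _) - _ * (c * _)) = E * c * osc _ _ (mulZ _ _) s + _
    ring
  simp only [e, e']
  refine ⟨(h2b.const_mul _).add (h1a.const_mul _), ?_⟩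
  rw [integral_add (h2b.const_mul _) (h1a.const_mul _), integral_const_mul, integral_const_mul]

lemma integrable_integral_norm (hK : IsCompact K) 
    (hu : TestOn K u) : Integrable (fun x => ∫ y, ‖u x y‖ ∂(vol D)) (vol D) := by
  simpa using (integrable_of_testOn hK hu (g := fun _ => 1) continuous_const).norm.integral_prod_left

/-- The amplitude of a test function of two points is given by its values on the diagonal. -/
lemma ampInf_pair (hD : 1 ≤ D) (hK : IsCompact K)
    (hu : TestOn K u) :
    I / 2 * ampInf D (vol₂ D) (fun P => embZ P.1 P.2) (fun P => u P.1 P.2) 1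
      = ampConst D * ∫ x, u x x ∂(vol D) := by
  obtain ⟨R, hR0, hR⟩ := exists_embZ_bound hK
  have h0 : ∀ x y, y ∉ {y | (x, y) ∈ K} → u x y = 0 := fun x y h => hu.2 x y h
  have hch : ∀ x, WaveChain D ((vol D).restrict {y | (x, y) ∈ K}) (embZ x) R
      fun i => boxFn^[i] (u x) := fun x =>
    waveChain_point hD x (isCompact_slice hK x) (fun y hy => hR (x, y) hy) (hu.1.swap.slice x) (h0 x)
  obtain ⟨C, hC, hamp⟩ := exists_amp_le (dS D) D hR0
  obtain ⟨C', -, hamp'⟩ := exists_amp_sub_le (dS D) D hR0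
  have hpt : ∀ x, ampInf D (vol D) (embZ x) (u x) 1 = -(2 * I) * (ampConst D * u x x) := fun x => by
    rw [← ampInf_point hD x (isCompact_slice hK x) (hu.1.swap.slice x) (h0 x),
      ampInf_restrict _ _ (h0 x)]
    linear_combination (ampInf D (vol D) (embZ x) (u x) 1) * I_sq
  have hlim : Tendsto (fun s => ∫ x, amp D (vol D) (embZ x) (u x) 1 s ∂(vol D)) atTop
      (𝓝 (∫ x, ampInf D (vol D) (embZ x) (u x) 1 ∂(vol D))) := by
    refine tendsto_integral_filter_of_dominated_convergence
      (fun x => C * ∑ j ∈ Finset.range (D + 1 + 1), ∫ y, ‖(box2^[j] u) x y‖ ∂(vol D))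
      (.of_forall fun s => (amp_prod hK hu 1 s).1.1) ?_ ?_ (.of_forall fun x => ?_)
    · filter_upwards [eventually_ge_atTop 1] with s hs
      refine .of_forall fun x => ?_
      have h := hamp _ _ _ (hch x) 0 s hs 1 (by simp)
      simp only [Function.iterate_zero, id_eq, zero_add] at h
      rw [amp_restrict _ _ (h0 x)] at h
      refine h.trans_eq ?_
      simp only [l1Sum, iterate_box2_apply]
      congr 2 with j
      exact setIntegral_eq_integral_of_forall_compl_eq_zero fun y hy => by
        rw [iterate_boxFn_eq_zero (isCompact_slice hK x) (h0 x) j y hy, norm_zero]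
    · exact (integrable_finsetSum _ fun j _ =>
        integrable_integral_norm hK (hu.iterate_box2 hK j)).const_mul C
    · have h := (hamp' _ _ _ (hch x) 0 1 (by simp)).1
      simp only [Function.iterate_zero, id_eq] at h
      rw [ampInf_restrict _ _ (h0 x)] at h
      exact h.congr fun s => amp_restrict _ _ (h0 x) 1 s
  have hinf : ampInf D (vol₂ D) (fun P => embZ P.1 P.2) (fun P => u P.1 P.2) 1
      = ∫ x, ampInf D (vol D) (embZ x) (u x) 1 ∂(vol D) :=
    (hlim.congr fun s => (amp_prod hK hu 1 s).2.symm).limUnder_eq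
  rw [hinf]
  simp only [hpt, integral_const_mul]
  linear_combination -(ampConst D * ∫ x, u x x ∂(vol D)) * I_sq

end

section
open scoped ContDiff

/-! ### Resolvent integrals -/

variable {Ω : Type*} [MeasurableSpace Ω] {μ : Measure Ω} {Z : Ω → ℝ} {f : Ω → ℂ} {g : ℕ → Ω → ℂ}
  {D : ℕ} {R a p : ℝ} {r y : ℂ}

/-- The integral `∫ (y - Z)^{-a} f`. -/
def res (μ : Measure Ω) (Z : Ω → ℝ) (f : Ω → ℂ) (a : ℝ) (y : ℂ) : ℂ :=
  ∫ x, (y - Z x) ^ (-(a : ℂ)) * f x ∂μ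

lemma im_sub_ofReal (y : ℂ) (t : ℝ) : (y - t).im = y.im := by simp

lemma sub_mem_slitPlane (hy : 0 < y.im) (t : ℝ) : y - t ∈ slitPlane :=
  Or.inr (by rw [im_sub_ofReal]; exact hy.ne')

lemma norm_cpow_neg_le {w : ℂ} {r : ℝ} (hr : 0 < r) (hw : r ≤ ‖w‖) (ha : 0 ≤ a) :
    ‖w ^ (-(a : ℂ))‖ ≤ r ^ (-a) := by
  rw [← ofReal_neg, Complex.norm_cpow_real]
  exact rpow_le_rpow_of_nonpos hr hw (by linarith)

lemma im_le_norm_sub (t : ℝ) : y.im ≤ ‖y - t‖ := by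
  rw [← im_sub_ofReal y t]; exact (le_abs_self _).trans (Complex.abs_im_le_norm _)

lemma aesm_res (hZ : Measurable Z) (a : ℝ) (y : ℂ) :
    AEStronglyMeasurable (fun x => (y - Z x) ^ (-(a : ℂ))) μ := by
  have : Measurable fun x => (y - Z x) ^ (-(a : ℂ)) := by fun_prop
  exact this.aestronglyMeasurable

lemma integrable_res (hZ : Measurable Z) (hf : Integrable f μ) (ha : 0 ≤ a) (hy : 0 < y.im) :
    Integrable (fun x => (y - Z x) ^ (-(a : ℂ)) * f x) μ :=
  hf.bdd_mul (c := y.im ^ (-a)) (aesm_res hZ a y)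
    (.of_forall fun _ => norm_cpow_neg_le hy (im_le_norm_sub _) ha)

lemma hasDerivAt_res (hZ : Measurable Z) (hf : Integrable f μ) (ha : 0 ≤ a) (hy : 0 < y.im) :
    HasDerivAt (res μ Z f a) (-a * res μ Z f (a + 1) y) y := by
  have hs : {w : ℂ | y.im / 2 < w.im} ∈ 𝓝 y :=
    (isOpen_lt continuous_const continuous_im).mem_nhds (by
      change y.im / 2 < y.im; linarith)
  have h := (hasDerivAt_integral_of_dominated_loc_of_deriv_le (s := {w : ℂ | y.im / 2 < w.im})
    (F := fun y x => (y - Z x) ^ (-(a : ℂ)) * f x)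
    (F' := fun y x => -a * ((y - Z x) ^ (-((a + 1 : ℝ) : ℂ)) * f x))
    (bound := fun x => a * ((y.im / 2) ^ (-(a + 1)) * ‖f x‖)) hs
    (.of_forall fun y => (aesm_res hZ a y).mul hf.1) (integrable_res hZ hf ha hy)
    (((aesm_res hZ (a + 1) y).mul hf.1).const_mul _) ?_ ((hf.norm.const_mul _).const_mul _) ?_).2
  · rw [integral_const_mul] at h
    exact h
  · refine .of_forall fun x w hw => ?_
    rw [norm_mul, norm_mul, norm_neg, norm_real, norm_of_nonneg ha]
    have := norm_cpow_neg_le (a := a + 1) (half_pos hy) ((le_of_lt hw).trans (im_le_norm_sub (Z x)))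
      (by linarith)
    gcongr
  · refine .of_forall fun x w hw => ?_
    have hw' : 0 < w.im := (half_pos hy).trans hw
    have h1 := (((hasDerivAt_id w).sub_const (Z x : ℂ)).cpow_const (c := -(a : ℂ))
      (sub_mem_slitPlane hw' _)).mul_const (f x)
    refine h1.congr_deriv ?_
    rw [show -((a + 1 : ℝ) : ℂ) = -(a : ℂ) - 1 by push_cast; ring]
    simp only [id_eq]
    ring

lemma contDiff_cpow_sub (c : ℂ) (hy : 0 < y.im) :
    ContDiff ℝ ∞ fun t : ℝ => (y - t) ^ c :=
  contDiff_iff_contDiffAt.2 fun t => ContDiffAt.comp (g := fun w : ℂ => (y - w) ^ c) t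
    (((analyticAt_const.sub analyticAt_id).cpow analyticAt_const
      (sub_mem_slitPlane hy t)).contDiffAt.restrict_scalars ℝ) ofRealCLM.contDiff.contDiffAt

lemma deriv_cpow_sub (c : ℂ) (hy : 0 < y.im) :
    deriv (fun t : ℝ => (y - t) ^ c) = fun t : ℝ => -c * (y - t) ^ (c - 1) := by
  funext t
  have h1 : HasDerivAt (fun w : ℂ => y - w) (-1) (t : ℂ) := (hasDerivAt_id _).const_sub y
  have h2 := (h1.cpow_const (c := c) (sub_mem_slitPlane hy t)).comp_ofReal
  rw [h2.deriv]; ring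

/-- The wave equation for the resolvent integrals. -/
lemma WaveChain.res_ode
    (h : WaveChain D μ Z R g) (i : ℕ) (hp : 0 ≤ p) (hD : (D : ℝ) = 2 * p + 1)
    (hy : 0 < y.im) :
    res μ Z (g (i + 1)) p y = p ^ 2 * res μ Z (g i) p y
      - (y ^ 2 - 1) * (p * (p + 1)) * res μ Z (g i) (p + 2) y + p * y * res μ Z (g i) (p + 1) y := by
  have hg := h.green i _ (contDiff_cpow_sub (-(p : ℂ)) hy)
  have e2 : deriv (deriv fun t : ℝ => (y - t) ^ (-(p : ℂ)))
      = fun t : ℝ => p * (p + 1) * (y - t) ^ (-((p + 2 : ℝ) : ℂ)) := by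
    rw [deriv_cpow_sub _ hy]
    funext t
    have h1 := congrFun (deriv_cpow_sub (-(p : ℂ) - 1) hy) t
    rw [deriv_const_mul_field, h1]
    push_cast
    rw [show -(p : ℂ) - 1 - 1 = -(p + 2) by ring]
    ring
  rw [e2, deriv_cpow_sub _ hy] at hg
  rw [res, hg, res, res, res, ← integral_const_mul, ← integral_const_mul, ← integral_const_mul]
  have i0 := (integrable_res h.meas (h.int i) hp hy).const_mul ((p : ℂ) ^ 2)
  have i1 := (integrable_res h.meas (h.int i) (a := p + 1) (by linarith) hy).const_mul (p * y)
  have i2 := (integrable_res h.meas (h.int i) (a := p + 2) (by linarith) hy).const_mul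
    ((y ^ 2 - 1) * (p * (p + 1)))
  rw [← integral_sub i0 i2]
  refine Eq.trans ?_ (integral_add (i0.sub i2) i1)
  congr 1 with x
  have hw := sub_mem_slitPlane hy (Z x)
  have hw0 := slitPlane_ne_zero hw
  have hD' : (D : ℂ) = 2 * p + 1 := by exact_mod_cast congrArg ((↑) : ℝ → ℂ) hD
  have e0 := Complex.cpow_sub (-(p : ℂ)) 1 hw0
  have e1 := Complex.cpow_sub (-(p : ℂ) - 1) 1 hw0
  rw [cpow_one] at e0 e1
  push_cast
  rw [show -((p : ℂ) + 1) = -p - 1 by ring, show -((p : ℂ) + 2) = -p - 1 - 1 by ring, e1, e0, hD']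
  field_simp
  ring

lemma WaveChain.integral_succ
    (h : WaveChain D μ Z R g) (i : ℕ) : ∫ x, g (i + 1) x ∂μ = 0 := by
  have := h.green i (fun _ => 1) contDiff_const
  simpa using this

/-! ### The resolvent integral as a Laplace transform -/

/-- The Laplace transform `∫ s^{a-1} e^{isy} Φ(s) ds` over the positive half-line. -/
def osInt (a : ℝ) (Φ : ℝ → ℂ) (y : ℂ) : ℂ :=
  ∫ s in Ioi (0 : ℝ), (s : ℂ) ^ ((a : ℂ) - 1) * exp (I * y * s) * Φ s

/-- The constant relating resolvents to Laplace transforms. -/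
def cGam (a : ℝ) : ℂ := exp (-(I * π * a / 2)) / Gamma a

lemma integrable_rpow_exp (ha : 0 < a) {b : ℝ} (hb : 0 < b) :
    IntegrableOn (fun s : ℝ => s ^ (a - 1) * rexp (-b * s)) (Ioi 0) := by
  have h := integrableOn_rpow_mul_exp_neg_mul_rpow (s := a - 1) (p := 1) (b := b) (by linarith)
    one_pos hb
  simpa using h

lemma continuousOn_cpow_exp (a : ℝ) (r : ℂ) :
    ContinuousOn (fun s : ℝ => (s : ℂ) ^ ((a : ℂ) - 1) * exp (-(r * s))) (Ioi 0) := fun s hs => by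
  have hs' : (s : ℂ) ∈ slitPlane := Or.inl (by simpa using hs)
  have h1 : ContinuousAt (fun s : ℝ => (s : ℂ) ^ ((a : ℂ) - 1)) s :=
    (continuous_ofReal.continuousAt).cpow continuousAt_const hs'
  exact (h1.mul (by fun_prop)).continuousWithinAt

lemma norm_cpow_exp {s : ℝ} (hs : 0 < s) (r : ℂ) :
    ‖(s : ℂ) ^ ((a : ℂ) - 1) * exp (-(r * s))‖ = s ^ (a - 1) * rexp (-r.re * s) := by
  rw [norm_mul, norm_cpow_eq_rpow_re_of_pos hs, norm_exp]
  simp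

lemma integrable_cpow_exp_neg (ha : 0 < a) (hr : 0 < r.re) :
    IntegrableOn (fun s : ℝ => (s : ℂ) ^ ((a : ℂ) - 1) * exp (-(r * s))) (Ioi 0) := by
  refine Integrable.mono' (integrable_rpow_exp ha hr)
    ((continuousOn_cpow_exp a r).aestronglyMeasurable measurableSet_Ioi) ?_
  filter_upwards [ae_restrict_mem measurableSet_Ioi] with s hs
  exact (norm_cpow_exp hs r).le

/-- The Laplace transform of a power on the right half-plane, by analytic continuation from the
positive half-line. -/
lemma integral_cpow_exp_neg (ha : 0 < a) (hr : 0 < r.re) :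
    ∫ s in Ioi (0 : ℝ), (s : ℂ) ^ ((a : ℂ) - 1) * exp (-(r * s)) = (1 / r) ^ (a : ℂ) * Gamma a := by
  have hU : IsOpen {r : ℂ | 0 < r.re} := isOpen_lt continuous_const continuous_re
  have hd1 : DifferentiableOn ℂ (fun r : ℂ => ∫ s in Ioi (0 : ℝ),
      (s : ℂ) ^ ((a : ℂ) - 1) * exp (-(r * s))) {r : ℂ | 0 < r.re} := fun r hr => by
    have hr' : 0 < r.re := hr
    have hs : {w : ℂ | r.re / 2 < w.re} ∈ 𝓝 r :=
      (isOpen_lt continuous_const continuous_re).mem_nhds (by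
        change r.re / 2 < r.re; linarith)
    refine ((hasDerivAt_integral_of_dominated_loc_of_deriv_le (s := {w : ℂ | r.re / 2 < w.re})
      (F' := fun r (s : ℝ) => (s : ℂ) ^ ((a : ℂ) - 1) * (exp (-(r * s)) * -s))
      (bound := fun s => s ^ ((a + 1) - 1) * rexp (-(r.re / 2) * s)) hs
      (.of_forall fun w =>
        (continuousOn_cpow_exp a w).aestronglyMeasurable measurableSet_Ioi)
      (integrable_cpow_exp_neg ha hr') ?_ ?_ (integrable_rpow_exp (by linarith) (by linarith))
      ?_).2).differentiableAt.differentiableWithinAt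
    · refine ContinuousOn.aestronglyMeasurable ?_ measurableSet_Ioi
      have := (continuousOn_cpow_exp a r).mul
        (continuous_ofReal.neg.continuousOn (s := Ioi (0 : ℝ)))
      refine this.congr fun s _ => ?_
      exact (mul_assoc _ _ _).symm
    · filter_upwards [ae_restrict_mem measurableSet_Ioi] with s hs w hw
      have hs : 0 < s := hs
      have hw : r.re / 2 < w.re := hw
      rw [← mul_assoc, norm_mul, norm_cpow_exp hs, norm_neg, norm_real,
        norm_of_nonneg hs.le, show a + 1 - 1 = (a - 1) + 1 by ring, rpow_add_one hs.ne',
        mul_right_comm]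
      gcongr
    · refine .of_forall fun s w _ => ?_
      have h1 : HasDerivAt (fun w : ℂ => -(w * s)) (-s) w := by
        simpa using ((hasDerivAt_id w).mul_const (s : ℂ)).fun_neg
      exact h1.cexp.const_mul _
  have hd2 : DifferentiableOn ℂ (fun r : ℂ => (1 / r) ^ (a : ℂ) * Gamma a)
      {r : ℂ | 0 < r.re} := fun r hr => by
    have hr0 : r ≠ 0 := fun h => by rw [h] at hr; simp at hr
    refine (DifferentiableAt.mul_const (DifferentiableAt.cpow_const ?_ ?_) _).differentiableWithinAt
    · exact (differentiableAt_const _).div differentiableAt_id hr0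
    · rw [one_div]
      exact Or.inl (by rw [inv_re]; exact div_pos hr (Complex.normSq_pos.2 hr0))
  have hc : IsPreconnected {r : ℂ | 0 < r.re} := (convex_halfSpace_re_gt 0).isPreconnected
  refine (hd1.analyticOnNhd hU).eqOn_of_preconnected_of_frequently_eq (hd2.analyticOnNhd hU) hc
    (z₀ := 1) (by simp) ?_ hr
  have ht : Tendsto (fun t : ℝ => (t : ℂ)) (𝓝[>] 1) (𝓝[≠] 1) := by
    refine tendsto_nhdsWithin_iff.2
      ⟨by simpa using (continuous_ofReal.tendsto 1).mono_left nhdsWithin_le_nhds, ?_⟩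
    filter_upwards [self_mem_nhdsWithin] with t ht
    simpa using ne_of_gt ht
  refine ht.frequently (Eventually.frequently ?_)
  filter_upwards [self_mem_nhdsWithin] with t ht
  exact Complex.integral_cpow_mul_exp_neg_mul_Ioi (by simpa) (zero_lt_one.trans ht)

lemma integral_cpow_exp (ha : 0 < a) {w : ℂ} (hw : 0 < w.im) :
    ∫ s in Ioi (0 : ℝ), (s : ℂ) ^ ((a : ℂ) - 1) * exp (I * w * s)
      = Gamma a * exp (I * π * a / 2) * w ^ (-(a : ℂ)) := by
  have hw0 : w ≠ 0 := fun h => by rw [h] at hw; simp at hw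
  have hr : 0 < (-I * w).re := by simpa using hw
  have h := integral_cpow_exp_neg ha hr
  have e : ∀ s : ℝ, -(-I * w * s) = I * w * s := fun s => by ring
  simp only [e] at h
  rw [h, mul_comm, mul_assoc]
  congr 1
  have hlog : Complex.log (-I * w) = -(I * π / 2) + Complex.log w := by
    rw [(Complex.log_mul_eq_add_log_iff (by simp) hw0).2, Complex.log, arg_neg_I]
    · simp; ring
    · rw [arg_neg_I]
      have h1 : 0 ≤ w.arg := Complex.arg_nonneg_iff.2 hw.le
      have h2 := Complex.arg_le_pi w
      have := pi_pos
      constructor <;> linarith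
  have harg : (-I * w).arg ≠ π :=
    (Complex.arg_lt_pi_iff.2 (Or.inl hr.le)).ne
  have hne : -I * w ≠ 0 := mul_ne_zero (by simp) hw0
  rw [one_div, cpow_def_of_ne_zero (inv_ne_zero hne), Complex.log_inv _ harg, hlog,
    cpow_def_of_ne_zero hw0, ← exp_add]
  congr 1
  ring

lemma integrable_cpow_exp (ha : 0 < a) (hy : 0 < y.im) :
    IntegrableOn (fun s : ℝ => (s : ℂ) ^ ((a : ℂ) - 1) * exp (I * y * s)) (Ioi 0) := by
  have h := integrable_cpow_exp_neg ha (r := -I * y) (by simpa using hy)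
  have e : ∀ s : ℝ, -(-I * y * s) = I * y * s := fun s => by ring
  simpa only [e] using h

lemma res_eq_osInt [SFinite μ] (hZ : Measurable Z)
    (hf : Integrable f μ) (ha : 0 < a) (hy : 0 < y.im) :
    res μ Z f a y = cGam a * osInt a (osc μ Z f) y := by
  have hG : Gamma a ≠ 0 := Gamma_ne_zero_of_re_pos (by simpa)
  have e1 : ∀ x, (y - Z x) ^ (-(a : ℂ)) * f x = cGam a * ∫ s in Ioi (0 : ℝ),
      ((s : ℂ) ^ ((a : ℂ) - 1) * exp (I * y * s)) * (exp (-(I * s * Z x)) * f x) := fun x => by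
    have h := integral_cpow_exp ha (w := y - Z x) (by rwa [im_sub_ofReal])
    have e : ∀ s : ℝ, ((s : ℂ) ^ ((a : ℂ) - 1) * exp (I * y * s)) * (exp (-(I * s * Z x)) * f x)
        = ((s : ℂ) ^ ((a : ℂ) - 1) * exp (I * (y - Z x) * s)) * f x := fun s => by
      rw [show I * (y - Z x) * s = I * y * s + -(I * s * Z x) by ring, exp_add]
      ring
    simp only [e]
    rw [integral_mul_const, h, cGam, exp_neg]
    field_simp
  simp only [res, e1]
  rw [integral_const_mul, integral_integral_swap]
  · congr 1
    simp only [osInt, osc, integral_const_mul]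
  · have h1 := hf.mul_prod (integrable_cpow_exp ha hy)
    have hm : Measurable fun P : Ω × ℝ => exp (-(I * P.2 * Z P.1)) := by fun_prop
    refine (h1.mul_bdd (c := 1) hm.aestronglyMeasurable
      (.of_forall fun P => (norm_exp_osc _ _).le)).congr (.of_forall fun P => ?_)
    simp only [Function.uncurry]
    ring

end

section
open scoped ContDiff
variable {R a s B : ℝ} {y u : ℂ}

/-! ### Boundary values of the resolvent integrals -/

variable {Ω : Type*} [MeasurableSpace Ω]

/-- A bound by `B` and by `B s^{-(a + 1/2)}`. -/
def Decays (a B : ℝ) (Φ : ℝ → ℂ) : Prop :=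
  ∀ s, 0 < s → ‖Φ s‖ ≤ B ∧ s ^ (a + 1 / 2) * ‖Φ s‖ ≤ B

/-- A wave chain in dimension `D = 2p + 1`; the exponent of its resolvent integrals is `p`. -/
structure PChain (D : ℕ) (p : ℝ) (μ : Measure Ω) (Z : Ω → ℝ) (R : ℝ) (f : ℕ → Ω → ℂ) : Prop
    extends WaveChain D μ Z R f where
  pos : 0 < p
  dim : (D : ℝ) = 2 * p + 1
  nonneg : 0 ≤ R

/-- Uniform decay of the oscillatory integrals of a wave chain. -/
lemma exists_osc_le (Ω : Type*) [MeasurableSpace Ω] (D : ℕ) {p : ℝ} (hD : (D : ℝ) = 2 * p + 1)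
    (hR : 0 ≤ R) : ∃ C : ℝ, 0 ≤ C ∧ ∀ (μ : Measure Ω) (Z : Ω → ℝ) (f : ℕ → Ω → ℂ),
      WaveChain D μ Z R f → ∀ i, Decays p (C * l1Sum μ f (i + (D + 1))) (osc μ Z (f i)) := by
  obtain ⟨C, hC, h⟩ := exists_amp_le Ω D hR
  refine ⟨C + 1, by linarith, fun μ Z f hf i s hs => ?_⟩
  have hl := l1Sum_nonneg μ f (i + (D + 1))
  have h1 : ‖osc μ Z (f i) s‖ ≤ l1Sum μ f (i + (D + 1)) :=
    (norm_osc_le _ _).trans (le_l1Sum μ f (by omega))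
  rw [show p + 1 / 2 = (D : ℝ) / 2 by rw [hD]; ring]
  refine ⟨h1.trans (by nlinarith), ?_⟩
  rcases le_total s 1 with hs1 | hs1
  · refine (mul_le_of_le_one_left (norm_nonneg _) (Real.rpow_le_one hs.le hs1 ?_)).trans
      (h1.trans ?_)
    · positivity
    · nlinarith
  · have h2 := norm_psi_le_amp D μ Z (f i) s (h μ Z f hf i s hs1)
    rw [psi, norm_mul, norm_real, norm_of_nonneg (by positivity)] at h2
    exact h2.trans (by nlinarith)

/-- The dominating function `min (s^{a-1}, s^{-3/2})`. -/
def domin (a s : ℝ) : ℝ := min (s ^ (a - 1)) (s ^ (-(3 / 2) : ℝ))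

lemma domin_nonneg (hs : 0 < s) : 0 ≤ domin a s :=
  le_min (by positivity) (by positivity)

lemma integrable_domin (ha : 0 < a) : IntegrableOn (domin a) (Ioi 0) := by
  have hm : Measurable (domin a) := by unfold domin; fun_prop
  rw [← Set.Ioc_union_Ioi_eq_Ioi zero_le_one]
  refine IntegrableOn.union ?_ ?_
  · refine Integrable.mono' ((intervalIntegrable_iff_integrableOn_Ioc_of_le zero_le_one).1
      (intervalIntegral.intervalIntegrable_rpow' (by linarith : -1 < a - 1)))
      hm.aestronglyMeasurable ?_
    filter_upwards [ae_restrict_mem measurableSet_Ioc] with s hs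
    rw [norm_of_nonneg (domin_nonneg hs.1)]
    exact min_le_left _ _
  · refine Integrable.mono' (integrableOn_Ioi_rpow_of_lt (a := -(3 / 2)) (by norm_num) one_pos)
      hm.aestronglyMeasurable ?_
    filter_upwards [ae_restrict_mem measurableSet_Ioi] with s hs
    rw [norm_of_nonneg (domin_nonneg (zero_lt_one.trans hs))]
    exact min_le_right _ _

lemma norm_exp_I_mul_le (hy : 0 ≤ y.im) (hs : 0 < s) :
    ‖exp (I * y * s)‖ ≤ 1 := by
  rw [norm_exp, exp_le_one_iff]
  simp only [Complex.mul_re, Complex.I_re, Complex.I_im, ofReal_re, ofReal_im,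
    mul_im]
  nlinarith [mul_nonneg hy hs.le]

lemma norm_osInt_integrand_le {Φ : ℝ → ℂ} (h : Decays a B Φ) (hy : 0 ≤ y.im)
    (hs : 0 < s) :
    ‖(s : ℂ) ^ ((a : ℂ) - 1) * exp (I * y * s) * Φ s‖ ≤ domin a s * B := by
  have h1 : ‖(s : ℂ) ^ ((a : ℂ) - 1)‖ = s ^ (a - 1) := by
    rw [norm_cpow_eq_rpow_re_of_pos hs]; simp
  have h2 := norm_exp_I_mul_le hy hs
  have hB : 0 ≤ B := (norm_nonneg _).trans (h s hs).1
  calc _ ≤ s ^ (a - 1) * 1 * ‖Φ s‖ := by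
        rw [norm_mul, norm_mul, h1]; gcongr
    _ ≤ _ := by
        rw [mul_one, domin, min_mul_of_nonneg _ _ hB]
        refine le_min ?_ ?_
        · have := (h s hs).1
          gcongr
        · have := (h s hs).2
          calc s ^ (a - 1) * ‖Φ s‖ = s ^ (-(3 / 2) : ℝ) * (s ^ (a + 1 / 2) * ‖Φ s‖) := by
                rw [← mul_assoc, ← rpow_add hs]; congr 2; ring
            _ ≤ _ := by gcongr

lemma continuousOn_osInt_integrand {Φ : ℝ → ℂ} (hΦ : Continuous Φ) (y : ℂ) :
    ContinuousOn (fun s : ℝ => (s : ℂ) ^ ((a : ℂ) - 1) * exp (I * y * s) * Φ s)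
      (Ioi 0) := by
  have h := (continuousOn_cpow_exp a (-I * y)).mul hΦ.continuousOn
  refine h.congr fun s _ => ?_
  rw [Pi.mul_apply, show -(-I * y * s) = I * y * s by ring]

lemma norm_osInt_le (ha : 0 < a) {Φ : ℝ → ℂ} (h : Decays a B Φ) (hy : 0 ≤ y.im) :
    ‖osInt a Φ y‖ ≤ (∫ s in Ioi (0 : ℝ), domin a s) * B := by
  rw [← integral_mul_const]
  refine norm_integral_le_of_norm_le ((integrable_domin ha).mul_const B) ?_
  filter_upwards [ae_restrict_mem measurableSet_Ioi] with s hs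
  exact norm_osInt_integrand_le h hy hs

lemma integrable_osInt (ha : 0 < a) {Φ : ℝ → ℂ} (hΦ : Continuous Φ) (h : Decays a B Φ) (hy : 0 ≤ y.im) :
    IntegrableOn (fun s : ℝ => (s : ℂ) ^ ((a : ℂ) - 1) * exp (I * y * s) * Φ s)
      (Ioi 0) := by
  refine Integrable.mono' ((integrable_domin ha).mul_const B)
    ((continuousOn_osInt_integrand hΦ y).aestronglyMeasurable measurableSet_Ioi) ?_
  filter_upwards [ae_restrict_mem measurableSet_Ioi] with s hs
  exact norm_osInt_integrand_le h hy hs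

lemma continuousOn_osInt (ha : 0 < a) {Φ : ℝ → ℂ} (hΦ : Continuous Φ) (h : Decays a B Φ) :
    ContinuousOn (osInt a Φ) {y | 0 ≤ y.im} := by
  refine continuousOn_of_dominated (bound := fun s => domin a s * B)
    (fun y _ => (continuousOn_osInt_integrand hΦ y).aestronglyMeasurable measurableSet_Ioi)
    (fun y hy => ?_) ((integrable_domin ha).mul_const B) (.of_forall fun s => by fun_prop)
  filter_upwards [ae_restrict_mem measurableSet_Ioi] with s hs
  exact norm_osInt_integrand_le h hy hs

/-- The boundary value `∫ (y - Z)^{-p} f`, `Im y ≥ 0`, of the resolvent integral. -/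
def mInt (p : ℝ) (μ : Measure Ω) (Z : Ω → ℝ) (f : Ω → ℂ) (y : ℂ) : ℂ :=
  cGam p * osInt p (osc μ Z f) y

/-- The resolvent integral minus its leading term at infinity, `y ~ e^u / 2`. -/
def bInt (p : ℝ) (μ : Measure Ω) (Z : Ω → ℝ) (f : Ω → ℂ) (u y : ℂ) : ℂ :=
  mInt p μ Z f y - ((2 ^ p : ℝ) : ℂ) * exp (-(p * u)) * ∫ x, f x ∂μ

lemma continuousOn_mInt {D : ℕ} {p : ℝ} {μ : Measure Ω} {Z : Ω → ℝ} {f : ℕ → Ω → ℂ}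
    (h : PChain D p μ Z R f) (i : ℕ) : ContinuousOn (mInt p μ Z (f i)) {y | 0 ≤ y.im} := by
  obtain ⟨C, _, hC⟩ := exists_osc_le Ω D h.dim h.nonneg
  exact (continuousOn_osInt h.pos (continuous_osc h.toWaveChain i)
    (hC μ Z f h.toWaveChain i)).const_mul _

lemma half_exp_cpow (a : ℝ) (hu : |u.im| ≤ 1) :
    (exp u / 2) ^ (-(a : ℂ)) = ((2 ^ a : ℝ) : ℂ) * exp (-(a * u)) := by
  have hpi := pi_gt_three
  rw [abs_le] at hu
  have h1 : exp u / 2 = ((1 / 2 : ℝ) : ℂ) * exp u := by push_cast; ring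
  rw [h1, ofReal_mul_cpow (by norm_num) (exp_ne_zero u),
    cpow_def_of_ne_zero (exp_ne_zero u), log_exp (by linarith) (by linarith)]
  congr 1
  · rw [← ofReal_neg, ← ofReal_cpow (by norm_num), one_div, inv_rpow (by norm_num),
      rpow_neg (by norm_num), inv_inv]
  · congr 1; ring

lemma quarter_exp_le_re (hu : |u.im| ≤ 1) :
    rexp u.re / 4 ≤ (exp u / 2).re := by
  have h1 : (1 : ℝ) / 2 ≤ Real.cos u.im := by
    rw [← Real.cos_abs, ← Real.cos_pi_div_three]
    refine Real.cos_le_cos_of_nonneg_of_le_pi (abs_nonneg _) ?_ ?_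
    · linarith [pi_pos]
    · linarith [pi_gt_three]
  have h2 : (exp u / 2).re = rexp u.re * Real.cos u.im / 2 := by
    rw [show exp u / 2 = ((1 / 2 : ℝ) : ℂ) * exp u by push_cast; ring,
      re_ofReal_mul, exp_re]; ring
  rw [h2]
  have := exp_pos u.re
  nlinarith

/-- A power `w^{-a}` is `2^a e^{-au}` up to `e^{-(a+1) Re u}` when `w - e^u/2` is bounded. -/
lemma norm_cpow_neg_sub_exp_le {a E : ℝ} (ha : 0 ≤ a) {u w : ℂ} (hu : |u.im| ≤ 1)
    (hd : ‖w - exp u / 2‖ ≤ E) (hV : 8 * E ≤ rexp u.re) :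
    ‖w ^ (-(a : ℂ)) - ((2 ^ a : ℝ) : ℂ) * exp (-(a * u))‖
      ≤ a * 8 ^ (a + 1) * E * rexp (-((a + 1) * u.re)) := by
  set r := rexp u.re / 8 with hr
  have hr0 : 0 < r := by positivity
  have h4 := quarter_exp_le_re hu
  have hm1 : exp u / 2 ∈ {w : ℂ | r ≤ w.re} := by
    change r ≤ _; linarith [exp_pos u.re]
  have hm0 : w ∈ {w : ℂ | r ≤ w.re} := by
    have := (Complex.abs_re_le_norm (w - exp u / 2)).trans hd
    rw [sub_re, abs_le] at this
    change r ≤ _; linarith [this.1]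
  have key := Convex.norm_image_sub_le_of_norm_hasDerivWithin_le (𝕜 := ℂ)
    (f := fun w : ℂ => w ^ (-(a : ℂ))) (f' := fun w => -(a : ℂ) * w ^ (-(a : ℂ) - 1))
    (C := a * r ^ (-(a + 1))) (s := {w : ℂ | r ≤ w.re}) ?_ ?_ (convex_halfSpace_re_ge r) hm1 hm0
  · rw [half_exp_cpow a hu] at key
    refine key.trans ?_
    have e : r ^ (-(a + 1)) = 8 ^ (a + 1) * rexp (-((a + 1) * u.re)) := by
      rw [hr, div_rpow (by positivity) (by norm_num), rpow_neg (by norm_num : (0 : ℝ) ≤ 8),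
        div_inv_eq_mul, mul_comm, ← Real.exp_mul]
      congr 2; ring
    rw [e]
    calc _ ≤ a * (8 ^ (a + 1) * rexp (-((a + 1) * u.re))) * E := by gcongr
      _ = _ := by ring
  · intro w hw
    have hw' : 0 < w.re := hr0.trans_le hw
    have := ((hasDerivAt_id w).cpow_const (c := -(a : ℂ)) (Or.inl hw')).hasDerivWithinAt
      (s := {w : ℂ | r ≤ w.re})
    simpa using this
  · intro w hw
    have hw' : r ≤ ‖w‖ := le_trans hw (re_le_norm w)
    rw [norm_mul, norm_neg, norm_real, norm_of_nonneg ha,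
      show -(a : ℂ) - 1 = -((a + 1 : ℝ) : ℂ) by push_cast; ring]
    have := norm_cpow_neg_le hr0 hw' (a := a + 1) (by linarith)
    gcongr

lemma norm_cpow_sub_exp_le (ha : 0 ≤ a) {z : ℝ} (hz : |z| ≤ R)
    (hu : |u.im| ≤ 1) (hy : ‖y - exp u / 2‖ ≤ 3) (hV : 8 * (3 + R) ≤ rexp u.re) :
    ‖(y - z) ^ (-(a : ℂ)) - ((2 ^ a : ℝ) : ℂ) * exp (-(a * u))‖
      ≤ a * 8 ^ (a + 1) * (3 + R) * rexp (-((a + 1) * u.re)) := by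
  refine norm_cpow_neg_sub_exp_le ha hu ?_ hV
  calc ‖(y - z) - exp u / 2‖ = ‖(y - exp u / 2) - z‖ := by congr 1; ring
    _ ≤ ‖y - exp u / 2‖ + ‖(z : ℂ)‖ := norm_sub_le _ _
    _ ≤ _ := by rw [norm_real, norm_eq_abs]; linarith

lemma norm_res_sub_exp_le {D : ℕ} {μ : Measure Ω} {Z : Ω → ℝ} {f : ℕ → Ω → ℂ}
    (h : WaveChain D μ Z R f) (i : ℕ) (ha : 0 ≤ a) (hy0 : 0 < y.im)
    (hu : |u.im| ≤ 1) (hy : ‖y - exp u / 2‖ ≤ 3) (hV : 8 * (3 + R) ≤ rexp u.re) :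
    ‖res μ Z (f i) a y - ((2 ^ a : ℝ) : ℂ) * exp (-(a * u)) * ∫ x, f i x ∂μ‖
      ≤ a * 8 ^ (a + 1) * (3 + R) * rexp (-((a + 1) * u.re)) * ∫ x, ‖f i x‖ ∂μ := by
  rw [res, ← integral_const_mul, ← integral_sub (integrable_res h.meas (h.int i) ha hy0)
    ((h.int i).const_mul _), ← integral_const_mul]
  refine norm_integral_le_of_norm_le ((h.int i).norm.const_mul _) ?_
  filter_upwards [h.bound] with x hx
  rw [← sub_mul, norm_mul]
  have := norm_cpow_sub_exp_le ha hx hu hy hV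
  gcongr

/-- Uniform exponential decay of the subtracted resolvent integrals. -/
lemma exists_bInt_le (Ω : Type*) [MeasurableSpace Ω] (D : ℕ) {p R : ℝ} (hp : 0 < p)
    (hD : (D : ℝ) = 2 * p + 1) (hR : 0 ≤ R) :
    ∃ C : ℝ, 0 ≤ C ∧ ∀ (μ : Measure Ω) [SFinite μ] (Z : Ω → ℝ) (f : ℕ → Ω → ℂ),
      WaveChain D μ Z R f → ∀ (i : ℕ) (u y : ℂ), 0 ≤ u.re → |u.im| ≤ 1 → 0 ≤ y.im →
      ‖y - exp u / 2‖ ≤ 2 →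
      ‖bInt p μ Z (f i) u y‖ ≤ C * l1Sum μ f (i + (D + 1)) * rexp (-((p + 1) * u.re)) := by
  obtain ⟨C0, hC0, h0⟩ := exists_osc_le Ω D hD hR
  set I0 := ∫ s in Ioi (0 : ℝ), domin p s with hI0
  have hI0' : 0 ≤ I0 := setIntegral_nonneg measurableSet_Ioi fun s hs => domin_nonneg hs
  set E := 8 * (3 + R) with hE
  have hE1 : 1 ≤ E := by linarith
  set C1 := p * 8 ^ (p + 1) * (3 + R) with hC1
  set C2 := (‖cGam p‖ * (I0 * C0) + 2 ^ p) * E ^ (p + 1) with hC2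
  have hC1' : 0 ≤ C1 := by positivity
  have hC2' : 0 ≤ C2 := by positivity
  refine ⟨C1 + C2, by positivity, fun μ _ Z f h i => ?_⟩
  set L := l1Sum μ f (i + (D + 1)) with hL
  have hL0 : 0 ≤ L := l1Sum_nonneg μ f _
  have hf1 : ∫ x, ‖f i x‖ ∂μ ≤ L := le_l1Sum μ f (by omega)
  have hosc := h0 μ Z f h i
  have main : ∀ u y : ℂ, 0 ≤ u.re → |u.im| ≤ 1 → 0 < y.im → ‖y - exp u / 2‖ ≤ 3 →
      ‖bInt p μ Z (f i) u y‖ ≤ (C1 + C2) * L * rexp (-((p + 1) * u.re)) := fun u y hu0 hu hy0 hy => by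
    rcases le_total E (rexp u.re) with hV | hV
    · have h1 := norm_res_sub_exp_le h i hp.le hy0 hu hy hV
      rw [res_eq_osInt h.meas (h.int i) hp hy0] at h1
      refine h1.trans ?_
      calc _ ≤ C1 * rexp (-((p + 1) * u.re)) * L := by gcongr
        _ ≤ C1 * rexp (-((p + 1) * u.re)) * L + C2 * rexp (-((p + 1) * u.re)) * L := by
          have : 0 ≤ C2 * rexp (-((p + 1) * u.re)) * L := by positivity
          linarith
        _ = _ := by ring
    · have h1 : ‖mInt p μ Z (f i) y‖ ≤ ‖cGam p‖ * (I0 * (C0 * L)) := by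
        rw [mInt, norm_mul]
        have := norm_osInt_le hp hosc hy0.le
        gcongr
      have h2 : ‖((2 ^ p : ℝ) : ℂ) * exp (-(p * u)) * ∫ x, f i x ∂μ‖ ≤ 2 ^ p * L := by
        rw [norm_mul, norm_mul, norm_real, norm_of_nonneg (by positivity),
          norm_exp]
        have h3 : (-((p : ℂ) * u)).re = -(p * u.re) := by simp
        have h4 : rexp (-((p : ℂ) * u)).re ≤ 1 := by
          rw [h3, exp_le_one_iff]; nlinarith
        have h5 : ‖∫ x, f i x ∂μ‖ ≤ L := (norm_integral_le_integral_norm _).trans hf1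
        calc _ ≤ 2 ^ p * 1 * L := by gcongr
          _ = _ := by ring
      have h6 : 1 ≤ E ^ (p + 1) * rexp (-((p + 1) * u.re)) := by
        rw [Real.exp_neg, ← div_eq_mul_inv, one_le_div (exp_pos _), mul_comm, Real.exp_mul]
        exact rpow_le_rpow (exp_pos _).le hV (by linarith)
      calc _ ≤ ‖cGam p‖ * (I0 * (C0 * L)) + 2 ^ p * L := (norm_sub_le _ _).trans (add_le_add h1 h2)
        _ = (‖cGam p‖ * (I0 * C0) + 2 ^ p) * L * 1 := by ring
        _ ≤ (‖cGam p‖ * (I0 * C0) + 2 ^ p) * L * (E ^ (p + 1) * rexp (-((p + 1) * u.re))) := by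
          gcongr
        _ = C2 * L * rexp (-((p + 1) * u.re)) := by rw [hC2]; ring
        _ ≤ _ := by gcongr; linarith
  intro u y hu0 hu hy0 hy
  have hlim : Tendsto (fun ε : ℝ => bInt p μ Z (f i) u (y + ε * I)) (𝓝[>] 0)
      (𝓝 (bInt p μ Z (f i) u y)) := by
    have h2 : Tendsto (fun ε : ℝ => y + ε * I) (𝓝[>] 0) (𝓝[{y | 0 ≤ y.im}] y) := by
      have : Continuous fun ε : ℝ => y + ε * I := by fun_prop
      refine tendsto_nhdsWithin_iff.2
        ⟨by simpa using (this.tendsto 0).mono_left nhdsWithin_le_nhds, ?_⟩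
      filter_upwards [self_mem_nhdsWithin] with ε hε
      simpa using add_nonneg hy0 (le_of_lt hε)
    exact ((continuousOn_mInt ⟨h, hp, hD, hR⟩ i y hy0).tendsto.comp h2).sub_const _
  refine le_of_tendsto hlim.norm ?_
  have h1 : Ioo (0 : ℝ) 1 ∈ 𝓝[>] (0 : ℝ) := Ioo_mem_nhdsGT one_pos
  filter_upwards [h1] with ε hε
  refine main u _ hu0 hu ?_ ?_
  · simp; linarith [hε.1]
  · rw [show y + ε * I - exp u / 2 = y - exp u / 2 + ε * I by ring]
    refine (norm_add_le _ _).trans ?_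
    rw [norm_mul, norm_real, norm_I, norm_of_nonneg hε.1.le]
    linarith [hε.2]

end

section
open scoped ContDiff
variable {u : ℂ} {δ : ℝ} {k k' k'' l : ℂ → ℂ}

/-! ### Integral transforms of the subtracted resolvent -/

variable {Ω : Type*} [MeasurableSpace Ω]

/-- Continuous kernels of order `u e^{pu}` on the strip `Re u ≥ 0`, `|Im u| ≤ 1`. -/
structure KBound (p : ℝ) (k : ℂ → ℂ) : Prop where
  cont : Continuous k
  bound : ∃ C : ℝ, 0 ≤ C ∧ ∀ u : ℂ, 0 ≤ u.re → |u.im| ≤ 1 →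
    ‖k u‖ ≤ C * ((1 + u.re) * rexp (p * u.re))

lemma KBound.const_mul {p : ℝ} (h : KBound p k) (c : ℂ) : KBound p fun u => c * k u := by
  obtain ⟨C, h0, hC⟩ := h.bound
  refine ⟨h.cont.const_mul c, ‖c‖ * C, by positivity, fun u h0 h1 => ?_⟩
  rw [norm_mul, mul_assoc]
  have := hC u h0 h1
  gcongr

lemma KBound.add {p : ℝ} (h : KBound p k) (h' : KBound p l) : KBound p fun u => k u + l u := by
  obtain ⟨C, h0, hC⟩ := h.bound
  obtain ⟨C', h0', hC'⟩ := h'.bound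
  refine ⟨h.cont.add h'.cont, C + C', by positivity, fun u h0 h1 => (norm_add_le _ _).trans ?_⟩
  rw [add_mul]
  exact add_le_add (hC u h0 h1) (hC' u h0 h1)

lemma KBound.sub {p : ℝ} (h : KBound p k) (h' : KBound p l) : KBound p fun u => k u - l u := by
  simpa only [sub_eq_add_neg, neg_one_mul] using h.add (h'.const_mul (-1))

/-- The contour `t ↦ t + δ (1 + i)`. -/
def ctr (δ t : ℝ) : ℂ := t + δ * (1 + I)

@[simp] lemma ctr_re (δ t : ℝ) : (ctr δ t).re = t + δ := by simp [ctr]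

@[simp] lemma ctr_im (δ t : ℝ) : (ctr δ t).im = δ := by simp [ctr]

lemma continuous_ctr (δ : ℝ) : Continuous (ctr δ) := by unfold ctr; fun_prop

lemma hasDerivAt_ctr (δ t : ℝ) : HasDerivAt (ctr δ) 1 t := by
  have h := (hasDerivAt_id (t : ℂ)).comp_ofReal.add_const ((δ : ℂ) * (1 + I))
  exact h

lemma cosh_im (u : ℂ) : (cosh u).im = Real.sinh u.re * Real.sin u.im := by
  conv_lhs => rw [← Complex.re_add_im u, Complex.cosh_add, Complex.sinh_mul_I, Complex.cosh_mul_I]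
  simp [← Complex.ofReal_sinh, ← Complex.ofReal_sin]

lemma sinh_re (u : ℂ) : (sinh u).re = Real.sinh u.re * Real.cos u.im := by
  conv_lhs => rw [← Complex.re_add_im u, Complex.sinh_add, Complex.sinh_mul_I, Complex.cosh_mul_I]
  simp [← Complex.ofReal_sinh, ← Complex.ofReal_cos]

lemma cosh_im_pos (h0 : 0 < u.re) (h1 : 0 < u.im) (h2 : u.im ≤ 1) :
    0 < (cosh u).im := by
  rw [cosh_im]
  exact mul_pos (sinh_pos_iff.2 h0)
    (Real.sin_pos_of_pos_of_lt_pi h1 (by linarith [pi_gt_three]))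

lemma cosh_im_nonneg (h0 : 0 ≤ u.re) (h1 : 0 ≤ u.im) (h2 : u.im ≤ 1) :
    0 ≤ (cosh u).im := by
  rw [cosh_im]
  exact mul_nonneg (Real.sinh_nonneg_iff.2 h0)
    (Real.sin_nonneg_of_nonneg_of_le_pi h1 (by linarith [pi_gt_three]))

lemma norm_cosh_sub_exp_le (h0 : 0 ≤ u.re) : ‖cosh u - exp u / 2‖ ≤ 1 := by
  rw [cosh, show (exp u + exp (-u)) / 2 - exp u / 2
    = exp (-u) / 2 by ring, norm_div, norm_exp]
  have : rexp (-u).re ≤ 1 := by rw [exp_le_one_iff]; simpa using h0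
  simp only [norm_ofNat]
  linarith

/-- The transform of the subtracted resolvent integral with the kernel `k`. -/
def wInt (p : ℝ) (k : ℂ → ℂ) (μ : Measure Ω) (Z : Ω → ℝ) (f : Ω → ℂ) : ℂ :=
  ∫ v in Ioi (0 : ℝ), k v * bInt p μ Z f v (cosh v)

/-- The function dominating all transforms. -/
lemma integrable_wdom (C : ℝ) :
    IntegrableOn (fun t : ℝ => C * ((2 + t) * rexp (-t))) (Ioi 0) := by
  have h1 := integrable_rpow_exp (a := 1) one_pos one_pos
  have h2 := integrable_rpow_exp (a := 2) two_pos one_pos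
  refine (((h1.const_mul 2).add h2).const_mul C).congr ?_
  filter_upwards [ae_restrict_mem measurableSet_Ioi] with t ht
  have : t ^ ((2 : ℝ) - 1) = t := by norm_num
  simp only [Pi.add_apply, sub_self, rpow_zero, this, neg_one_mul]
  ring

lemma norm_kernel_mul_le {p C B t : ℝ} {k b : ℂ} (hC : 0 ≤ C) (hB : 0 ≤ B) (ht : 0 ≤ t)
    (h1 : t ≤ u.re) (h2 : u.re ≤ t + 1) (hk : ‖k‖ ≤ C * ((1 + u.re) * rexp (p * u.re)))
    (hb : ‖b‖ ≤ B * rexp (-((p + 1) * u.re))) : ‖k * b‖ ≤ C * B * ((2 + t) * rexp (-t)) := by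
  have hu := ht.trans h1
  rw [norm_mul]
  calc _ ≤ C * ((1 + u.re) * rexp (p * u.re)) * (B * rexp (-((p + 1) * u.re))) := by gcongr
    _ = C * B * ((1 + u.re) * rexp (-u.re)) := by
        rw [show -u.re = p * u.re + -((p + 1) * u.re) by ring, Real.exp_add]; ring
    _ ≤ _ := by
        have : 1 + u.re ≤ 2 + t := by linarith
        gcongr

/-- The points `(u, y)` with `Re u` between `t` and `t + 1` at which `y` is close to `e^u / 2`. -/
def OnStrip (t : ℝ) (u y : ℂ) : Prop :=
  t ≤ u.re ∧ u.re ≤ t + 1 ∧ |u.im| ≤ 1 ∧ 0 ≤ y.im ∧ ‖y - exp u / 2‖ ≤ 2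

/-- Uniform decay of the integrands of the transforms. -/
lemma exists_kernel_le (Ω : Type*) [MeasurableSpace Ω] (D : ℕ) {p R : ℝ} (hp : 0 < p)
    (hD : (D : ℝ) = 2 * p + 1) (hR : 0 ≤ R) (hk : KBound p k) :
    ∃ C : ℝ, 0 ≤ C ∧ ∀ (μ : Measure Ω) [SFinite μ] (Z : Ω → ℝ) (f : ℕ → Ω → ℂ),
      WaveChain D μ Z R f → ∀ (i : ℕ) (t : ℝ) (u y : ℂ), 0 ≤ t → OnStrip t u y →
      ‖k u * bInt p μ Z (f i) u y‖ ≤ C * l1Sum μ f (i + (D + 1)) * ((2 + t) * rexp (-t)) := by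
  obtain ⟨C, hC0, hC⟩ := exists_bInt_le Ω D hp hD hR
  obtain ⟨B, hB0, hB⟩ := hk.bound
  refine ⟨B * C, by positivity, fun μ _ Z f h i t u y ht ⟨h1, h2, hu, hy0, hy⟩ => ?_⟩
  rw [mul_assoc B C]
  exact norm_kernel_mul_le hB0 (mul_nonneg hC0 (l1Sum_nonneg _ _ _)) ht h1 h2
    (hB u (ht.trans h1) hu) (hC μ Z f h i u y (ht.trans h1) hu hy0 hy)

/-- Families of contours `t ↦ U δ t` in the `u`-plane together with points `Y δ t` close to
`e^u / 2`, which converge to `t` and `cosh t` as `δ → 0`. -/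
structure Contour (U Y : ℝ → ℝ → ℂ) : Prop where
  contU : Continuous fun P : ℝ × ℝ => U P.1 P.2
  contY : Continuous fun P : ℝ × ℝ => Y P.1 P.2
  zeroU t : U 0 t = t
  zeroY t : Y 0 t = cosh t
  mem δ t : 0 ≤ δ → δ ≤ 1 → 0 ≤ t → OnStrip t (U δ t) (Y δ t)

lemma contour_ctr : Contour ctr fun δ t => cosh (ctr δ t) where
  contU := by unfold ctr; fun_prop
  contY := by unfold ctr; fun_prop
  zeroU t := by simp [ctr]
  zeroY t := by simp [ctr]
  mem δ t h0 h1 ht := by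
    refine ⟨by simpa, by simpa, by simpa [abs_of_nonneg h0],
      cosh_im_nonneg (by simpa using add_nonneg ht h0) (by simpa) (by simpa), ?_⟩
    exact (norm_cosh_sub_exp_le (by simpa using add_nonneg ht h0)).trans (by norm_num)

lemma contour_shift : Contour (fun _ t => t) fun ε t => cosh t + ε * I where
  contU := by fun_prop
  contY := by fun_prop
  zeroU t := rfl
  zeroY t := by simp
  mem ε t h0 h1 ht := by
    refine ⟨by simp, by simp, by simp, by simpa [← ofReal_cosh] using h0, ?_⟩
    have e1 := norm_cosh_sub_exp_le (u := t) (by simpa)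
    have e2 : ‖(ε : ℂ) * I‖ ≤ 1 := by simpa [abs_of_nonneg h0]
    rw [add_sub_right_comm]
    linarith [norm_add_le (cosh t - exp t / 2) (ε * I)]

section
variable {D : ℕ} {p R : ℝ} {μ : Measure Ω} {Z : Ω → ℝ} {f : ℕ → Ω → ℂ}

/-- The subtracted resolvent integral at `y = cosh u`. -/
abbrev bCosh (p : ℝ) (μ : Measure Ω) (Z : Ω → ℝ) (f : Ω → ℂ) (u : ℂ) : ℂ :=
  bInt p μ Z f u (cosh u)

lemma hasDerivAt_exp_neg_mul (p : ℝ) (c : ℂ) (u : ℂ) :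
    HasDerivAt (fun u => ((2 ^ p : ℝ) : ℂ) * exp (-(p * u)) * c)
      (-(p * ((2 ^ p : ℝ) : ℂ) * exp (-(p * u)) * c)) u := by
  have h1 : HasDerivAt (fun u : ℂ => -(p * u)) (-(p : ℂ)) u := by
    simpa using ((hasDerivAt_id u).const_mul (p : ℂ)).fun_neg
  refine ((h1.cexp.const_mul _).mul_const c).congr_deriv ?_
  ring

/-- The derivative of the subtracted resolvent integral. -/
def dbInt (p : ℝ) (μ : Measure Ω) (Z : Ω → ℝ) (f : Ω → ℂ) (u : ℂ) : ℂ :=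
  -p * res μ Z f (p + 1) (cosh u) * sinh u
    + p * ((2 ^ p : ℝ) : ℂ) * exp (-(p * u)) * ∫ x, f x ∂μ

lemma norm_sinh_le (h0 : 0 ≤ u.re) : ‖sinh u‖ ≤ rexp u.re := by
  rw [sinh, norm_div, norm_ofNat]
  have h1 := norm_sub_le (exp u) (exp (-u))
  rw [norm_exp, norm_exp, neg_re] at h1
  have h2 : rexp (-u.re) ≤ rexp u.re := exp_le_exp.2 (by linarith)
  linarith

lemma exists_dbInt_le (h : PChain D p μ Z R f) (i : ℕ) :
    ∃ C : ℝ, 0 ≤ C ∧ ∀ u : ℂ, 0 ≤ u.re → |u.im| ≤ 1 → 0 < (cosh u).im →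
      8 * (3 + R) ≤ rexp u.re →
      ‖dbInt p μ Z (f i) u‖ ≤ C * rexp (-((p + 1) * u.re)) := by
  have hp := h.pos
  have hR := h.nonneg
  set C1 := (p + 1) * 8 ^ (p + 1 + 1) * (3 + R) with hC1
  set L := ∫ x, ‖f i x‖ ∂μ with hL
  have hL0 : 0 ≤ L := integral_nonneg fun _ => norm_nonneg _
  have hC1' : 0 ≤ C1 := by positivity
  refine ⟨p * C1 * L + p * 2 ^ p * L, by positivity, fun u h0 hu hy hV => ?_⟩
  have h1 := norm_res_sub_exp_le h.toWaveChain i (a := p + 1) (by linarith) hy hu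
    ((norm_cosh_sub_exp_le h0).trans (by norm_num)) hV
  have e : dbInt p μ Z (f i) u = -p * (res μ Z (f i) (p + 1) (cosh u)
      - ((2 ^ (p + 1) : ℝ) : ℂ) * exp (-((p + 1 : ℝ) * u)) * ∫ x, f i x ∂μ) * sinh u
      + p * ((2 ^ p : ℝ) : ℂ) * exp (-((p + 2 : ℝ) * u)) * ∫ x, f i x ∂μ := by
    rw [dbInt, sinh, rpow_add_one two_ne_zero,
      show -((p + 1 : ℝ) * u) = -(p * u) + -u by push_cast; ring,
      show -((p + 2 : ℝ) * u) = -(p * u) + (-u + -u) by push_cast; ring,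
      exp_add, exp_add, exp_add]
    have h3 : exp u * exp (-u) = 1 := by rw [← exp_add]; simp
    rw [ofReal_mul, ofReal_ofNat]
    linear_combination (-(p * ((2 ^ p : ℝ) : ℂ) * exp (-(p * u)) * ∫ x, f i x ∂μ)) * h3
  have h2 := norm_sinh_le h0
  have h3 : ‖∫ x, f i x ∂μ‖ ≤ L := norm_integral_le_integral_norm _
  have h4 : ‖exp (-((p + 2 : ℝ) * u))‖ ≤ rexp (-((p + 1) * u.re)) := by
    rw [norm_exp, neg_re, re_ofReal_mul]
    exact exp_le_exp.2 (by nlinarith)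
  rw [e]
  refine (norm_add_le _ _).trans ?_
  simp only [norm_mul, norm_neg, norm_real, norm_of_nonneg hp.le,
    norm_of_nonneg (Real.rpow_nonneg (zero_le_two (α := ℝ)) p)]
  calc _ ≤ p * (C1 * rexp (-((p + 1 + 1) * u.re)) * L) * rexp u.re
        + p * 2 ^ p * rexp (-((p + 1) * u.re)) * L := by gcongr
    _ = _ := by
      rw [show -((p + 1) * u.re) = -((p + 1 + 1) * u.re) + u.re by ring, Real.exp_add]; ring

variable {U Y : ℝ → ℝ → ℂ}

lemma Contour.aestronglyMeasurable (hc : Contour U Y) (h : PChain D p μ Z R f) (i : ℕ)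
    (hk : KBound p k) (hδ : 0 ≤ δ) (hδ1 : δ ≤ 1) :
    AEStronglyMeasurable (fun t => k (U δ t) * bInt p μ Z (f i) (U δ t) (Y δ t))
      (volume.restrict (Ioi 0)) := by
  have hU : Continuous fun t => U δ t := hc.contU.comp (by fun_prop : Continuous fun t => (δ, t))
  have hY : Continuous fun t => Y δ t := hc.contY.comp (by fun_prop : Continuous fun t => (δ, t))
  refine ((hk.cont.comp hU).continuousOn.mul (ContinuousOn.sub ((continuousOn_mInt h i).comp
    hY.continuousOn fun t ht => (hc.mem δ t hδ hδ1 (le_of_lt ht)).2.2.2.1) ?_)).aestronglyMeasurable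
      measurableSet_Ioi
  fun_prop

variable [SFinite μ]

lemma Contour.exists_le (hc : Contour U Y) (h : PChain D p μ Z R f) (i : ℕ) (hk : KBound p k) :
    ∃ C : ℝ, ∀ δ : ℝ, 0 ≤ δ → δ ≤ 1 → ∀ t : ℝ, 0 ≤ t →
      ‖k (U δ t) * bInt p μ Z (f i) (U δ t) (Y δ t)‖ ≤ C * ((2 + t) * rexp (-t)) := by
  obtain ⟨C, _, hC⟩ := exists_kernel_le Ω D h.pos h.dim h.nonneg hk
  exact ⟨_, fun δ h0 h1 t ht => hC μ Z f h.toWaveChain i t _ _ ht (hc.mem δ t h0 h1 ht)⟩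

lemma Contour.integrableOn (hc : Contour U Y) (h : PChain D p μ Z R f) (i : ℕ) (hk : KBound p k)
    (hδ : 0 ≤ δ) (hδ1 : δ ≤ 1) :
    IntegrableOn (fun t => k (U δ t) * bInt p μ Z (f i) (U δ t) (Y δ t)) (Ioi 0) := by
  obtain ⟨C, hC⟩ := hc.exists_le h i hk
  refine Integrable.mono' (integrable_wdom C) (hc.aestronglyMeasurable h i hk hδ hδ1) ?_
  filter_upwards [ae_restrict_mem measurableSet_Ioi] with t ht
  exact hC δ hδ hδ1 t (le_of_lt ht)

/-- The transform is the limit of integrals along contours in the upper half of the strip. -/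
lemma Contour.tendsto_wInt (hc : Contour U Y) (h : PChain D p μ Z R f) (i : ℕ) (hk : KBound p k) :
    Tendsto (fun δ => ∫ t in Ioi (0 : ℝ), k (U δ t) * bInt p μ Z (f i) (U δ t) (Y δ t)) (𝓝[>] 0)
      (𝓝 (wInt p k μ Z (f i))) := by
  obtain ⟨C, hC⟩ := hc.exists_le h i hk
  have hI : Ioo (0 : ℝ) 1 ∈ 𝓝[>] (0 : ℝ) := Ioo_mem_nhdsGT one_pos
  refine tendsto_integral_filter_of_dominated_convergence _ ?_ ?_ (integrable_wdom C) ?_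
  · filter_upwards [hI] with δ hδ using hc.aestronglyMeasurable h i hk hδ.1.le hδ.2.le
  · filter_upwards [hI] with δ hδ
    filter_upwards [ae_restrict_mem measurableSet_Ioi] with t ht
    exact hC δ hδ.1.le hδ.2.le t (le_of_lt ht)
  · filter_upwards [ae_restrict_mem measurableSet_Ioi] with t ht
    have l : ∀ {F : ℝ → ℝ → ℂ}, (Continuous fun P : ℝ × ℝ => F P.1 P.2) →
        Tendsto (F · t) (𝓝[>] 0) (𝓝 (F 0 t)) := fun hF =>
      ((hF.comp (by fun_prop : Continuous fun δ : ℝ => (δ, t))).tendsto 0).mono_left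
        nhdsWithin_le_nhds
    have lU := l hc.contU
    have lY := l hc.contY
    rw [hc.zeroU] at lU
    rw [hc.zeroY] at lY
    refine ((hk.cont.tendsto _).comp lU).mul (Tendsto.sub ?_ ?_)
    · refine (continuousOn_mInt h i (cosh t) ?_).tendsto.comp (tendsto_nhdsWithin_iff.2 ⟨lY, ?_⟩)
      · simp [← ofReal_cosh]
      · filter_upwards [hI] with δ hδ
        exact (hc.mem δ t hδ.1.le hδ.2.le (le_of_lt ht)).2.2.2.1
    · have : Continuous fun u : ℂ => ((2 ^ p : ℝ) : ℂ) * exp (-(p * u)) * ∫ x, f i x ∂μ := by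
        fun_prop
      exact (this.tendsto _).comp lU

lemma bInt_cosh_eq (h : PChain D p μ Z R f) (i : ℕ) {u y : ℂ} (hy : 0 < y.im) :
    bInt p μ Z (f i) u y = res μ Z (f i) p y
      - ((2 ^ p : ℝ) : ℂ) * exp (-(p * u)) * ∫ x, f i x ∂μ := by
  rw [bInt, mInt, ← res_eq_osInt h.meas (h.int i) h.pos hy]

lemma hasDerivAt_bInt (h : PChain D p μ Z R f) (i : ℕ) (hy : 0 < (cosh u).im) :
    HasDerivAt (bCosh p μ Z (f i)) (dbInt p μ Z (f i) u) u := by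
  have h1 := (hasDerivAt_res h.meas (h.int i) h.pos.le hy).comp u (hasDerivAt_cosh u)
  have h2 := h1.sub (hasDerivAt_exp_neg_mul p (∫ x, f i x ∂μ) u)
  have ho : ∀ᶠ w in 𝓝 u, 0 < (cosh w).im :=
    (isOpen_lt continuous_const (continuous_im.comp continuous_cosh)).mem_nhds hy
  refine (h2.congr_deriv ?_).congr_of_eventuallyEq ?_
  · rw [dbInt]; ring
  · filter_upwards [ho] with w hw
    exact bInt_cosh_eq h i hw

lemma hasDerivAt_dbInt (h : PChain D p μ Z R f) (i : ℕ)
    (hy : 0 < (cosh u).im) :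
    HasDerivAt (dbInt p μ Z (f i)) (p ^ 2 * bCosh p μ Z (f i) u - bCosh p μ Z (f (i + 1)) u) u := by
  have hp := h.pos
  have h1 := (hasDerivAt_res h.meas (h.int i) (a := p + 1) (by linarith) hy).comp u
    (hasDerivAt_cosh u)
  have h2 := ((h1.const_mul (-(p : ℂ))).mul (Complex.hasDerivAt_sinh u)).add
    ((hasDerivAt_exp_neg_mul p (∫ x, f i x ∂μ) u).const_mul (p : ℂ))
  have h3 : dbInt p μ Z (f i) = fun u => -p * (res μ Z (f i) (p + 1) ∘ cosh) u * sinh u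
      + p * (((2 ^ p : ℝ) : ℂ) * exp (-(p * u)) * ∫ x, f i x ∂μ) := by
    funext u; simp only [dbInt, Function.comp]; ring
  rw [h3]
  refine h2.congr_deriv ?_
  rw [bCosh, bCosh, bInt_cosh_eq h i hy, bInt_cosh_eq h (i + 1) hy, h.integral_succ,
    h.res_ode i hp.le h.dim hy, ← Complex.sinh_sq, show p + 1 + 1 = p + 2 by ring]
  simp only [Function.comp]
  push_cast
  ring

lemma tendsto_wdom (C : ℝ) : Tendsto (fun t : ℝ => C * ((2 + t) * rexp (-t))) atTop (𝓝 0) := by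
  have h := (((tendsto_pow_mul_exp_neg_atTop_nhds_zero 0).const_mul 2).add
    (tendsto_pow_mul_exp_neg_atTop_nhds_zero 1)).const_mul C
  simp only [mul_zero, add_zero] at h
  exact h.congr fun t => by ring

/-- Integration by parts along a contour: the transform intertwines the wave operator with
`p² - d²/du²`, up to a boundary term. -/
lemma integral_ctr_succ (h : PChain D p μ Z R f) (i : ℕ) (hk : ∀ u, HasDerivAt k (k' u) u)
    (hk' : ∀ u, HasDerivAt k' (k'' u) u) (b0 : KBound p k) (b1 : KBound p k') (b2 : KBound p k'')
    (hδ : 0 < δ) (hδ1 : δ ≤ 1) :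
    ∫ t in Ioi (0 : ℝ), k (ctr δ t) * bCosh p μ Z (f (i + 1)) (ctr δ t)
    = (∫ t in Ioi (0 : ℝ), (p ^ 2 * k (ctr δ t) - k'' (ctr δ t)) * bCosh p μ Z (f i) (ctr δ t))
      + (k (ctr δ 0) * dbInt p μ Z (f i) (ctr δ 0)
        - k' (ctr δ 0) * bCosh p μ Z (f i) (ctr δ 0)) := by
  have hpos : ∀ t : ℝ, 0 ≤ t → 0 < (cosh (ctr δ t)).im := fun t ht =>
    cosh_im_pos (by simp; linarith) (by simpa) (by simpa)
  have i0 := contour_ctr.integrableOn h (i + 1) b0 hδ.le hδ1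
  have i2 := contour_ctr.integrableOn h i ((b0.const_mul (p ^ 2)).sub b2) hδ.le hδ1
  have hder : ∀ t ∈ Ici (0 : ℝ), HasDerivAt (fun t => k (ctr δ t) * dbInt p μ Z (f i) (ctr δ t)
      - k' (ctr δ t) * bCosh p μ Z (f i) (ctr δ t))
      ((p ^ 2 * k (ctr δ t) - k'' (ctr δ t)) * bCosh p μ Z (f i) (ctr δ t)
        - k (ctr δ t) * bCosh p μ Z (f (i + 1)) (ctr δ t)) t := fun t ht => by
    have hy := hpos t ht
    refine (HasDerivAt.comp t (((hk _).mul (hasDerivAt_dbInt h i hy)).sub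
      ((hk' _).mul (hasDerivAt_bInt h i hy))) (hasDerivAt_ctr δ t)).congr_deriv ?_
    ring
  have hlim : Tendsto (fun t => k (ctr δ t) * dbInt p μ Z (f i) (ctr δ t)
      - k' (ctr δ t) * bCosh p μ Z (f i) (ctr δ t)) atTop (𝓝 (0 - 0)) := by
    obtain ⟨C0, hC0, hk0⟩ := b0.bound
    obtain ⟨C1, hC1⟩ := contour_ctr.exists_le h i b1
    obtain ⟨C2, hC2, hd⟩ := exists_dbInt_le h i
    refine (squeeze_zero_norm' ?_ (tendsto_wdom (C0 * C2))).sub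
      (squeeze_zero_norm' ?_ (tendsto_wdom C1))
    · filter_upwards [eventually_ge_atTop (0 : ℝ), (Real.tendsto_exp_atTop.comp
        (tendsto_atTop_add_const_right atTop δ tendsto_id)).eventually_ge_atTop (8 * (3 + R))]
        with t ht hV
      obtain ⟨h1, h2, h3, -⟩ := contour_ctr.mem δ t hδ.le hδ1 ht
      exact norm_kernel_mul_le hC0 hC2 ht h1 h2 (hk0 _ (ht.trans h1) h3)
        (hd _ (ht.trans h1) h3 (hpos t ht) (by simpa using hV))
    · filter_upwards [eventually_ge_atTop (0 : ℝ)] with t ht using hC1 δ hδ.le hδ1 t ht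
  rw [sub_zero] at hlim
  linear_combination -((integral_sub i2 i0).symm.trans
    (integral_Ioi_of_hasDerivAt_of_tendsto' hder (i2.sub i0) hlim))

/-- The action of the wave operator on a transform. -/
lemma wInt_succ (h : PChain D p μ Z R f) (i : ℕ) (hk : ∀ u, HasDerivAt k (k' u) u)
    (hk' : ∀ u, HasDerivAt k' (k'' u) u) (b0 : KBound p k) (b1 : KBound p k') (b2 : KBound p k'')
    {L : ℂ} (hL : Tendsto (fun δ => k (ctr δ 0) * dbInt p μ Z (f i) (ctr δ 0)
        - k' (ctr δ 0) * bCosh p μ Z (f i) (ctr δ 0)) (𝓝[>] 0) (𝓝 L)) :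
    wInt p k μ Z (f (i + 1)) = wInt p (fun u => p ^ 2 * k u - k'' u) μ Z (f i) + L := by
  refine tendsto_nhds_unique (contour_ctr.tendsto_wInt h (i + 1) b0) (((contour_ctr.tendsto_wInt
    h i ((b0.const_mul (p ^ 2)).sub b2)).add hL).congr' ?_)
  filter_upwards [Ioo_mem_nhdsGT (one_pos (α := ℝ))] with δ hδ
  exact (integral_ctr_succ h i hk hk' b0 b1 b2 hδ.1 hδ.2.le).symm

end

end

section
open scoped ContDiff

/-! ### The boundary term at coinciding points -/

variable {Ω : Type*} [MeasurableSpace Ω]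

lemma tendsto_ctr_zero {F : ℂ → ℂ} (hF : Continuous F) :
    Tendsto (fun δ => F (ctr δ 0)) (𝓝[>] 0) (𝓝 (F 0)) := by
  have : Continuous fun δ : ℝ => F (ctr δ 0) := by unfold ctr; fun_prop
  simpa [ctr] using (this.tendsto 0).mono_left nhdsWithin_le_nhds

lemma sq_cpow_neg_half {w : ℂ} (hw : 0 < w.re) :
    (w ^ 2) ^ (-((1 / 2 : ℝ) : ℂ)) = w⁻¹ := by
  have hw0 : w ≠ 0 := fun h => by rw [h] at hw; simp at hw
  have h1 := abs_lt.1 (Complex.abs_arg_lt_pi_div_two_iff.2 (Or.inl hw))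
  have h3 : Complex.log (w ^ 2) = 2 * Complex.log w := by
    rw [show w ^ 2 = exp (2 * Complex.log w) by rw [two_mul, exp_add, exp_log hw0, sq],
      log_exp] <;>
    · simp only [mul_im, Complex.re_ofNat, Complex.im_ofNat, zero_mul, add_zero,
        Complex.log_im]
      linarith [h1.1, h1.2]
  rw [cpow_def_of_ne_zero (pow_ne_zero 2 hw0), h3,
    show 2 * Complex.log w * -((1 / 2 : ℝ) : ℂ) = -Complex.log w by push_cast; ring,
    exp_neg, exp_log hw0]

lemma cosh_sub_one_cpow_mul_sinh {δ : ℝ} (hδ : 0 < δ) (hδ1 : δ ≤ 1) :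
    (cosh (ctr δ 0) - 1) ^ (-((1 / 2 : ℝ) : ℂ)) * sinh (ctr δ 0)
      = ((√2 : ℝ) : ℂ) * cosh (ctr (δ / 2) 0) := by
  set h := ctr (δ / 2) 0 with hh
  have hu : ctr δ 0 = 2 * h := by simp [hh, ctr]; ring
  have hs0 : 0 < (sinh h).re := by
    rw [sinh_re, hh, ctr_re, ctr_im, zero_add]
    refine mul_pos (sinh_pos_iff.2 (by linarith)) (Real.cos_pos_of_mem_Ioo ⟨?_, ?_⟩) <;>
    linarith [pi_gt_three]
  have hs1 : sinh h ≠ 0 := fun e => by rw [e] at hs0; simp at hs0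
  have e1 : cosh (2 * h) - 1 = ((2 : ℝ) : ℂ) * sinh h ^ 2 := by
    rw [Complex.cosh_two_mul, Complex.cosh_sq]; push_cast; ring
  have e2 : (((2 : ℝ)) : ℂ) ^ (-((1 / 2 : ℝ) : ℂ)) = (((√2)⁻¹ : ℝ) : ℂ) := by
    rw [← ofReal_neg, ← ofReal_cpow (by norm_num), rpow_neg (by norm_num),
      sqrt_eq_rpow]
  rw [hu, e1, ofReal_mul_cpow two_pos (pow_ne_zero 2 hs1), sq_cpow_neg_half hs0, e2,
    Complex.sinh_two_mul]
  have h3 : ((√2 : ℝ) : ℂ) * ((√2 : ℝ) : ℂ) = 2 := by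
    rw [← ofReal_mul, mul_self_sqrt (by norm_num)]; norm_num
  have h4 : ((√2 : ℝ) : ℂ) ≠ 0 := by
    rw [Ne, Complex.ofReal_eq_zero]; positivity
  push_cast
  field_simp
  linear_combination -cosh h * h3

/-- The constant in `∫ s^{-1/2} e^{isw} ds = gHalf w^{-1/2}`. -/
def gHalf : ℂ := Gamma (1 / 2 : ℝ) * exp (I * π * (1 / 2 : ℝ) / 2)

lemma mul_cGam_add_one {p : ℝ} (hp : 0 < p) : p * cGam (p + 1) = -I * cGam p := by
  have hp' : (p : ℂ) ≠ 0 := by exact_mod_cast hp.ne'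
  have hG : Gamma p ≠ 0 := Gamma_ne_zero_of_re_pos (by simpa)
  have he : exp (-(I * π * ((p + 1 : ℝ) : ℂ) / 2))
      = -I * exp (-(I * π * p / 2)) := by
    rw [show -(I * π * ((p + 1 : ℝ) : ℂ) / 2)
      = -(π / 2 * I) + -(I * π * p / 2) by push_cast; ring,
      exp_add, exp_neg, Complex.exp_pi_div_two_mul_I, Complex.inv_I]
  rw [cGam, he, cGam]
  push_cast
  rw [Gamma_add_one _ hp']
  field_simp

variable {D : ℕ} {p R : ℝ} {μ : Measure Ω} {Z : Ω → ℝ} {f : ℕ → Ω → ℂ}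

lemma exists_psiRem_le (h : PChain D p μ Z R f) (i : ℕ) :
    ∃ B : ℝ, Decays (1 / 2) B (psiRem D μ Z (f i)) := by
  obtain ⟨C0, hC0, h0⟩ := exists_osc_le Ω D h.dim h.nonneg
  obtain ⟨C1, hC1, hlarge⟩ := exists_psiRem_le_inv h.nonneg h.toWaveChain i
  set L0 := l1Sum μ f (i + (D + 1))
  have hL0 : 0 ≤ L0 := l1Sum_nonneg _ _ _
  set A := I / 2 * ampInf D μ Z (f i) 1
  set B := -(I / 2) * ampInf D μ Z (f i) (-1)
  have hsmall : ∀ s, 0 < s → ‖psiRem D μ Z (f i) s‖ ≤ C0 * L0 + ‖A‖ + ‖B‖ := fun s hs => by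
    obtain ⟨n1, n2⟩ := norm_exp_I_ofReal s
    have e1 : ‖psi D μ Z (f i) s‖ ≤ C0 * L0 := by
      rw [psi, norm_mul, norm_real, norm_of_nonneg (by positivity), h.dim,
        show (2 * p + 1) / 2 = p + 1 / 2 by ring]
      exact (h0 μ Z f h.toWaveChain i s hs).2
    refine (norm_sub_le _ _).trans (add_le_add ((norm_sub_le _ _).trans (add_le_add e1 ?_)) ?_)
    · rw [norm_mul, n2, mul_one]
    · rw [norm_mul, n1, mul_one]
  have hn' : 0 ≤ C0 * L0 + ‖A‖ + ‖B‖ := by positivity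
  refine ⟨C0 * L0 + ‖A‖ + ‖B‖ + C1, fun s hs => ⟨(hsmall s hs).trans (by linarith), ?_⟩⟩
  rw [show (1 / 2 : ℝ) + 1 / 2 = 1 by norm_num, rpow_one]
  rcases le_total s 1 with hs1 | hs1
  · linarith [mul_le_of_le_one_left (norm_nonneg (psiRem D μ Z (f i) s)) hs1, hsmall s hs]
  · calc _ ≤ s * (C1 * s⁻¹) := by have := hlarge s hs1; gcongr
      _ = C1 := by field_simp
      _ ≤ _ := by linarith

lemma osInt_osc_eq (h : PChain D p μ Z R f) (i : ℕ) {y : ℂ} (hy : 0 < y.im) :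
    osInt (p + 1) (osc μ Z (f i)) y
      = I / 2 * ampInf D μ Z (f i) 1 * (gHalf * (y - 1) ^ (-((1 / 2 : ℝ) : ℂ)))
      + -(I / 2) * ampInf D μ Z (f i) (-1) * (gHalf * (y + 1) ^ (-((1 / 2 : ℝ) : ℂ)))
      + osInt (1 / 2) (psiRem D μ Z (f i)) y := by
  obtain ⟨B, hB⟩ := exists_psiRem_le h i
  have i3 := integrable_osInt (a := 1 / 2) (by norm_num) (continuous_psiRem h.toWaveChain i) hB hy.le
  have hy1 : 0 < (y - 1).im := by simpa using hy
  have hy2 : 0 < (y + 1).im := by simpa using hy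
  have i1 := (integrable_cpow_exp (a := 1 / 2) (by norm_num) hy1).const_mul
    (I / 2 * ampInf D μ Z (f i) 1)
  have i2 := (integrable_cpow_exp (a := 1 / 2) (by norm_num) hy2).const_mul
    (-(I / 2) * ampInf D μ Z (f i) (-1))
  unfold gHalf
  rw [← integral_cpow_exp (by norm_num) hy1, ← integral_cpow_exp (by norm_num) hy2,
    ← integral_const_mul, ← integral_const_mul, osInt, osInt, ← integral_add i1 i2]
  refine Eq.trans ?_ (integral_add (i1.add i2) i3)
  refine setIntegral_congr_fun measurableSet_Ioi fun s hs => ?_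
  have hs : 0 < s := hs
  have hs0 : (s : ℂ) ≠ 0 := by exact_mod_cast hs.ne'
  have e1 : exp (I * (y - 1) * s)
      = exp (I * y * s) * exp (-(I * s)) := by
    rw [← exp_add]; congr 1; ring
  have e2 : exp (I * (y + 1) * s)
      = exp (I * y * s) * exp (I * s) := by
    rw [← exp_add]; congr 1; ring
  have e3 : (s : ℂ) ^ (((p + 1 : ℝ) : ℂ) - 1) = (s : ℂ) ^ (((1 / 2 : ℝ) : ℂ) - 1)
      * ((s ^ ((D : ℝ) / 2) : ℝ) : ℂ) := by
    rw [ofReal_cpow hs.le, ← cpow_add _ _ hs0]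
    congr 1
    rw [h.dim]; push_cast; ring
  rw [e1, e2, e3, psiRem, psi]
  ring

variable [SFinite μ]

/-- The boundary term produced by each application of the wave operator. -/
def tipTerm (D : ℕ) (p : ℝ) (μ : Measure Ω) (Z : Ω → ℝ) (f : Ω → ℂ) : ℂ :=
  p * ((2 ^ p : ℝ) : ℂ) * ∫ x, f x ∂μ
    + I * cGam p * (gHalf * ((√2 : ℝ) : ℂ)) * (I / 2 * ampInf D μ Z f 1)

/-- The limit of the derivative of the subtracted resolvent integral at the tip of the contour
comes from the wave whose phase is stationary at coinciding points. -/
lemma tendsto_dbInt (h : PChain D p μ Z R f) (i : ℕ) :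
    Tendsto (fun δ => dbInt p μ Z (f i) (ctr δ 0)) (𝓝[>] 0) (𝓝 (tipTerm D p μ Z (f i))) := by
  obtain ⟨B, hB⟩ := exists_psiRem_le h i
  have hI : Ioo (0 : ℝ) 1 ∈ 𝓝[>] (0 : ℝ) := Ioo_mem_nhdsGT one_pos
  have hsinh := tendsto_ctr_zero Complex.continuous_sinh
  rw [Complex.sinh_zero] at hsinh
  have hpos : ∀ᶠ δ in 𝓝[>] (0 : ℝ), 0 < (cosh (ctr δ 0)).im := by
    filter_upwards [hI] with δ hδ
    exact cosh_im_pos (by simpa using hδ.1) (by simpa using hδ.1) (by simpa using hδ.2.le)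
  have t1 : Tendsto (fun δ => (cosh (ctr δ 0) - 1) ^ (-((1 / 2 : ℝ) : ℂ)) * sinh (ctr δ 0))
      (𝓝[>] 0) (𝓝 ((√2 : ℝ) : ℂ)) := by
    have : Continuous fun δ : ℝ => ((√2 : ℝ) : ℂ) * cosh (ctr (δ / 2) 0) := by
      unfold ctr; fun_prop
    have h1 := (this.tendsto 0).mono_left (nhdsWithin_le_nhds (s := Ioi 0))
    rw [zero_div, show ctr 0 0 = 0 by simp [ctr], Complex.cosh_zero, mul_one] at h1
    refine h1.congr' ?_
    filter_upwards [hI] with δ hδ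
    exact (cosh_sub_one_cpow_mul_sinh hδ.1 hδ.2.le).symm
  have t2 : Tendsto (fun δ => (cosh (ctr δ 0) + 1) ^ (-((1 / 2 : ℝ) : ℂ)) * sinh (ctr δ 0))
      (𝓝[>] 0) (𝓝 0) := by
    have h1 := tendsto_ctr_zero (F := fun u => cosh u + 1) (by fun_prop)
    simpa using (h1.cpow (tendsto_const_nhds (x := -((1 / 2 : ℝ) : ℂ)))
      (Or.inl (by simp))).mul hsinh
  have t3 : Tendsto (fun δ => osInt (1 / 2) (psiRem D μ Z (f i)) (cosh (ctr δ 0))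
      * sinh (ctr δ 0)) (𝓝[>] 0) (𝓝 0) := by
    have h1 := hsinh.norm.const_mul ((∫ s in Ioi (0 : ℝ), domin (1 / 2) s) * B)
    rw [norm_zero, mul_zero] at h1
    refine squeeze_zero_norm' ?_ h1
    filter_upwards [hpos] with δ hδ
    rw [norm_mul]
    have := norm_osInt_le (a := 1 / 2) (by norm_num) hB hδ.le
    gcongr
  have t4 := tendsto_ctr_zero (F := fun u => p * ((2 ^ p : ℝ) : ℂ) * exp (-(p * u))
    * ∫ x, f i x ∂μ) (by fun_prop)
  rw [mul_zero, neg_zero, Complex.exp_zero, mul_one] at t4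
  have t := ((((t1.const_mul (I / 2 * ampInf D μ Z (f i) 1 * gHalf)).add
    (t2.const_mul (-(I / 2) * ampInf D μ Z (f i) (-1) * gHalf))).add t3).const_mul
    (-(-I * cGam p))).add t4
  refine (t.congr' ?_).trans_eq (congrArg 𝓝 ?_)
  · filter_upwards [hpos] with δ hδ
    rw [dbInt, res_eq_osInt h.meas (h.int i) (by linarith [h.pos]) hδ, osInt_osc_eq h i hδ,
      ← mul_cGam_add_one h.pos]
    ring
  · rw [tipTerm]; ring

end

section
open scoped ContDiff

/-! ### The iterated kernel -/

lemma norm_cosh_le {u : ℂ} (h0 : 0 ≤ u.re) : ‖cosh u‖ ≤ rexp u.re := by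
  rw [cosh, norm_div, norm_ofNat]
  have h1 := norm_add_le (exp u) (exp (-u))
  rw [norm_exp, norm_exp, neg_re] at h1
  have h2 : rexp (-u.re) ≤ rexp u.re := exp_le_exp.2 (by linarith)
  linarith

lemma kBound_of_norm_le {p r : ℝ} (hr : 0 ≤ r) (hrp : r ≤ p) {g : ℂ → ℂ}
    (hgc : Continuous g) (hg : ∀ u : ℂ, 0 ≤ u.re → ‖g u‖ ≤ rexp u.re) :
    KBound p (fun u => g (r * u)) ∧ KBound p (fun u => u * g (r * u)) := by
  have h : ∀ u : ℂ, 0 ≤ u.re → ‖g (r * u)‖ ≤ rexp (p * u.re) := fun u h0 => by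
    have := hg (r * u) (by rw [re_ofReal_mul]; positivity)
    rw [re_ofReal_mul] at this
    exact this.trans (exp_le_exp.2 (by gcongr))
  refine ⟨⟨by fun_prop, 1, zero_le_one, fun u h0 h1 => ?_⟩,
    ⟨by fun_prop, 1, zero_le_one, fun u h0 h1 => ?_⟩⟩
  · have := exp_pos (p * u.re)
    refine (h u h0).trans ?_
    nlinarith
  · rw [norm_mul, one_mul]
    have e : ‖u‖ ≤ 1 + u.re := by
      refine (Complex.norm_le_abs_re_add_abs_im u).trans ?_
      rw [abs_of_nonneg h0]; linarith
    have := h u h0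
    gcongr

/-- The even kernels `a cosh pu + b u sinh pu + c cosh qu + d u sinh qu`. -/
def kern (p q : ℝ) (a b c d u : ℂ) : ℂ :=
  a * cosh (p * u) + b * (u * sinh (p * u)) + c * cosh (q * u)
    + d * (u * sinh (q * u))

/-- The first derivatives of the even kernels. -/
def dkern (p q : ℝ) (a b c d u : ℂ) : ℂ :=
  (a * p + b) * sinh (p * u) + b * p * (u * cosh (p * u))
    + (c * q + d) * sinh (q * u) + d * q * (u * cosh (q * u))

lemma hasDerivAt_cosh_mul (p : ℝ) (u : ℂ) :
    HasDerivAt (fun u : ℂ => cosh (p * u)) (p * sinh (p * u)) u := by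
  have h : HasDerivAt (fun u : ℂ => (p : ℂ) * u) p u := by
    simpa using (hasDerivAt_id u).const_mul (p : ℂ)
  exact h.ccosh.congr_deriv (mul_comm _ _)

lemma hasDerivAt_sinh_mul (p : ℝ) (u : ℂ) :
    HasDerivAt (fun u : ℂ => sinh (p * u)) (p * cosh (p * u)) u := by
  have h : HasDerivAt (fun u : ℂ => (p : ℂ) * u) p u := by
    simpa using (hasDerivAt_id u).const_mul (p : ℂ)
  exact h.csinh.congr_deriv (mul_comm _ _)

variable {p q : ℝ} (a b c d : ℂ)

lemma hasDerivAt_kern (u : ℂ) : HasDerivAt (kern p q a b c d) (dkern p q a b c d u) u := by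
  have h := ((((hasDerivAt_cosh_mul p u).const_mul a).add
    (((hasDerivAt_id u).mul (hasDerivAt_sinh_mul p u)).const_mul b)).add
    ((hasDerivAt_cosh_mul q u).const_mul c)).add
    (((hasDerivAt_id u).mul (hasDerivAt_sinh_mul q u)).const_mul d)
  refine h.congr_deriv ?_
  simp only [dkern, id_eq]
  ring

lemma hasDerivAt_dkern (u : ℂ) : HasDerivAt (dkern p q a b c d)
    (kern p q (a * p ^ 2 + 2 * p * b) (b * p ^ 2) (c * q ^ 2 + 2 * q * d) (d * q ^ 2) u) u := by
  have h := ((((hasDerivAt_sinh_mul p u).const_mul (a * p + b)).add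
    (((hasDerivAt_id u).mul (hasDerivAt_cosh_mul p u)).const_mul (b * p))).add
    ((hasDerivAt_sinh_mul q u).const_mul (c * q + d))).add
    (((hasDerivAt_id u).mul (hasDerivAt_cosh_mul q u)).const_mul (d * q))
  refine h.congr_deriv ?_
  simp only [kern, id_eq]
  ring

lemma kBound_cosh_sinh (hq : 0 ≤ q) (hqp : q ≤ p) :
    (KBound p (fun u => cosh (q * u)) ∧ KBound p (fun u => u * cosh (q * u))) ∧
      KBound p (fun u => sinh (q * u)) ∧ KBound p (fun u => u * sinh (q * u)) :=
  ⟨kBound_of_norm_le hq hqp continuous_cosh fun _ => norm_cosh_le,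
    kBound_of_norm_le hq hqp Complex.continuous_sinh fun _ => norm_sinh_le⟩

lemma kBound_kern (hq : 0 ≤ q) (hqp : q ≤ p) : KBound p (kern p q a b c d) := by
  obtain ⟨⟨p1, -⟩, -, p2⟩ := kBound_cosh_sinh (hq.trans hqp) (le_refl p)
  obtain ⟨⟨q1, -⟩, -, q2⟩ := kBound_cosh_sinh hq hqp
  exact (((p1.const_mul a).add (p2.const_mul b)).add (q1.const_mul c)).add (q2.const_mul d)

lemma kBound_dkern (hq : 0 ≤ q) (hqp : q ≤ p) : KBound p (dkern p q a b c d) := by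
  obtain ⟨⟨-, p1⟩, p2, -⟩ := kBound_cosh_sinh (hq.trans hqp) (le_refl p)
  obtain ⟨⟨-, q1⟩, q2, -⟩ := kBound_cosh_sinh hq hqp
  exact (((p2.const_mul (a * p + b)).add (p1.const_mul (b * p))).add
    (q2.const_mul (c * q + d))).add (q1.const_mul (d * q))

variable {Ω : Type*} [MeasurableSpace Ω] {D : ℕ} {R : ℝ} {μ : Measure Ω} [SFinite μ] {Z : Ω → ℝ}
  {f : ℕ → Ω → ℂ}

/-- The wave operator acts on the transforms through the coefficients of the kernel. -/
lemma wInt_kern_succ (hq : 0 ≤ q) (hqp : q ≤ p) (h : PChain D p μ Z R f) (i : ℕ) :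
    wInt p (kern p q a b c d) μ Z (f (i + 1))
      = wInt p (kern p q (-2 * p * b) 0 (c * (p ^ 2 - q ^ 2) - 2 * q * d) (d * (p ^ 2 - q ^ 2))) μ Z
        (f i) + (a + c) * tipTerm D p μ Z (f i) := by
  have k0 := kBound_kern a b c d hq hqp
  have k1 := kBound_dkern a b c d hq hqp
  have hL : Tendsto (fun δ => kern p q a b c d (ctr δ 0) * dbInt p μ Z (f i) (ctr δ 0)
      - dkern p q a b c d (ctr δ 0) * bCosh p μ Z (f i) (ctr δ 0))
      (𝓝[>] 0) (𝓝 ((a + c) * tipTerm D p μ Z (f i) - 0)) := by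
    refine Tendsto.sub (Tendsto.mul ?_ (tendsto_dbInt h i)) ?_
    · simpa [kern] using tendsto_ctr_zero k0.cont
    · obtain ⟨C, hC0, hC⟩ := exists_bInt_le Ω D h.pos h.dim h.nonneg
      have h2 := (tendsto_ctr_zero k1.cont).norm.mul_const (C * l1Sum μ f (i + (D + 1)))
      simp only [dkern, mul_zero, Complex.sinh_zero, zero_mul, add_zero, norm_zero] at h2
      refine squeeze_zero_norm' ?_ h2
      filter_upwards [Ioo_mem_nhdsGT (one_pos (α := ℝ))] with δ hδ
      obtain ⟨e0, -, e1, e2, e3⟩ := contour_ctr.mem δ 0 hδ.1.le hδ.2.le le_rfl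
      rw [norm_mul]
      refine mul_le_mul_of_nonneg_left ((hC μ Z f h.toWaveChain i _ _ e0 e1 e2 e3).trans
        (mul_le_of_le_one_right (mul_nonneg hC0 (l1Sum_nonneg _ _ _)) ?_)) (norm_nonneg _)
      rw [exp_le_one_iff]
      nlinarith [h.pos]
  rw [sub_zero] at hL
  rw [wInt_succ h i (hasDerivAt_kern a b c d) (hasDerivAt_dkern a b c d) k0 k1
    (kBound_kern _ _ _ _ hq hqp) hL]
  congr 2
  funext u
  simp only [kern]
  ring

lemma wInt_add (h : PChain D p μ Z R f) (i : ℕ) {k l : ℂ → ℂ} (hk : KBound p k)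
    (hl : KBound p l) (c : ℂ) :
    wInt p (fun u => k u + c * l u) μ Z (f i) = wInt p k μ Z (f i) + c * wInt p l μ Z (f i) := by
  have i1 := contour_shift.integrableOn h i hk le_rfl zero_le_one
  have i2 := (contour_shift.integrableOn h i hl le_rfl zero_le_one).const_mul c
  simp only [contour_shift.zeroY] at i1 i2
  rw [wInt, wInt, wInt, ← integral_const_mul]
  refine Eq.trans ?_ (integral_add i1 i2)
  congr 1 with v
  ring

/-- The kernel of the fourth-order problem. -/
def kern0 (p q : ℝ) : ℂ → ℂ :=
  kern p q (-4 / ((p : ℂ) ^ 2 - q ^ 2) ^ 3) (1 / (((p : ℂ) ^ 2 - q ^ 2) ^ 2 * p))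
    (4 / ((p : ℂ) ^ 2 - q ^ 2) ^ 3) (1 / (((p : ℂ) ^ 2 - q ^ 2) ^ 2 * q))

/-- The fourth-order equation for the transform with kernel `kern0`. -/
lemma wInt_kern0 (hq : 0 < q) (hqp : q < p) (h : PChain D p μ Z R f) :
    wInt p (kern0 p q) μ Z (f 4) - 2 * ((p : ℂ) ^ 2 - q ^ 2) * wInt p (kern0 p q) μ Z (f 3)
      + ((p : ℂ) ^ 2 - q ^ 2) ^ 2 * wInt p (kern0 p q) μ Z (f 2) = -2 * tipTerm D p μ Z (f 0) := by
  have hp := hq.trans hqp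
  have hp0 : (p : ℂ) ≠ 0 := by exact_mod_cast hp.ne'
  have hq0 : (q : ℂ) ≠ 0 := by exact_mod_cast hq.ne'
  have hm0 : (p : ℂ) ^ 2 - q ^ 2 ≠ 0 := by
    have : 0 < p ^ 2 - q ^ 2 := by nlinarith
    exact_mod_cast this.ne'
  set m := (p : ℂ) ^ 2 - q ^ 2 with hm
  have s := fun (a b c d : ℂ) i => wInt_kern_succ (q := q) a b c d hq.le hqp.le h i
  have s1 : ∀ i, wInt p (kern0 p q) μ Z (f (i + 1))
      = wInt p (kern p q (-2 / m ^ 2) 0 (2 / m ^ 2) (1 / (m * q))) μ Z (f i) := by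
    intro i
    rw [kern0, s, ← hm, neg_div, neg_add_cancel, zero_mul, add_zero]
    congr 2 <;> field_simp
    ring
  have s2 : ∀ i, wInt p (kern p q (-2 / m ^ 2) 0 (2 / m ^ 2) (1 / (m * q))) μ Z (f (i + 1))
      = wInt p (kern p q 0 0 0 (1 / q)) μ Z (f i) := by
    intro i
    rw [s, ← hm, neg_div, neg_add_cancel, zero_mul, add_zero]
    congr 2 <;> field_simp <;> ring
  have s3 : ∀ i, wInt p (kern p q 0 0 0 (1 / q)) μ Z (f (i + 1))
      = wInt p (kern p q 0 0 (-2) (m / q)) μ Z (f i) := by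
    intro i
    rw [s, ← hm, add_zero (0 : ℂ), zero_mul (tipTerm _ _ _ _ _), add_zero]
    congr 2 <;> field_simp <;> ring
  have k0 := fun (a b c d : ℂ) => kBound_kern a b c d hq.le hqp.le
  rw [s1, s1, s1, s2, s2, s3]
  have e1 := wInt_add h 1 (k0 0 0 (-2) (m / q)) (k0 0 0 0 (1 / q)) (-2 * m)
  have e2 := wInt_add h 1 ((k0 0 0 (-2) (m / q)).add ((k0 0 0 0 (1 / q)).const_mul (-2 * m)))
    (k0 (-2 / m ^ 2) 0 (2 / m ^ 2) (1 / (m * q))) (m ^ 2)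
  have e3 : (fun u => (kern p q 0 0 (-2) (m / q) u + -2 * m * kern p q 0 0 0 (1 / q) u)
      + m ^ 2 * kern p q (-2 / m ^ 2) 0 (2 / m ^ 2) (1 / (m * q)) u) = kern p q (-2) 0 0 0 := by
    funext u
    simp only [kern]
    field_simp
    ring
  have e4 : kern p q (-2 * p * 0) 0 (0 * m - 2 * q * 0) (0 * m) = fun _ => 0 := by
    funext u; simp [kern]
  rw [e3, s (-2) 0 0 0 0, ← hm, e4, e1] at e2
  have e5 : wInt p (fun _ => 0) μ Z (f 0) = 0 := by simp [wInt]
  rw [e5] at e2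
  linear_combination -e2

end

section
open scoped ContDiff
variable {z x : ℂ} {K : Set ℂ} {p : ℝ}

/-! ### The resolvent kernel in the cut plane -/

lemma cosh_sub_mem_slitPlane (hz : z ∈ cutPlane) (v : ℝ) :
    cosh v - z ∈ slitPlane := by
  by_contra h
  simp [Complex.mem_slitPlane_iff, ← ofReal_cosh] at h
  exact hz ⟨h.2, by linarith [one_le_cosh v]⟩

lemma isOpen_cutPlane : IsOpen cutPlane :=
  ((isClosed_eq continuous_im continuous_const).inter
    (isClosed_le continuous_const continuous_re)).isOpen_compl

lemma exists_cosh_sub_ge (hK : IsCompact K) (hKc : K ⊆ cutPlane) :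
    ∃ c : ℝ, 0 < c ∧ ∀ z ∈ K, ∀ v : ℝ, c * Real.cosh v ≤ ‖cosh v - z‖ := by
  have hpos : ∀ P ∈ K ×ˢ Icc (0 : ℝ) 1, 0 < ‖1 - (P.2 : ℂ) * P.1‖ := by
    rintro ⟨z, τ⟩ ⟨hz, hτ⟩
    refine norm_pos_iff.2 fun h => hKc hz ?_
    have h1 : (τ : ℂ) * z = 1 := (sub_eq_zero.1 h).symm
    have hτp : 0 < τ := hτ.1.lt_of_ne' fun (e : τ = 0) => by simp [e] at h1
    rw [eq_inv_of_mul_eq_one_right h1, ← ofReal_inv]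
    exact ⟨ofReal_im _, (one_le_inv₀ hτp).2 hτ.2⟩
  obtain ⟨c, hc, h⟩ := (hK.prod isCompact_Icc).exists_forall_le' (f := fun P : ℂ × ℝ =>
    ‖1 - (P.2 : ℂ) * P.1‖) (by fun_prop) (a := 0) hpos
  refine ⟨c, hc, fun z hz v => ?_⟩
  have hch := cosh_pos v
  have h2 : cosh v - z = (Real.cosh v : ℂ) * (1 - (((Real.cosh v)⁻¹ : ℝ) : ℂ) * z) := by
    rw [← ofReal_cosh, ofReal_inv, mul_sub, mul_one,
      mul_inv_cancel_left₀ (ofReal_ne_zero.2 hch.ne')]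
  rw [h2, norm_mul, norm_real, norm_of_nonneg hch.le, mul_comm]
  gcongr
  exact h (z, _) ⟨hz, by positivity, inv_le_one_of_one_le₀ (one_le_cosh v)⟩

/-- The resolvent kernel minus its leading term at `v → -∞`. -/
def gSub (p : ℝ) (z : ℂ) (v : ℝ) : ℂ :=
  (cosh v - z) ^ (-(p : ℂ)) - ((2 ^ p : ℝ) : ℂ) * exp (p * v)

lemma norm_cosh_sub_cpow_le {a c : ℝ} (ha : 0 ≤ a) (hc : 0 < c) {v : ℝ}
    (h : c * Real.cosh v ≤ ‖cosh v - z‖) :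
    ‖(cosh v - z) ^ (-(a : ℂ))‖ ≤ c ^ (-a) * 2 ^ a * Real.exp (-(a * |v|)) := by
  have hv := cosh_pos v
  refine (norm_cpow_neg_le (by positivity) h ha).trans ?_
  have h1 : rexp |v| / 2 ≤ Real.cosh v := by
    rw [← Real.cosh_abs, cosh_eq]
    linarith [exp_pos (-|v|)]
  have h2 := rpow_le_rpow_of_nonpos (by positivity) h1 (neg_nonpos.2 ha)
  rw [div_rpow (exp_pos _).le zero_le_two, rpow_neg zero_le_two, div_inv_eq_mul, mul_comm,
    ← Real.exp_mul, mul_neg, mul_comm |v|] at h2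
  rw [mul_rpow hc.le hv.le, mul_assoc]
  gcongr

lemma gSub_neg_eq (p : ℝ) (z : ℂ) (v : ℝ) : gSub p z (-v)
    = (cosh v - z) ^ (-(p : ℂ)) - ((2 ^ p : ℝ) : ℂ) * exp (-(p * v)) := by
  simp [gSub]

/-- The subtraction improves the decay by one power of `e^{-v}`. -/
lemma exists_gSub_neg_le (hp : 0 < p) (hK : IsCompact K)
(hKc : K ⊆ cutPlane) : ∃ C : ℝ, 0 ≤ C ∧ ∀ z ∈ K, ∀ v : ℝ, 0 ≤ v →
      ‖gSub p z (-v)‖ ≤ C * Real.exp (-((p + 1) * v)) := by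
  obtain ⟨c, hc, h⟩ := exists_cosh_sub_ge hK hKc
  obtain ⟨M, hM⟩ := hK.isBounded.exists_norm_le
  set E := 1 + |M|
  set C1 := p * 8 ^ (p + 1) * E
  set C2 := (c ^ (-p) * 2 ^ p + 2 ^ p) * (8 * E) ^ (p + 1) with hC2
  have h1 : 0 ≤ C1 := by positivity
  have h2 : 0 ≤ C2 := by positivity
  refine ⟨C1 + C2, by positivity, fun z hz v hv => ?_⟩
  rw [gSub_neg_eq]
  rcases le_total (8 * E) (rexp v) with hV | hV
  · have h1 := norm_cpow_neg_sub_exp_le (a := p) (E := E) (u := (v : ℂ)) (w := cosh v - z)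
      hp.le (by simp) ?_ (by simpa using hV)
    · rw [ofReal_re] at h1
      refine h1.trans ?_
      gcongr
      linarith
    · rw [sub_right_comm]
      refine (norm_sub_le _ _).trans (add_le_add (norm_cosh_sub_exp_le (by simpa using hv)) ?_)
      exact (hM z hz).trans (le_abs_self M)
  · have h1 := norm_cosh_sub_cpow_le hp.le hc (h z hz v)
    have h4 : Real.exp (-(p * |v|)) ≤ 1 := exp_le_one_iff.2 (by simp; positivity)
    have h3 : ‖((2 ^ p : ℝ) : ℂ) * exp (-(p * v))‖ ≤ 2 ^ p * 1 := by
      rw [norm_mul, norm_real, norm_of_nonneg (by positivity), norm_exp]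
      gcongr
      simpa [abs_of_nonneg hv] using h4
    have h6 : 1 ≤ (8 * E) ^ (p + 1) * Real.exp (-((p + 1) * v)) := by
      rw [Real.exp_neg, ← div_eq_mul_inv, one_le_div (exp_pos _), mul_comm, Real.exp_mul]
      exact rpow_le_rpow (exp_pos _).le hV (by linarith)
    calc _ ≤ c ^ (-p) * 2 ^ p * 1 + 2 ^ p * 1 :=
          (norm_sub_le _ _).trans (add_le_add (h1.trans (by gcongr)) h3)
      _ = (c ^ (-p) * 2 ^ p + 2 ^ p) * 1 := by ring
      _ ≤ (c ^ (-p) * 2 ^ p + 2 ^ p) * ((8 * E) ^ (p + 1) * Real.exp (-((p + 1) * v))) := by gcongr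
      _ = C2 * Real.exp (-((p + 1) * v)) := by rw [hC2]; ring
      _ ≤ _ := by gcongr; linarith

lemma exists_exp_gSub_le {p σ κ : ℝ} (hp : 0 < p) (h1 : κ ≤ σ - p) (h2 : κ ≤ p + 1 - σ)
    (hK : IsCompact K) (hKc : K ⊆ cutPlane) :
    ∃ C : ℝ, 0 ≤ C ∧ ∀ z ∈ K, ∀ v : ℝ, ∀ x : ℂ, x.re = σ →
      ‖exp (-(x * v)) * gSub p z v‖ ≤ C * Real.exp (-(κ * |v|)) := by
  obtain ⟨C1, hC1, g1⟩ := exists_gSub_neg_le hp hK hKc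
  obtain ⟨c, hc, h⟩ := exists_cosh_sub_ge hK hKc
  set C2 := c ^ (-p) * 2 ^ p + 2 ^ p with hC2
  have hC2' : 0 ≤ C2 := by positivity
  refine ⟨C1 + C2, by positivity, fun z hz v x hx => ?_⟩
  rw [norm_mul, show ‖exp (-(x * v))‖ = rexp (-(σ * v)) by simp [norm_exp, hx]]
  rcases le_total v 0 with hv | hv
  · have := neg_neg v ▸ g1 z hz (-v) (by linarith)
    calc _ ≤ Real.exp (-(σ * v)) * (C1 * Real.exp (-((p + 1) * -v))) := by gcongr
      _ = C1 * Real.exp (-((p + 1 - σ) * |v|)) := by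
        rw [abs_of_nonpos hv, mul_left_comm, ← Real.exp_add]; congr 2; ring
      _ ≤ _ := by
        gcongr
        linarith
  · have e1 := norm_cosh_sub_cpow_le hp.le hc (h z hz v)
    have e2 : ‖((2 ^ p : ℝ) : ℂ) * exp (p * v)‖ = 2 ^ p * Real.exp (p * v) := by
      rw [norm_mul, norm_real, norm_of_nonneg (by positivity), norm_exp]
      simp
    have e4 : ‖gSub p z v‖ ≤ C2 * Real.exp (p * v) := by
      refine (norm_sub_le _ _).trans ?_
      rw [e2, hC2, add_mul]
      refine add_le_add_left (e1.trans ?_) _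
      gcongr
      exact (neg_nonpos.2 (by positivity)).trans (by positivity)
    calc _ ≤ Real.exp (-(σ * v)) * (C2 * Real.exp (p * v)) := by gcongr
      _ = C2 * Real.exp (-((σ - p) * |v|)) := by
        rw [abs_of_nonneg hv, mul_left_comm, ← Real.exp_add]; congr 2; ring
      _ ≤ _ := by
        gcongr
        linarith

lemma integrable_exp_neg_mul_abs {κ : ℝ} (hκ : 0 < κ) :
    Integrable fun v : ℝ => Real.exp (-(κ * |v|)) := by
  rw [← integrableOn_univ, ← Set.Iic_union_Ioi (a := (0 : ℝ))]
  refine .union ((integrableOn_exp_mul_Iic hκ 0).congr_fun (fun v hv => ?_) measurableSet_Iic)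
    ((exp_neg_integrableOn_Ioi 0 hκ).congr_fun (fun v hv => ?_) measurableSet_Ioi)
  · simp [abs_of_nonpos hv.out]
  · simp [abs_of_pos hv.out]

lemma continuous_cosh_sub_cpow (hz : z ∈ cutPlane) (a : ℂ) :
    Continuous fun v : ℝ => (cosh v - z) ^ a :=
  Continuous.cpow (by fun_prop) continuous_const (cosh_sub_mem_slitPlane hz)

lemma continuous_gSub (hz : z ∈ cutPlane) : Continuous (gSub p z) :=
  (continuous_cosh_sub_cpow hz _).sub (by fun_prop)

lemma integrable_exp_gSub (hp : 0 < p) (h1 : p < x.re) (h2 : x.re < p + 1)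
    (hz : z ∈ cutPlane) :
    Integrable fun v : ℝ => exp (-(x * v)) * gSub p z v := by
  obtain ⟨C, _, hC⟩ := exists_exp_gSub_le (κ := min (x.re - p) (p + 1 - x.re)) hp (min_le_left _ _)
    (min_le_right _ _) isCompact_singleton (singleton_subset_iff.2 hz)
  refine Integrable.mono' ((integrable_exp_neg_mul_abs (lt_min (by linarith)
    (by linarith))).const_mul C) ?_ (.of_forall fun v => hC z rfl v x rfl)
  exact (Continuous.mul (by fun_prop) (continuous_gSub hz)).aestronglyMeasurable

/-- The two-sided Laplace transform of the subtracted resolvent kernel. -/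
def gLap (p : ℝ) (x z : ℂ) : ℂ := ∫ v : ℝ, exp (-(x * v)) * gSub p z v

lemma differentiableOn_gLap (hp : 0 < p) (h1 : p < x.re) (h2 : x.re < p + 1) :
    DifferentiableOn ℂ (gLap p x) cutPlane := by
  intro z hz
  obtain ⟨r, hr, hrc⟩ := Metric.nhds_basis_closedBall.mem_iff.1 (isOpen_cutPlane.mem_nhds hz)
  obtain ⟨c, hc, h⟩ := exists_cosh_sub_ge (isCompact_closedBall z r) hrc
  refine (hasDerivAt_integral_of_dominated_loc_of_deriv_le (s := Metric.ball z r)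
    (F := fun z (v : ℝ) => exp (-(x * v)) * gSub p z v)
    (F' := fun z (v : ℝ) => exp (-(x * v)) * (p * (cosh v - z) ^ (-((p + 1 : ℝ) : ℂ))))
    (bound := fun v => p * (c ^ (-(p + 1)) * 2 ^ (p + 1)) * Real.exp (-((p + 1 - x.re) * |v|)))
    (Metric.ball_mem_nhds z hr) ?_ (integrable_exp_gSub hp h1 h2 hz) ?_ ?_
    ((integrable_exp_neg_mul_abs (by linarith)).const_mul _)
    ?_).2.differentiableAt.differentiableWithinAt
  · filter_upwards [isOpen_cutPlane.mem_nhds hz] with w hw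
    exact (integrable_exp_gSub hp h1 h2 hw).1
  · exact (Continuous.mul (by fun_prop)
      ((continuous_cosh_sub_cpow hz _).const_mul _)).aestronglyMeasurable
  · refine Eventually.of_forall fun v w hw => ?_
    have h3 := norm_cosh_sub_cpow_le (a := p + 1) (by linarith) hc
      (h w (Metric.ball_subset_closedBall hw) v)
    rw [norm_mul, norm_mul, norm_real, norm_of_nonneg hp.le, norm_exp]
    have h4 : (-(x * v)).re ≤ x.re * |v| := by
      have := mul_le_mul_of_nonneg_left (neg_le_abs v) (by linarith : 0 ≤ x.re)
      simpa
    calc _ ≤ Real.exp (x.re * |v|) * (p * (c ^ (-(p + 1)) * 2 ^ (p + 1)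
          * Real.exp (-((p + 1) * |v|)))) := by gcongr
      _ = _ := by
        rw [show -((p + 1 - x.re) * |v|) = x.re * |v| + -((p + 1) * |v|) by ring, Real.exp_add]
        ring
  · refine Eventually.of_forall fun v w hw => ?_
    have hw' := cosh_sub_mem_slitPlane (hrc (Metric.ball_subset_closedBall hw)) v
    have h3 := ((hasDerivAt_id w).const_sub (cosh v)).cpow_const (c := -(p : ℂ)) hw'
    have h4 := (h3.sub_const (((2 ^ p : ℝ) : ℂ) * exp (p * v))).const_mul
      (exp (-(x * v)))
    refine h4.congr_deriv ?_
    rw [show -((p + 1 : ℝ) : ℂ) = -(p : ℂ) - 1 by push_cast; ring, id]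
    ring

end

section
open scoped Nat
variable {x : ℂ}

/-! ### Beta integrals -/

/-- The logarithm of `1 + e^v`. -/
def logExp (v : ℝ) : ℝ := Real.log (1 + Real.exp v)

lemma exp_logExp (v : ℝ) : Real.exp (logExp v) = 1 + Real.exp v :=
  Real.exp_log (by positivity)

lemma sigmoid_eq (v : ℝ) : Real.sigmoid v = Real.exp (v - logExp v) := by
  rw [Real.sigmoid_def, Real.exp_sub, exp_logExp, Real.exp_neg]
  field_simp
  ring

lemma one_sub_sigmoid_eq (v : ℝ) : 1 - Real.sigmoid v = Real.exp (-logExp v) := by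
  rw [sigmoid_eq, Real.exp_sub, Real.exp_neg, exp_logExp]
  field_simp
  ring

lemma one_add_cosh_eq (v : ℝ) : 1 + Real.cosh v = Real.exp (2 * logExp v - v) / 2 := by
  have := exp_pos v
  rw [Real.exp_sub, two_mul, Real.exp_add, exp_logExp, cosh_eq, Real.exp_neg]
  field_simp
  ring

lemma hasDerivAt_logExp (v : ℝ) : HasDerivAt logExp (Real.sigmoid v) v := by
  refine (((Real.hasDerivAt_exp v).const_add 1).log (by positivity)).congr_deriv ?_
  rw [sigmoid_eq, Real.exp_sub, exp_logExp]

lemma ofReal_exp_cpow (t : ℝ) (c : ℂ) : ((Real.exp t : ℝ) : ℂ) ^ c = exp (t * c) := by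
  rw [cpow_def_of_ne_zero (by exact_mod_cast (exp_pos t).ne'), ← ofReal_log
(exp_pos t).le, Real.log_exp]

/-- The Beta integral over the real line, by the substitution `t = e^v / (1 + e^v)`. -/
lemma betaIntegral_eq_integral (a b : ℂ) :
    betaIntegral a b
      = ∫ v : ℝ, exp (a * v - (a + b) * logExp v) := by
  have h := integral_image_eq_integral_abs_deriv_smul (s := Set.univ) (f := Real.sigmoid)
    (f' := fun v => Real.sigmoid v * (1 - Real.sigmoid v)) MeasurableSet.univ
    (fun v _ => (Real.hasDerivAt_sigmoid v).hasDerivWithinAt) Real.sigmoid_injective.injOn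
    (fun t : ℝ => (t : ℂ) ^ (a - 1) * (1 - (t : ℂ)) ^ (b - 1))
  rw [Set.image_univ, Real.range_sigmoid, setIntegral_univ] at h
  rw [betaIntegral, intervalIntegral.integral_of_le zero_le_one,
    integral_Ioc_eq_integral_Ioo, h]
  congr 1 with v
  have e1 : (1 : ℂ) - (Real.sigmoid v : ℂ) = ((Real.exp (-logExp v) : ℝ) : ℂ) := by
    rw [← one_sub_sigmoid_eq]; push_cast; ring
  rw [e1, one_sub_sigmoid_eq, sigmoid_eq, abs_of_pos (by positivity), ofReal_exp_cpow,
    ofReal_exp_cpow, real_smul]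
  push_cast
  simp only [← exp_add]
  congr 1
  ring

lemma cosh_add_one_cpow (a : ℝ) (v : ℝ) : (cosh v - (-1)) ^ (-(a : ℂ))
    = ((2 ^ a : ℝ) : ℂ) * exp (a * v - 2 * a * logExp v) := by
  have h1 : cosh v - (-1) = ((1 / 2 : ℝ) : ℂ) * ((Real.exp (2 * logExp v - v) : ℝ) : ℂ) := by
    rw [← ofReal_mul, one_div, inv_mul_eq_div, ← one_add_cosh_eq]
    push_cast; ring
  rw [h1, ofReal_mul_cpow (by norm_num) (by exact_mod_cast (exp_pos _).ne'), ofReal_exp_cpow]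
  congr 1
  · rw [← ofReal_neg, ← ofReal_cpow (by norm_num), one_div,
      inv_rpow (by norm_num), rpow_neg (by norm_num), inv_inv]
  · congr 1; push_cast; ring

lemma neg_one_mem_cutPlane : (-1 : ℂ) ∈ cutPlane := by
  norm_num [cutPlane]

lemma integral_exp_cosh_cpow (a : ℝ) (x : ℂ) :
    ∫ v : ℝ, exp (-(x * v)) * (cosh v - (-1)) ^ (-(a : ℂ))
      = ((2 ^ a : ℝ) : ℂ) * betaIntegral (a - x) (a + x) := by
  rw [betaIntegral_eq_integral, ← integral_const_mul]
  congr 1 with v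
  rw [cosh_add_one_cpow, mul_left_comm, ← exp_add]
  congr 2
  ring

lemma integrable_exp_cosh_cpow {a : ℝ} (ha : 0 ≤ a) (h1 : x.re < a) (h2 : -x.re < a) :
    Integrable fun v : ℝ => exp (-(x * v)) * (cosh v - (-1)) ^ (-(a : ℂ)) := by
  obtain ⟨c, hc, h⟩ := exists_cosh_sub_ge isCompact_singleton
    (singleton_subset_iff.2 neg_one_mem_cutPlane)
  have hk : 0 < a - |x.re| := by
    linarith [abs_lt.2 ⟨by linarith, h1⟩]
  refine Integrable.mono' ((integrable_exp_neg_mul_abs hk).const_mul (c ^ (-a) * 2 ^ a)) ?_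
    (Eventually.of_forall fun v => ?_)
  · exact (Continuous.mul (by fun_prop)
      (continuous_cosh_sub_cpow neg_one_mem_cutPlane _)).aestronglyMeasurable
  · have h3 := norm_cosh_sub_cpow_le ha hc (h (-1) rfl v)
    rw [norm_mul, norm_exp]
    have h4 : (-(x * v)).re ≤ |x.re| * |v| := by
      simpa [← abs_mul] using neg_le_abs (x.re * v)
    calc _ ≤ Real.exp (|x.re| * |v|) * (c ^ (-a) * 2 ^ a * Real.exp (-(a * |v|))) := by gcongr
      _ = _ := by
        rw [show -((a - |x.re|) * |v|) = |x.re| * |v| + -(a * |v|) by ring, Real.exp_add]; ring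

/-- The regularized Beta integral. -/
lemma gLap_neg_one {p : ℝ} (hp : 0 < p) (h1 : p < x.re) (h2 : x.re < p + 1) :
    (p - x) * gLap p x (-1) = ((2 ^ p : ℝ) : ℂ) * (2 * p)
      * betaIntegral (p - x + 1) (p + x) := by
  set F : ℝ → ℂ := fun v => exp (-(x * v)) * gSub p (-1) v with hF
  have hFe : F = fun v : ℝ => ((2 ^ p : ℝ) : ℂ) * (exp ((p - x) * v)
      * (exp (-(2 * p * logExp v)) - 1)) := by
    funext v
    simp only [hF, gSub]
    rw [cosh_add_one_cpow, show (p : ℂ) * v - 2 * p * logExp v = p * v + -(2 * p * logExp v) by ring,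
      show ((p : ℂ) - x) * v = -(x * v) + p * v by ring, exp_add, exp_add]
    ring
  have hi := integrable_exp_gSub hp h1 h2 neg_one_mem_cutPlane
  set G : ℝ → ℂ := fun v => ((2 ^ p : ℝ) : ℂ) * (2 * p)
    * exp ((p - x + 1) * v - ((p - x + 1) + (p + x)) * logExp v) with hG
  have hd : ∀ v, HasDerivAt F ((p - x) * F v - G v) v := fun v => by
    simp only [hFe, hG]
    have d1 : HasDerivAt (fun v : ℝ => (p - x) * (v : ℂ)) (p - x) v := by
      simpa using (hasDerivAt_id (v : ℂ)).comp_ofReal.const_mul (p - x)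
    have d2 : HasDerivAt (fun v : ℝ => -(2 * p * (logExp v : ℂ)))
        (-(2 * p * (Real.sigmoid v : ℂ))) v :=
      ((hasDerivAt_logExp v).ofReal_comp.const_mul (2 * p : ℂ)).fun_neg
    refine ((d1.cexp.mul (d2.cexp.sub_const 1)).const_mul _).congr_deriv ?_
    rw [show (p - x + 1) * (v : ℂ) - ((p - x + 1) + (p + x)) * logExp v
      = (p - x) * v + (-(2 * p * logExp v) + ((v - logExp v : ℝ) : ℂ)) by push_cast; ring,
      exp_add, exp_add, sigmoid_eq, Complex.ofReal_exp]
    ring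
  obtain ⟨C, _, hC⟩ := exists_exp_gSub_le (κ := min (x.re - p) (p + 1 - x.re)) hp (min_le_left _ _)
    (min_le_right _ _) isCompact_singleton (singleton_subset_iff.2 neg_one_mem_cutPlane)
  have hl : ∀ l : Filter ℝ, Tendsto (fun v : ℝ => |v|) l atTop → Tendsto F l (𝓝 0) := fun l hl => by
    refine squeeze_zero_norm (fun v => hC (-1) rfl v x rfl) ?_
    simpa using (Real.tendsto_exp_neg_atTop_nhds_zero.comp
      (hl.const_mul_atTop (lt_min (by linarith) (by linarith)))).const_mul C
  have hi2 : Integrable G := by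
    have h3 := integrable_exp_cosh_cpow (a := p + 1 / 2) (x := x - 1 / 2) (by linarith)
      (by simp; linarith) (by simp; linarith)
    refine (h3.const_mul (((2 ^ p : ℝ) : ℂ) * (2 * p) * (((2 ^ (p + 1 / 2) : ℝ) : ℂ))⁻¹)).congr
      (.of_forall fun v => ?_)
    beta_reduce
    rw [cosh_add_one_cpow, mul_left_comm (exp _), ← exp_add, mul_assoc _ _⁻¹,
      inv_mul_cancel_left₀ (ofReal_ne_zero.2 (Real.rpow_pos_of_pos two_pos _).ne')]
    congr 2
    push_cast
    ring
  have key := integral_of_hasDerivAt_of_tendsto hd ((hi.const_mul (p - x)).sub hi2)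
    (hl atBot tendsto_abs_atBot_atTop) (hl atTop tendsto_abs_atTop_atTop)
  rw [integral_sub (hi.const_mul _) hi2, integral_const_mul, integral_const_mul,
    ← betaIntegral_eq_integral] at key
  rw [gLap]
  linear_combination key

lemma hasSum_one_sub_cpow (p : ℝ) {X : ℂ} (hX : ‖X‖ < 1) :
    HasSum (fun n : ℕ => ((n ! : ℂ)⁻¹ * (ascPochhammer ℂ n).eval (p : ℂ)) * X ^ n)
      ((1 - X) ^ (-(p : ℂ))) := by
  have h := Complex.one_add_cpow_hasFPowerSeriesOnBall_zero (a := -(p : ℂ))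
  have h2 := h.hasSum (y := -X) (by simpa [← ENNReal.ofReal_one, Metric.eball_ofReal] using hX)
  rw [binomialSeries_eq_ordinaryHypergeometricSeries (b := (1 : ℂ)) (fun k hk =>
    k.cast_add_one_ne_zero (R := ℂ) (by rw [hk]; ring)), zero_add, ← sub_eq_add_neg] at h2
  have e : ∀ n : ℕ, ((ordinaryHypergeometricSeries ℂ (-(-(p : ℂ))) 1 1).compContinuousLinearMap
      (-(.id _ _))) n (fun _ => -X)
      = ((n ! : ℂ)⁻¹ * (ascPochhammer ℂ n).eval (p : ℂ)) * X ^ n := fun n => by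
    have h4 : (ascPochhammer ℂ n).eval (1 : ℂ) ≠ 0 := by
      simpa using n.factorial_ne_zero
    simp only [FormalMultilinearSeries.compContinuousLinearMap_apply, Function.comp_def,
      neg_apply, ContinuousLinearMap.coe_id', id_eq, neg_neg]
    rw [ordinaryHypergeometricSeries_apply_eq, smul_eq_mul, mul_inv_cancel_right₀ h4]
  simpa only [e] using h2

end

section
open scoped Nat
variable {w x z : ℂ} {p : ℝ}

/-! ### The Green's function as a Laplace transform -/

/-- The coefficients of the binomial series of `(1 - X)^{-p}`. -/
def binC (p : ℝ) (n : ℕ) : ℂ := (n ! : ℂ)⁻¹ * (ascPochhammer ℂ n).eval (p : ℂ)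

lemma cosh_sub_cpow_eq (p : ℝ) (v : ℝ) (hw : ‖w‖ < 1) :
    ‖2 * w * (cosh v - (-1))⁻¹‖ ≤ ‖w‖ ∧
    (cosh v - (2 * w - 1)) ^ (-(p : ℂ)) = (cosh v - (-1)) ^ (-(p : ℂ))
      * (1 - 2 * w * (cosh v - (-1))⁻¹) ^ (-(p : ℂ)) := by
  have h1 : cosh v - (-1) = ((Real.cosh v + 1 : ℝ) : ℂ) := by push_cast; ring
  have h2 : (2 : ℝ) ≤ Real.cosh v + 1 := by linarith [one_le_cosh v]
  have h0 : 0 < Real.cosh v + 1 := by linarith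
  have hn : ‖2 * w * (cosh v - (-1))⁻¹‖ ≤ ‖w‖ := by
    rw [h1, norm_mul, norm_mul, norm_inv, norm_real, norm_of_nonneg h0.le,
      norm_ofNat, ← div_eq_mul_inv, div_le_iff₀ h0]
    nlinarith [norm_nonneg w]
  refine ⟨hn, ?_⟩
  have h4 : 1 - 2 * w * (cosh v - (-1))⁻¹ ≠ 0 := fun h => by
    have := hn.trans_lt hw
    rw [← sub_eq_zero.1 h] at this
    simp at this
  have h5 : cosh v - (2 * w - 1)
      = ((Real.cosh v + 1 : ℝ) : ℂ) * (1 - 2 * w * (cosh v - (-1))⁻¹) := by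
    rw [h1, mul_sub, mul_one, mul_comm (2 * w), mul_inv_cancel_left₀ (ofReal_ne_zero.2 h0.ne')]
    push_cast; ring
  rw [h5, ofReal_mul_cpow h0 h4, h1]

lemma two_mul_sub_one_mem_cutPlane : 2 * w - 1 ∈ cutPlane ↔ w ∈ cutPlane := by
  simp only [cutPlane, Set.mem_ofPred_eq, not_iff_not]
  constructor <;> rintro ⟨h, h'⟩ <;> simp at * <;> constructor <;> linarith

lemma mem_cutPlane_of_norm_lt_one (hw : ‖w‖ < 1) : w ∈ cutPlane := fun h => by
  linarith [re_le_norm w, h.2]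

/-- The power series of the Laplace transform of the subtracted resolvent kernel. -/
lemma hasSum_gLap (hp : 0 < p) (h1 : p < x.re) (h2 : x.re < p + 1) 
    (hw : ‖w‖ < 1) :
    HasSum (fun n : ℕ => binC p (n + 1) * (2 * w) ^ (n + 1) * (((2 ^ (p + (n + 1)) : ℝ) : ℂ)
      * betaIntegral (p + (n + 1) - x) (p + (n + 1) + x)))
      (gLap p x (2 * w - 1) - gLap p x (-1)) := by
  set Q : ℝ → ℂ := fun v => cosh v - (-1)
  set F : ℕ → ℝ → ℂ := fun n v => binC p (n + 1) * (2 * w) ^ (n + 1)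
    * (exp (-(x * v)) * Q v ^ (-((p + (n + 1) : ℝ) : ℂ))) with hF
  have hQ0 : ∀ v : ℝ, 0 < Real.cosh v + 1 := fun v => by linarith [one_le_cosh v]
  have hQr : ∀ v, Q v = ((Real.cosh v + 1 : ℝ) : ℂ) := fun v => by simp [Q]
  have hshift : ∀ (n : ℕ) v, Q v ^ (-((p + n : ℝ) : ℂ)) = Q v ^ (-(p : ℂ)) * (Q v)⁻¹ ^ n := fun n v => by
    rw [show -((p + n : ℝ) : ℂ) = -(p : ℂ) - (n : ℂ) by push_cast; ring, Complex.cpow_sub _ _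
      (hQr v ▸ ofReal_ne_zero.2 (hQ0 v).ne'), cpow_natCast, inv_pow, div_eq_mul_inv]
  have hint : ∀ n, Integrable (F n) := fun n => by
    have : (0 : ℝ) ≤ n := n.cast_nonneg
    exact (integrable_exp_cosh_cpow (by positivity) (by linarith) (by linarith)).const_mul _
  -- The integrands with `n ≥ 1` are dominated by that with `n = 1`.
  have hle : ∀ n v, ‖F n v‖ ≤ ‖binC p (n + 1) * w ^ (n + 1)‖
      * (2 * ‖exp (-(x * v)) * Q v ^ (-((p + 1 : ℝ) : ℂ))‖) := fun n v => by
    have e1 : F n v = binC p (n + 1) * w ^ (n + 1) * ((2 * (Q v)⁻¹) ^ n * (2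
        * (exp (-(x * v)) * Q v ^ (-((p + 1 : ℝ) : ℂ))))) := by
      have s1 := hshift (n + 1) v
      have s2 := hshift 1 v
      push_cast [hF] at s1 s2 ⊢
      rw [s1, s2]
      ring
    have e2 : ‖(2 * (Q v)⁻¹) ^ n‖ ≤ 1 := by
      rw [norm_pow, norm_mul, norm_inv, hQr, norm_real, norm_of_nonneg (hQ0 v).le, norm_ofNat,
        ← div_eq_mul_inv]
      exact pow_le_one₀ (by have := hQ0 v; positivity)
        ((div_le_one (hQ0 v)).2 (by linarith [one_le_cosh v]))
    rw [e1, norm_mul, norm_mul _ (2 * _), norm_mul (2 : ℂ), norm_ofNat]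
    exact mul_le_mul_of_nonneg_left (mul_le_of_le_one_left (by positivity) e2) (norm_nonneg _)
  have hi1 := integrable_exp_cosh_cpow (a := p + 1) (x := x) (by positivity) h2 (by linarith)
  have hsum : Summable fun n => ∫ v, ‖F n v‖ := by
    refine (((summable_nat_add_iff 1).2 (hasSum_one_sub_cpow p hw).summable).norm.mul_right
      (∫ v : ℝ,
      2 * ‖exp (-(x * v)) * Q v ^ (-((p + 1 : ℝ) : ℂ))‖)).of_nonneg_of_le (fun n => integral_nonneg fun v => norm_nonneg _) fun n => ?_
    rw [← integral_const_mul]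
    exact integral_mono (hint n).norm ((hi1.norm.const_mul 2).const_mul _) (hle n)
  have key := hasSum_integral_of_summable_integral_norm hint hsum
  have hpt : ∀ v, ∑' n, F n v = exp (-(x * v)) * gSub p (2 * w - 1) v
      - exp (-(x * v)) * gSub p (-1) v := fun v => by
    obtain ⟨e1, e2⟩ := cosh_sub_cpow_eq p v hw
    have e4 := ((hasSum_nat_add_iff' 1).2 (hasSum_one_sub_cpow p (e1.trans_lt hw))).mul_left
      (exp (-(x * v)) * Q v ^ (-(p : ℂ)))
    simp only [Finset.range_one, sum_singleton, Nat.factorial_zero, Nat.cast_one, inv_one,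
      ascPochhammer_zero, Polynomial.eval_one, pow_zero, mul_one] at e4
    rw [gSub, gSub, e2, ← mul_sub, sub_sub_sub_cancel_right, ← mul_sub_one, ← mul_assoc,
      ← e4.tsum_eq]
    refine tsum_congr fun n => ?_
    have s1 := hshift (n + 1) v
    push_cast [hF] at s1 ⊢
    rw [s1, binC, mul_pow (2 * w)]
    ring
  simp only [hpt, F, integral_const_mul, Q, integral_exp_cosh_cpow] at key
  rw [integral_sub (integrable_exp_gSub hp h1 h2 (two_mul_sub_one_mem_cutPlane.2
    (mem_cutPlane_of_norm_lt_one hw))) (integrable_exp_gSub hp h1 h2 neg_one_mem_cutPlane)] at key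
  exact_mod_cast key

lemma ascPochhammer_eval_two_mul (p : ℂ) (n : ℕ) :
    (ascPochhammer ℂ (2 * n)).eval (2 * p)
      = 4 ^ n * (ascPochhammer ℂ n).eval p * (ascPochhammer ℂ n).eval (p + 1 / 2) := by
  induction n with
  | zero => simp
  | succ n ih =>
    simp only [Nat.mul_succ, ascPochhammer_succ_eval, ih]
    push_cast
    ring

lemma Gamma_add_nat_eq (hz : ∀ k : ℕ, z ≠ -k) (n : ℕ) :
    Gamma (z + n) = Gamma z * (ascPochhammer ℂ n).eval z := by
  rw [← Gamma_add_nat_div_Gamma_eq z hz, mul_div_cancel₀ _ (Gamma_ne_zero hz)]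

lemma ne_neg_natCast_of_re_pos (hz : 0 < z.re) (k : ℕ) : z ≠ -k := fun h => by
  simp [h] at hz
  exact absurd hz k.cast_nonneg.not_gt

lemma ne_neg_natCast_of_re_mem (h0 : 0 < z.re) (h1 : z.re < 1) (k : ℕ) : -z ≠ -k := fun h => by
  simp [neg_injective h] at h0 h1
  omega

lemma ascPochhammer_eval_ne_zero (hz : 0 < z.re) (n : ℕ) :
    (ascPochhammer ℂ n).eval z ≠ 0 := by
  have h := ne_neg_natCast_of_re_pos hz
  rw [← Gamma_add_nat_div_Gamma_eq z h]
  exact div_ne_zero (Gamma_ne_zero_of_re_pos (by simp; positivity)) (Gamma_ne_zero h)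

/-- The constant relating the Laplace transform to the hypergeometric function. -/
def lapConst (p : ℝ) (z : ℂ) : ℂ :=
  ((2 ^ p : ℝ) : ℂ) * Gamma (-z) * Gamma (z + 2 * p) / Gamma (2 * p)

/-- On the unit disc the Laplace transform of the subtracted resolvent kernel is a hypergeometric
function. -/
lemma gLap_eq_hypergeometric (hp : 0 < p) (h1 : 0 < z.re) (h2 : z.re < 1) 
    (hw : ‖w‖ < 1) :
    gLap p (z + p) (2 * w - 1)
      = lapConst p z * ordinaryHypergeometric (-z) (z + 2 * p) ((p : ℂ) + 1 / 2) w := by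
  have hp0 : (p : ℂ) ≠ 0 := by exact_mod_cast hp.ne'
  have hz0 : z ≠ 0 := fun h => by simp [h] at h1
  have hx1 : p < (z + p).re := by simp; linarith
  have hx2 : (z + p).re < p + 1 := by simp; linarith
  have hG1 := Gamma_add_nat_eq (ne_neg_natCast_of_re_mem h1 h2)
  have hre : 0 < (z + 2 * p).re := by simp; linarith
  have hG2 := Gamma_add_nat_eq (ne_neg_natCast_of_re_pos hre)
  have hre3 : 0 < (2 * (p : ℂ)).re := by simp; linarith
  have h2p := Gamma_ne_zero_of_re_pos hre3
  have hG3 := Gamma_add_nat_eq (ne_neg_natCast_of_re_pos hre3)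
  have hbeta : ∀ n : ℕ, betaIntegral (p + (n + 1) - (z + p)) (p + (n + 1) + (z + p))
      = Gamma (-z) * (ascPochhammer ℂ (n + 1)).eval (-z)
        * (Gamma (z + 2 * p) * (ascPochhammer ℂ (n + 1)).eval (z + 2 * p))
        / (Gamma (2 * p) * (4 ^ (n + 1) * (ascPochhammer ℂ (n + 1)).eval (p : ℂ)
          * (ascPochhammer ℂ (n + 1)).eval ((p : ℂ) + 1 / 2))) := fun n => by
    have hn : (0 : ℝ) ≤ n := n.cast_nonneg
    rw [betaIntegral_eq_Gamma_mul_div _ _ (by simp; linarith) (by simp; linarith),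
      ← ascPochhammer_eval_two_mul, ← hG1, ← hG2, ← hG3,
      show (p : ℂ) + (n + 1) - (z + p) = -z + ((n + 1 : ℕ) : ℂ) by push_cast; ring,
      show (p : ℂ) + (n + 1) + (z + p) = z + 2 * p + ((n + 1 : ℕ) : ℂ) by push_cast; ring,
      show -z + ((n + 1 : ℕ) : ℂ) + (z + 2 * p + ((n + 1 : ℕ) : ℂ))
        = 2 * p + ((2 * (n + 1) : ℕ) : ℂ) by push_cast; ring]
  have hzero : gLap p (z + p) (-1) = lapConst p z := by
    have h := gLap_neg_one hp hx1 hx2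
    rw [show (p : ℂ) - (z + p) + 1 = -z + 1 by ring, show (p : ℂ) + (z + p) = z + 2 * p by ring,
      show (p : ℂ) - (z + p) = -z by ring,
      betaIntegral_eq_Gamma_mul_div _ _ (by simp; linarith) hre,
      Gamma_add_one _ (neg_ne_zero.2 hz0),
      show -z + 1 + (z + 2 * p) = 2 * p + 1 by ring, Gamma_add_one _ (by simpa using hp0)] at h
    refine mul_left_cancel₀ (neg_ne_zero.2 hz0) (h.trans ?_)
    rw [lapConst]
    field_simp
  have hs := hasSum_gLap hp hx1 hx2 hw
  rw [hzero] at hs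
  have hterm : ∀ n : ℕ, binC p (n + 1) * (2 * w) ^ (n + 1) * (((2 ^ (p + (n + 1)) : ℝ) : ℂ)
      * betaIntegral (p + (n + 1) - (z + p)) (p + (n + 1) + (z + p)))
      = lapConst p z * ((((n + 1)! : ℂ)⁻¹ * (ascPochhammer ℂ (n + 1)).eval (-z)
        * (ascPochhammer ℂ (n + 1)).eval (z + 2 * p)
        * ((ascPochhammer ℂ (n + 1)).eval ((p : ℂ) + 1 / 2))⁻¹) • w ^ (n + 1)) := fun n => by
    have e1 : ((2 ^ (p + (n + 1)) : ℝ) : ℂ) = ((2 ^ p : ℝ) : ℂ) * 2 ^ (n + 1) := by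
      rw [rpow_add two_pos, ofReal_mul]
      exact_mod_cast rfl
    have e2 := ascPochhammer_eval_ne_zero (z := (p : ℂ)) (by simpa) (n + 1)
    have e3 := ascPochhammer_eval_ne_zero (z := (p : ℂ) + 1 / 2) (by simp; linarith) (n + 1)
    rw [hbeta, e1, binC, lapConst, smul_eq_mul, show (4 : ℂ) = 2 * 2 by norm_num, mul_pow, mul_pow]
    field_simp
  simp only [hterm] at hs
  have hs2 := (hasSum_nat_add_iff (f := fun n : ℕ => lapConst p z * ((((n)! : ℂ)⁻¹
    * (ascPochhammer ℂ n).eval (-z) * (ascPochhammer ℂ n).eval (z + 2 * p)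
    * ((ascPochhammer ℂ n).eval ((p : ℂ) + 1 / 2))⁻¹) • w ^ n)) 1).1 hs
  simp only [Finset.range_one, sum_singleton, Nat.factorial_zero, Nat.cast_one, inv_one,
      ascPochhammer_zero, Polynomial.eval_one, pow_zero, mul_one, smul_eq_mul,
      sub_add_cancel] at hs2
  rw [ordinaryHypergeometric_eq_tsum, ← tsum_mul_left]
  exact hs2.tsum_eq.symm

lemma isPreconnected_cutPlane : IsPreconnected cutPlane := by
  have h : StarConvex ℝ (0 : ℂ) cutPlane := by
    rw [starConvex_zero_iff]
    intro z hz t ht0 ht1 h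
    refine hz ?_
    have hi : (t • z).im = t * z.im := by simp
    have hr : (t • z).re = t * z.re := by simp
    rw [hi, hr] at h
    have htp : 0 < t := ht0.lt_of_ne' fun h0 => by linarith [h0 ▸ h.2]
    exact ⟨(mul_eq_zero.1 h.1).resolve_left htp.ne', by_contra fun _ => by nlinarith [h.2]⟩
  exact (h.isPathConnected (mem_cutPlane_of_norm_lt_one (by simp))).isConnected.isPreconnected

lemma gauss2F1_eq {a b c : ℂ} {F : ℂ → ℂ} (hF : DifferentiableOn ℂ F cutPlane)
    (h : ∀ w : ℂ, ‖w‖ < 1 → F w = ordinaryHypergeometric a b c w) (hz : z ∈ cutPlane) :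
    gauss2F1 a b c z = F z := by
  have hex : ∃ F : ℂ → ℂ, DifferentiableOn ℂ F cutPlane ∧
      ∀ w : ℂ, ‖w‖ < 1 → F w = ordinaryHypergeometric a b c w := ⟨F, hF, h⟩
  rw [gauss2F1, dif_pos hex]
  obtain ⟨h1, h2⟩ := hex.choose_spec
  refine (h1.analyticOnNhd isOpen_cutPlane).eqOn_of_preconnected_of_eventuallyEq
    (hF.analyticOnNhd isOpen_cutPlane) isPreconnected_cutPlane
    (mem_cutPlane_of_norm_lt_one (w := 0) (by simp)) ?_ hz
  filter_upwards [Metric.ball_mem_nhds (0 : ℂ) one_pos] with w hw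
  rw [h2 w (by simpa using hw), h w (by simpa using hw)]

/-- The normalization of the Green's function relative to the resolvent kernel. -/
def greenConst (D : ℕ) (p : ℝ) : ℂ :=
  Gamma (2 * p) / (((2 ^ p : ℝ) : ℂ) * (4 * (π : ℂ)) ^ ((D : ℂ) / 2)
    * Gamma ((D : ℂ) / 2))

/-- The Green's function is the Laplace transform of the subtracted resolvent kernel. -/
lemma greenDelta_eq {D : ℕ} (hp : 0 < p) (hD : (D : ℝ) = 2 * p + 1) 
    (h1 : 0 < x.re) (h2 : x.re < 1) (hz : z ∈ cutPlane) :
    greenDelta D x z = greenConst D p * gLap p (x + p) z := by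
  have hD' : (D : ℂ) = 2 * p + 1 := by exact_mod_cast congrArg Complex.ofReal hD
  have hG1 : Gamma (-x) ≠ 0 := Gamma_ne_zero (ne_neg_natCast_of_re_mem h1 h2)
  have hG2 : Gamma (x + 2 * p) ≠ 0 :=
    Gamma_ne_zero_of_re_pos (by simp; linarith)
  have hG3 : Gamma (2 * p) ≠ 0 := Gamma_ne_zero_of_re_pos (by simp; linarith)
  have h2p : ((2 ^ p : ℝ) : ℂ) ≠ 0 := ofReal_ne_zero.2 (by positivity)
  have hL : lapConst p x ≠ 0 := div_ne_zero (mul_ne_zero (mul_ne_zero h2p hG1) hG2) hG3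
  have hz' : (1 + z) / 2 ∈ cutPlane := by
    rw [← two_mul_sub_one_mem_cutPlane]
    ring_nf
    exact hz
  have key := gauss2F1_eq (F := fun w => (lapConst p x)⁻¹ * gLap p (x + p) (2 * w - 1))
    (((differentiableOn_gLap hp (x := x + p) (by simp; linarith) (by simp; linarith)).comp
      (by fun_prop) fun w hw => two_mul_sub_one_mem_cutPlane.2 hw).const_mul _) (fun w hw => by
    rw [gLap_eq_hypergeometric hp h1 h2 hw, inv_mul_cancel_left₀ hL]) hz'
  rw [greenDelta, show x + (D : ℂ) - 1 = x + 2 * p by rw [hD']; ring,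
    show (D : ℂ) / 2 = p + 1 / 2 by rw [hD']; ring, key, greenConst,
    show (D : ℂ) / 2 = p + 1 / 2 by rw [hD']; ring, show 2 * ((1 + z) / 2) - 1 = z by ring, lapConst]
  generalize Gamma (x + 2 * p) = G2 at hG2 ⊢
  generalize Gamma (2 * p) = G3 at hG3 ⊢
  field_simp

end

section
open scoped FourierTransform
variable {k : ℝ → ℂ} {x L z : ℂ} {r p s : ℝ} {D : ℕ}

/-! ### The contour integral as a transform of the resolvent kernel -/

/-- `L` is the Laplace transform of `k` at `x`. -/
def HasLaplace (k : ℝ → ℂ) (x L : ℂ) : Prop :=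
  IntegrableOn (fun v : ℝ => k v * exp (-(x * v))) (Ioi 0) ∧
    ∫ v in Ioi (0 : ℝ), k v * exp (-(x * v)) = L

lemma HasLaplace.add {k l : ℝ → ℂ} {x L M : ℂ} (h : HasLaplace k x L) (h' : HasLaplace l x M) :
    HasLaplace (fun v => k v + l v) x (L + M) := by
  simp only [HasLaplace, add_mul]
  exact ⟨h.1.add h'.1, by rw [← h.2, ← h'.2]; exact integral_add h.1 h'.1⟩

lemma HasLaplace.const_mul (c : ℂ) (h : HasLaplace k x L) :
    HasLaplace (fun v => c * k v) x (c * L) := by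
  simp only [HasLaplace, mul_assoc]
  exact ⟨h.1.const_mul c, by rw [integral_const_mul, h.2]⟩

lemma hasLaplace_exp (h : r < x.re) :
    HasLaplace (fun v => exp (r * v)) x (x - r)⁻¹ := by
  have hr : 0 < (x - r).re := by simpa using h
  have h1 := integrable_cpow_exp_neg (a := 1) one_pos hr
  have h2 := integral_cpow_exp_neg (a := 1) one_pos hr
  have e : ∀ v : ℝ, exp (r * v) * exp (-(x * v)) = exp (-((x - r) * v)) := fun v => by
    rw [← exp_add]; ring_nf
  simp only [ofReal_one, sub_self, Complex.cpow_zero, one_mul, cpow_one,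
    Gamma_one, mul_one, one_div] at h1 h2
  simpa only [HasLaplace, e] using ⟨h1, h2⟩

lemma hasLaplace_mul_exp (h : r < x.re) :
    HasLaplace (fun v => v * exp (r * v)) x ((x - r) ^ 2)⁻¹ := by
  have hr : 0 < (x - r).re := by simpa using h
  have h1 := integrable_cpow_exp_neg (a := 2) two_pos hr
  have h2 := integral_cpow_exp_neg (a := 2) two_pos hr
  have e : ∀ v : ℝ, v * exp (r * v) * exp (-(x * v)) = v * exp (-((x - r) * v)) := fun v => by
    rw [mul_assoc, ← exp_add]; ring_nf
  have e2 : ((2 : ℝ) : ℂ) - 1 = 1 := by norm_num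
  have e3 : Gamma ((2 : ℝ) : ℂ) = 1 := by
    rw [Gamma_ofReal, Real.Gamma_two, ofReal_one]
  simp only [e3, e2, cpow_one, mul_one, one_div] at h1 h2
  rw [ofReal_ofNat, Complex.cpow_ofNat, inv_pow] at h2
  simpa only [HasLaplace, e] using ⟨h1, h2⟩

lemma sub_add_ne_zero (hr : 0 ≤ r) (h : r < x.re) : x - r ≠ 0 ∧ x + r ≠ 0 := by
  constructor <;> intro e <;> have := congrArg Complex.re e <;> simp at this <;> linarith

lemma hasLaplace_cosh (hr : 0 ≤ r) (h : r < x.re) :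
    HasLaplace (fun v => cosh (r * v)) x (x / (x ^ 2 - r ^ 2)) := by
  obtain ⟨n1, n2⟩ := sub_add_ne_zero hr h
  convert! ((hasLaplace_exp h).add (hasLaplace_exp (by linarith : -r < x.re))).const_mul (1 / 2)
    using 1
  · funext v; rw [cosh]; push_cast; rw [neg_mul]; ring
  · push_cast
    rw [sub_neg_eq_add, sq_sub_sq]
    field_simp
    ring

lemma hasLaplace_mul_sinh (hr : 0 ≤ r) (h : r < x.re) :
    HasLaplace (fun v => v * sinh (r * v)) x (2 * r * x / (x ^ 2 - r ^ 2) ^ 2) := by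
  obtain ⟨n1, n2⟩ := sub_add_ne_zero hr h
  convert! ((hasLaplace_mul_exp h).add ((hasLaplace_mul_exp (by linarith : -r < x.re)).const_mul
    (-1))).const_mul (1 / 2) using 1
  · funext v; rw [sinh]; push_cast; rw [neg_mul]; ring
  · push_cast
    rw [sub_neg_eq_add, sq_sub_sq]
    field_simp
    ring

/-- The Laplace transform of the kernel `kern0`. -/
def symb (p q : ℝ) (x : ℂ) : ℂ := 2 * x / ((x ^ 2 - p ^ 2) ^ 2 * (x ^ 2 - q ^ 2) ^ 2)

lemma hasLaplace_kern0 {p q : ℝ} (hq : 0 < q) (hqp : q < p) (h : p < x.re) :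
    HasLaplace (fun v => kern0 p q v) x (symb p q x) := by
  have hp := hq.trans hqp
  have hp0 : (p : ℂ) ≠ 0 := ofReal_ne_zero.2 hp.ne'
  have hq0 : (q : ℂ) ≠ 0 := ofReal_ne_zero.2 hq.ne'
  have hm0 : (p : ℂ) ^ 2 - q ^ 2 ≠ 0 := by
    exact_mod_cast (sub_pos.2 (pow_lt_pow_left₀ hqp hq.le two_ne_zero)).ne'
  have hne : ∀ r : ℝ, 0 < r → r < x.re → x ^ 2 - (r : ℂ) ^ 2 ≠ 0 := fun r hr0 hr => by
    obtain ⟨n1, n2⟩ := sub_add_ne_zero hr0.le hr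
    rw [sq_sub_sq]
    exact mul_ne_zero n2 n1
  have n1 := hne p hp h
  have n2 := hne q hq (hqp.trans h)
  have h1 := ((((hasLaplace_cosh hp.le h).const_mul (-4 / ((p : ℂ) ^ 2 - q ^ 2) ^ 3)).add
    ((hasLaplace_mul_sinh hp.le h).const_mul (1 / (((p : ℂ) ^ 2 - q ^ 2) ^ 2 * p)))).add
    ((hasLaplace_cosh hq.le (hqp.trans h)).const_mul (4 / ((p : ℂ) ^ 2 - q ^ 2) ^ 3))).add
    ((hasLaplace_mul_sinh hq.le (hqp.trans h)).const_mul (1 / (((p : ℂ) ^ 2 - q ^ 2) ^ 2 * q)))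
  convert! h1 using 1
  rw [symb]
  -- With `P = x² - p²`, `Q = x² - q²` the right side is `2x (1/P - 1/Q)² / (Q - P)²`.
  have hPQ : (p : ℂ) ^ 2 - q ^ 2 = (x ^ 2 - q ^ 2) - (x ^ 2 - p ^ 2) := by ring
  rw [hPQ] at hm0 ⊢
  generalize x ^ 2 - (p : ℂ) ^ 2 = P at *
  generalize x ^ 2 - (q : ℂ) ^ 2 = Q at *
  field_simp
  ring

/-- The decay of the symbol along vertical lines. -/
lemma norm_symb_le (hp : 1 ≤ p) (h0 : 0 < s) (h1 : s < 1) (t : ℝ) :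
    ‖symb p (p - 1) (s + t * I + p)‖ ≤ 2 / s ^ 2 * (1 + t ^ 2)⁻¹ := by
  set w : ℂ := s + t * I with hw
  have hwr : w.re = s := by simp [hw]
  have e : symb p (p - 1) (w + p)
      = 2 * (w + p) / (w ^ 2 * (w + 2 * p) ^ 2 * (w + 1) ^ 2 * (w + (2 * p - 1)) ^ 2) := by
    rw [symb]
    push_cast
    ring_nf
  have n0 : ‖w‖ ^ 2 = s ^ 2 + t ^ 2 := by
    rw [sq_norm, normSq_apply, hw]; simp; ring
  have n1 : 1 ≤ ‖w + 2 * p‖ := le_trans (by simp [hwr]; linarith) (re_le_norm _)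
  have n2 : 1 ≤ ‖w + 1‖ := le_trans (by simp [hwr]; linarith) (re_le_norm _)
  have n3 : 1 ≤ ‖w + (2 * p - 1)‖ := le_trans (by simp [hwr]; linarith) (re_le_norm _)
  have n4 : ‖w + p‖ ≤ ‖w + 2 * p‖ := by
    rw [← sq_le_sq₀ (norm_nonneg _) (norm_nonneg _), sq_norm, sq_norm]
    simp [normSq_apply, hwr]
    nlinarith
  have hw0 : 0 < ‖w‖ ^ 2 := by rw [n0]; positivity
  simp only [e, norm_div, norm_mul, norm_pow, norm_ofNat]
  have hA : 0 < ‖w + 2 * p‖ := by linarith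
  calc _ ≤ 2 * ‖w + 2 * p‖ / (‖w‖ ^ 2 * ‖w + 2 * p‖ ^ 2 * 1 ^ 2 * 1 ^ 2) := by gcongr
    _ = 2 / (‖w‖ ^ 2 * ‖w + 2 * p‖) := by field_simp
    _ ≤ 2 / (s ^ 2 * (1 + t ^ 2) * 1) := by
      gcongr
      nlinarith [mul_nonneg (sq_nonneg t) (show 0 ≤ 1 - s ^ 2 by nlinarith)]
    _ = _ := by field_simp

lemma integrable_symb (hp : 1 ≤ p) (h0 : 0 < s) (h1 : s < 1) :
    Integrable fun t : ℝ => symb p (p - 1) (s + t * I + p) := by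
  refine Integrable.mono' (integrable_inv_one_add_sq.const_mul (2 / s ^ 2)) ?_
    (Eventually.of_forall fun t => norm_symb_le hp h0 h1 t)
  exact Measurable.aestronglyMeasurable (by unfold symb; fun_prop)

/-- Laplace inversion for the kernel `kern0`. -/
lemma integral_symb (hp : 1 < p) (h0 : 0 < s) (h1 : s < 1) (v : ℝ) :
    ∫ t : ℝ, symb p (p - 1) (s + t * I + p) * exp ((s + t * I + p) * v)
      = 2 * π * (Ici 0).indicator (fun v : ℝ => kern0 p (p - 1) v) v := by
  set h := (Ici 0).indicator fun v : ℝ => kern0 p (p - 1) v * exp (-((s + p) * v))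
  have hk : Continuous (kern0 p (p - 1)) := by
    unfold kern0 kern; fun_prop
  have hcont : Continuous h :=
    Continuous.indicator (by simp [kern0, kern, neg_div]) (by fun_prop)
  have hx : ∀ t : ℝ, p < ((s : ℂ) + t * I + p).re := fun t => by simp; linarith
  have hL := fun t : ℝ => hasLaplace_kern0 (p := p) (q := p - 1) (by linarith) (by linarith) (hx t)
  have hI : Integrable h := (integrable_indicator_iff measurableSet_Ici).2 <| by
    rw [integrableOn_Ici_iff_integrableOn_Ioi]
    simpa using (hL 0).1
  have hint : ∀ g : ℝ → ℂ, ∫ v, g v * h v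
      = ∫ v in Ioi (0 : ℝ), g v * (kern0 p (p - 1) v * exp (-((s + p) * v))) := fun g => by
    rw [← integral_Ici_eq_integral_Ioi, ← integral_indicator measurableSet_Ici]
    simp only [h, Set.indicator_mul_right]
  have hF : 𝓕 h = fun w : ℝ => symb p (p - 1) (s + ((2 * π * w : ℝ) : ℂ) * I + p) := by
    funext w
    simp only [Real.fourier_real_eq_integral_exp_smul, smul_eq_mul, hint, ← (hL (2 * π * w)).2]
    congr 1 with v
    rw [mul_left_comm, ← exp_add]
    congr 2
    push_cast
    ring
  have hFI : Integrable (𝓕 h) := by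
    rw [hF]
    exact (integrable_symb hp.le h0 h1).comp_mul_left' (by positivity)
  have key := congrFun (hcont.fourierInv_fourier_eq hI hFI) v
  rw [fourierInv_eq', hF] at key
  have hsub := Measure.integral_comp_mul_left (fun t : ℝ => exp (t * v * I)
    * symb p (p - 1) (s + t * I + p)) (2 * π)
  have e1 : ∫ t : ℝ, symb p (p - 1) (s + t * I + p) * exp ((s + t * I + p) * v)
      = exp ((s + p) * v) * ∫ t : ℝ, exp (t * v * I) * symb p (p - 1) (s + t * I + p) := by
    rw [← integral_const_mul]
    congr 1 with t
    rw [show (s + t * I + p) * (v : ℂ) = (s + p) * v + t * v * I by ring, exp_add]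
    ring
  have e2 : ∫ w : ℝ, exp (((2 * π * w : ℝ) : ℂ) * v * I)
      * symb p (p - 1) (s + ((2 * π * w : ℝ) : ℂ) * I + p) = h v := by
    rw [← key]
    congr 1 with w
    rw [smul_eq_mul]
    congr 2
    simp
    ring_nf
  rw [e2, abs_of_pos (by positivity), real_smul, ofReal_inv, eq_inv_mul_iff_mul_eq₀ (by simp)] at hsub
  rw [e1, ← hsub, ofReal_mul, mul_left_comm, ofReal_ofNat]
  by_cases hv : 0 ≤ v <;> simp [h, hv, exp_neg]
  field_simp

/-- The integrand of the contour integral. -/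
lemma uIntegrand_eq (hp : 0 < p) (hD : (D : ℝ) = 2 * p + 1) (h0 : 0 < s)
    (h1 : s < 1) (hz : z ∈ cutPlane) (t : ℝ) :
    uIntegrand D z (s + t * I) = greenConst D p
      * (symb p (p - 1) (s + t * I + p) * gLap p (s + t * I + p) z) := by
  have hD' : (D : ℂ) = 2 * p + 1 := by exact_mod_cast congrArg Complex.ofReal hD
  rw [uIntegrand, greenDelta_eq hp hD (by simpa) (by simpa) hz, hD', symb, mul_left_comm]
  congr 3
  · ring
  · push_cast; ring

lemma integrable_symb_gSub (hp : 1 < p) (h0 : 0 < s) (h1 : s < 1) 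
    (hz : z ∈ cutPlane) : Integrable (fun P : ℝ × ℝ => symb p (p - 1) (s + P.1 * I + p)
      * (exp (-((s + P.1 * I + p) * P.2)) * gSub p z P.2)) := by
  have hi := integrable_exp_gSub (p := p) (x := s + p) (by linarith) (by simpa) (by simp; linarith)
    hz
  have hm : Measurable fun P : ℝ × ℝ => exp (-(P.1 * P.2 * I)) := by fun_prop
  refine (((integrable_symb hp.le h0 h1).mul_prod hi).bdd_mul (c := 1) hm.aestronglyMeasurable
    (Eventually.of_forall fun P => ?_)).congr (Eventually.of_forall fun P => ?_)
  · rw [norm_exp]; simp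
  · beta_reduce
    rw [show -((s + P.1 * I + p) * (P.2 : ℂ))
      = -(P.1 * P.2 * I) + -((s + p) * P.2) by ring, exp_add]
    ring

/-- The contour integral as a transform of the subtracted resolvent kernel. -/
lemma uFun_eq (hp : 1 < p) (hD : (D : ℝ) = 2 * p + 1) (h0 : 0 < s)
    (h1 : s < 1) (hz : z ∈ cutPlane) :
    uFun D s z = -(4 * ((D : ℂ) - 2) ^ 2 / ((D : ℂ) - 3) ^ 2) * greenConst D p
      * ∫ v in Ioi (0 : ℝ), kern0 p (p - 1) v * gSub p z (-v) := by
  have hpi : (π : ℂ) ≠ 0 := ofReal_ne_zero.2 pi_ne_zero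
  have key : ∫ t : ℝ, symb p (p - 1) (s + t * I + p) * gLap p (s + t * I + p) z
      = 2 * π * ∫ v in Ioi (0 : ℝ), kern0 p (p - 1) v * gSub p z (-v) := by
    have hI := integrable_symb_gSub hp h0 h1 hz
    simp only [gLap, ← integral_const_mul]
    rw [integral_integral_swap hI, ← integral_neg_eq_self, ← integral_Ici_eq_integral_Ioi, ← integral_indicator measurableSet_Ici]
    congr 1 with v
    have e := integral_symb hp h0 h1 v
    have e2 : ∀ t : ℝ, symb p (p - 1) (s + t * I + p)
        * (exp (-((s + t * I + p) * ((-v : ℝ) : ℂ))) * gSub p z (-v))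
        = symb p (p - 1) (s + t * I + p) * exp ((s + t * I + p) * v)
          * gSub p z (-v) := fun t => by
      rw [ofReal_neg, mul_neg, neg_neg, mul_assoc]
    simp only [e2]
    rw [integral_mul_const, e]
    by_cases hv : 0 ≤ v <;> simp [hv, mul_assoc]
  simp only [uFun, uIntegrand_eq (by linarith : 0 < p) hD h0 h1 hz]
  rw [integral_mul_const, integral_const_mul, key]
  field_simp

lemma integrable_uIntegrand (hp : 1 < p) (hD : (D : ℝ) = 2 * p + 1) 
    (h0 : 0 < s) (h1 : s < 1) (hz : z ∈ cutPlane) :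
    Integrable fun t : ℝ => uIntegrand D z (s + t * I) := by
  simp only [uIntegrand_eq (by linarith : 0 < p) hD h0 h1 hz]
  have h := (integrable_symb_gSub hp h0 h1 hz).integral_prod_left
  simp only [integral_const_mul] at h
  exact h.const_mul _

end

section
open scoped ContDiff
variable {D : ℕ} {K : Set (dS D × dS D)} {n : ℕ} {u v : dS D → dS D → ℂ} {B : ℝ}

/-! ### Derivatives of iterated d'Alembertians -/

/-- The derivatives of `u` up to the order `n` are bounded by `B` on `K`. -/
def DerivLe (K : Set (dS D × dS D)) (n : ℕ) (u : dS D → dS D → ℂ) (B : ℝ) : Prop :=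
  ∀ m ≤ n, ∀ P ∈ K,
    ‖iteratedFDerivWithin ℝ m (biExt u) (cone D ×ˢ cone D) (P.1.1, P.2.1)‖ ≤ B

lemma coe_mem_cone_prod (P : dS D × dS D) : (P.1.1, P.2.1) ∈ cone D ×ˢ cone D :=
  ⟨coe_mem_cone P.1, coe_mem_cone P.2⟩

lemma DerivLe.add {B' : ℝ} (hu : Sm2 u) (hv : Sm2 v) (h : DerivLe K n u B)
    (h' : DerivLe K n v B') : DerivLe K n (fun x y => u x y + v x y) (B + B') := by
  intro m hm P hP
  have hmem := coe_mem_cone_prod P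
  have e : EqOn (biExt fun x y => u x y + v x y) (biExt u + biExt v) (cone D ×ˢ cone D) :=
    fun Q hQ => by
      rw [← Prod.mk.eta (p := Q), Pi.add_apply, biExt_of_mem _ hQ.1 hQ.2, biExt_of_mem _ hQ.1 hQ.2,
        biExt_of_mem _ hQ.1 hQ.2]
  rw [iteratedFDerivWithin_congr e hmem, iteratedFDerivWithin_add_apply
    ((hu _ hmem).of_le (by exact_mod_cast le_top)) ((hv _ hmem).of_le (by exact_mod_cast le_top))
    isOpen_cone_prod.uniqueDiffOn hmem]
  exact (norm_add_le _ _).trans (add_le_add (h m hm P hP) (h' m hm P hP))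

lemma DerivLe.const_mul (hu : Sm2 u) {c : ℂ} (h : DerivLe K n u B) :
    DerivLe K n (fun x y => c * u x y) (‖c‖ * B) := by
  intro m hm P hP
  have hmem := coe_mem_cone_prod P
  have e : EqOn (biExt fun x y => c * u x y) (c • biExt u) (cone D ×ˢ cone D) :=
    fun Q hQ => by
      rw [← Prod.mk.eta (p := Q), Pi.smul_apply, biExt_of_mem _ hQ.1 hQ.2,
        biExt_of_mem _ hQ.1 hQ.2, smul_eq_mul]
  rw [iteratedFDerivWithin_congr e hmem, iteratedFDerivWithin_const_smul_apply
    ((hu _ hmem).of_le (by exact_mod_cast le_top)) isOpen_cone_prod.uniqueDiffOn hmem, norm_smul]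
  gcongr
  exact h m hm P hP

lemma DerivLe.sum {α : Type*} {s : Finset α} {u : α → dS D → dS D → ℂ} {B : α → ℝ}
    (hu : ∀ i, Sm2 (u i)) (h : ∀ i, DerivLe K n (u i) (B i)) :
    DerivLe K n (fun x y => ∑ i ∈ s, u i x y) (∑ i ∈ s, B i) := by
  classical
  induction s using Finset.induction_on with
  | empty =>
    intro m hm P hP
    have e : biExt (fun _ _ : dS D => (0 : ℂ)) = 0 := by
      funext Q; simp [biExt, ext]
    simp [e]
  | insert a s ha ih => simpa only [sum_insert ha] using (h a).add (hu a) (Sm2.sum s hu) ih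

lemma DerivLe.swap (h : DerivLe K n u B) :
    DerivLe (Prod.swap ⁻¹' K) n (fun x y => u y x) B := by
  intro m hm P hP
  have e : (biExt fun x y => u y x) = biExt u ∘ LinearIsometryEquiv.prodComm ℝ (Amb D) (Amb D) := by
    funext Q
    by_cases h1 : 0 < mink Q.1 Q.1 <;> by_cases h2 : 0 < mink Q.2 Q.2 <;> simp [biExt, ext, h1, h2]
  have h1 := (LinearIsometryEquiv.prodComm ℝ (Amb D) (Amb D)).norm_iteratedFDerivWithin_comp_right
    (biExt u) isOpen_cone_prod.uniqueDiffOn (x := (P.1.1, P.2.1)) (coe_mem_cone_prod P.swap) m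
  have h2 : LinearIsometryEquiv.prodComm ℝ (Amb D) (Amb D) ⁻¹' (cone D ×ˢ cone D)
      = cone D ×ˢ cone D := Set.ext fun Q => and_comm
  rw [h2] at h1
  rw [e, h1]
  exact h m hm P.swap hP

lemma exists_derivLe_partialD (hK : IsCompact K) (n : ℕ) (A : Ix D) :
    ∃ C, ∀ u B, Sm2 u → DerivLe K (n + 1) u B →
      DerivLe K n (fun x y => partialD (fun z => u z y) x A) (C * B) := by
  set S := cone D ×ˢ cone D with hS
  have hSo : IsOpen S := isOpen_cone_prod
  have hle : ∀ k : ℕ, (k : WithTop ℕ∞) ≤ ∞ := fun k => by exact_mod_cast le_top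
  set g : Amb D × Amb D → ℂ := fun P => (√(mink P.1 P.1) : ℂ) with hg
  have hgs : ContDiffOn ℝ ∞ g S := by
    refine ofRealCLM.contDiff.comp_contDiffOn fun P hP => ?_
    exact ((contDiff_minkSelf.comp contDiff_fst).contDiffAt.sqrt
      (show 0 < mink P.1 P.1 from hP.1).ne').contDiffWithinAt
  have hcoe : Continuous fun P : dS D × dS D => (P.1.1, P.2.1) := by fun_prop
  have hG : ∀ i : ℕ, ∃ G, ∀ P ∈ K, ‖iteratedFDerivWithin ℝ i g S (P.1.1, P.2.1)‖ ≤ G := fun i =>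
    hK.exists_bound_of_continuousOn (((hgs.continuousOn_iteratedFDerivWithin
      (by exact_mod_cast le_top) hSo.uniqueDiffOn).comp_continuous hcoe
      coe_mem_cone_prod).continuousOn)
  choose G hG using hG
  set M := ∑ i ∈ Finset.range (n + 1), |G i| with hM
  have hM' : ∀ i ≤ n, G i ≤ M := fun i hi => (le_abs_self _).trans
    (single_le_sum (f := fun i => |G i|) (fun _ _ => abs_nonneg _) (by simpa using by omega))
  set e : Amb D × Amb D := (Pi.single A 1, 0) with he
  refine ⟨2 ^ n * M * ‖e‖, fun u B hu h m hm P hP => ?_⟩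
  have hmem : (P.1.1, P.2.1) ∈ S := coe_mem_cone_prod P
  have hB : 0 ≤ B := (norm_nonneg _).trans (h 0 (by omega) P hP)
  have hM0 : 0 ≤ M := sum_nonneg fun _ _ => abs_nonneg _
  have hf : ContDiffOn ℝ ∞ (fderivWithin ℝ (biExt u) S) S :=
    ContDiffOn.fderivWithin hu hSo.uniqueDiffOn (by simp)
  have heq : EqOn (biExt fun x y => DeSitter.partialD (fun z => u z y) x A)
      (fun Q => g Q * fderivWithin ℝ (biExt u) S Q e) S := by
    rintro ⟨X, Y⟩ hQ
    have h1 : HasFDerivAt (fun X' => biExt u (X', Y)) ((fderiv ℝ (biExt u) (X, Y)).comp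
        (ContinuousLinearMap.inl ℝ (Amb D) (Amb D))) X :=
      HasFDerivAt.comp (f := fun X' => (X', Y)) X
        ((hu.contDiffAt hQ).differentiableAt (by simp)).hasFDerivAt (hasFDerivAt_prodMk_left X Y)
    rw [biExt_partialD u A hQ.1 hQ.2, h1.fderiv]
    simp only [fderivWithin_of_isOpen hSo hQ]
    simp [hg, he]
  rw [iteratedFDerivWithin_congr heq hmem]
  refine (norm_iteratedFDerivWithin_mul_le hgs (hf.clm_apply contDiffOn_const)
    hSo.uniqueDiffOn hmem (by exact_mod_cast le_top)).trans ?_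
  calc _ ≤ ∑ i ∈ Finset.range (m + 1), (m.choose i : ℝ) * M * (‖e‖ * B) := by
        refine sum_le_sum fun i hi => ?_
        have hi' : i ≤ m := by simpa [Nat.lt_succ_iff] using hi
        have h2 := norm_iteratedFDerivWithin_clm_apply_const (c := e) (n := m - i)
          (hf _ hmem) hSo.uniqueDiffOn hmem (hle _)
        rw [norm_iteratedFDerivWithin_fderivWithin hSo.uniqueDiffOn hmem] at h2
        have h3 := h (m - i + 1) (by omega) P hP
        have h4 := (hG i P hP).trans (hM' i (hi'.trans hm))
        have h5 := h2.trans (mul_le_mul_of_nonneg_left h3 (norm_nonneg _))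
        gcongr
    _ = 2 ^ m * M * (‖e‖ * B) := by
        rw [← sum_mul, ← sum_mul]
        congr 2
        exact_mod_cast Nat.sum_range_choose m
    _ ≤ 2 ^ n * M * ‖e‖ * B := by
        rw [mul_assoc (2 ^ n * M)]
        gcongr
        norm_num

lemma exists_derivLe_box1 (hK : IsCompact K) (n : ℕ) :
    ∃ C, ∀ u B, Sm2 u → DerivLe K (n + 2) u B → DerivLe K n (box1 u) (C * B) := by
  choose C hC using exists_derivLe_partialD (D := D) hK
  refine ⟨∑ A, ‖(eta A : ℂ)‖ * (C n A * C (n + 1) A), fun u B hu h => ?_⟩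
  have h1 := DerivLe.sum (s := Finset.univ) (fun A => (Sm2.const _).mul ((hu.partialD A).partialD A))
    fun A => ((hC n A _ _ (hu.partialD A) (hC (n + 1) A _ _ hu h)).const_mul
      ((hu.partialD A).partialD A) (c := (eta A : ℂ)))
  rw [sum_mul]
  simp only [← mul_assoc] at h1 ⊢
  exact h1

lemma Sm2.box2 (hu : Sm2 u) : Sm2 (box2 u) := by
  have := Sm2.sum Finset.univ fun A =>
    (Sm2.const (eta A : ℂ)).mul ((hu.swap.partialD A).partialD A)
  exact this.swap

lemma exists_derivLe_box2 (hK : IsCompact K) (i : ℕ) : ∀ n, ∃ C, ∀ u B, Sm2 u →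
    DerivLe K (n + 2 * i) u B → DerivLe K n (DeSitter.box2^[i] u) (C * B) := by
  induction i with
  | zero => exact fun n => ⟨1, fun u B hu h => by rwa [one_mul]⟩
  | succ i ih =>
    intro n
    obtain ⟨C, hC⟩ := ih n
    obtain ⟨C', hC'⟩ := exists_derivLe_box1 (isCompact_swap hK) (n + 2 * i)
    refine ⟨C * C', fun u B hu h => ?_⟩
    rw [Function.iterate_succ_apply, mul_assoc]
    exact hC _ _ hu.box2 (hC' _ _ hu.swap h.swap).swap

/-- Iterated d'Alembertians of a test function are bounded by its derivatives. -/
lemma exists_norm_boxSeq_le (hK : IsCompact K) (i : ℕ) : ∃ C, ∀ φ : BField D 0 0, IsBiTestOn K φ →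
    ∀ B : ℝ, (∀ n ≤ 2 * i, ∀ P ∈ K, ‖iteratedFDeriv ℝ n (biExt φ) (P.1.1, P.2.1)‖ ≤ B) →
      ∀ P ∈ K, ‖boxSeq (fn φ) i P‖ ≤ C * B := by
  obtain ⟨C, hC⟩ := exists_derivLe_box2 hK i 0
  refine ⟨C, fun φ hφ B hB P hP => ?_⟩
  have hu : TestOn K (fn φ) := by rwa [← isBiTestOn_bi, bi_fn]
  have h : DerivLe K (0 + 2 * i) (fn φ) B := by
    intro m hm Q hQ
    have hmem := coe_mem_cone_prod Q
    set L : ((Fin 0 → Ix D) → (Fin 0 → Ix D) → ℂ) →L[ℝ] ℂ :=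
      (ContinuousLinearMap.proj (R := ℝ) (φ := fun _ : Fin 0 → Ix D => ℂ) ![]).comp
        (ContinuousLinearMap.proj
          (φ := fun _ : Fin 0 → Ix D => (Fin 0 → Ix D) → ℂ) ![]) with hL
    have hL1 : ‖L‖ ≤ 1 := ContinuousLinearMap.opNorm_le_bound _ zero_le_one fun T => by
      rw [one_mul]
      exact (norm_le_pi_norm (T ![]) ![]).trans (norm_le_pi_norm T ![])
    have e : biExt (fn φ) = L ∘ biExt φ := by
      funext R
      rw [← biExt_bi (fn φ) R ![] ![], bi_fn]; rfl
    have h1 := L.norm_iteratedFDerivWithin_comp_left (hφ.smooth _ hmem)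
      isOpen_cone_prod.uniqueDiffOn hmem (n := m) (by exact_mod_cast le_top)
    rw [iteratedFDerivWithin_of_isOpen (f := biExt φ) m isOpen_cone_prod hmem] at h1
    rw [e]
    refine h1.trans ((mul_le_of_le_one_left (norm_nonneg _) hL1).trans (hB m (by omega) Q hQ))
  have := hC _ _ hu.1 h 0 le_rfl P hP
  rwa [norm_iteratedFDerivWithin_zero, biExt_coe] at this

end

section
open scoped ContDiff

/-! ### The boundary value of the transforms -/

section
variable {Ω Ω' : Type*} [MeasurableSpace Ω] [MeasurableSpace Ω'] {μ : Measure Ω} {ν : Measure Ω'}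
  {Z : Ω → ℝ} {Z' : Ω' → ℝ} {f : Ω → ℂ} {g : Ω' → ℂ}

lemma osc_zero (μ : Measure Ω) (Z : Ω → ℝ) (f : Ω → ℂ) : osc μ Z f 0 = ∫ x, f x ∂μ := by
  simp [osc]

lemma bInt_congr (h : osc μ Z f = osc ν Z' g) (p : ℝ) : bInt p μ Z f = bInt p ν Z' g := by
  funext u y
  rw [bInt, bInt, mInt, mInt, ← osc_zero μ Z f, ← osc_zero ν Z' g, h]

lemma wInt_congr (h : osc μ Z f = osc ν Z' g) (p : ℝ) (k : ℂ → ℂ) :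
    wInt p k μ Z f = wInt p k ν Z' g := by
  rw [wInt, bInt_congr h]; rfl

end

variable {D : ℕ} {p : ℝ} {K : Set (dS D × dS D)} {u w : dS D → dS D → ℂ} {k : ℂ → ℂ}

/-- The transform of a function of two points. -/
def pairInt (p : ℝ) (k : ℂ → ℂ) (u : dS D → dS D → ℂ) : ℂ :=
  wInt p k (vol₂ D) (fun P => embZ P.1 P.2) fun P => u P.1 P.2

lemma osc_restrict_pair (hu : TestOn K u) : osc ((vol₂ D).restrict K)
    (fun P => embZ P.1 P.2) (boxSeq u 0) = oscPair u :=
  funext fun s => osc_restrict _ _ (fun P hP => hu.2 P.1 P.2 hP) s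

lemma TestOn.integrable_pair (hu : TestOn K u) (hK : IsCompact K) :
    Integrable (fun P : dS D × dS D => u P.1 P.2) (vol₂ D) := by
  simpa only [one_mul] using integrable_of_testOn hK hu (g := fun _ => 1) continuous_const

lemma exists_pChain (hp : 0 < p) (hD : (D : ℝ) = 2 * p + 1) (hK : IsCompact K) :
    1 ≤ D ∧ ∃ R, 0 ≤ R ∧ ∀ {u}, TestOn K u →
      PChain D p ((vol₂ D).restrict K) (fun P => embZ P.1 P.2) R (boxSeq u) := by
  have hD1 : 1 ≤ D := by
    have : (1 : ℝ) ≤ D := by linarith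
    exact_mod_cast this
  obtain ⟨R, hR0, hR⟩ := exists_embZ_bound hK
  exact ⟨hD1, R, hR0, fun hu => ⟨waveChain_pair hD1 hK hR hu, hp, hD, hR0⟩⟩

lemma sub_I_mem_cutPlane (t : ℝ) {ε : ℝ} (hε : 0 < ε) :
    (t : ℂ) - ε * I ∈ cutPlane := fun h => by
  have := h.1
  simp at this
  exact hε.ne' this

lemma integrable_gSub_pair (hp : 0 < p) (hK : IsCompact K) (hu : TestOn K u) (hk : KBound p k) {ε : ℝ} (hε : 0 < ε) :
    Integrable (fun Q : (dS D × dS D) × ℝ =>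
        k Q.2 * gSub p ((embZ Q.1.1 Q.1.2 : ℂ) - ε * I) (-Q.2) * u Q.1.1 Q.1.2)
      ((vol₂ D).prod (volume.restrict (Ioi 0))) := by
  have hZ : Continuous fun P : dS D × dS D => (embZ P.1 P.2 : ℂ) - ε * I :=
    (continuous_ofReal.comp continuous_embZ).sub continuous_const
  obtain ⟨C, hC0, hC⟩ := exists_gSub_neg_le hp (hK.image hZ)
    (by rintro _ ⟨P, -, rfl⟩; exact sub_I_mem_cutPlane _ hε)
  obtain ⟨C', hC0', hC'⟩ := hk.bound
  refine Integrable.mono' ((hu.integrable_pair hK).norm.mul_prod (integrable_wdom (C' * C))) ?_ ?_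
  · refine Continuous.aestronglyMeasurable ?_
    have h1 : Continuous fun Q : (dS D × dS D) × ℝ => (embZ Q.1.1 Q.1.2 : ℂ) - ε * I :=
      hZ.comp continuous_fst
    have h2 : Continuous fun Q : (dS D × dS D) × ℝ =>
        (cosh Q.2 - ((embZ Q.1.1 Q.1.2 : ℂ) - ε * I)) ^ (-(p : ℂ)) :=
      ((by fun_prop : Continuous fun Q : (dS D × dS D) × ℝ => cosh Q.2).sub h1).cpow
        continuous_const fun Q => cosh_sub_mem_slitPlane (sub_I_mem_cutPlane _ hε) _
    have h3 : Continuous fun Q : (dS D × dS D) × ℝ => u Q.1.1 Q.1.2 :=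
      hu.1.continuous.comp continuous_fst
    simp only [gSub_neg_eq]
    have := hk.cont
    exact (Continuous.mul (by fun_prop) (h2.sub (by fun_prop))).mul h3
  · have : ∀ᵐ Q : (dS D × dS D) × ℝ ∂((vol₂ D).prod (volume.restrict (Ioi 0))),
        Q.2 ∈ Ioi 0 := Measure.quasiMeasurePreserving_snd.ae (ae_restrict_mem measurableSet_Ioi)
    filter_upwards [this] with Q hQ
    have hQ : 0 < Q.2 := hQ
    by_cases hPK : Q.1 ∈ K
    · have h1 := hC _ ⟨Q.1, hPK, rfl⟩ Q.2 hQ.le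
      have h2 := hC' Q.2 (by simpa using hQ.le) (by simp)
      have h3 := norm_kernel_mul_le (u := Q.2) hC0' hC0 hQ.le (by simp) (by simp) h2 (by simpa using h1)
      rw [norm_mul, mul_comm ‖u Q.1.1 Q.1.2‖]
      gcongr
    · rw [hu.2 _ _ hPK]; simp

lemma bInt_pair_eq (hp : 0 < p) (hD : (D : ℝ) = 2 * p + 1) (hK : IsCompact K) (hu : TestOn K u)
    {ε : ℝ} (hε : 0 < ε) (v : ℝ) :
    bInt p (vol₂ D) (fun P => embZ P.1 P.2) (fun P => u P.1 P.2) v (cosh v + ε * I)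
      = ∫ P, gSub p ((embZ P.1 P.2 : ℂ) - ε * I) (-v) * u P.1 P.2 ∂(vol₂ D) := by
  obtain ⟨-, R, -, h⟩ := exists_pChain hp hD hK
  have hy : 0 < (cosh v + ε * I).im := by rw [← ofReal_cosh]; simpa using hε
  have hu1 := hu.integrable_pair hK
  rw [← bInt_congr (osc_restrict_pair hu), bInt_cosh_eq (h hu) 0 hy,
    setIntegral_eq_integral_of_forall_compl_eq_zero (fun P hP => hu.2 P.1 P.2 hP), res,
    setIntegral_eq_integral_of_forall_compl_eq_zero
      (fun P hP => by rw [boxSeq, Function.iterate_zero, id, hu.2 P.1 P.2 hP, mul_zero]),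
    ← integral_const_mul]
  refine (integral_sub (integrable_res continuous_embZ.measurable hu1 hp.le hy)
    (hu1.const_mul _)).symm.trans ?_
  congr 1 with P
  rw [gSub_neg_eq, show cosh v - ((embZ P.1 P.2 : ℂ) - ε * I)
    = cosh v + ε * I - embZ P.1 P.2 by ring]
  ring

/-- The transform is a boundary value of integrals of functions of `Z - iε`. -/
lemma tendsto_pairInt (hp : 0 < p) (hD : (D : ℝ) = 2 * p + 1) (hK : IsCompact K)
    (hu : TestOn K u) (hk : KBound p k) :
    Tendsto (fun ε : ℝ => ∫ P, (∫ v in Ioi (0 : ℝ),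
        k v * gSub p ((embZ P.1 P.2 : ℂ) - ε * I) (-v)) * u P.1 P.2 ∂(vol₂ D))
      (𝓝[>] 0) (𝓝 (pairInt p k u)) := by
  obtain ⟨-, R, -, h⟩ := exists_pChain hp hD hK
  have key := contour_shift.tendsto_wInt (h hu) 0 hk
  rw [wInt_congr (osc_restrict_pair hu)] at key
  refine key.congr' ?_
  filter_upwards [self_mem_nhdsWithin] with ε hε
  have hi := integrable_gSub_pair hp hK hu hk hε
  rw [bInt_congr (osc_restrict_pair hu)]
  refine Eq.trans ?_ ((integral_integral_swap (f := fun (P : dS D × dS D) (v : ℝ) =>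
    k v * gSub p ((embZ P.1 P.2 : ℂ) - ε * I) (-v) * u P.1 P.2) hi).symm.trans ?_)
  · congr 1 with v
    rw [bInt_pair_eq hp hD hK hu hε, ← integral_const_mul]
    simp only [mul_assoc]
  · congr 1 with P
    rw [integral_mul_const]

lemma integrable_pair (hp : 0 < p) (hK : IsCompact K) (hu : TestOn K u) (hk : KBound p k) {ε : ℝ} (hε : 0 < ε) :
    Integrable (fun P : dS D × dS D => (∫ v in Ioi (0 : ℝ),
        k v * gSub p ((embZ P.1 P.2 : ℂ) - ε * I) (-v)) * u P.1 P.2)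
      (vol₂ D) := by
  have := (integrable_gSub_pair hp hK hu hk hε).integral_prod_left
  simpa only [integral_mul_const] using this

lemma pairInt_add (hp : 0 < p) (hD : (D : ℝ) = 2 * p + 1) (hK : IsCompact K)
    (hu : TestOn K u) (hw : TestOn K w) (hk : KBound p k) :
    pairInt p k (fun x y => u x y + w x y) = pairInt p k u + pairInt p k w := by
  refine tendsto_nhds_unique (tendsto_pairInt hp hD hK (hu.add hw) hk)
    (((tendsto_pairInt hp hD hK hu hk).add (tendsto_pairInt hp hD hK hw hk)).congr' ?_)
  filter_upwards [self_mem_nhdsWithin] with ε hε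
  refine (integral_add (integrable_pair hp hK hu hk hε)
    (integrable_pair hp hK hw hk hε)).symm.trans ?_
  simp only [mul_add]

lemma pairInt_const_mul (hp : 0 < p) (hD : (D : ℝ) = 2 * p + 1) (hK : IsCompact K)
    (hu : TestOn K u) (hk : KBound p k) (c : ℂ) :
    pairInt p k (fun x y => c * u x y) = c * pairInt p k u := by
  refine tendsto_nhds_unique (tendsto_pairInt hp hD hK (hu.const_mul c) hk)
    (((tendsto_pairInt hp hD hK hu hk).const_mul c).congr' ?_)
  filter_upwards [self_mem_nhdsWithin] with ε hε
  rw [← integral_const_mul]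
  congr 1 with P
  ring

/-- The transform is bounded by finitely many derivatives. -/
lemma exists_norm_pairInt_le (hp : 0 < p) (hD : (D : ℝ) = 2 * p + 1) (hK : IsCompact K)
    (hk : KBound p k) :
    ∃ C : ℝ, ∀ φ : BField D 0 0, IsBiTestOn K φ → ∀ B : ℝ, (∀ n ≤ 2 * (D + 1), ∀ P ∈ K,
      ‖iteratedFDeriv ℝ n (biExt φ) (P.1.1, P.2.1)‖ ≤ B) → ‖pairInt p k (fn φ)‖ ≤ C * B := by
  obtain ⟨-, R, hR0, h⟩ := exists_pChain hp hD hK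
  obtain ⟨C, hC0, hC⟩ := exists_kernel_le (dS D × dS D) D hp hD hR0 hk
  choose M hM using exists_norm_boxSeq_le (D := D) hK
  set μ := (vol₂ D).restrict K with hμ
  set J := ∫ t in Ioi (0 : ℝ), (2 + t) * rexp (-t)
  have hJ : 0 ≤ J := setIntegral_nonneg measurableSet_Ioi fun t ht => by
    have : 0 < t := ht
    positivity
  refine ⟨C * J * ∑ j ∈ Finset.range (0 + (D + 1) + 1),
    M j * (vol₂ D).real K, fun φ hφ B hB => ?_⟩
  have hu : TestOn K (fn φ) := by rwa [← isBiTestOn_bi, bi_fn]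
  have hl : l1Sum μ (boxSeq (fn φ)) (0 + (D + 1))
      ≤ (∑ j ∈ Finset.range (0 + (D + 1) + 1), M j * (vol₂ D).real K) * B := by
    rw [sum_mul]
    refine sum_le_sum fun j hj => ?_
    have h1 := hM j φ hφ B fun n hn => hB n (hn.trans (by
      have := Finset.mem_range.1 hj; omega))
    have h2 := norm_setIntegral_le_of_norm_le_const (μ := vol₂ D)
      (f := fun P => ‖boxSeq (fn φ) j P‖) hK.measure_lt_top fun P hP => by
        rw [norm_norm]; exact h1 P hP
    refine (le_abs_self _).trans (h2.trans (le_of_eq (by ring)))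
  have h1 : ‖pairInt p k (fn φ)‖ ≤ ∫ t in Ioi (0 : ℝ),
      C * l1Sum μ (boxSeq (fn φ)) (0 + (D + 1)) * ((2 + t) * rexp (-t)) := by
    rw [pairInt, ← wInt_congr (osc_restrict_pair hu)]
    refine norm_integral_le_of_norm_le (integrable_wdom _) ?_
    filter_upwards [ae_restrict_mem measurableSet_Ioi] with t ht
    have := contour_ctr.mem 0 t le_rfl zero_le_one (le_of_lt ht)
    rw [contour_ctr.zeroU] at this
    exact hC _ _ _ (h hu).toWaveChain 0 t _ _ (le_of_lt ht) this
  rw [integral_const_mul] at h1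
  refine h1.trans ?_
  calc _ = C * J * l1Sum μ (boxSeq (fn φ)) (0 + (D + 1)) := by ring
    _ ≤ C * J * _ := mul_le_mul_of_nonneg_left hl (by positivity)
    _ = _ := by ring

end

section
open scoped ContDiff

/-! ### The constants -/

lemma greenConst_eq {D : ℕ} {p : ℝ} (hp : 0 < p) (hD : (D : ℝ) = 2 * p + 1) :
    greenConst D p = ((Real.Gamma p / (4 * 2 ^ p * π ^ (p + 1)) : ℝ) : ℂ) := by
  have hDc : (D : ℂ) / 2 = ((p + 1 / 2 : ℝ) : ℂ) := by
    rw [show (D : ℂ) = ((D : ℝ) : ℂ) by simp, hD]; push_cast; ring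
  rw [greenConst, hDc, show (2 * p : ℂ) = ((2 * p : ℝ) : ℂ) by push_cast; ring,
    show (4 * (π : ℂ)) = ((4 * π : ℝ) : ℂ) by push_cast; ring,
    Gamma_ofReal, Gamma_ofReal, ← ofReal_cpow (by positivity)]
  norm_cast
  have hpi := pi_pos
  have h := Real.Gamma_mul_Gamma_add_half p
  have h1 := Gamma_pos_of_pos hp
  have h2 : 0 < Real.Gamma (p + 1 / 2) := Gamma_pos_of_pos (by linarith)
  have e1 : (2 : ℝ) ^ (1 - 2 * p) = 2 / (2 ^ p) ^ 2 := by
    rw [Real.rpow_sub two_pos, rpow_one, two_mul, rpow_add two_pos, sq]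
  have e2 : (4 * π) ^ (p + 1 / 2) = 2 * (2 ^ p) ^ 2 * π ^ (p + 1) / √π := by
    rw [mul_rpow (by norm_num) hpi.le, show (4 : ℝ) = 2 ^ (2 : ℝ) by norm_num,
      ← rpow_mul two_pos.le, show (2 : ℝ) * (p + 1 / 2) = p + p + 1 by ring,
      rpow_add two_pos, rpow_add two_pos, rpow_one, sqrt_eq_rpow,
      eq_div_iff (by positivity), mul_assoc (2 ^ p * 2 ^ p * 2), ← rpow_add hpi,
      show p + 1 / 2 + 1 / 2 = p + 1 by ring]
    ring
  rw [e1] at h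
  rw [e2]
  have h3 : 0 < √π := sqrt_pos.2 hpi
  generalize Real.Gamma (2 * p) = G at *
  generalize Real.Gamma (p + 1 / 2) = H at *
  have h4 : 0 < (2 : ℝ) ^ p := by positivity
  have h5 : 0 < π ^ (p + 1) := by positivity
  generalize (2 : ℝ) ^ p = T at *
  generalize π ^ (p + 1) = Q at *
  field_simp at h ⊢
  linear_combination -2 * h

lemma greenConst_volSphere {D : ℕ} {p : ℝ} (hp : 0 < p) (hD : (D : ℝ) = 2 * p + 1) :
    2 * greenConst D p * (p * ((2 ^ p : ℝ) : ℂ)) = 1 / (volSphere D : ℂ) := by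
  rw [greenConst_eq hp hD, volSphere, hD, show (2 * p + 1 + 1) / 2 = p + 1 by ring,
    Real.Gamma_add_one hp.ne']
  norm_cast
  have := Gamma_pos_of_pos hp
  have := pi_pos
  generalize Real.Gamma p = G at *
  field_simp
  norm_num

lemma two_pi_mul_cpow {w : ℂ} (hw : w ≠ 0) : (2 * π * w) ^ (1 / 2 : ℂ)
    = ((√(2 * π) : ℝ) : ℂ) * exp (Complex.log w / 2) := by
  have hpi := pi_pos
  rw [show (2 * π * w : ℂ) = ((2 * π : ℝ) : ℂ) * w by push_cast; ring,
    ofReal_mul_cpow (by positivity) hw, cpow_def_of_ne_zero hw, sqrt_eq_rpow,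
    ofReal_cpow (by positivity)]
  congr 2
  · push_cast; ring
  · ring

lemma ampConst_eq {D : ℕ} {p : ℝ} (hD1 : 1 ≤ D) (hD : (D : ℝ) = 2 * p + 1) :
    ampConst D = (((2 * π) ^ (p + 1 / 2) : ℝ) : ℂ)
      * exp (I * π * (2 * p - 1) / 4) := by
  have hpi := pi_pos
  have h1 : ((D - 1 : ℕ) : ℂ) = 2 * p := by
    rw [Nat.cast_sub hD1, show (D : ℂ) = ((D : ℝ) : ℂ) by simp, hD]; push_cast; ring
  rw [ampConst, show (2 * π * I * ((-1 : ℝ) : ℂ)) = 2 * π * (-I) by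
    push_cast; ring, two_pi_mul_cpow I_ne_zero, two_pi_mul_cpow (neg_ne_zero.2
    I_ne_zero), Complex.log_I, Complex.log_neg_I, mul_pow, ← Complex.exp_nat_mul, h1,
    mul_mul_mul_comm, ← exp_add, ← pow_succ', Nat.sub_add_cancel hD1,
    ← ofReal_pow, sqrt_pow_eq D (by positivity), hD,
    show (2 * p + 1) / 2 = p + 1 / 2 by ring]
  congr 2
  ring

lemma greenConst_ampConst {D : ℕ} {p : ℝ} (hp : 0 < p) (hD1 : 1 ≤ D)
    (hD : (D : ℝ) = 2 * p + 1) :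
    2 * greenConst D p * (I * cGam p * (gHalf * ((√2 : ℝ) : ℂ)) * ampConst D) = I := by
  have hpi := pi_pos
  have hG := Gamma_pos_of_pos hp
  have hph : exp (-(I * π * p / 2))
      * exp (I * π * (1 / 2 : ℝ) / 2)
      * exp (I * π * (2 * p - 1) / 4) = 1 := by
    rw [← exp_add, ← exp_add, Complex.exp_eq_one_iff]
    exact ⟨0, by push_cast; ring⟩
  have hm : 2 * (Real.Gamma p / (4 * 2 ^ p * π ^ (p + 1))) / Real.Gamma p
      * Real.Gamma (1 / 2) * √2 * (2 * π) ^ (p + 1 / 2) = 1 := by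
    rw [Real.Gamma_one_half_eq, mul_assoc _ (√π), ← sqrt_mul hpi.le, mul_comm π 2,
      sqrt_eq_rpow, mul_assoc, ← rpow_add (by positivity),
      show 1 / 2 + (p + 1 / 2) = p + 1 by ring, mul_rpow two_pos.le hpi.le,
      rpow_add two_pos, rpow_one]
    generalize Real.Gamma p = G at *
    field_simp
    norm_num
  have hm' : (2 * (Real.Gamma p / (4 * 2 ^ p * π ^ (p + 1)) : ℝ) / (Real.Gamma p : ℝ)
      * (Real.Gamma (1 / 2) : ℝ) * (√2 : ℝ) * ((2 * π) ^ (p + 1 / 2) : ℝ) : ℂ) = 1 := by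
    exact_mod_cast hm
  rw [greenConst_eq hp hD, ampConst_eq hD1 hD, cGam, gHalf, Gamma_ofReal, Gamma_ofReal]
  linear_combination I * (exp (-(I * π * p / 2))
      * exp (I * π * (1 / 2 : ℝ) / 2)
      * exp (I * π * (2 * p - 1) / 4)) * hm' + I * hph

/-! ### The maximally symmetric solution -/

variable {D : ℕ} {p : ℝ} {K : Set (dS D × dS D)} {u w : dS D → dS D → ℂ}

/-- Equality of the integrals against all smooth functions of the embedding distance. -/
def SameInt (u w : dS D → dS D → ℂ) : Prop := ∀ F : ℝ → ℂ, ContDiff ℝ ∞ F →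
  ∫ P, F (embZ P.1 P.2) * u P.1 P.2 ∂(vol₂ D)
    = ∫ P, F (embZ P.1 P.2) * w P.1 P.2 ∂(vol₂ D)

lemma SameInt.box2 (hD : 1 ≤ D) (hK : IsCompact K) (hu : TestOn K u) (hw : TestOn K w)
    (h : SameInt u w) : SameInt (box2 u) (box2 w) := fun F hF => by
  have hF1 := (contDiff_infty_iff_deriv.1 hF).2
  have hF2 := (contDiff_infty_iff_deriv.1 hF1).2
  have : ContDiff ℝ ∞ fun t : ℝ => (t : ℂ) := ofRealCLM.contDiff
  rw [integral_embZ_box2 hD hK hu hF, integral_embZ_box2 hD hK hw hF]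
  exact h (fun t => (1 - (t : ℂ) ^ 2) * deriv (deriv F) t - D * (t : ℂ) * deriv F t) (by fun_prop)

lemma SameInt.pairInt_eq (h : SameInt u w) (k : ℂ → ℂ) : pairInt p k u = pairInt p k w := by
  refine wInt_congr (funext fun s => h (fun t => exp (-(I * s * t))) ?_) p k
  have : ContDiff ℝ ∞ fun t : ℝ => (t : ℂ) := ofRealCLM.contDiff
  fun_prop

lemma oscPair_act (Λ : Amb D →ₗ[ℝ] Amb D) (hΛ : ∀ X Y, mink (Λ X) (Λ Y) = mink X Y)
    (hu : Sm2 u) : oscPair (fun x y => u (act Λ hΛ x) (act Λ hΛ y)) = oscPair u := by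
  funext s
  have hm : MeasurePreserving (act Λ hΛ) (vol D) (vol D) :=
    ⟨(continuous_act Λ hΛ).measurable, map_act_vol Λ hΛ⟩
  have hm2 := hm.prod hm
  have hc : Continuous fun P : dS D × dS D =>
      exp (-(I * s * (embZ P.1 P.2 : ℂ))) * u P.1 P.2 := by
    have := continuous_ofReal.comp (continuous_embZ (D := D))
    exact (continuous_exp.comp (continuous_const.mul this).neg).mul hu.continuous
  have h := integral_map (μ := vol₂ D) hm2.measurable.aemeasurable
    (hc.aestronglyMeasurable (μ := Measure.map _ _))
  rw [hm2.map_eq] at h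
  rw [oscPair, osc, oscPair, osc, h]
  congr 1 with P
  simp only [Prod.map_fst, Prod.map_snd, embZ, act, hΛ]

/-- The maximally symmetric solution, which is the boundary value of `uFun`. -/
def solU (D : ℕ) (p : ℝ) : BDist D 0 0 := fun φ =>
  -(4 * ((D : ℂ) - 2) ^ 2 / ((D : ℂ) - 3) ^ 2) * greenConst D p * pairInt p (kern0 p (p - 1)) (fn φ)

lemma kBound_kern0 (hp : 1 < p) : KBound p (kern0 p (p - 1)) :=
  kBound_kern _ _ _ _ (by linarith) (by linarith)

lemma isDistribution_solU (hp : 1 < p) (hD : (D : ℝ) = 2 * p + 1) (O : Set (dS D)) :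
    IsDistribution O (solU D p) where
  map_add φ ψ hφ hψ := by
    obtain ⟨K, hK, -, h⟩ := isBiTest_iff.1 hφ
    obtain ⟨L, hL, -, h'⟩ := isBiTest_iff.1 hψ
    rw [solU, solU, solU, ← mul_add, ← pairInt_add (by linarith) hD (hK.union hL)
      (h.mono Set.subset_union_left) (h'.mono Set.subset_union_right) (kBound_kern0 hp)]
    rfl
  map_smul c φ hφ := by
    obtain ⟨K, hK, -, h⟩ := isBiTest_iff.1 hφ
    rw [solU, solU, mul_left_comm, ← pairInt_const_mul (by linarith) hD hK h (kBound_kern0 hp)]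
    rfl
  bound K hK _ := by
    obtain ⟨C, hC⟩ := exists_norm_pairInt_le (by linarith) hD hK (kBound_kern0 hp)
    refine ⟨‖-(4 * ((D : ℂ) - 2) ^ 2 / ((D : ℂ) - 3) ^ 2) * greenConst D p‖ * C, 2 * (D + 1),
      fun φ hφ B hB => ?_⟩
    rw [solU, norm_mul]
    refine (mul_le_mul_of_nonneg_left (hC φ hφ B hB) (norm_nonneg _)).trans (mul_assoc _ _ _).ge

lemma isBoundaryValue_solU (hp : 1 < p) (hD : (D : ℝ) = 2 * p + 1) (O : Set (dS D)) {s : ℝ}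
    (h0 : 0 < s) (h1 : s < 1) : IsBoundaryValue O (uFun D s) (solU D p) := by
  intro φ hφ
  obtain ⟨K, hK, -, h⟩ := isBiTest_iff.1 hφ
  have hp0 : 0 < p := by linarith
  refine ((tendsto_pairInt hp0 hD hK h (kBound_kern0 hp)).const_mul
    (-(4 * ((D : ℂ) - 2) ^ 2 / ((D : ℂ) - 3) ^ 2) * greenConst D p)).congr' ?_
  filter_upwards [self_mem_nhdsWithin] with ε hε
  rw [integral_prod _ (integrable_pair hp0 hK h (kBound_kern0 hp) hε)]
  simp only [← integral_const_mul]
  congr 1 with x; congr 1 with y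
  rw [uFun_eq hp hD h0 h1 (sub_I_mem_cutPlane _ hε), mul_assoc, mul_assoc, mul_assoc]
  rfl

lemma isMaximallySymmetric_solU (p : ℝ) (O : Set (dS D)) :
    IsMaximallySymmetric O (solU D p) := by
  intro Λ hΛ φ hφ _
  obtain ⟨K, hK, -, h⟩ := isBiTest_iff.1 hφ
  have := wInt_congr (oscPair_act Λ hΛ h.1) p (kern0 p (p - 1))
  rw [solU, solU]
  exact congrArg _ this

lemma solvesU_solU (hp : 1 < p) (hD : (D : ℝ) = 2 * p + 1) (O : Set (dS D)) :
    SolvesU O (1 / (volSphere D : ℂ)) 0 (solU D p) := by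
  intro φ hφ
  have hp0 : 0 < p := by linarith
  have hDc : (D : ℂ) = 2 * p + 1 := by exact_mod_cast congrArg (Complex.ofReal) hD
  obtain ⟨K, hK, hKO, hu⟩ := isBiTest_iff.1 hφ
  set u := fn φ with hu'
  obtain ⟨hD1, R, -, h⟩ := exists_pChain hp0 hD hK
  have e1 : ∀ v, TestOn K v → SameInt (box1 v) (box2 v) := fun v hv F hF =>
    integral_embZ_box1 hD1 hK hv hF
  have b1 := hu.box1 hK
  have b2 := hu.box2 hK
  have s2 := (e1 u hu).box2 hD1 hK b1 b2
  have s3 := s2.box2 hD1 hK (b1.box2 hK) (b2.box2 hK)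
  have s4 := s3.box2 hD1 hK ((b1.box2 hK).box2 hK) ((b2.box2 hK).box2 hK)
  have t3 := (e1 _ b1).box2 hD1 hK (b1.box1 hK) (b1.box2 hK)
  have t4 := t3.box2 hD1 hK ((b1.box1 hK).box2 hK) ((b1.box2 hK).box2 hK)
  have hU : ∀ v, solU D p (bi v) = -(4 * ((D : ℂ) - 2) ^ 2 / ((D : ℂ) - 3) ^ 2) * greenConst D p
    * pairInt p (kern0 p (p - 1)) v := fun v => rfl
  have hw : ∀ i, wInt p (kern0 p (p - 1)) ((vol₂ D).restrict K)
      (fun P => embZ P.1 P.2) (boxSeq u i) = pairInt p (kern0 p (p - 1)) (DeSitter.box2^[i] u) :=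
    fun i => wInt_congr (osc_restrict_pair (hu.iterate_box2 hK i)) p _
  have hmain := wInt_kern0 (by linarith : 0 < p - 1) (by linarith) (h hu)
  rw [hw, hw, hw, tipTerm, ampInf_restrict _ _ (fun P hP => hu.2 P.1 P.2 hP),
    show boxSeq u 0 = fun P => u P.1 P.2 from rfl, ampInf_pair hD1 hK hu,
    setIntegral_eq_integral_of_forall_compl_eq_zero (fun P hP => hu.2 P.1 P.2 hP)] at hmain
  have hL := boxL_mass_boxR_mass (solU D p) ((D : ℂ) - 2) ⟨K, hK, hKO, hu⟩
  rw [hu', bi_fn, ← hu', hU, hU, hU, hU, t4.pairInt_eq, s4.pairInt_eq, t3.pairInt_eq,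
    s3.pairInt_eq, s2.pairInt_eq] at hL
  have hR : ∫ x, (∫ y, (1 / (volSphere D : ℂ) + 0 * (embZ x y : ℂ)) * φ x y ![] ![] ∂(vol D)) ∂(vol D)
      = 1 / (volSphere D : ℂ) * ∫ P, u P.1 P.2 ∂(vol₂ D) := by
    rw [integral_prod _ (hu.integrable_pair hK)]
    simp only [zero_mul, add_zero, integral_const_mul]
    rfl
  rw [hR]
  change _ * boxL (boxL (boxR (boxR (solU D p) - ((D : ℂ) - 2) • solU D p))
    - ((D : ℂ) - 2) • boxR (boxR (solU D p) - ((D : ℂ) - 2) • solU D p)) φ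
    = _ + I * ∫ x, u x x ∂(vol D)
  rw [hL]
  have d2 : (D : ℂ) - 2 ≠ 0 := by
    have : (D : ℝ) - 2 ≠ 0 := by linarith
    exact_mod_cast this
  have hm : (p : ℂ) ^ 2 - ((p - 1 : ℝ) : ℂ) ^ 2 = (D : ℂ) - 2 := by rw [hDc]; push_cast; ring
  rw [hm] at hmain
  have hN : ((D : ℂ) - 3) ^ 2 / (4 * ((D : ℂ) - 2) ^ 2)
      * (-(4 * ((D : ℂ) - 2) ^ 2 / ((D : ℂ) - 3) ^ 2) * greenConst D p) = -greenConst D p := by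
    have d3 : (D : ℂ) - 3 ≠ 0 := by
      have : (D : ℝ) - 3 ≠ 0 := by linarith
      exact_mod_cast this
    field_simp
  have c1 := greenConst_volSphere hp0 hD
  have c2 := greenConst_ampConst hp0 hD1 hD
  simp only [Function.iterate_succ_apply', Function.iterate_zero, id] at hmain
  linear_combination (pairInt p (kern0 p (p - 1)) (box2 (box2 (box2 (box2 u))))
    - 2 * ((D : ℂ) - 2) * pairInt p (kern0 p (p - 1)) (box2 (box2 (box2 u)))
    + ((D : ℂ) - 2) ^ 2 * pairInt p (kern0 p (p - 1)) (box2 (box2 u))) * hN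
    - greenConst D p * hmain + (∫ P, u P.1 P.2 ∂(vol₂ D)) * c1
    + (∫ x, u x x ∂(vol D)) * c2

end

end DeSitter

end


theorem mainTheorem5 (D : ℕ) (hD : 4 ≤ D) (O : Set (DeSitter.dS D)) (hO : IsOpen O) :
    (∀ U : DeSitter.BDist D 0 0, DeSitter.IsDistribution O U →
      ∀ a b : ℂ, DeSitter.SolvesU O a b U →
        DeSitter.IsTTIdentity O
          (-Complex.I • DeSitter.projL (DeSitter.projR (DeSitter.mulTTwo U)))) ∧
    (∀ s ∈ Set.Ioo (0 : ℝ) 1, ∀ z ∈ DeSitter.cutPlane,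
      MeasureTheory.Integrable (fun t : ℝ => DeSitter.uIntegrand D z (s + t * Complex.I))) ∧
    ∃ U : DeSitter.BDist D 0 0, DeSitter.IsDistribution O U ∧
      (∀ s ∈ Set.Ioo (0 : ℝ) 1, DeSitter.IsBoundaryValue O (DeSitter.uFun D s) U) ∧
      DeSitter.IsMaximallySymmetric O U ∧
      DeSitter.SolvesU O (1 / (DeSitter.volSphere D : ℂ)) 0 U := by
  have hD4 : (4 : ℝ) ≤ D := by exact_mod_cast hD
  have hp : (1 : ℝ) < ((D : ℝ) - 1) / 2 := by linarith
  have hDp : (D : ℝ) = 2 * (((D : ℝ) - 1) / 2) + 1 := by ring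
  exact ⟨fun U hU a b hS => DeSitter.isTTIdentity hD hU hS,
    fun s hs z hz => DeSitter.integrable_uIntegrand hp hDp hs.1 hs.2 hz,
    DeSitter.solU D _, DeSitter.isDistribution_solU hp hDp O,
    fun s hs => DeSitter.isBoundaryValue_solU hp hDp O hs.1 hs.2,
    DeSitter.isMaximallySymmetric_solU _ O, DeSitter.solvesU_solU hp hDp O⟩
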